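/- All objects are piecewise linear. Let $p:\mathbb{R}^3=\mathbb{R}^2\times\mathbb{R}\to\mathbb{R}^2$ be the projection. A link $L=M\sqcup U\subset\mathbb{R}^3$ consists of a sublink $M$ and one further component $U$; it has a diagram (via $p$) if all multiple points of its projection are transverse double points (crossings), each decorated by which strand is over. Let $\mathcal{D}^0,\dots,\mathcal{D}^r$ be a sequence of diagrams of links $L^i=M^i\sqcup U^i$ in which $\mathcal{D}^{i+1}$ is obtained from $\mathcal{D}^i$ by a planar isotopy or by one Reidemeister move RI, RII or RIII (in either direction), respecting the partition into $M$ and $U$. Suppose that $p$ is injective on $U^0$ and on $U^r$, so that $\mathcal{U}_0=p(U^0)$ and $\mathcal{U}_1=p(U^r)$ are simple closed curves, and that for some integer $m\ge 0$ every $\mathcal{D}^i$, $0\le i\le r$, has at most $m$ crossings. (This applies in particular when $\mathcal{D}^r$ is a split diagram in which $M$ and $U$ are separated and $U$ is drawn without self-crossings; splitness is not needed.) Then there exist an ambient isotopy $\Phi':\mathbb{R}^3\times[0,1]\to\mathbb{R}^3$ with compact support (hence extending to $\mathbb{S}^3$ by fixing $\infty$), with $\Phi'(\cdot,0)=\mathrm{id}$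 and $\Phi'(M^0,1)=M^r$, and an isotopy of simple closed curves $h:\mathbb{S}^1\times[0,1]\to\mathbb{R}^2$ (i.e. $h(\cdot,t)$ is injective for every $t$), such that 1. $h(\mathbb{S}^1,0)=\mathcal{U}_0$ and $h(\mathbb{S}^1,1)=\mathcal{U}_1$; and 2. for all $t\in[0,1]$, the total number of crossings in the overlay of $p(\Phi'(M^0,t))$ and $h(\mathbb{S}^1,t)$ in $\mathbb{R}^2$ is at most $m$. Here one counts the pairs of distinct points of $\Phi'(M^0,t)$ with the same projection together with the points of $\Phi'(M^0,t)$ that project into $h(\mathbb{S}^1,t)$. -/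

import Mathlib

open Set Topology

namespace PLLink

/-- The plane of projection. -/
abbrev Plane : Type := ℝ × ℝ

/-- Three-space, split as plane of projection times height. The projection `p` is `Prod.fst`, and of
two points with the same projection the one with the larger second coordinate is the upper one. -/
abbrev Space : Type := Plane × ℝ

section PL

variable {E F : Type*} [NormedAddCommGroup E] [NormedSpace ℝ E]
  [NormedAddCommGroup F] [NormedSpace ℝ F]

/-- Piecewise-linear maps on a closed polyhedron `s`: `f` is continuous on `s`, and near each point
of `s` its values are selected from finitely many affine maps. (On each convex cell cut out by
the hyperplanes where two of these affine maps agree, a continuous selection is one of the affine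
maps, so this is piecewise linearity with respect to a locally finite polyhedral decomposition.) -/
def PLOn (f : E → F) (s : Set E) : Prop :=
  ContinuousOn f s ∧ ∀ x ∈ s, ∃ 𝒜 : Set (E →ᵃ[ℝ] F), 𝒜.Finite ∧
    ∀ᶠ y in 𝓝[s] x, ∃ A ∈ 𝒜, f y = A y

/-- Piecewise-linear homeomorphisms. -/
def IsPLHomeo (e : E ≃ₜ E) : Prop :=
  PLOn e univ ∧ PLOn e.symm univ

/-- A (compactly supported, PL) ambient isotopy `Φ : E × [0,1] → E`, written `Φ t x`, starting at the
identity. For `E = ℝ³` it extends by `∞ ↦ ∞` to an ambient isotopy of the three-sphere. -/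
structure IsAmbientIsotopy (Φ : ℝ → E → E) : Prop where
  start : ∀ x, Φ 0 x = x
  pl : PLOn (fun q : ℝ × E => Φ q.1 q.2) (Icc 0 1 ×ˢ univ)
  inverse : ∃ Ψ : ℝ → E → E, PLOn (fun q : ℝ × E => Ψ q.1 q.2) (Icc 0 1 ×ˢ univ) ∧
    ∀ t ∈ Icc (0 : ℝ) 1, ∀ x, Ψ t (Φ t x) = x ∧ Φ t (Ψ t x) = x
  support : ∃ K : Set E, IsCompact K ∧ ∀ t ∈ Icc (0 : ℝ) 1, ∀ x ∉ K, Φ t x = x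

/-- The PL circle: the unit sphere of the sup norm, i.e. the boundary of the square `[-1,1]²`. -/
def S1 : Set Plane := Metric.sphere 0 1

/-- `K` is the image of a PL embedding of the circle. -/
def IsPLCircle (K : Set E) : Prop :=
  ∃ c : Plane → E, PLOn c S1 ∧ InjOn c S1 ∧ c '' S1 = K

/-- An isotopy of simple closed curves `h : S¹ × [0,1] → E`, written `h t s`. -/
def IsCurveIsotopy (h : ℝ → Plane → E) : Prop :=
  PLOn (fun q : ℝ × Plane => h q.1 q.2) (Icc 0 1 ×ˢ S1) ∧
    ∀ t ∈ Icc (0 : ℝ) 1, InjOn (h t) S1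

end PL

/-- A link: a finite disjoint union of PL circles in three-space. -/
def IsPLLink (M : Set Space) : Prop :=
  ∃ 𝒦 : Set (Set Space), 𝒦.Finite ∧ (∀ K ∈ 𝒦, IsPLCircle K) ∧
    𝒦.PairwiseDisjoint id ∧ M = ⋃₀ 𝒦

/-- `Θ` is a PL homeomorphism of three-space that covers the map `φ` of the plane and preserves the
upward direction on every vertical line. It carries the decorated diagram of a link `L` by `φ`
to that of `Θ '' L`; two lifts of one decorated diagram differ by such a `Θ` covering `id`. -/
structure Covers (Θ : Space ≃ₜ Space) (φ : Plane → Plane) : Prop where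
  pl : IsPLHomeo Θ
  proj : ∀ a, (Θ a).1 = φ a.1
  mono : ∀ x, StrictMono fun z => (Θ (x, z)).2

/-- The vertical cylinder over the closed square `[-1,1]²` (a closed ball of the sup norm). -/
def cyl : Set Space := {a | a.1 ∈ Metric.closedBall (0 : Plane) 1}

/-- The projection of `L` has a transverse double point at `x`: in suitable PL coordinates the part
of the diagram in a disc around `x` consists of the two coordinate axes, one passing over the
other. -/
def IsCrossing (L : Set Space) (x : Plane) : Prop :=
  ∃ (φ : Plane ≃ₜ Plane) (Θ : Space ≃ₜ Space), IsPLHomeo φ ∧ Covers Θ φ ∧ φ 0 = x ∧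
    Θ ⁻¹' L ∩ cyl =
      segment ℝ ((-1, 0), -1) ((1, 0), -1) ∪ segment ℝ ((0, -1), 1) ((0, 1), 1)

/-- The projection of `L` is regular: all multiple points are transverse double points. -/
def IsRegular (L : Set Space) : Prop :=
  ∀ a ∈ L, ∀ b ∈ L, a ≠ b → a.1 = b.1 → IsCrossing L a.1

/-- A diagram of a link consisting of a sublink `M` and a further component `U`, given by a link in
three-space with regular projection. -/
structure Diagram where
  M : Set Space
  U : Set Space
  link_M : IsPLLink M
  knot_U : IsPLCircle U
  disj : Disjoint M U
  regular : IsRegular (M ∪ U)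

/-- The crossings of the projection of `L`, as pairs (lower point, upper point). -/
def crossings (L : Set Space) : Set (Space × Space) :=
  {q | q.1 ∈ L ∧ q.2 ∈ L ∧ q.1.1 = q.2.1 ∧ q.1.2 < q.2.2}

/-- The number of crossings of a diagram. -/
noncomputable def Diagram.cr (D : Diagram) : ℕ∞ := (crossings (D.M ∪ D.U)).encard

/-- The number of crossings in the overlay of the projection of `M` and a simple closed curve `C` in
the plane: the self-crossings of the projection of `M`, and its intersections with `C`. A point
where several strands meet counts once for each pair of strands. -/
noncomputable def overlayCr (M : Set Space) (C : Set Plane) : ℕ∞ :=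
  (crossings M).encard + {a | a ∈ M ∧ a.1 ∈ C}.encard

/-- `D'` arises from `D` by a planar isotopy: the decorated diagram `D'` is the image of the decorated
diagram `D` under the end of an ambient isotopy of the plane. -/
def PlanarIsotopic (D D' : Diagram) : Prop :=
  ∃ (f : ℝ → Plane → Plane) (Θ : Space ≃ₜ Space), IsAmbientIsotopy f ∧ Covers Θ (f 1) ∧
    Θ '' D.M = D'.M ∧ Θ '' D.U = D'.U

/-- `D'` arises from `D` by replacing, in some disc, a copy of the strands `T` by a copy of the strands
`T'`; outside the disc the decorated diagrams agree. The strands with index in `I` belong to `M`,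
the other ones to `U`. The disc is `φ ([-1,1]²)`, and `φ` may reverse the orientation. -/
def LocalMove {n : ℕ} (T T' : Fin n → Set Space) (D D' : Diagram) : Prop :=
  ∃ (φ : Plane ≃ₜ Plane) (Θ Θ' : Space ≃ₜ Space) (I : Set (Fin n)),
    IsPLHomeo φ ∧ Covers Θ φ ∧ Covers Θ' φ ∧
    Θ ⁻¹' D.M ∩ cyl = ⋃ i ∈ I, T i ∧ Θ ⁻¹' D.U ∩ cyl = ⋃ i ∈ Iᶜ, T i ∧
    Θ' ⁻¹' D'.M ∩ cyl = ⋃ i ∈ I, T' i ∧ Θ' ⁻¹' D'.U ∩ cyl = ⋃ i ∈ Iᶜ, T' i ∧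
    Θ ⁻¹' D.M \ cyl = Θ' ⁻¹' D'.M \ cyl ∧ Θ ⁻¹' D.U \ cyl = Θ' ⁻¹' D'.U \ cyl

/-- A straight strand. -/
def flat : Fin 1 → Set Space := ![segment ℝ ((-1, 0), 0) ((1, 0), 0)]

/-- A strand with a kink: it crosses over itself once, at the origin. The mirror image kink is
obtained through an orientation reversing `φ` in `LocalMove`. -/
noncomputable def kinked : Fin 1 → Set Space :=
  ![segment ℝ ((-1, 0), 0) ((1 / 2, 0), 0) ∪ segment ℝ ((1 / 2, 0), 0) ((0, 1 / 2), 1) ∪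
    segment ℝ ((0, 1 / 2), 1) ((0, -1 / 2), 1) ∪ segment ℝ ((0, -1 / 2), 1) ((1, 0), 0)]

/-- Two parallel strands. -/
noncomputable def apart : Fin 2 → Set Space :=
  ![segment ℝ ((-1 / 2, -1), 0) ((-1 / 2, 1), 0), segment ℝ ((1 / 2, -1), 1) ((1 / 2, 1), 1)]

/-- The right strand has been moved over the left one, creating a bigon. -/
noncomputable def overlapping : Fin 2 → Set Space :=
  ![segment ℝ ((-1 / 2, -1), 0) ((-1 / 2, 1), 0),
    segment ℝ ((1 / 2, -1), 1) ((-3 / 4, 0), 1) ∪ segment ℝ ((-3 / 4, 0), 1) ((1 / 2, 1), 1)]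

/-- Three strands: the two diagonals of the square at heights `0` and `1`, and a strand at height `2`
that runs from left to right, passing above (`s > 0`) or below (`s < 0`) the centre in the plane
and crossing over both diagonals. -/
noncomputable def triangle (s : ℝ) : Fin 3 → Set Space :=
  ![segment ℝ ((-1, -1), 0) ((1, 1), 0), segment ℝ ((1, -1), 1) ((-1, 1), 1),
    segment ℝ ((-1, 0), 2) ((0, s), 2) ∪ segment ℝ ((0, s), 2) ((1, 0), 2)]

/-- One step of a sequence of Reidemeister moves: a planar isotopy, or a move RI, RII or RIII in
either direction. -/
def Step (D D' : Diagram) : Prop :=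
  PlanarIsotopic D D' ∨
  (LocalMove flat kinked D D' ∨ LocalMove kinked flat D D') ∨
  (LocalMove apart overlapping D D' ∨ LocalMove overlapping apart D D') ∨
  (LocalMove (triangle (1 / 2)) (triangle (-1 / 2)) D D' ∨
    LocalMove (triangle (-1 / 2)) (triangle (1 / 2)) D D')

end PLLink

/-!
A state sum modulo two over the smoothings of the self-crossings of `U` detects whether the desired isotopy
exists.

Let `reachable` be the function that assigns to a link `N` in space and a set `C` in the plane the value `1`
in `ZMod 2` if `(N, C)` can be obtained from the initial overlay `((D 0).M, p ((D 0).U))` by a pair of ambient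
isotopies, of space and of the plane, through overlays with at most `m` crossings, and `0` otherwise. It is
invariant under such isotopies, and it vanishes if `C` is disconnected, since the initial curve is connected.
A function with these two properties is called a `Valuation`.

For a diagram whose component `U` crosses itself, every self-crossing of `U` is smoothed in the two possible
ways, and the values of the valuation on all the resulting curves, overlaid with `M`, are added modulo two
(`bracket`, `StateSum`). No state has more crossings in the overlay than the diagram, as smoothing only
removes crossings (`Diagram.overlayCr_le`, `overlayCr_smooth`). The two smoothings at a crossing need not be
told apart. By `StateSum.unique` the sum depends on the diagram only, not on the coordinates used for the
smoothings: changes of coordinates are conical near the crossing, being piecewise linear, and a conical change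
of coordinates alters the smoothings by an isotopy and possibly by their order (`cornerMove`, `bracket_indep`).

The state sum is invariant under the moves of diagrams (`Step.stateSum`). For planar isotopies this is clear.
Each Reidemeister move involves strands of `M`, for which an isotopy of space is performed, and strands of `U`,
which are treated as in the proof of invariance of the Kauffman bracket with the value `0` for a closed loop:
* for a kink of `U`, one smoothing splits off a loop and so contributes `0`, and the other one is isotopic to
  the line without the kink (`localInv_kink`);
* for a bigon of `U`, one of the four states has a closed loop, two are isotopic and cancel modulo two, and the
  last one is isotopic to the pair of arcs after the move (`bigon`, `localInv_overlap`);
* for a triangle, one double point of the strands of `U`, if there is any, is smoothed, and every resulting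
  picture is moved to one that is symmetric under the rotation by a half-turn (`Evaluates`). As this rotation
  exchanges the two sides of the move, both have the same state sum (`localInv_triangle`).

If a move involves strands of both kinds, then one has to check in addition that the crossings of the
overlay do not exceed `m` at intermediate times. They never exceed the larger count at the two ends of the move.
`LocalInv.eq` reduces the invariance for a diagram to what happens in the disc of the move, by smoothing the
double points outside it simultaneously in both diagrams.

Neither the first nor the last diagram has self-crossings of `U`, so that the state sum is the value of
`reachable` itself there. It is `1` for the first diagram, hence for the last one. This means that
the last overlay is reachable from the first one.
-/

open Set Topology

namespace PLLink

/-! ### Piecewise linear maps and ambient isotopies -/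

section PLCalculus

variable {E F G : Type*} [NormedAddCommGroup E] [NormedSpace ℝ E]
  [NormedAddCommGroup F] [NormedSpace ℝ F] [NormedAddCommGroup G] [NormedSpace ℝ G]

theorem PLOn.mono {f : E → F} {s t : Set E} (h : PLOn f s) (hts : t ⊆ s) : PLOn f t := by
  refine ⟨h.1.mono hts, fun x hx => ?_⟩
  obtain ⟨A, hA, hf⟩ := h.2 x (hts hx)
  exact ⟨A, hA, hf.filter_mono (nhdsWithin_mono _ hts)⟩

theorem PLOn.comp {g : F → G} {f : E → F} {s : Set E} {t : Set F} (hg : PLOn g t)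
    (hf : PLOn f s) (hst : MapsTo f s t) : PLOn (fun x => g (f x)) s := by
  refine ⟨hg.1.comp hf.1 hst, fun x hx => ?_⟩
  obtain ⟨A, hA, hAf⟩ := hf.2 x hx
  obtain ⟨B, hB, hBg⟩ := hg.2 (f x) (hst hx)
  refine ⟨(fun q : (F →ᵃ[ℝ] G) × (E →ᵃ[ℝ] F) => q.1.comp q.2) '' (B ×ˢ A), (hB.prod hA).image _, ?_⟩
  have ht : Filter.Tendsto f (𝓝[s] x) (𝓝[t] (f x)) :=
    tendsto_nhdsWithin_of_tendsto_nhds_of_eventually_within _ (hf.1 x hx)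
      (by filter_upwards [self_mem_nhdsWithin] with y hy using hst hy)
  filter_upwards [hAf, ht.eventually hBg] with y ⟨a, ha, hya⟩ ⟨b, hb, hyb⟩
  exact ⟨b.comp a, ⟨(b, a), ⟨hb, ha⟩, rfl⟩, by rw [hyb, hya]; rfl⟩

theorem PLOn.prodMk {f : E → F} {g : E → G} {s : Set E} (hf : PLOn f s) (hg : PLOn g s) :
    PLOn (fun x => (f x, g x)) s := by
  refine ⟨hf.1.prodMk hg.1, fun x hx => ?_⟩
  obtain ⟨A, hA, hAf⟩ := hf.2 x hx
  obtain ⟨B, hB, hBg⟩ := hg.2 x hx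
  refine ⟨(fun q : (E →ᵃ[ℝ] F) × (E →ᵃ[ℝ] G) => q.1.prod q.2) '' (A ×ˢ B), (hA.prod hB).image _, ?_⟩
  filter_upwards [hAf, hBg] with y ⟨a, ha, hya⟩ ⟨b, hb, hyb⟩
  exact ⟨a.prod b, ⟨(a, b), ⟨ha, hb⟩, rfl⟩, by simp [hya, hyb]⟩

/-- Maps that are piecewise linear on the whole space. -/
@[fun_prop]
def IsPL (f : E → F) : Prop := PLOn f univ

theorem IsPL.plOn {f : E → F} (h : IsPL f) (s : Set E) : PLOn f s := PLOn.mono h (subset_univ s)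

@[fun_prop]
theorem IsPL.continuous {f : E → F} (h : IsPL f) : Continuous f := continuousOn_univ.1 h.1

theorem isPL_of_affine (A : E →ᵃ[ℝ] F) (hA : Continuous A) : IsPL A :=
  ⟨hA.continuousOn, fun _ _ => ⟨{A}, finite_singleton A, by simp⟩⟩

theorem isPL_clm (A : E →L[ℝ] F) : IsPL A :=
  isPL_of_affine (A : E →ₗ[ℝ] F).toAffineMap A.continuous

@[fun_prop]
theorem isPL_id : IsPL (fun x : E => x) := isPL_clm (ContinuousLinearMap.id ℝ E)

@[fun_prop]
theorem isPL_const (c : F) : IsPL (fun _ : E => c) :=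
  isPL_of_affine (AffineMap.const ℝ E c) continuous_const

@[fun_prop]
theorem IsPL.comp {g : F → G} {f : E → F} (hg : IsPL g) (hf : IsPL f) : IsPL (fun x => g (f x)) :=
  PLOn.comp hg hf (mapsTo_univ _ _)

@[fun_prop]
theorem IsPL.prodMk {f : E → F} {g : E → G} (hf : IsPL f) (hg : IsPL g) :
    IsPL (fun x => (f x, g x)) := PLOn.prodMk hf hg

@[fun_prop]
theorem IsPL.fst {f : E → F × G} (hf : IsPL f) : IsPL (fun x => (f x).1) :=
  (isPL_clm (ContinuousLinearMap.fst ℝ F G)).comp hf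

@[fun_prop]
theorem IsPL.snd {f : E → F × G} (hf : IsPL f) : IsPL (fun x => (f x).2) :=
  (isPL_clm (ContinuousLinearMap.snd ℝ F G)).comp hf

@[fun_prop]
theorem IsPL.add {f g : E → F} (hf : IsPL f) (hg : IsPL g) : IsPL (fun x => f x + g x) :=
  (isPL_clm (ContinuousLinearMap.fst ℝ F F + ContinuousLinearMap.snd ℝ F F)).comp (hf.prodMk hg)

@[fun_prop]
theorem IsPL.sub {f g : E → F} (hf : IsPL f) (hg : IsPL g) : IsPL (fun x => f x - g x) :=
  (isPL_clm (ContinuousLinearMap.fst ℝ F F - ContinuousLinearMap.snd ℝ F F)).comp (hf.prodMk hg)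

@[fun_prop]
theorem IsPL.neg {f : E → F} (hf : IsPL f) : IsPL (fun x => - f x) :=
  (isPL_clm (-ContinuousLinearMap.id ℝ F)).comp hf

@[fun_prop]
theorem IsPL.const_smul {f : E → F} (c : ℝ) (hf : IsPL f) : IsPL (fun x => c • f x) :=
  (isPL_clm (c • ContinuousLinearMap.id ℝ F)).comp hf

@[fun_prop]
theorem IsPL.const_mul {f : E → ℝ} (c : ℝ) (hf : IsPL f) : IsPL (fun x => c * f x) :=
  hf.const_smul c

@[fun_prop]
theorem IsPL.mul_const {f : E → ℝ} (c : ℝ) (hf : IsPL f) : IsPL (fun x => f x * c) := by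
  simpa only [mul_comm] using hf.const_mul c

@[fun_prop]
theorem IsPL.div_const {f : E → ℝ} (c : ℝ) (hf : IsPL f) : IsPL (fun x => f x / c) := by
  simpa only [div_eq_inv_mul] using hf.const_mul c⁻¹

/-- A continuous function whose value is at each point that of one of two piecewise linear functions
is piecewise linear. -/
theorem IsPL.of_or {f g h : E → F} (hf : IsPL f) (hg : IsPL g) (hc : Continuous h)
    (hh : ∀ x, h x = f x ∨ h x = g x) : IsPL h := by
  refine ⟨hc.continuousOn, fun x _ => ?_⟩
  obtain ⟨A, hA, hAf⟩ := hf.2 x (mem_univ x)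
  obtain ⟨B, hB, hBg⟩ := hg.2 x (mem_univ x)
  refine ⟨A ∪ B, hA.union hB, ?_⟩
  filter_upwards [hAf, hBg] with y ⟨a, ha, hya⟩ ⟨b, hb, hyb⟩
  rcases hh y with h | h
  · exact ⟨a, Or.inl ha, by rw [h, hya]⟩
  · exact ⟨b, Or.inr hb, by rw [h, hyb]⟩

@[fun_prop]
theorem IsPL.max {f g : E → ℝ} (hf : IsPL f) (hg : IsPL g) : IsPL (fun x => max (f x) (g x)) :=
  IsPL.of_or hf hg (hf.continuous.max hg.continuous) fun _ => max_choice _ _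

@[fun_prop]
theorem IsPL.min {f g : E → ℝ} (hf : IsPL f) (hg : IsPL g) : IsPL (fun x => min (f x) (g x)) :=
  IsPL.of_or hf hg (hf.continuous.min hg.continuous) fun _ => min_choice _ _

@[fun_prop]
theorem IsPL.abs {f : E → ℝ} (hf : IsPL f) : IsPL (fun x => |f x|) :=
  IsPL.of_or hf hf.neg hf.continuous.abs fun _ => abs_choice _

/-- A piecewise linear map that fixes the origin commutes with scaling near the origin. -/
theorem IsPL.eventually_conical [FiniteDimensional ℝ E] {f : E → F} (hf : IsPL f) (h0 : f 0 = 0) :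
    ∃ r > 0, ∀ v, ‖v‖ ≤ r → ∀ s ∈ Icc (0 : ℝ) 1, f (s • v) = s • f v := by
  obtain ⟨A, hA, h⟩ := hf.2 0 (mem_univ _)
  rw [nhdsWithin_univ] at h
  have hc : ContinuousAt f 0 := hf.continuous.continuousAt
  -- the affine maps that do not vanish at the origin are not used near the origin
  have h1 : ∀ᶠ y in 𝓝 (0 : E), ∀ a ∈ A, f y = a y → a 0 = 0 := by
    refine (Filter.eventually_all_finite hA).2 fun a _ => ?_
    by_cases ha : a 0 = 0
    · exact Filter.Eventually.of_forall fun _ _ => ha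
    · have hca : Continuous a := a.continuous_of_finiteDimensional
      have : ∀ᶠ y in 𝓝 (0 : E), f y - a y ≠ 0 := by
        refine ContinuousAt.eventually_ne (hc.sub hca.continuousAt) ?_
        simpa [h0] using ha
      filter_upwards [this] with y hy h2
      exact absurd (sub_eq_zero.2 h2) hy
  obtain ⟨r, hr, hb⟩ := Metric.nhds_basis_closedBall.eventually_iff.1 (h.and h1)
  refine ⟨r, hr, fun v hv s hs => ?_⟩
  have hsel : ∀ s ∈ Ioc (0 : ℝ) 1, ∃ a ∈ A, f (s • v) = s • a v := by
    intro s hs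
    have : s • v ∈ Metric.closedBall (0 : E) r := by
      rw [mem_closedBall_zero_iff, norm_smul, Real.norm_of_nonneg hs.1.le]
      nlinarith [norm_nonneg v, hs.1, hs.2]
    obtain ⟨⟨a, ha, h2⟩, h3⟩ := hb this
    refine ⟨a, ha, ?_⟩
    have h4 : a (s • v) = a.linear (s • v) := by
      have := a.map_vadd 0 (s • v)
      simpa [h3 a ha h2] using this
    have h5 : a v = a.linear v := by
      have := a.map_vadd 0 v
      simpa [h3 a ha h2] using this
    rw [h2, h4, h5, map_smul]
  rcases hs.1.eq_or_lt with rfl | hs0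
  · simp [h0]
  have hpre : IsPreconnected ((fun s : ℝ => s⁻¹ • f (s • v)) '' Ioc (0 : ℝ) 1) := by
    refine isPreconnected_Ioc.image _ ?_
    refine ContinuousOn.smul (continuousOn_inv₀.mono fun x hx => hx.1.ne') ?_
    exact (hf.continuous.comp (by fun_prop)).continuousOn
  have hfin : ((fun s : ℝ => s⁻¹ • f (s • v)) '' Ioc (0 : ℝ) 1).Finite := by
    refine (hA.image fun a => a v).subset ?_
    rintro _ ⟨s, hs, rfl⟩
    obtain ⟨a, ha, h2⟩ := hsel s hs
    refine ⟨a, ha, ?_⟩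
    simp only [h2]
    rw [smul_smul, inv_mul_cancel₀ hs.1.ne', one_smul]
  have hsub := hfin.countable.isTotallyDisconnected _ Subset.rfl hpre
  have := hsub ⟨s, ⟨hs0, hs.2⟩, rfl⟩ ⟨1, ⟨one_pos, le_rfl⟩, rfl⟩
  simp only [inv_one, one_smul] at this
  rw [← this, smul_smul, mul_inv_cancel₀ hs0.ne', one_smul]

theorem isPL_norm_plane : IsPL (fun v : Plane => ‖v‖) := by
  have : (fun v : Plane => ‖v‖) = fun v => Max.max |v.1| |v.2| := by
    ext v; simp [Prod.norm_def]
  rw [this]; fun_prop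

/-- Truncation of the time parameter to `[0,1]`. -/
def clampT (t : ℝ) : ℝ := Max.max 0 (Min.min 1 t)

@[fun_prop]
theorem IsPL.clampT {f : E → ℝ} (hf : IsPL f) : IsPL (fun x => clampT (f x)) := by
  unfold PLLink.clampT; fun_prop

theorem clampT_mem (t : ℝ) : clampT t ∈ Icc (0 : ℝ) 1 :=
  ⟨le_max_left _ _, max_le zero_le_one (min_le_left _ _)⟩

theorem clampT_of_mem {t : ℝ} (ht : t ∈ Icc (0 : ℝ) 1) : clampT t = t := by
  simp [clampT, ht.1, ht.2]

/-- Homeomorphisms given by piecewise linear maps inverse to each other. -/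
def plHomeo (f g : E → E) (hf : IsPL f) (hg : IsPL g) (h₁ : ∀ x, g (f x) = x)
    (h₂ : ∀ x, f (g x) = x) : E ≃ₜ E where
  toFun := f
  invFun := g
  left_inv := h₁
  right_inv := h₂
  continuous_toFun := hf.continuous
  continuous_invFun := hg.continuous

theorem isPLHomeo_plHomeo (f g : E → E) (hf : IsPL f) (hg : IsPL g) (h₁ h₂) :
    IsPLHomeo (plHomeo f g hf hg h₁ h₂) := ⟨hf, hg⟩

theorem IsPLHomeo.trans {e e' : E ≃ₜ E} (h : IsPLHomeo e) (h' : IsPLHomeo e') :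
    IsPLHomeo (e.trans e') :=
  ⟨IsPL.comp (f := e) h'.1 h.1, IsPL.comp (g := e.symm) h.2 h'.2⟩

theorem IsPLHomeo.symm {e : E ≃ₜ E} (h : IsPLHomeo e) : IsPLHomeo e.symm := ⟨h.2, h.1⟩

theorem isPLHomeo_refl : IsPLHomeo (Homeomorph.refl E) := ⟨isPL_id, isPL_id⟩

/-- Ambient isotopies with compact support, with all times in `ℝ` allowed and with the inverse as part
of the data. -/
structure Isotopy (E : Type*) [NormedAddCommGroup E] [NormedSpace ℝ E] where
  /-- the point to which a point has moved at a given time -/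
  toFun : ℝ → E → E
  /-- the inverse at a given time -/
  invFun : ℝ → E → E
  pl : IsPL (fun q : ℝ × E => toFun q.1 q.2)
  pl_inv : IsPL (fun q : ℝ × E => invFun q.1 q.2)
  left_inv : ∀ t x, invFun t (toFun t x) = x
  right_inv : ∀ t x, toFun t (invFun t x) = x
  start : ∀ x, toFun 0 x = x
  supp : ∃ K : Set E, IsCompact K ∧ ∀ t, ∀ x ∉ K, toFun t x = x

namespace Isotopy

instance : CoeFun (Isotopy E) (fun _ => ℝ → E → E) := ⟨toFun⟩

@[fun_prop]
theorem isPL_comp (Φ : Isotopy F) {a : E → ℝ} {b : E → F} (ha : IsPL a) (hb : IsPL b) :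
    IsPL (fun x => Φ.toFun (a x) (b x)) := Φ.pl.comp (ha.prodMk hb)

@[fun_prop]
theorem isPL_inv_comp (Φ : Isotopy F) {a : E → ℝ} {b : E → F} (ha : IsPL a) (hb : IsPL b) :
    IsPL (fun x => Φ.invFun (a x) (b x)) := Φ.pl_inv.comp (ha.prodMk hb)

theorem isAmbientIsotopy (Φ : Isotopy E) : IsAmbientIsotopy Φ where
  start := Φ.start
  pl := Φ.pl.plOn _
  inverse := ⟨Φ.invFun, Φ.pl_inv.plOn _, fun t _ x => ⟨Φ.left_inv t x, Φ.right_inv t x⟩⟩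
  support := by
    obtain ⟨K, hK, h⟩ := Φ.supp
    exact ⟨K, hK, fun t _ x hx => h t x hx⟩

theorem inv_eq_of_fix (Φ : Isotopy E) {t : ℝ} {x : E} (h : Φ t x = x) : Φ.invFun t x = x := by
  conv_lhs => rw [← h]
  exact Φ.left_inv t x

/-- The homeomorphism at a given time. -/
def homeo (Φ : Isotopy E) (t : ℝ) : E ≃ₜ E :=
  plHomeo (Φ t) (Φ.invFun t) (by fun_prop) (by fun_prop) (Φ.left_inv t) (Φ.right_inv t)

@[simp] theorem homeo_apply (Φ : Isotopy E) (t : ℝ) (x : E) : Φ.homeo t x = Φ t x := rfl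

theorem isPLHomeo_homeo (Φ : Isotopy E) (t : ℝ) : IsPLHomeo (Φ.homeo t) :=
  isPLHomeo_plHomeo _ _ _ _ _ _

/-- The constant isotopy. -/
def refl (E : Type*) [NormedAddCommGroup E] [NormedSpace ℝ E] : Isotopy E where
  toFun _ x := x
  invFun _ x := x
  pl := by fun_prop
  pl_inv := by fun_prop
  left_inv _ _ := rfl
  right_inv _ _ := rfl
  start _ := rfl
  supp := ⟨∅, isCompact_empty, fun _ _ _ => rfl⟩

theorem refl_image (t : ℝ) (S : Set E) : refl E t '' S = S := image_id S

/-- The isotopy run backwards. -/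
def reverse (Φ : Isotopy E) : Isotopy E where
  toFun t x := Φ (1 - t) (Φ.invFun 1 x)
  invFun t x := Φ 1 (Φ.invFun (1 - t) x)
  pl := by fun_prop
  pl_inv := by fun_prop
  left_inv t x := by rw [Φ.left_inv, Φ.right_inv]
  right_inv t x := by rw [Φ.left_inv, Φ.right_inv]
  start x := by rw [sub_zero, Φ.right_inv]
  supp := by
    obtain ⟨K, hK, h⟩ := Φ.supp
    exact ⟨K, hK, fun t x hx => by rw [Φ.inv_eq_of_fix (h 1 x hx), h _ x hx]⟩

/-- One isotopy followed by another one. -/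
def trans (Φ Ψ : Isotopy E) : Isotopy E where
  toFun t x := Ψ (Max.max 0 (2 * t - 1)) (Φ (Min.min (2 * t) 1) x)
  invFun t x := Φ.invFun (Min.min (2 * t) 1) (Ψ.invFun (Max.max 0 (2 * t - 1)) x)
  pl := by fun_prop
  pl_inv := by fun_prop
  left_inv t x := by rw [Ψ.left_inv, Φ.left_inv]
  right_inv t x := by rw [Φ.right_inv, Ψ.right_inv]
  start x := by simp [Φ.start, Ψ.start]
  supp := by
    obtain ⟨K, hK, h⟩ := Φ.supp
    obtain ⟨K', hK', h'⟩ := Ψ.supp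
    refine ⟨K ∪ K', hK.union hK', fun t x hx => ?_⟩
    rw [mem_union, not_or] at hx
    rw [h _ x hx.1, h' _ x hx.2]

theorem trans_of_le (Φ Ψ : Isotopy E) {t : ℝ} (ht : 2 * t ≤ 1) (x : E) :
    Φ.trans Ψ t x = Φ (2 * t) x := by
  have : Max.max 0 (2 * t - 1) = 0 := max_eq_left (by linarith)
  simp [trans, this, Ψ.start, min_eq_left ht]

theorem trans_of_ge (Φ Ψ : Isotopy E) {t : ℝ} (ht : 1 ≤ 2 * t) (x : E) :
    Φ.trans Ψ t x = Ψ (2 * t - 1) (Φ 1 x) := by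
  have : Max.max 0 (2 * t - 1) = 2 * t - 1 := max_eq_right (by linarith)
  simp [trans, this, min_eq_right ht]

/-- The isotopy transported by a piecewise linear homeomorphism. -/
def conj (Φ : Isotopy E) (e : E ≃ₜ E) (he : IsPLHomeo e) : Isotopy E where
  toFun t x := e (Φ t (e.symm x))
  invFun t x := e (Φ.invFun t (e.symm x))
  pl := by
    have h1 : IsPL e := he.1
    have h2 : IsPL e.symm := he.2
    fun_prop
  pl_inv := by
    have h1 : IsPL e := he.1
    have h2 : IsPL e.symm := he.2
    fun_prop
  left_inv t x := by simp [Φ.left_inv]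
  right_inv t x := by simp [Φ.right_inv]
  start x := by simp [Φ.start]
  supp := by
    obtain ⟨K, hK, h⟩ := Φ.supp
    refine ⟨e '' K, hK.image e.continuous, fun t x hx => ?_⟩
    rw [h t _ fun hk => hx ⟨_, hk, e.apply_symm_apply x⟩, e.apply_symm_apply]

@[simp] theorem conj_apply (Φ : Isotopy E) (e : E ≃ₜ E) (he : IsPLHomeo e) (t : ℝ) (x : E) :
    Φ.conj e he t x = e (Φ t (e.symm x)) := rfl

/-- An ambient isotopy parametrized by `[0,1]` extends to all times. -/
theorem exists_eq {Φ : ℝ → E → E} (h : IsAmbientIsotopy Φ) :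
    ∃ Ψ : Isotopy E, ∀ t ∈ Icc (0 : ℝ) 1, ∀ x, Ψ t x = Φ t x := by
  obtain ⟨Φ', hΦ', hinv⟩ := h.inverse
  have hm : MapsTo (fun q : ℝ × E => (clampT q.1, q.2)) univ (Icc (0 : ℝ) 1 ×ˢ univ) :=
    fun q _ => ⟨clampT_mem _, mem_univ _⟩
  have hc : IsPL (fun q : ℝ × E => (clampT q.1, q.2)) := by fun_prop
  refine ⟨⟨fun t x => Φ (clampT t) x, fun t x => Φ' (clampT t) x, h.pl.comp hc hm,
    hΦ'.comp hc hm, fun t x => (hinv _ (clampT_mem t) x).1, fun t x => (hinv _ (clampT_mem t) x).2,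
    fun x => ?_, ?_⟩, fun t ht x => ?_⟩
  · rw [clampT_of_mem ⟨le_rfl, zero_le_one⟩, h.start]
  · obtain ⟨K, hK, hs⟩ := h.support
    exact ⟨K, hK, fun t x hx => hs _ (clampT_mem t) x hx⟩
  · change Φ (clampT t) x = _
    rw [clampT_of_mem ht]

end Isotopy
end PLCalculus

/-! ### Pushing along the last coordinate -/

section Fibrewise

/-- The pointwise maximum of two increasing bijections of the line; its inverse is the minimum of the
inverses. -/
noncomputable def ordSup (e f : ℝ ≃o ℝ) : ℝ ≃o ℝ :=
  StrictMono.orderIsoOfRightInverse (fun y => max (e y) (f y))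
    (fun _ _ h => max_lt_max (e.strictMono h) (f.strictMono h))
    (fun y => min (e.symm y) (f.symm y)) fun y => by
      rcases le_total (e.symm y) (f.symm y) with h | h
      · have := f.monotone h
        simp_all
      · have := e.monotone h
        simp_all

/-- The pointwise minimum of two increasing bijections of the line. -/
noncomputable def ordInf (e f : ℝ ≃o ℝ) : ℝ ≃o ℝ := (ordSup e.symm f.symm).symm

/-- The homothety of ratio `1/(1+k)` and centre `u`. -/
noncomputable def contract (k : ℝ) (hk : 0 < k) (u : ℝ) : ℝ ≃o ℝ :=
  StrictMono.orderIsoOfRightInverse (fun y => (y + k * u) / (1 + k))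
    (fun a b h => by
      have : a + k * u < b + k * u := by linarith
      exact div_lt_div_of_pos_right this (by linarith))
    (fun y => (1 + k) * y - k * u) fun y => by
      have : 1 + k ≠ 0 := by positivity
      field_simp; ring

/-- The push by `d` inside the interval `(l, u)`: a bijection of the line that is the identity outside
`(l, u)` and translates by `d` the points that are far enough from both ends. -/
noncomputable def pushO (k : ℝ) (hk : 0 < k) (d l u : ℝ) : ℝ ≃o ℝ :=
  ordSup (OrderIso.refl ℝ)
    (ordInf (OrderIso.addRight d) (ordInf (contract k hk u) (contract k hk l).symm))

variable {k : ℝ} (hk : 0 < k) {d l u y : ℝ}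

theorem pushO_apply : pushO k hk d l u y =
    max y (min (y + d) (min ((y + k * u) / (1 + k)) ((1 + k) * y - k * l))) := rfl

theorem pushO_symm_apply : (pushO k hk d l u).symm y =
    min y (max (y - d) (max ((1 + k) * y - k * u) ((y + k * l) / (1 + k)))) := by
  rw [sub_eq_add_neg y d]; rfl

theorem pushO_eq_self (h : d ≤ 0 ∨ y ≤ l ∨ u ≤ y) : pushO k hk d l u y = y := by
  rw [pushO_apply]
  apply max_eq_left
  rcases h with h | h | h
  · exact (min_le_left _ _).trans (by linarith)
  · refine (min_le_right _ _).trans ((min_le_right _ _).trans ?_)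
    nlinarith
  · refine (min_le_right _ _).trans ((min_le_left _ _).trans ?_)
    rw [div_le_iff₀ (by linarith)]; nlinarith

theorem pushO_symm_eq_self (h : d ≤ 0 ∨ y ≤ l ∨ u ≤ y) : (pushO k hk d l u).symm y = y := by
  rw [OrderIso.symm_apply_eq, pushO_eq_self hk h]

theorem pushO_eq_add (h₁ : d ≤ k * (y - l)) (h₂ : d ≤ k * (u - y - d)) :
    pushO k hk d l u y = y + max 0 d := by
  have h3 : y + d ≤ (y + k * u) / (1 + k) := by
    rw [le_div_iff₀ (by linarith)]; linarith
  have h4 : y + d ≤ (1 + k) * y - k * l := by linarith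
  rw [pushO_apply, min_eq_left (le_min h3 h4)]
  rcases le_total 0 d with h | h
  · rw [max_eq_right h, max_eq_right (by linarith)]
  · rw [max_eq_left h, max_eq_left (by linarith), add_zero]

variable {E B : Type*} [NormedAddCommGroup E] [NormedSpace ℝ E]
  [NormedAddCommGroup B] [NormedSpace ℝ B]

@[fun_prop]
theorem IsPL.pushO {d l u y : E → ℝ} (hd : IsPL d) (hl : IsPL l) (hu : IsPL u) (hy : IsPL y) :
    IsPL (fun x => pushO k hk (d x) (l x) (u x) (y x)) := by
  simp only [pushO_apply]; fun_prop

@[fun_prop]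
theorem IsPL.pushO_symm {d l u y : E → ℝ} (hd : IsPL d) (hl : IsPL l) (hu : IsPL u)
    (hy : IsPL y) : IsPL (fun x => (PLLink.pushO k hk (d x) (l x) (u x)).symm (y x)) := by
  simp only [pushO_symm_apply]; fun_prop

/-- An isotopy that moves points along the last coordinate. -/
def Isotopy.fibre (e : ℝ → B → ℝ ≃o ℝ) (h : IsPL fun q : ℝ × (B × ℝ) => e q.1 q.2.1 q.2.2)
    (h' : IsPL fun q : ℝ × (B × ℝ) => (e q.1 q.2.1).symm q.2.2) (h0 : ∀ b y, e 0 b y = y)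
    (hs : ∃ K : Set (B × ℝ), IsCompact K ∧ ∀ t, ∀ x ∉ K, e t x.1 x.2 = x.2) :
    Isotopy (B × ℝ) where
  toFun t x := (x.1, e t x.1 x.2)
  invFun t x := (x.1, (e t x.1).symm x.2)
  pl := IsPL.prodMk (by fun_prop) h
  pl_inv := IsPL.prodMk (by fun_prop) h'
  left_inv t x := by simp
  right_inv t x := by simp
  start x := by rw [h0]
  supp := by
    obtain ⟨K, hK, hf⟩ := hs
    exact ⟨K, hK, fun t x hx => by rw [hf t x hx]⟩

/-- The push along the last coordinate by `d`, inside the region between `l` and `u`. -/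
theorem exists_push (hk : 0 < k) {d : ℝ × B → ℝ} {l u : B → ℝ} (hd : IsPL d) (hl : IsPL l)
    (hu : IsPL u) (h0 : ∀ b, d (0, b) ≤ 0)
    (hs : ∃ K : Set (B × ℝ), IsCompact K ∧
      ∀ t b y, 0 < d (t, b) → l b < y → y < u b → (b, y) ∈ K) :
    ∃ F : Isotopy (B × ℝ), (∀ t x, (F t x).1 = x.1) ∧
      (∀ t b y, d (t, b) ≤ k * (y - l b) → d (t, b) ≤ k * (u b - y - d (t, b)) →
        F t (b, y) = (b, y + max 0 (d (t, b)))) ∧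
      ∀ t b y, d (t, b) ≤ 0 ∨ y ≤ l b ∨ u b ≤ y → F t (b, y) = (b, y) := by
  refine ⟨Isotopy.fibre (fun t b => pushO k hk (d (t, b)) (l b) (u b)) ?_ ?_ ?_ ?_, ?_, ?_, ?_⟩
  · have : IsPL fun q : ℝ × (B × ℝ) => d (q.1, q.2.1) := by fun_prop
    fun_prop
  · have : IsPL fun q : ℝ × (B × ℝ) => d (q.1, q.2.1) := by fun_prop
    fun_prop
  · exact fun b y => pushO_eq_self hk (Or.inl (h0 b))
  · obtain ⟨K, hK, h⟩ := hs
    refine ⟨K, hK, fun t x hx => pushO_eq_self hk ?_⟩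
    by_contra! hc
    exact hx (h t x.1 x.2 hc.1 hc.2.1 hc.2.2)
  · exact fun t x => rfl
  · intro t b y h1 h2
    exact Prod.ext rfl (pushO_eq_add hk h1 h2)
  · intro t b y h
    exact Prod.ext rfl (pushO_eq_self hk h)

end Fibrewise

/-! ### The number of crossings of an overlay -/

section Overlay

/-- The overlay count is invariant under maps of the link that cover an injective map of the plane and
preserve the order of heights. -/
theorem overlayCr_image {Θ : Space → Space} {φ : Plane → Plane} {M : Set Space} {C : Set Plane}
    (hp : ∀ a ∈ M, (Θ a).1 = φ a.1)
    (hm : ∀ a ∈ M, ∀ b ∈ M, a.1 = b.1 → a.2 < b.2 → (Θ a).2 < (Θ b).2)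
    (hφ : Function.Injective φ) : overlayCr (Θ '' M) (φ '' C) = overlayCr M C := by
  have hinj : InjOn Θ M := by
    intro a ha b hb hab
    have h1 : a.1 = b.1 := hφ (by rw [← hp a ha, ← hp b hb, hab])
    rcases lt_trichotomy a.2 b.2 with h | h | h
    · exact absurd (congrArg Prod.snd hab) (hm a ha b hb h1 h).ne
    · exact Prod.ext h1 h
    · exact absurd (congrArg Prod.snd hab) (hm b hb a ha h1.symm h).ne'
  have e1 : crossings (Θ '' M) = Prod.map Θ Θ '' crossings M := by
    ext ⟨p, q⟩
    constructor
    · rintro ⟨⟨a, ha, rfl⟩, ⟨b, hb, rfl⟩, h1, h2⟩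
      have h3 : a.1 = b.1 := hφ (by rw [← hp a ha, ← hp b hb]; exact h1)
      refine ⟨(a, b), ⟨ha, hb, h3, ?_⟩, rfl⟩
      rcases lt_trichotomy a.2 b.2 with h | h | h
      · exact h
      · rw [show a = b from Prod.ext h3 h] at h2
        exact absurd h2 (lt_irrefl _)
      · exact absurd (hm b hb a ha h3.symm h) (not_lt.2 (le_of_lt h2))
    · rintro ⟨⟨a, b⟩, ⟨ha, hb, h1, h2⟩, heq⟩
      rw [Prod.map_apply, Prod.mk.injEq] at heq
      obtain ⟨rfl, rfl⟩ := heq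
      exact ⟨⟨a, ha, rfl⟩, ⟨b, hb, rfl⟩, by simpa [hp a ha, hp b hb] using congrArg φ h1,
        hm a ha b hb h1 h2⟩
  have e2 : {a | a ∈ Θ '' M ∧ a.1 ∈ φ '' C} = Θ '' {a | a ∈ M ∧ a.1 ∈ C} := by
    ext p
    constructor
    · rintro ⟨⟨a, ha, rfl⟩, ⟨c, hc, h⟩⟩
      rw [hp a ha] at h
      exact ⟨a, ⟨ha, hφ h ▸ hc⟩, rfl⟩
    · rintro ⟨a, ⟨ha, hc⟩, rfl⟩
      exact ⟨⟨a, ha, rfl⟩, ⟨a.1, hc, (hp a ha).symm⟩⟩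
  rw [overlayCr, overlayCr, e1, e2, InjOn.encard_image, InjOn.encard_image]
  · exact hinj.mono fun a ha => ha.1
  · rintro ⟨a, b⟩ ⟨ha, hb, -⟩ ⟨a', b'⟩ ⟨ha', hb', -⟩ h
    rw [Prod.map_apply, Prod.map_apply, Prod.mk.injEq] at h
    exact Prod.ext (hinj ha ha' h.1) (hinj hb hb' h.2)

theorem Covers.overlayCr {Θ : Space ≃ₜ Space} {φ : Plane → Plane} (h : Covers Θ φ)
    (hφ : Function.Injective φ) (M : Set Space) (C : Set Plane) :
    overlayCr (Θ '' M) (φ '' C) = overlayCr M C := by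
  refine overlayCr_image (fun a _ => h.proj a) (fun a _ b _ h1 h2 => ?_) hφ
  obtain ⟨x, z⟩ := a
  obtain ⟨x', z'⟩ := b
  obtain rfl : x = x' := h1
  exact h.mono x h2

theorem crossings_mono {M N : Set Space} (h : M ⊆ N) : crossings M ⊆ crossings N :=
  fun _ hq => ⟨h hq.1, h hq.2.1, hq.2.2⟩

/-- The overlay count is additive with respect to a partition of the plane. -/
theorem overlayCr_split (S : Set Plane) (M : Set Space) (C : Set Plane) :
    overlayCr M C = overlayCr (M ∩ Prod.fst ⁻¹' S) (C ∩ S) +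
      overlayCr (M \ Prod.fst ⁻¹' S) (C \ S) := by
  have e1 : crossings M = crossings (M ∩ Prod.fst ⁻¹' S) ∪ crossings (M \ Prod.fst ⁻¹' S) := by
    ext ⟨p, q⟩
    constructor
    · rintro ⟨h1, h2, h3, h4⟩
      change p.1 = q.1 at h3
      by_cases hs : p.1 ∈ S
      · exact Or.inl ⟨⟨h1, hs⟩, ⟨h2, by rwa [mem_preimage, ← h3]⟩, h3, h4⟩
      · exact Or.inr ⟨⟨h1, hs⟩, ⟨h2, by rwa [mem_preimage, ← h3]⟩, h3, h4⟩
    · rintro (h | h)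
      · exact crossings_mono inter_subset_left h
      · exact crossings_mono sdiff_subset h
  have e2 : {a | a ∈ M ∧ a.1 ∈ C} = {a | a ∈ M ∩ Prod.fst ⁻¹' S ∧ a.1 ∈ C ∩ S} ∪
      {a | a ∈ M \ Prod.fst ⁻¹' S ∧ a.1 ∈ C \ S} := by
    ext p
    simp only [mem_ofPred_eq, mem_union, mem_inter_iff, mem_preimage, mem_sdiff]
    tauto
  rw [overlayCr, overlayCr, overlayCr, e1, e2, encard_union_eq, encard_union_eq]
  · abel
  · refine disjoint_left.2 fun a ha hb => hb.1.2 ha.1.2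
  · refine disjoint_left.2 fun a ha hb => hb.1.2 ha.1.2

end Overlay

/-! ### Isotopies of overlays -/

section Iso

/-- `(N, C)` is carried to `(N', C')` by a pair of ambient isotopies of space and of the plane in such a
way that the overlay has at most `m` crossings at each time. -/
def Iso (m : ℕ∞) (N : Set Space) (C : Set Plane) (N' : Set Space) (C' : Set Plane) : Prop :=
  ∃ (Φ : Isotopy Space) (f : Isotopy Plane), Φ 1 '' N = N' ∧ f 1 '' C = C' ∧
    ∀ t ∈ Icc (0 : ℝ) 1, overlayCr (Φ t '' N) (f t '' C) ≤ m

variable {m : ℕ∞} {N N' N'' : Set Space} {C C' C'' : Set Plane}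

theorem Iso.refl (h : overlayCr N C ≤ m) : Iso m N C N C :=
  ⟨Isotopy.refl _, Isotopy.refl _, Isotopy.refl_image _ _, Isotopy.refl_image _ _, fun t _ => by
    rwa [Isotopy.refl_image, Isotopy.refl_image]⟩

theorem Iso.symm (h : Iso m N C N' C') : Iso m N' C' N C := by
  obtain ⟨Φ, f, rfl, rfl, h⟩ := h
  have key : ∀ {E : Type} [NormedAddCommGroup E] [NormedSpace ℝ E] (Φ : Isotopy E) (S : Set E)
      (t : ℝ), Φ.reverse t '' (Φ 1 '' S) = Φ (1 - t) '' S := by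
    intro E _ _ Φ S t
    rw [image_image]
    exact image_congr fun x _ => by simp [Isotopy.reverse, Φ.left_inv]
  refine ⟨Φ.reverse, f.reverse, ?_, ?_, fun t ht => ?_⟩
  · rw [key, sub_self]; simp [Φ.start]
  · rw [key, sub_self]; simp [f.start]
  · rw [key, key]
    exact h _ ⟨by linarith [ht.2], by linarith [ht.1]⟩

theorem Iso.trans (h : Iso m N C N' C') (h' : Iso m N' C' N'' C'') : Iso m N C N'' C'' := by
  obtain ⟨Φ, f, rfl, rfl, h⟩ := h
  obtain ⟨Ψ, g, rfl, rfl, h'⟩ := h'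
  have k1 : ∀ {E : Type} [NormedAddCommGroup E] [NormedSpace ℝ E] (Φ Ψ : Isotopy E) (S : Set E)
      (t : ℝ), 2 * t ≤ 1 → Φ.trans Ψ t '' S = Φ (2 * t) '' S :=
    fun Φ Ψ S t ht => image_congr fun x _ => Φ.trans_of_le Ψ ht x
  have k2 : ∀ {E : Type} [NormedAddCommGroup E] [NormedSpace ℝ E] (Φ Ψ : Isotopy E) (S : Set E)
      (t : ℝ), 1 ≤ 2 * t → Φ.trans Ψ t '' S = Ψ (2 * t - 1) '' (Φ 1 '' S) := by
    intro E _ _ Φ Ψ S t ht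
    rw [image_image]
    exact image_congr fun x _ => Φ.trans_of_ge Ψ ht x
  have e : (2 : ℝ) * 1 - 1 = 1 := by norm_num
  refine ⟨Φ.trans Ψ, f.trans g, ?_, ?_, fun t ht => ?_⟩
  · rw [k2 _ _ _ _ (by norm_num), e]
  · rw [k2 _ _ _ _ (by norm_num), e]
  · rcases le_total (2 * t) 1 with h1 | h1
    · rw [k1 _ _ _ _ h1, k1 _ _ _ _ h1]
      exact h _ ⟨by linarith [ht.1], h1⟩
    · rw [k2 _ _ _ _ h1, k2 _ _ _ _ h1]
      exact h' _ ⟨by linarith, by linarith [ht.2]⟩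

theorem Iso.overlay_left (h : Iso m N C N' C') : overlayCr N C ≤ m := by
  obtain ⟨Φ, f, -, -, h⟩ := h
  simpa [Φ.start, f.start] using h 0 ⟨le_rfl, zero_le_one⟩

theorem Iso.overlay_right (h : Iso m N C N' C') : overlayCr N' C' ≤ m := h.symm.overlay_left

/-- Transport by a homeomorphism of space that covers a homeomorphism of the plane. -/
theorem Iso.conj {Θ : Space ≃ₜ Space} {φ : Plane ≃ₜ Plane} (hφ : IsPLHomeo φ) (hΘ : Covers Θ φ)
    (h : Iso m N C N' C') : Iso m (Θ '' N) (φ '' C) (Θ '' N') (φ '' C') := by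
  obtain ⟨Φ, f, rfl, rfl, h⟩ := h
  have key : ∀ {E : Type} [NormedAddCommGroup E] [NormedSpace ℝ E] (Φ : Isotopy E) (e : E ≃ₜ E)
      (he : IsPLHomeo e) (S : Set E) (t : ℝ), Φ.conj e he t '' (e '' S) = e '' (Φ t '' S) := by
    intro E _ _ Φ e he S t
    simp only [image_image, Isotopy.conj_apply, e.symm_apply_apply]
  refine ⟨Φ.conj Θ hΘ.pl, f.conj φ hφ, key _ _ _ _ _, key _ _ _ _ _, fun t ht => ?_⟩
  rw [key, key, hΘ.overlayCr φ.injective]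
  exact h t ht

/-- Moving the curve without touching the projection of the link. -/
theorem Iso.of_curve (f : Isotopy Plane) (hf : ∀ t, ∀ a ∈ N, f t a.1 = a.1)
    (h : overlayCr N C ≤ m) : Iso m N C N (f 1 '' C) := by
  refine ⟨Isotopy.refl _, f, Isotopy.refl_image _ _, rfl, fun t _ => ?_⟩
  rw [Isotopy.refl_image]
  rw [← overlayCr_image (Θ := id) (M := N) (φ := f t) (C := C) (fun a ha => (hf t a ha).symm)
    (fun _ _ _ _ _ h => h) (f.homeo t).injective, image_id] at h
  exact h

/-- The isotopy of space that moves the points at height `z` by a planar isotopy at time `τ (t, z)`. -/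
def Isotopy.lift (f : Isotopy Plane) (τ : ℝ × ℝ → ℝ) (hτ : IsPL τ) (h0 : ∀ z, τ (0, z) = 0)
    (hs : ∃ r, ∀ t z, r < |z| → τ (t, z) = 0) : Isotopy Space where
  toFun t a := (f (τ (t, a.2)) a.1, a.2)
  invFun t a := (f.invFun (τ (t, a.2)) a.1, a.2)
  pl := by
    have : IsPL fun q : ℝ × Space => τ (q.1, q.2.2) := by fun_prop
    fun_prop
  pl_inv := by
    have : IsPL fun q : ℝ × Space => τ (q.1, q.2.2) := by fun_prop
    fun_prop
  left_inv t a := by simp [f.left_inv]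
  right_inv t a := by simp [f.right_inv]
  start a := by rw [h0, f.start]
  supp := by
    obtain ⟨r, hr⟩ := hs
    obtain ⟨K, hK, hf⟩ := f.supp
    refine ⟨K ×ˢ Icc (-r) r, hK.prod isCompact_Icc, fun t a ha => ?_⟩
    by_cases h1 : a.1 ∈ K
    · have : r < |a.2| := by
        by_contra! hc
        exact ha ⟨h1, abs_le.1 hc⟩
      rw [hr t _ this, f.start]
    · rw [hf _ _ h1]

/-- The product of a homeomorphism of the plane and the identity of the vertical line. -/
def liftH (φ : Plane ≃ₜ Plane) : Space ≃ₜ Space := φ.prodCongr (Homeomorph.refl ℝ)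

@[simp] theorem liftH_apply (φ : Plane ≃ₜ Plane) (a : Space) : liftH φ a = (φ a.1, a.2) := rfl
@[simp] theorem liftH_symm_apply (φ : Plane ≃ₜ Plane) (a : Space) :
    (liftH φ).symm a = (φ.symm a.1, a.2) := rfl

theorem covers_liftH {φ : Plane ≃ₜ Plane} (hφ : IsPLHomeo φ) : Covers (liftH φ) φ := by
  have h1 : IsPL φ := hφ.1
  have h2 : IsPL φ.symm := hφ.2
  refine ⟨⟨?_, ?_⟩, fun a => rfl, fun x a b h => h⟩
  · change IsPL fun a : Space => (φ a.1, a.2)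
    fun_prop
  · change IsPL fun a : Space => (φ.symm a.1, a.2)
    fun_prop

/-- A planar isotopy applied to both the link and the curve. -/
theorem Iso.of_planar (f : Isotopy Plane) (hN : IsCompact N) (h : overlayCr N C ≤ m) :
    Iso m N C (liftH (f.homeo 1) '' N) (f 1 '' C) := by
  obtain ⟨R, hR⟩ := (hN.image continuous_snd).isBounded.exists_norm_le
  have hR' : ∀ a ∈ N, |a.2| ≤ R := fun a ha => hR _ ⟨a, ha, rfl⟩
  have e : ∀ t ∈ Icc (0 : ℝ) 1, ∀ a ∈ N, max 0 (min t (R + 1 - |a.2|)) = t := by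
    intro t ht a ha
    rw [min_eq_left (by linarith [hR' a ha, ht.2]), max_eq_right ht.1]
  have key : ∀ t ∈ Icc (0 : ℝ) 1,
      f.lift (fun q => max 0 (min q.1 (R + 1 - |q.2|))) (by fun_prop)
        (fun z => max_eq_left (min_le_left _ _))
        ⟨R + 1, fun t z hz => max_eq_left ((min_le_right _ _).trans (by linarith))⟩ t '' N =
      liftH (f.homeo t) '' N := by
    intro t ht
    refine image_congr fun a ha => ?_
    simp [Isotopy.lift, e t ht a ha]
  refine ⟨f.lift _ _ _ _, f, key 1 ⟨zero_le_one, le_rfl⟩, rfl, fun t ht => ?_⟩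
  rw [key t ht]
  exact (Covers.overlayCr (covers_liftH (f.isPLHomeo_homeo t)) (f.homeo t).injective N C).trans_le h

/-- The increasing bijection of a vertical line given by a homeomorphism covering the identity. -/
noncomputable def vertO {G : Space ≃ₜ Space} (hG : Covers G id) (x : Plane) : ℝ ≃o ℝ :=
  StrictMono.orderIsoOfRightInverse (fun z => (G (x, z)).2) (hG.mono x)
    (fun z => (G.symm (x, z)).2) fun z => by
      have h1 : (G.symm (x, z)).1 = x := by
        have := hG.proj (G.symm (x, z))
        rw [G.apply_symm_apply] at this
        exact this.symm
      have h2 : (x, (G.symm (x, z)).2) = G.symm (x, z) := Prod.ext h1.symm rfl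
      simp only [h2, G.apply_symm_apply]

/-- Changing the heights without changing the decorated diagram. -/
theorem Iso.of_covers_id {G : Space ≃ₜ Space} (hG : Covers G id) (hN : IsCompact N)
    (h : overlayCr N C ≤ m) : Iso m N C (G '' N) C := by
  have hG1 : IsPL G := hG.pl.1
  have hG2 : IsPL G.symm := hG.pl.2
  obtain ⟨R₁, hR₁⟩ := hN.isBounded.exists_norm_le
  obtain ⟨R₂, hR₂⟩ := (hN.image G.continuous).isBounded.exists_norm_le
  obtain ⟨R, hR0, hRN, hRG⟩ : ∃ R : ℝ, 0 ≤ R ∧ (∀ a ∈ N, ‖a‖ ≤ R) ∧ ∀ a ∈ N, ‖G a‖ ≤ R :=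
    ⟨max 0 (max R₁ R₂), le_max_left _ _,
      fun a ha => (hR₁ a ha).trans ((le_max_left _ _).trans (le_max_right _ _)),
      fun a ha => (hR₂ _ ⟨a, ha, rfl⟩).trans ((le_max_right _ _).trans (le_max_right _ _))⟩
  set d : ℝ → Plane → ℝ := fun t x => max 0 (min (2 * R * t) (3 * R - ‖x‖)) with hd
  have hn : IsPL fun v : Plane => ‖v‖ := isPL_norm_plane
  have hdPL : IsPL fun q : ℝ × Space => d q.1 q.2.1 := by
    have : IsPL fun q : ℝ × Space => ‖q.2.1‖ := hn.comp (by fun_prop)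
    fun_prop
  set L : ℝ := 5 * R + 1 with hL
  let U : ℝ → Plane → ℝ ≃o ℝ := fun t x => pushO 1 one_pos (d t x) (-L) L
  have hd0 : ∀ x, d 0 x = 0 := fun x => max_eq_left ((min_le_left _ _).trans (by simp))
  let e : ℝ → Plane → ℝ ≃o ℝ := fun t x => ordSup (U t x).symm (ordInf (U t x) (vertO hG x))
  have he : ∀ t x z, e t x z = max ((U t x).symm z) (min (U t x z) (G (x, z)).2) := fun _ _ _ => rfl
  have he' : ∀ t x z, (e t x).symm z = min (U t x z) (max ((U t x).symm z) (G.symm (x, z)).2) :=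
    fun _ _ _ => rfl
  let Φ : Isotopy Space := Isotopy.fibre e (by simp only [he, U]; fun_prop)
    (by simp only [he', U]; fun_prop)
    (fun x z => by
      rw [he, pushO_eq_self _ (Or.inl (hd0 x).le), pushO_symm_eq_self _ (Or.inl (hd0 x).le)]
      exact max_eq_left (min_le_left _ _))
    (by
      refine ⟨Metric.closedBall 0 (3 * R) ×ˢ Icc (-L) L,
        (isCompact_closedBall _ _).prod isCompact_Icc, fun t a ha => ?_⟩
      have hc : d t a.1 ≤ 0 ∨ a.2 ≤ -L ∨ L ≤ a.2 := by
        by_contra! hc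
        refine ha ⟨?_, hc.2.1.le, hc.2.2.le⟩
        by_contra! hx
        rw [Metric.mem_closedBall, dist_zero_right, not_le] at hx
        exact absurd hc.1 (not_lt.2 (max_le le_rfl ((min_le_right _ _).trans (by linarith))))
      rw [he, pushO_eq_self _ hc, pushO_symm_eq_self _ hc]
      exact max_eq_left (min_le_left _ _))
  have hfib : ∀ t a, (Φ t a).1 = a.1 := fun _ _ => rfl
  refine ⟨Φ, Isotopy.refl _, ?_, Isotopy.refl_image _ _, fun t _ => ?_⟩
  · refine image_congr fun a ha => ?_
    have h1 : ‖a.1‖ ≤ R := (norm_fst_le a).trans (hRN a ha)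
    have h2 := abs_le.1 ((norm_snd_le a).trans (hRN a ha))
    have h3 := abs_le.1 ((norm_snd_le _).trans (hRG a ha))
    have hda : d 1 a.1 = 2 * R := by
      simp only [hd]
      rw [min_eq_left (by linarith), max_eq_right (by linarith), mul_one]
    have hu : ∀ z, -(3 * R) ≤ z → z ≤ R → U 1 a.1 z = z + 2 * R := by
      intro z hz1 hz2
      simp only [U, hda]
      rw [pushO_eq_add, max_eq_right] <;> linarith
    have h4 : U 1 a.1 a.2 = a.2 + 2 * R := hu _ (by linarith) (by linarith)
    have h5 : (U 1 a.1).symm a.2 = a.2 - 2 * R := by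
      rw [OrderIso.symm_apply_eq, hu _ (by linarith) (by linarith)]; ring
    refine Prod.ext (hG.proj a).symm ?_
    change e 1 a.1 a.2 = _
    rw [he, h4, h5, min_eq_right, max_eq_right] <;> simp only [Prod.mk.eta] <;> linarith
  · have := overlayCr_image (Θ := Φ t) (φ := id) (M := N) (C := C) (fun a _ => hfib t a)
      (fun a _ b _ hab hlt => ?_) Function.injective_id
    · rw [Isotopy.refl_image]
      rw [image_id] at this
      exact this.trans_le h
    · change e t a.1 a.2 < e t b.1 b.2
      rw [hab]
      exact (e t b.1).strictMono hlt

end Iso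

/-! ### Isotopies of curves in the plane -/

section Moves

/-- There is an ambient isotopy of the plane supported in `R` that carries `Γ` to `Γ'`. -/
def PlanarMove (R Γ Γ' : Set Plane) : Prop :=
  ∃ F : Isotopy Plane, (∀ t, ∀ v ∉ R, F t v = v) ∧ F 1 '' Γ = Γ'

variable {R R' Γ Γ' Γ'' : Set Plane}

theorem PlanarMove.refl (R Γ : Set Plane) : PlanarMove R Γ Γ :=
  ⟨Isotopy.refl _, fun _ _ _ => rfl, Isotopy.refl_image _ _⟩

theorem PlanarMove.mono (h : PlanarMove R Γ Γ') (hR : R ⊆ R') : PlanarMove R' Γ Γ' := by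
  obtain ⟨F, h1, h2⟩ := h
  exact ⟨F, fun t v hv => h1 t v fun h => hv (hR h), h2⟩

theorem PlanarMove.symm (h : PlanarMove R Γ Γ') : PlanarMove R Γ' Γ := by
  obtain ⟨F, h1, rfl⟩ := h
  refine ⟨F.reverse, fun t v hv => ?_, ?_⟩
  · change F (1 - t) (F.invFun 1 v) = v
    rw [F.inv_eq_of_fix (h1 1 v hv), h1 _ v hv]
  · rw [image_image]
    simp [Isotopy.reverse, F.left_inv, F.start]

theorem PlanarMove.trans (h : PlanarMove R Γ Γ') (h' : PlanarMove R Γ' Γ'') :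
    PlanarMove R Γ Γ'' := by
  obtain ⟨F, h1, rfl⟩ := h
  obtain ⟨G, h2, rfl⟩ := h'
  refine ⟨F.trans G, fun t v hv => ?_, ?_⟩
  · change G _ (F _ v) = v
    rw [h1 _ v hv, h2 _ v hv]
  · rw [image_image]
    refine image_congr fun x _ => ?_
    rw [F.trans_of_ge G (by norm_num)]; norm_num

theorem PlanarMove.conj (h : PlanarMove R Γ Γ') {φ : Plane ≃ₜ Plane} (hφ : IsPLHomeo φ) :
    PlanarMove (φ '' R) (φ '' Γ) (φ '' Γ') := by
  obtain ⟨F, h1, rfl⟩ := h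
  refine ⟨F.conj φ hφ, fun t v hv => ?_, ?_⟩
  · rw [Isotopy.conj_apply, h1 t _ fun hc => hv ⟨_, hc, φ.apply_symm_apply v⟩, φ.apply_symm_apply]
  · simp only [image_image, Isotopy.conj_apply, φ.symm_apply_apply]

end Moves

/-! ### Smoothings and their state sum -/

section Bracket

/-- The square `[-1,1]²`. -/
def box : Set Plane := Metric.closedBall 0 1

theorem mem_box {v : Plane} : v ∈ box ↔ |v.1| ≤ 1 ∧ |v.2| ≤ 1 := by
  simp [box, Prod.norm_def]

/-- The part of the coordinate axes in the square. -/
def cross : Set Plane := {v | v ∈ box ∧ (v.1 = 0 ∨ v.2 = 0)}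

/-- The two smoothings of the cross: a pair of segments that cut the corners in two opposite
quadrants. -/
def corner : Bool → Set Plane
  | true => {v | |v.1 + v.2| = 1 ∧ |v.1 - v.2| ≤ 1}
  | false => {v | |v.1 - v.2| = 1 ∧ |v.1 + v.2| ≤ 1}

theorem corner_subset_box (s : Bool) : corner s ⊆ box := by
  rintro ⟨x, y⟩ h
  rw [mem_box]
  cases s <;> obtain ⟨h1, h2⟩ := h <;> simp only [abs_le] at * <;>
    rcases abs_eq (zero_le_one' ℝ) |>.1 h1 with h | h <;> constructor <;> constructor <;> linarith

/-- Disc charts of the plane that show a double point of `Γ` as a pair of crossing straight lines, away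
from the projection of `N`. -/
structure IsChart (φ : Plane ≃ₜ Plane) (N : Set Space) (Γ : Set Plane) : Prop where
  pl : IsPLHomeo φ
  cross : φ ⁻¹' Γ ∩ box = cross
  free : ∀ a ∈ N, a.1 ∉ φ '' box

/-- Smoothing of a double point in one of the two possible ways. -/
def smooth (φ : Plane ≃ₜ Plane) (s : Bool) (Γ : Set Plane) : Set Plane :=
  (Γ \ φ '' box) ∪ φ '' corner s

/-- The state sum, over all smoothings in a list of charts, of the values of `W`. -/
def bracket (W : Set Plane → ZMod 2) : List (Plane ≃ₜ Plane) → Set Plane → ZMod 2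
  | [], Γ => W Γ
  | φ :: l, Γ => bracket W l (smooth φ true Γ) + bracket W l (smooth φ false Γ)

/-- Charts with disjoint discs. -/
def Apart (φ ψ : Plane ≃ₜ Plane) : Prop := Disjoint (φ '' box) (ψ '' box)

theorem Apart.symm {φ ψ : Plane ≃ₜ Plane} (h : Apart φ ψ) : Apart ψ φ := Disjoint.symm h

variable {φ φ' ψ : Plane ≃ₜ Plane} {N N' : Set Space} {Γ Γ' : Set Plane} {s : Bool}

theorem image_corner_subset (φ : Plane ≃ₜ Plane) (s : Bool) : φ '' corner s ⊆ φ '' box :=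
  image_mono (corner_subset_box s)

/-- Smoothings in disjoint discs commute. -/
theorem smooth_comm (h : Apart φ ψ) (s t : Bool) (Γ : Set Plane) :
    smooth φ s (smooth ψ t Γ) = smooth ψ t (smooth φ s Γ) := by
  ext v
  have h1 := @image_corner_subset φ s v
  have h2 := @image_corner_subset ψ t v
  have h3 : v ∈ φ '' box → v ∈ ψ '' box → False := fun h1 h2 => disjoint_left.1 h h1 h2
  simp only [smooth, mem_union, mem_sdiff]
  tauto

theorem smooth_inter_of_disjoint {S : Set Plane} (h : Disjoint S (φ '' box)) (s : Bool)
    (Γ : Set Plane) : smooth φ s Γ ∩ S = Γ ∩ S := by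
  ext v
  have h1 := @image_corner_subset φ s v
  have h3 : v ∈ S → v ∈ φ '' box → False := fun h1 h2 => disjoint_left.1 h h1 h2
  simp only [smooth, mem_union, mem_sdiff, mem_inter_iff]
  tauto

theorem smooth_congr_diff {S : Set Plane} (s : Bool) (h : Γ \ S = Γ' \ S) :
    smooth φ s Γ \ S = smooth φ s Γ' \ S := by
  ext v
  have := Set.ext_iff.1 h v
  simp only [smooth, mem_union, mem_sdiff] at *
  tauto

theorem IsChart.smooth (hψ : IsChart ψ N Γ) (h : Apart φ ψ) (s : Bool) :
    IsChart ψ N (smooth φ s Γ) := by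
  refine ⟨hψ.pl, ?_, hψ.free⟩
  rw [← hψ.cross]
  have := smooth_inter_of_disjoint (S := ψ '' box) h.symm s Γ
  ext v
  have := Set.ext_iff.1 this (ψ v)
  simpa [ψ.injective.mem_set_image] using this

/-- Smoothing takes place away from the link, so that it does not change the overlay count. -/
theorem overlayCr_smooth (h : ∀ a ∈ N, a.1 ∉ φ '' box) (s : Bool) (Γ : Set Plane) :
    overlayCr N (smooth φ s Γ) = overlayCr N Γ := by
  have : {a | a ∈ N ∧ a.1 ∈ PLLink.smooth φ s Γ} = {a | a ∈ N ∧ a.1 ∈ Γ} := by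
    ext a
    have h1 := @image_corner_subset φ s a.1
    have := h a
    simp only [PLLink.smooth, mem_union, mem_sdiff, mem_ofPred_eq]
    tauto
  rw [overlayCr, overlayCr, this]

theorem image_trans (φ F : Plane ≃ₜ Plane) (S : Set Plane) : φ.trans F '' S = F '' (φ '' S) := by
  rw [image_image]; rfl

theorem smooth_trans (φ F : Plane ≃ₜ Plane) (s : Bool) (Γ : Set Plane) :
    smooth (φ.trans F) s (F '' Γ) = F '' smooth φ s Γ := by
  simp only [smooth, image_union, image_sdiff F.injective, image_trans]

/-- State sums over corresponding charts agree if the values of the two functions agree on all pairs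
related by `R`, and `R` is preserved by corresponding smoothings. -/
theorem bracket_rel {R : Set Plane → Set Plane → Prop} {W W' : Set Plane → ZMod 2}
    (hW : ∀ Γ Γ', R Γ Γ' → W Γ = W' Γ') {l l' : List (Plane ≃ₜ Plane)}
    (h : List.Forall₂ (fun φ φ' => ∀ s Γ Γ', R Γ Γ' → R (smooth φ s Γ) (smooth φ' s Γ')) l l') :
    ∀ Γ Γ', R Γ Γ' → bracket W l Γ = bracket W' l' Γ' := by
  induction h with
  | nil => exact hW
  | cons h _ ih =>
    intro Γ Γ' hR
    rw [bracket, bracket, ih _ _ (h _ _ _ hR), ih _ _ (h _ _ _ hR)]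

theorem bracket_append (W : Set Plane → ZMod 2) (l l' : List (Plane ≃ₜ Plane)) :
    ∀ Γ, bracket W (l ++ l') Γ = bracket (bracket W l') l Γ := by
  induction l with
  | nil => exact fun _ => rfl
  | cons φ l ih => intro Γ; simp only [List.cons_append, bracket, ih]

/-- The order in which disjoint charts are smoothed is irrelevant. -/
theorem bracket_perm (W : Set Plane → ZMod 2) {l l' : List (Plane ≃ₜ Plane)} (h : l.Perm l') :
    l.Pairwise Apart → ∀ Γ, bracket W l Γ = bracket W l' Γ := by
  induction h with
  | nil => exact fun _ _ => rfl
  | cons φ _ ih =>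
    intro hl Γ
    rw [bracket, bracket, ih hl.of_cons, ih hl.of_cons]
  | swap φ ψ l =>
    intro hl Γ
    have h : Apart ψ φ := List.rel_of_pairwise_cons hl (List.mem_cons_self ..)
    simp only [bracket, smooth_comm h]
    abel
  | trans h1 _ ih1 ih2 =>
    intro hl Γ
    rw [ih1 hl, ih2 (h1.pairwise hl fun h => h.symm)]

theorem bracket_map {W W' : Set Plane → ZMod 2} {m : ℕ∞} (F : Plane ≃ₜ Plane)
    (hW : ∀ C, overlayCr N C ≤ m → W C = W' (F '' C)) {l : List (Plane ≃ₜ Plane)}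
    (hl : ∀ φ ∈ l, IsPLHomeo φ → ∀ a ∈ N, a.1 ∉ φ '' box) (hpl : ∀ φ ∈ l, IsPLHomeo φ)
    (hΓ : overlayCr N Γ ≤ m) :
    bracket W l Γ = bracket W' (l.map fun φ => φ.trans F) (F '' Γ) := by
  refine bracket_rel (R := fun C C' => overlayCr N C ≤ m ∧ C' = F '' C) ?_ ?_ _ _ ⟨hΓ, rfl⟩
  · rintro C _ ⟨h, rfl⟩
    exact hW C h
  · rw [List.forall₂_map_right_iff, List.forall₂_same]
    rintro φ hφ s C _ ⟨h, rfl⟩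
    exact ⟨by rwa [overlayCr_smooth (hl φ hφ (hpl φ hφ))], smooth_trans _ _ _ _⟩

/-- Functions of pairs of a link in space and a set in the plane that are invariant under isotopies with at
most `m` crossings in the overlay and vanish on disconnected sets. -/
structure Valuation (m : ℕ∞) (W : Set Space → Set Plane → ZMod 2) : Prop where
  inv : ∀ {N C N' C'}, Iso m N C N' C' → W N C = W N' C'
  disc : ∀ {N C}, ¬ IsPreconnected C → W N C = 0

variable {m : ℕ∞} {W : Set Space → Set Plane → ZMod 2}

theorem Valuation.comap (hW : Valuation m W) {Θ : Space ≃ₜ Space} (hφ : IsPLHomeo φ)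
    (hΘ : Covers Θ φ) : Valuation m fun N C => W (Θ '' N) (φ '' C) where
  inv h := hW.inv (h.conj hφ hΘ)
  disc {N C} h := hW.disc fun h' => h (by
    have := h'.image φ.symm φ.symm.continuous.continuousOn
    rwa [φ.image_symm, φ.preimage_image] at this)

theorem Valuation.of_move (hW : Valuation m W) {R : Set Plane} (h : PlanarMove R Γ Γ')
    (hN : ∀ a ∈ N, a.1 ∉ R) (hm : overlayCr N Γ ≤ m) : W N Γ = W N Γ' := by
  obtain ⟨F, h1, rfl⟩ := h
  exact hW.inv (Iso.of_curve F (fun t a ha => h1 t _ (hN a ha)) hm)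

/-- The scaling of the plane by a factor (by `1` if the factor is zero). -/
noncomputable def scale (ε : ℝ) : Plane ≃ₜ Plane :=
  if h : ε ≠ 0 then Homeomorph.smulOfNeZero ε h else Homeomorph.refl _

theorem scale_apply {ε : ℝ} (h : 0 < ε) (v : Plane) : scale ε v = ε • v := by
  simp [scale, h.ne']

theorem isPLHomeo_scale (ε : ℝ) : IsPLHomeo (scale ε) := by
  by_cases h : ε ≠ 0
  · refine ⟨?_, ?_⟩
    · have : ⇑(scale ε) = fun v : Plane => ε • v := by ext1 v; simp [scale, h]
      rw [this]; exact isPL_id.const_smul ε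
    · have : ⇑(scale ε).symm = fun v : Plane => ε⁻¹ • v := by
        ext1 v
        rw [Homeomorph.symm_apply_eq]; simp [scale, h]
      rw [this]; exact isPL_id.const_smul _
  · simp only [scale, h, dite_false]; exact isPLHomeo_refl

theorem smul_mem_box {v : Plane} (hv : v ∈ box) {s : ℝ} (hs : s ∈ Icc (0 : ℝ) 1) :
    s • v ∈ box := by
  rw [mem_box] at *
  have h1 := abs_of_nonneg hs.1
  simp only [Prod.smul_fst, Prod.smul_snd, smul_eq_mul, abs_mul, h1]
  exact ⟨mul_le_one₀ hs.2 (abs_nonneg _) hv.1, mul_le_one₀ hs.2 (abs_nonneg _) hv.2⟩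

theorem scale_image_box {ε : ℝ} (h : 0 < ε) (h1 : ε ≤ 1) : scale ε '' box ⊆ box := by
  rintro _ ⟨v, hv, rfl⟩
  rw [scale_apply h]
  exact smul_mem_box hv ⟨h.le, h1⟩

theorem IsChart.scale (hφ : IsChart φ N Γ) {ε : ℝ} (h : 0 < ε) (h1 : ε ≤ 1) :
    IsChart ((scale ε).trans φ) N Γ := by
  refine ⟨(isPLHomeo_scale ε).trans hφ.pl, ?_, fun a ha => ?_⟩
  · ext v
    have h2 := Set.ext_iff.1 hφ.cross (ε • v)
    simp only [PLLink.cross, mem_inter_iff, mem_preimage, mem_ofPred_eq, Homeomorph.trans_apply,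
      scale_apply h, Prod.smul_fst, Prod.smul_snd, smul_eq_mul, mul_eq_zero, h.ne', false_or] at *
    have h3 : v ∈ box → ε • v ∈ box := fun hv => smul_mem_box hv ⟨h.le, h1⟩
    tauto
  · rw [image_trans]
    exact fun hc => hφ.free a ha (image_mono (scale_image_box h h1) hc)

/-- `φ'` shows a smaller disc than `φ` with the same centre, and the change of coordinates commutes with
scaling. -/
structure Refines (φ φ' : Plane ≃ₜ Plane) : Prop where
  subset : φ' '' box ⊆ φ '' Metric.ball 0 1
  conical : ∀ v ∈ box, ∀ s ∈ Icc (0 : ℝ) 1, φ.symm (φ' (s • v)) = s • φ.symm (φ' v)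

theorem Refines.subset_box {φ φ' : Plane ≃ₜ Plane} (h : Refines φ φ') : φ' '' box ⊆ φ '' box :=
  h.subset.trans (image_mono Metric.ball_subset_closedBall)

theorem Apart.mono {φ φ' ψ ψ' : Plane ≃ₜ Plane} (h : Apart φ ψ) (h1 : φ' '' box ⊆ φ '' box)
    (h2 : ψ' '' box ⊆ ψ '' box) : Apart φ' ψ' := Disjoint.mono h1 h2 h

/-- The two smoothings of the cross in a smaller disc with conical coordinates agree, up to isotopy and
order, with those in the square. -/
def CornerMove : Prop :=
  ∀ ψ : Plane ≃ₜ Plane, IsPLHomeo ψ → (∀ v ∈ box, ∀ s ∈ Icc (0 : ℝ) 1, ψ (s • v) = s • ψ v) →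
    ψ '' box ⊆ Metric.ball 0 1 → (∀ v ∈ box, ψ v ∈ cross ↔ v ∈ cross) →
    ∃ b : Bool, ∀ Γ : Set Plane, Γ ∩ box = cross → ∀ s : Bool,
      PlanarMove box (smooth ψ s Γ) (smooth (Homeomorph.refl _) (xor b s) Γ)

/-- Passing to a smaller disc replaces the two states by isotopic ones, possibly in the other order;
their sum does not change. -/
theorem bracket_refines_one (hC : CornerMove) (hW : Valuation m W) (hφ : IsChart φ N Γ)
    (hφ' : IsChart φ' N Γ) (h : Refines φ φ') (hm : overlayCr N Γ ≤ m) :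
    bracket (W N) [φ] Γ = bracket (W N) [φ'] Γ := by
  have hsub : φ'.trans φ.symm '' box ⊆ Metric.ball 0 1 := by
    rintro _ ⟨v, hv, rfl⟩
    obtain ⟨w, hw, h2⟩ := h.subset ⟨v, hv, rfl⟩
    simpa [← h2] using hw
  obtain ⟨b, hb⟩ := hC (φ'.trans φ.symm) (hφ'.pl.trans hφ.pl.symm) h.conical hsub (fun v hv => by
    have h1 := Set.ext_iff.1 hφ.cross (φ.symm (φ' v))
    have h2 := Set.ext_iff.1 hφ'.cross v
    have h3 : φ.symm (φ' v) ∈ box := Metric.ball_subset_closedBall (hsub ⟨v, hv, rfl⟩)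
    simp only [mem_inter_iff, mem_preimage, φ.apply_symm_apply] at h1 h2
    change φ.symm (φ' v) ∈ _ ↔ _
    tauto)
  have key : ∀ s, W N (smooth φ' s Γ) = W N (smooth φ (xor b s) Γ) := by
    intro s
    have h1 := (hb (φ ⁻¹' Γ) hφ.cross s).conj hφ.pl
    rw [← smooth_trans, ← smooth_trans, φ.image_preimage] at h1
    have h2 : (φ'.trans φ.symm).trans φ = φ' := by ext1 v; simp
    have h3 : (Homeomorph.refl Plane).trans φ = φ := by ext1 v; simp
    rw [h2, h3] at h1
    exact hW.of_move h1 hφ.free (by rwa [overlayCr_smooth hφ'.free])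
  simp only [bracket, key]
  cases b
  · rfl
  · exact add_comm _ _

theorem bracket_refines (hC : CornerMove) (hW : Valuation m W) {l l' : List (Plane ≃ₜ Plane)}
    (h : List.Forall₂ Refines l l') : ∀ {Γ : Set Plane}, (∀ φ ∈ l, IsChart φ N Γ) →
    (∀ φ ∈ l', IsChart φ N Γ) → l.Pairwise Apart → overlayCr N Γ ≤ m →
    bracket (W N) l Γ = bracket (W N) l' Γ := by
  induction h with
  | nil => intros; rfl
  | @cons φ φ' l l' hφ hl ih =>
    intro Γ h1 h2 hp hm
    have hsub : ∀ ψ' ∈ l', ∃ ψ ∈ l, ψ' '' box ⊆ ψ '' box := by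
      clear ih h1 h2 hp hm
      induction hl with
      | nil => simp
      | cons h _ ih =>
        intro ψ' hψ'
        rcases List.mem_cons.1 hψ' with rfl | hψ'
        · exact ⟨_, List.mem_cons_self .., h.subset_box⟩
        · obtain ⟨ψ, h3, h4⟩ := ih ψ' hψ'
          exact ⟨ψ, List.mem_cons_of_mem _ h3, h4⟩
    have hap : ∀ ψ' ∈ l', Apart φ ψ' := by
      intro ψ' hψ'
      obtain ⟨ψ, h3, h4⟩ := hsub ψ' hψ'
      exact (List.rel_of_pairwise_cons hp h3).mono Subset.rfl h4
    have hcφ := h1 φ (List.mem_cons_self ..)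
    have hcφ' := h2 φ' (List.mem_cons_self ..)
    -- the other double points are refined first; then the first one is moved to the end of the list
    have step1 : bracket (W N) (φ :: l) Γ = bracket (W N) (φ :: l') Γ := by
      have : ∀ s, bracket (W N) l (smooth φ s Γ) = bracket (W N) l' (smooth φ s Γ) := fun s =>
        ih (fun ψ hψ => (h1 ψ (List.mem_cons_of_mem _ hψ)).smooth (List.rel_of_pairwise_cons hp hψ) s)
          (fun ψ hψ => (h2 ψ (List.mem_cons_of_mem _ hψ)).smooth (hap ψ hψ) s) hp.of_cons
          (by rwa [overlayCr_smooth hcφ.free])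
      rw [bracket, bracket, this, this]
    have hend : ∀ χ : Plane ≃ₜ Plane, (∀ ψ' ∈ l', Apart χ ψ') →
        bracket (W N) (χ :: l') Γ = bracket (bracket (W N) [χ]) l' Γ := by
      intro χ hχ
      rw [← bracket_append]
      have : ∀ (l' : List (Plane ≃ₜ Plane)), (∀ ψ' ∈ l', Apart χ ψ') → ∀ Γ,
          bracket (W N) (χ :: l') Γ = bracket (W N) (l' ++ [χ]) Γ := by
        clear * -
        intro l'
        induction l' with
        | nil => intros; rfl
        | cons ψ l' ih =>
          intro h Γ
          have h1 := ih fun ψ' hψ' => h ψ' (List.mem_cons_of_mem _ hψ')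
          simp only [List.cons_append, bracket, ← h1, smooth_comm (h ψ (List.mem_cons_self ..))]
          abel
      exact this l' hχ Γ
    rw [step1, hend φ hap, hend φ' fun ψ' hψ' => (hap ψ' hψ').mono hφ.subset_box Subset.rfl]
    refine bracket_rel
      (R := fun C C' => C = C' ∧ IsChart φ N C ∧ IsChart φ' N C ∧ overlayCr N C ≤ m) ?_ ?_ _ _
      ⟨rfl, hcφ, hcφ', hm⟩
    · rintro C _ ⟨rfl, h3, h4, h5⟩
      exact bracket_refines_one hC hW h3 h4 hφ h5
    · rw [List.forall₂_same]
      rintro ψ hψ s C _ ⟨rfl, h3, h4, h5⟩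
      exact ⟨rfl, h3.smooth (hap ψ hψ).symm s,
        h4.smooth ((hap ψ hψ).mono hφ.subset_box Subset.rfl).symm s,
        by rwa [overlayCr_smooth (h2 ψ (List.mem_cons_of_mem _ hψ)).free]⟩

theorem box_mem_nhds : box ∈ 𝓝 (0 : Plane) := Metric.closedBall_mem_nhds _ one_pos

theorem eventually_image_subset (hφ : Continuous φ) {O : Set Plane} (hO : O ∈ 𝓝 (φ 0)) :
    ∀ᶠ ε in 𝓝[>] (0 : ℝ), (scale ε).trans φ '' box ⊆ O := by
  obtain ⟨r, hr, h⟩ := Metric.nhds_basis_closedBall.mem_iff.1 (hφ.continuousAt.preimage_mem_nhds hO)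
  filter_upwards [Ioc_mem_nhdsGT hr] with ε hε
  rintro _ ⟨v, hv, rfl⟩
  apply h
  change scale ε v ∈ _
  rw [scale_apply hε.1, mem_closedBall_zero_iff, norm_smul, Real.norm_of_nonneg hε.1.le]
  have : ‖v‖ ≤ 1 := by simpa [box] using hv
  nlinarith [hε.1, hε.2, norm_nonneg v]

/-- A small multiple of a chart refines every other chart with the same centre, since the change of
coordinates, which is piecewise linear and fixes the origin, is conical near the origin. -/
theorem eventually_refines (hφ : IsPLHomeo φ) (hφ' : IsPLHomeo φ') (h : φ 0 = φ' 0) :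
    ∀ᶠ ε in 𝓝[>] (0 : ℝ), Refines φ ((scale ε).trans φ') := by
  have h1 : IsPL φ' := hφ'.1
  have h2 : IsPL φ.symm := hφ.2
  obtain ⟨r, hr, hcon⟩ := (h2.comp h1).eventually_conical (by rw [← h, φ.symm_apply_apply])
  have h3 : φ '' Metric.ball 0 1 ∈ 𝓝 (φ' 0) := by
    rw [← h]; exact φ.isOpenMap.image_mem_nhds (Metric.ball_mem_nhds _ one_pos)
  filter_upwards [eventually_image_subset φ'.continuous h3, Ioc_mem_nhdsGT hr] with ε h4 hε
  refine ⟨h4, fun v hv s hs => ?_⟩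
  have hv' : ‖v‖ ≤ 1 := by simpa [box] using hv
  simp only [Homeomorph.trans_apply, scale_apply hε.1]
  rw [smul_comm]
  refine hcon _ ?_ s hs
  rw [norm_smul, Real.norm_of_nonneg hε.1.le]
  nlinarith [hε.1, hε.2, norm_nonneg v]

theorem Apart.ne (h : Apart φ ψ) : φ 0 ≠ ψ 0 := fun he =>
  disjoint_left.1 h ⟨0, mem_of_mem_nhds box_mem_nhds, rfl⟩
    (he ▸ ⟨0, mem_of_mem_nhds box_mem_nhds, rfl⟩)

/-- The state sum does not depend on the choice of the charts. -/
theorem bracket_indep (hC : CornerMove) (hW : Valuation m W) {l l' : List (Plane ≃ₜ Plane)}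
    (hl : ∀ φ ∈ l, IsChart φ N Γ) (hl' : ∀ φ ∈ l', IsChart φ N Γ) (hp : l.Pairwise Apart)
    (hp' : l'.Pairwise Apart) (hc : ∀ x, (∃ φ ∈ l, φ 0 = x) ↔ ∃ φ ∈ l', φ 0 = x)
    (hm : overlayCr N Γ ≤ m) : bracket (W N) l Γ = bracket (W N) l' Γ := by
  have hinj : ∀ {l : List (Plane ≃ₜ Plane)}, l.Pairwise Apart → ∀ φ ∈ l, ∀ ψ ∈ l, φ 0 = ψ 0 →
      φ = ψ := by
    intro l hp φ hφ ψ hψ h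
    by_contra hne
    have : Std.Symm Apart := ⟨fun _ _ h => h.symm⟩
    exact (hp.forall hφ hψ hne).ne h
  have hnd : ∀ {l : List (Plane ≃ₜ Plane)}, l.Pairwise Apart → l.Nodup := fun hp =>
    hp.imp fun h he => h.ne (by rw [he])
  choose! c hc1 hc2 using fun φ (hφ : φ ∈ l) => (hc (φ 0)).1 ⟨φ, hφ, rfl⟩
  have hperm : (l.map c).Perm l' := by
    rw [List.perm_ext_iff_of_nodup _ (hnd hp')]
    · intro ψ
      rw [List.mem_map]
      constructor
      · rintro ⟨φ, hφ, rfl⟩; exact hc1 φ hφ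
      · intro hψ
        obtain ⟨φ, hφ, h⟩ := (hc (ψ 0)).2 ⟨ψ, hψ, rfl⟩
        exact ⟨φ, hφ, hinj hp' _ (hc1 φ hφ) _ hψ (by rw [hc2 φ hφ, h])⟩
    · refine List.Nodup.map_on (fun φ hφ ψ hψ h => hinj hp φ hφ ψ hψ ?_) (hnd hp)
      rw [← hc2 φ hφ, ← hc2 ψ hψ, h]
  have hev : ∀ᶠ ε in 𝓝[>] (0 : ℝ), (0 < ε ∧ ε ≤ 1) ∧ ∀ φ ∈ l, Refines φ ((scale ε).trans (c φ)) ∧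
      Refines (c φ) ((scale ε).trans (c φ)) := by
    refine Filter.Eventually.and (Ioc_mem_nhdsGT one_pos) ?_
    refine (Filter.eventually_all_finite (List.finite_toSet l)).2 fun φ hφ => ?_
    exact (eventually_refines (hl φ hφ).pl (hl' _ (hc1 φ hφ)).pl (hc2 φ hφ).symm).and
      (eventually_refines (hl' _ (hc1 φ hφ)).pl (hl' _ (hc1 φ hφ)).pl rfl)
  obtain ⟨ε, hε, h⟩ := hev.exists
  have hsmall : ∀ ψ ∈ l.map (fun φ => (scale ε).trans (c φ)), IsChart ψ N Γ := by
    intro ψ hψ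
    obtain ⟨φ, hφ, rfl⟩ := List.mem_map.1 hψ
    exact (hl' _ (hc1 φ hφ)).scale hε.1 hε.2
  rw [bracket_refines hC hW (l' := l.map fun φ => (scale ε).trans (c φ))
    (by rw [List.forall₂_map_right_iff, List.forall₂_same]; exact fun φ hφ => (h φ hφ).1) hl hsmall
    hp hm, ← bracket_perm _ hperm (hperm.symm.pairwise hp' fun h => h.symm)]
  refine (bracket_refines hC hW ?_ ?_ hsmall (hperm.symm.pairwise hp' fun h => h.symm) hm).symm
  · rw [List.forall₂_map_right_iff, List.forall₂_map_left_iff, List.forall₂_same]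
    exact fun φ hφ => (h φ hφ).2
  · intro ψ hψ
    exact hl' ψ (hperm.subset hψ)

/-- Charts at finitely many double points can be shrunk so that their discs become disjoint and lie in
a given neighbourhood. -/
theorem exists_charts (X : Finset Plane) {O : Set Plane} (hO : ∀ x ∈ X, O ∈ 𝓝 x)
    (h : ∀ x ∈ X, ∃ φ, IsChart φ N Γ ∧ φ 0 = x) :
    ∃ l : List (Plane ≃ₜ Plane), l.Pairwise Apart ∧ (∀ φ ∈ l, IsChart φ N Γ ∧ φ '' box ⊆ O) ∧
      ∀ x, (∃ φ ∈ l, φ 0 = x) ↔ x ∈ X := by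
  choose! φ h1 h2 using h
  obtain ⟨U, hU, hd⟩ := X.finite_toSet.t2_separation
  have hev : ∀ᶠ ε in 𝓝[>] (0 : ℝ), (0 < ε ∧ ε ≤ 1) ∧
      ∀ x ∈ X, (scale ε).trans (φ x) '' box ⊆ O ∩ U x := by
    refine Filter.Eventually.and (Ioc_mem_nhdsGT one_pos) ?_
    refine (Filter.eventually_all_finset X).2 fun x hx => ?_
    refine eventually_image_subset (φ x).continuous ?_
    rw [h2 x hx]
    exact Filter.inter_mem (hO x hx) ((hU x).2.mem_nhds (hU x).1)
  obtain ⟨ε, hε, he⟩ := hev.exists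
  have h0 : ∀ x ∈ X, (scale ε).trans (φ x) 0 = x := by
    intro x hx
    rw [Homeomorph.trans_apply, scale_apply hε.1, smul_zero, h2 x hx]
  refine ⟨X.toList.map fun x => (scale ε).trans (φ x), ?_, ?_, fun x => ?_⟩
  · rw [List.pairwise_map]
    refine X.nodup_toList.pairwise_of_forall_ne fun x hx y hy hne => ?_
    rw [Finset.mem_toList] at hx hy
    exact (hd hx hy hne).mono ((he x hx).trans inter_subset_right)
      ((he y hy).trans inter_subset_right)
  · intro ψ hψ
    obtain ⟨x, hx, rfl⟩ := List.mem_map.1 hψ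
    rw [Finset.mem_toList] at hx
    exact ⟨(h1 x hx).scale hε.1 hε.2, (he x hx).trans inter_subset_left⟩
  · constructor
    · rintro ⟨ψ, hψ, rfl⟩
      obtain ⟨x, hx, rfl⟩ := List.mem_map.1 hψ
      rw [Finset.mem_toList] at hx
      rwa [h0 x hx]
    · intro hx
      exact ⟨_, List.mem_map.2 ⟨x, Finset.mem_toList.2 hx, rfl⟩, h0 x hx⟩

end Bracket

/-! ### Moves of graphs -/

section GraphMove

/-- The region between two graphs. -/
def between (l u : ℝ → ℝ) : Set Plane := {v | l v.1 < v.2 ∧ v.2 < u v.1}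

/-- If `Γ` is the graph of `f` between `l` and `u`, then this graph can be raised to that of `g`. -/
theorem graph_move_refl {l u f g : ℝ → ℝ} (hl : IsPL l) (hu : IsPL u) (hf : IsPL f) (hg : IsPL g)
    {k : ℝ} (hk : 0 < k) (r : ℝ) (hr : ∀ x, l x < u x → |x| ≤ r)
    (h : ∀ x, l x < u x → f x ≤ g x ∧ l x < f x ∧ g x < u x ∧ g x - f x ≤ k * (f x - l x) ∧
      g x - f x ≤ k * (u x - g x)) {Γ Γ' : Set Plane}
    (h₁ : ∀ x y, l x < y → y < u x → ((x, y) ∈ Γ ↔ y = f x))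
    (h₂ : ∀ x y, l x < y → y < u x → ((x, y) ∈ Γ' ↔ y = g x))
    (h₃ : ∀ x y, ¬(l x < y ∧ y < u x) → ((x, y) ∈ Γ ↔ (x, y) ∈ Γ')) :
    PlanarMove (between l u) Γ Γ' := by
  obtain ⟨C, hC⟩ := (isCompact_Icc (a := -r) (b := r)).exists_bound_of_continuousOn
    ((hg.sub hf).continuous.continuousOn)
  obtain ⟨L, hL⟩ := (isCompact_Icc (a := -r) (b := r)).exists_bound_of_continuousOn
    (hl.continuous.continuousOn)
  obtain ⟨U, hU⟩ := (isCompact_Icc (a := -r) (b := r)).exists_bound_of_continuousOn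
    (hu.continuous.continuousOn)
  obtain ⟨F, -, hF1, hF2⟩ := exists_push (B := ℝ) hk (d := fun q => min (g q.2 - f q.2) (C * q.1))
    (by fun_prop) hl hu (fun b => (min_le_right _ _).trans (by simp)) (by
      refine ⟨Icc (-r) r ×ˢ Icc (-L) U, isCompact_Icc.prod isCompact_Icc, ?_⟩
      intro t b y _ h1 h2
      have hb := abs_le.1 (hr b (h1.trans h2))
      have h3 := abs_le.1 (hL b hb)
      have h4 := abs_le.1 (hU b hb)
      exact ⟨hb, by linarith, by linarith⟩)
  have hfix : ∀ t x y, ¬(l x < y ∧ y < u x) → F t (x, y) = (x, y) := by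
    intro t x y hxy
    refine hF2 t x y (Or.inr ?_)
    by_contra! hc
    exact hxy hc
  have hmv : ∀ x, l x < u x → F 1 (x, f x) = (x, g x) := by
    intro x hx
    obtain ⟨a1, a2, a3, a4, a5⟩ := h x hx
    have hb := abs_le.1 (hr x hx)
    have hd : min (g x - f x) (C * 1) = g x - f x :=
      min_eq_left (by linarith [(abs_le.1 (hC x hb)).2])
    rw [hF1]
    · simp only [hd]; rw [max_eq_right (by linarith)]; simp
    · simp only [hd]; exact a4
    · simp only [hd]; linarith
  refine ⟨F, fun t v hv => hfix t v.1 v.2 hv, ?_⟩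
  ext ⟨x, y⟩
  constructor
  · rintro ⟨⟨x', y'⟩, hv, hw⟩
    by_cases hR : l x' < y' ∧ y' < u x'
    · obtain rfl := (h₁ x' y' hR.1 hR.2).1 hv
      have hx := hR.1.trans hR.2
      obtain ⟨a1, a2, a3, a4, a5⟩ := h x' hx
      rw [hmv x' hx] at hw
      rw [← hw]
      exact (h₂ _ _ (by linarith) a3).2 rfl
    · rw [hfix _ _ _ hR] at hw
      rw [← hw]
      exact (h₃ _ _ hR).1 hv
  · intro hv
    by_cases hR : l x < y ∧ y < u x
    · obtain rfl := (h₂ x y hR.1 hR.2).1 hv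
      have hx := hR.1.trans hR.2
      obtain ⟨a1, a2, a3, a4, a5⟩ := h x hx
      exact ⟨(x, f x), (h₁ _ _ a2 (by linarith)).2 rfl, hmv x hx⟩
    · exact ⟨(x, y), (h₃ _ _ hR).2 hv, hfix _ _ _ hR⟩

/-- Raising a graph, in the coordinates `e`. -/
theorem graph_move {e : Plane ≃ₜ Plane} (he : IsPLHomeo e) {l u f g : ℝ → ℝ} (hl : IsPL l)
    (hu : IsPL u) (hf : IsPL f) (hg : IsPL g)
    {k : ℝ} (hk : 0 < k) (r : ℝ) (hr : ∀ x, l x < u x → |x| ≤ r)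
    (h : ∀ x, l x < u x → f x ≤ g x ∧ l x < f x ∧ g x < u x ∧ g x - f x ≤ k * (f x - l x) ∧
      g x - f x ≤ k * (u x - g x)) {Γ Γ' : Set Plane}
    (h₁ : ∀ x y, l x < y → y < u x → (e (x, y) ∈ Γ ↔ y = f x))
    (h₂ : ∀ x y, l x < y → y < u x → (e (x, y) ∈ Γ' ↔ y = g x))
    (h₃ : ∀ x y, ¬(l x < y ∧ y < u x) → (e (x, y) ∈ Γ ↔ e (x, y) ∈ Γ')) :
    PlanarMove (e '' between l u) Γ Γ' := by
  have := (graph_move_refl hl hu hf hg hk r hr h (Γ := e ⁻¹' Γ) (Γ' := e ⁻¹' Γ') h₁ h₂ h₃).conj he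
  rwa [e.image_preimage, e.image_preimage] at this

end GraphMove

/-! ### Moves of polygonal lines -/

section Polylines

/-- The affine coordinate system with origin `c` and basis `a`, `b`. -/
noncomputable def frame (c a b : Plane) (h : a.1 * b.2 - a.2 * b.1 ≠ 0) : Plane ≃ₜ Plane :=
  plHomeo (fun v => (c.1 + v.1 * a.1 + v.2 * b.1, c.2 + v.1 * a.2 + v.2 * b.2))
    (fun v => ((b.2 * (v.1 - c.1) - b.1 * (v.2 - c.2)) / (a.1 * b.2 - a.2 * b.1),
      (a.1 * (v.2 - c.2) - a.2 * (v.1 - c.1)) / (a.1 * b.2 - a.2 * b.1)))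
    (by fun_prop) (by fun_prop)
    (fun v => by ext <;> simp only <;> rw [div_eq_iff h] <;> ring)
    (fun v => by
      have h1 := div_mul_cancel₀ (b.2 * (v.1 - c.1) - b.1 * (v.2 - c.2)) h
      have h2 := div_mul_cancel₀ (a.1 * (v.2 - c.2) - a.2 * (v.1 - c.1)) h
      ext <;> simp only <;> refine mul_right_cancel₀ h ?_
      · linear_combination a.1 * h1 + b.1 * h2
      · linear_combination a.2 * h1 + b.2 * h2)

theorem isPLHomeo_frame (c a b : Plane) (h) : IsPLHomeo (frame c a b h) :=
  isPLHomeo_plHomeo _ _ _ _ _ _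

theorem frame_apply (c a b : Plane) (h) (s t : ℝ) :
    frame c a b h (s, t) = (c.1 + s * a.1 + t * b.1, c.2 + s * a.2 + t * b.2) := rfl

theorem mem_segment_plane {p q v : Plane} : v ∈ segment ℝ p q ↔
    ∃ θ : ℝ, 0 ≤ θ ∧ θ ≤ 1 ∧ v.1 = (1 - θ) * p.1 + θ * q.1 ∧ v.2 = (1 - θ) * p.2 + θ * q.2 := by
  constructor
  · rintro ⟨x, y, hx, hy, hxy, rfl⟩
    refine ⟨y, hy, by linarith, ?_, ?_⟩ <;> simp [← hxy]
  · rintro ⟨θ, h0, h1, h2, h3⟩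
    exact ⟨1 - θ, θ, by linarith, h0, by ring, Prod.ext h2.symm h3.symm⟩

theorem not_mem_segment {p q : Plane} {x y : ℝ}
    (h : ∀ θ : ℝ, 0 ≤ θ → θ ≤ 1 → x = (1 - θ) * p.1 + θ * q.1 → y = (1 - θ) * p.2 + θ * q.2 → False) :
    ((x, y) : Plane) ∉ segment ℝ p q := by
  rw [mem_segment_plane]
  rintro ⟨θ, h0, h1, h2, h3⟩
  exact h θ h0 h1 h2 h3

theorem frame_mem_segment {c a b : Plane} {h} {p q v : Plane} :
    frame c a b h v ∈ segment ℝ (frame c a b h p) (frame c a b h q) ↔ v ∈ segment ℝ p q := by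
  have key : ∀ θ : ℝ, frame c a b h ((1 - θ) * p.1 + θ * q.1, (1 - θ) * p.2 + θ * q.2) =
      ((1 - θ) * (frame c a b h p).1 + θ * (frame c a b h q).1,
        (1 - θ) * (frame c a b h p).2 + θ * (frame c a b h q).2) := by
    intro θ
    have hp : frame c a b h p = _ := frame_apply c a b h p.1 p.2
    have hq : frame c a b h q = _ := frame_apply c a b h q.1 q.2
    rw [frame_apply, hp, hq]
    ext <;> simp only <;> ring
  rw [mem_segment_plane, mem_segment_plane]
  constructor
  · rintro ⟨θ, h0, h1, h2, h3⟩
    have := (frame c a b h).injective ((Prod.ext h2 h3 : frame c a b h v = (_, _)).trans (key θ).symm)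
    exact ⟨θ, h0, h1, congrArg Prod.fst this, congrArg Prod.snd this⟩
  · rintro ⟨θ, h0, h1, h2, h3⟩
    have : frame c a b h v = _ := (congrArg (frame c a b h) (Prod.ext h2 h3 : v = (_, _))).trans (key θ)
    exact ⟨θ, h0, h1, congrArg Prod.fst this, congrArg Prod.snd this⟩

/-- The polygonal line with given vertices. -/
def poly : List Plane → Set Plane
  | a :: b :: l => segment ℝ a b ∪ poly (b :: l)
  | _ => ∅

theorem poly_append (l₁ : List Plane) (a : Plane) (l₂ : List Plane) :
    poly (l₁ ++ a :: l₂) = poly (l₁ ++ [a]) ∪ poly (a :: l₂) := by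
  induction l₁ with
  | nil => simp [poly]
  | cons b l ih =>
    cases l with
    | nil => simp [poly]
    | cons d l =>
      simp only [List.cons_append, poly] at ih ⊢
      rw [ih, union_assoc]

/-- Subdivision of a segment. -/
theorem union_segment_poly {p q r : Plane} (h : r ∈ segment ℝ p q) :
    segment ℝ p q = poly [p, r, q] := by
  simp only [poly, union_empty]
  refine Subset.antisymm (fun v hv => ?_) (union_subset ?_ ?_)
  · obtain ⟨s, s0, s1, s2, s3⟩ := mem_segment_plane.1 h
    obtain ⟨t, t0, t1, t2, t3⟩ := mem_segment_plane.1 hv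
    rcases le_total t s with hts | hts
    · rcases s0.eq_or_lt with rfl | s0
      · have : t = 0 := le_antisymm hts t0
        subst this
        exact Or.inl (mem_segment_plane.2 ⟨0, le_rfl, zero_le_one, by linarith, by linarith⟩)
      · refine Or.inl (mem_segment_plane.2 ⟨t / s, by positivity, (div_le_one s0).2 hts, ?_, ?_⟩)
        · rw [t2, s2]; field_simp; ring
        · rw [t3, s3]; field_simp; ring
    · rcases s1.eq_or_lt with rfl | s1
      · have : t = 1 := le_antisymm t1 hts
        subst this
        exact Or.inr (mem_segment_plane.2 ⟨1, zero_le_one, le_rfl, by linarith, by linarith⟩)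
      · have s1' : 0 < 1 - s := by linarith
        refine Or.inr (mem_segment_plane.2 ⟨(t - s) / (1 - s), div_nonneg (by linarith) s1'.le,
          (div_le_one s1').2 (by linarith), ?_, ?_⟩)
        · rw [t2, s2]; field_simp; ring
        · rw [t3, s3]; field_simp; ring
  · exact (convex_segment p q).segment_subset (left_mem_segment ℝ p q) h
  · exact (convex_segment p q).segment_subset h (right_mem_segment ℝ p q)

/-- The elementary move of a polygonal line: two sides `P L` and `L Q` of a triangle are replaced by the
third one. The conditions say that a neighbourhood of the triangle, which is parametrized by barycentric
coordinates, does not meet the rest of the curve. -/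
theorem triangle_move {P Q L : Plane} {ε : ℝ} (hε : 0 < ε)
    (hdet : (Q.1 - P.1) * (L.2 - P.2) - (Q.2 - P.2) * (L.1 - P.1) ≠ 0) {R Γ₀ : Set Plane}
    (h : ∀ x y α β γ : ℝ, x = α * P.1 + β * Q.1 + γ * L.1 → y = α * P.2 + β * Q.2 + γ * L.2 →
      α + β + γ = 1 → 0 < γ + ε * (2 * β + γ) → 0 < γ + ε * (2 * α + γ) →
      γ < (1 + ε) * (2 * β + γ) → γ < (1 + ε) * (2 * α + γ) → (x, y) ∈ R ∧ (x, y) ∉ Γ₀) :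
    PlanarMove R (Γ₀ ∪ (segment ℝ P L ∪ segment ℝ L Q)) (Γ₀ ∪ segment ℝ P Q) := by
  set c : Plane := ((P.1 + Q.1) / 2, (P.2 + Q.2) / 2) with hc
  set a : Plane := ((Q.1 - P.1) / 2, (Q.2 - P.2) / 2) with ha
  set b : Plane := (L.1 - c.1, L.2 - c.2) with hb
  have hd : a.1 * b.2 - a.2 * b.1 ≠ 0 := by
    have : a.1 * b.2 - a.2 * b.1 =
        ((Q.1 - P.1) * (L.2 - P.2) - (Q.2 - P.2) * (L.1 - P.1)) / 2 := by
      simp only [ha, hb, hc]; ring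
    rw [this]
    exact div_ne_zero hdet two_ne_zero
  set e := frame c a b hd with he
  have eP : e (-1, 0) = P := by rw [he, frame_apply]; ext <;> simp only [ha, hc] <;> ring
  have eQ : e (1, 0) = Q := by rw [he, frame_apply]; ext <;> simp only [ha, hc] <;> ring
  have eL : e (0, 1) = L := by rw [he, frame_apply]; ext <;> simp only [ha, hb, hc] <;> ring
  have m1 : ∀ s t : ℝ, e (s, t) ∈ segment ℝ P L ∪ segment ℝ L Q ↔ |s| ≤ 1 ∧ t = 1 - |s| := by
    intro s t
    rw [← eP, ← eQ, ← eL, mem_union, he, frame_mem_segment, frame_mem_segment, mem_segment_plane,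
      mem_segment_plane]
    simp only
    constructor
    · rintro (⟨θ, h0, h1, h2, h3⟩ | ⟨θ, h0, h1, h2, h3⟩)
      · have : s = -(1 - θ) := by linarith
        rw [this, abs_neg, abs_of_nonneg (by linarith)]
        constructor <;> linarith
      · have : s = θ := by linarith
        rw [this, abs_of_nonneg h0]
        constructor <;> linarith
    · rintro ⟨h1, h2⟩
      rcases abs_cases s with ⟨h3, h4⟩ | ⟨h3, h4⟩
      · exact Or.inr ⟨s, by linarith, by linarith, by linarith, by linarith⟩
      · exact Or.inl ⟨1 + s, by linarith, by linarith, by linarith, by linarith⟩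
  have m2 : ∀ s t : ℝ, e (s, t) ∈ segment ℝ P Q ↔ |s| ≤ 1 ∧ t = 0 := by
    intro s t
    rw [← eP, ← eQ, he, frame_mem_segment, mem_segment_plane]
    simp only [abs_le]
    constructor
    · rintro ⟨θ, h0, h1, h2, h3⟩
      refine ⟨⟨?_, ?_⟩, ?_⟩ <;> linarith
    · rintro ⟨⟨h1, h2⟩, h3⟩
      exact ⟨(s + 1) / 2, by linarith, by linarith, by linarith, by linarith⟩
  have hR : ∀ s t : ℝ, -ε * (1 - |s|) < t → t < (1 + ε) * (1 - |s|) →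
      e (s, t) ∈ R ∧ e (s, t) ∉ Γ₀ := by
    intro s t h1 h2
    have h3 := le_abs_self s
    have h4 := neg_le_abs s
    have h5 : ε * |s| ≥ ε * s := by gcongr
    have h6 : ε * |s| ≥ ε * -s := by gcongr
    refine h _ _ ((1 - s - t) / 2) ((1 + s - t) / 2) t ?_ ?_ (by ring) ?_ ?_ ?_ ?_
    · simp only [ha, hb, hc]; ring
    · simp only [ha, hb, hc]; ring
    all_goals linarith
  refine (graph_move (isPLHomeo_frame c a b hd) (l := fun s => -ε * (1 - |s|))
    (u := fun s => (1 + ε) * (1 - |s|)) (f := fun _ => 0) (g := fun s => 1 - |s|) (by fun_prop)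
    (by fun_prop) (by fun_prop) (by fun_prop) (inv_pos.2 hε) 1 (fun x h => ?_) (fun x h => ?_)
    (fun x y h1 h2 => ?_) (fun x y h1 h2 => ?_) fun x y h => ?_).symm.mono ?_
  · nlinarith
  · have hx : |x| < 1 := by nlinarith
    have : 0 < ε * (1 - |x|) := mul_pos hε (by linarith)
    have e1 : ε⁻¹ * (0 - -ε * (1 - |x|)) = 1 - |x| := by field_simp; ring
    have e2 : ε⁻¹ * ((1 + ε) * (1 - |x|) - (1 - |x|)) = 1 - |x| := by field_simp; ring
    refine ⟨by linarith, by linarith, by linarith, by rw [e1]; linarith, by rw [e2]; linarith⟩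
  · have hx : |x| ≤ 1 := by nlinarith
    rw [mem_union, or_iff_right (hR x y h1 h2).2]
    exact (m2 x y).trans (and_iff_right hx)
  · have hx : |x| ≤ 1 := by nlinarith
    rw [mem_union, or_iff_right (hR x y h1 h2).2]
    exact (m1 x y).trans (and_iff_right hx)
  · refine or_congr Iff.rfl ((m2 x y).trans (Iff.trans ?_ (m1 x y).symm))
    refine and_congr_right fun hx => ?_
    rcases hx.eq_or_lt with h1 | h1
    · rw [h1, sub_self]
    · have : 0 < ε * (1 - |x|) := mul_pos hε (by linarith)
      constructor <;> intro hy <;> refine absurd ⟨?_, ?_⟩ h <;> linarith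
  · rintro _ ⟨⟨s, t⟩, ⟨h1, h2⟩, rfl⟩
    exact (hR s t h1 h2).1

/-- The open sector spanned by two vectors, inside the open unit square. -/
def sector (a b : Plane) : Set Plane :=
  {v | ‖v‖ < 1 ∧ 0 < a.1 * v.2 - a.2 * v.1 ∧ 0 < v.1 * b.2 - v.2 * b.1}

/-- A linear function that is positive at both ends of a symmetric interval. -/
theorem exists_pos_mul_le (x : ℝ) {y : ℝ} (hy : 0 < y) : ∃ ε > 0, ∀ δ ≤ ε, 0 ≤ δ → δ * |x| < y := by
  refine ⟨y / (|x| + 1), by positivity, fun δ h h0 => ?_⟩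
  have := (le_div_iff₀ (by positivity)).1 h
  have h1 : 0 ≤ δ * |x| := by positivity
  rcases h0.eq_or_lt with rfl | h0
  · simpa
  · linarith

/-- A linear function of `γ` that is positive at the ends of the range of `γ`. -/
theorem pos_of_range {ε D x s γ : ℝ} (h1 : ε * |x - D / 2| < x)
    (h2 : ε * |x - D / 2| < D / 2) (h3 : 0 < γ + ε * s) (h4 : γ < (1 + ε) * s) (hs : 0 < s) :
    0 < D * s / 2 + γ * (x - D / 2) := by
  rcases le_total 0 (x - D / 2) with h | h
  · rw [abs_of_nonneg h] at h1 h2; nlinarith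
  · rw [abs_of_nonpos h] at h1 h2; nlinarith

/-- A broken line can be straightened inside the sector spanned by its ends. -/
theorem kite_move {P Q L : Plane} (hPL : 0 < P.1 * L.2 - P.2 * L.1) (hLQ : 0 < L.1 * Q.2 - L.2 * Q.1)
    (hPQ : 0 < P.1 * Q.2 - P.2 * Q.1) (hP : ‖P‖ < 1) (hQ : ‖Q‖ < 1) (hL : ‖L‖ < 1) {Γ₀ : Set Plane}
    (hΓ : ∀ v ∈ sector P Q, v ∉ Γ₀) :
    PlanarMove (sector P Q) (Γ₀ ∪ (segment ℝ P L ∪ segment ℝ L Q)) (Γ₀ ∪ segment ℝ P Q) := by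
  set D := P.1 * Q.2 - P.2 * Q.1 with hD
  set p := P.1 * L.2 - P.2 * L.1 with hp
  set q := L.1 * Q.2 - L.2 * Q.1 with hq
  by_cases hdet : (Q.1 - P.1) * (L.2 - P.2) - (Q.2 - P.2) * (L.1 - P.1) = 0
  · -- the broken line is straight already
    have e : D = p + q := by rw [hD, hp, hq]; linarith
    have i1 : L.1 * D = q * P.1 + p * Q.1 := by rw [hD, hp, hq]; ring
    have i2 : L.2 * D = q * P.2 + p * Q.2 := by rw [hD, hp, hq]; ring
    have : L ∈ segment ℝ P Q := by
      refine mem_segment_plane.2 ⟨p / D, by positivity, (div_le_one hPQ).2 (by linarith), ?_, ?_⟩ <;>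
        field_simp
      · linear_combination i1 - P.1 * e
      · linear_combination i2 - P.2 * e
    have := union_segment_poly this
    simp only [poly, union_empty] at this
    rw [← this]
    exact .refl _ _
  · obtain ⟨M, ⟨hMP, hMQ, hML⟩, hM1⟩ : ∃ M, (‖P‖ ≤ M ∧ ‖Q‖ ≤ M ∧ ‖L‖ ≤ M) ∧ M < 1 :=
      ⟨max ‖P‖ (max ‖Q‖ ‖L‖), by simp, max_lt hP (max_lt hQ hL)⟩
    have hM0 := (norm_nonneg P).trans hMP
    obtain ⟨ε₁, g1, k1⟩ := exists_pos_mul_le (p - D / 2) (lt_min hPL (half_pos hPQ))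
    obtain ⟨ε₂, g2, k2⟩ := exists_pos_mul_le (q - D / 2) (lt_min hLQ (half_pos hPQ))
    obtain ⟨ε₃, g3, k3⟩ := exists_pos_mul_le (12 * M) (sub_pos.2 hM1)
    obtain ⟨ε, hε, e1, e2, e3⟩ : ∃ ε > 0, ε ≤ ε₁ ∧ ε ≤ ε₂ ∧ ε ≤ ε₃ :=
      ⟨min ε₁ (min ε₂ ε₃), by positivity, by simp, by simp, by simp⟩
    obtain ⟨k1, k1'⟩ := lt_min_iff.1 (k1 ε e1 hε.le)
    obtain ⟨k2, k2'⟩ := lt_min_iff.1 (k2 ε e2 hε.le)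
    have k3 := k3 ε e3 hε.le
    rw [abs_of_nonneg (by positivity)] at k3
    have hsub : ∀ x y α β γ : ℝ, x = α * P.1 + β * Q.1 + γ * L.1 → y = α * P.2 + β * Q.2 + γ * L.2 →
        α + β + γ = 1 → 0 < γ + ε * (2 * β + γ) → 0 < γ + ε * (2 * α + γ) →
        γ < (1 + ε) * (2 * β + γ) → γ < (1 + ε) * (2 * α + γ) → (x, y) ∈ sector P Q := by
      intro x y α β γ hx hy hs h1 h2 h3 h4
      have hpos : ∀ s, 0 < γ + ε * s → γ < (1 + ε) * s → 0 < s := fun s h h' => by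
        clear * - hε h h'; nlinarith
      have s1 := hpos _ h1 h3
      have s2 := hpos _ h2 h4
      refine ⟨?_, ?_, ?_⟩
      · have hxy : ((x, y) : Plane) = α • P + β • Q + γ • L := Prod.ext hx hy
        have habs : |α| + |β| + |γ| ≤ 1 + 12 * ε := by
          have m1 : ε * (2 * β + γ) ≤ ε * 2 := by gcongr; linarith
          have m2 : ε * (2 * α + γ) ≤ ε * 2 := by gcongr; linarith
          rcases abs_cases α with ⟨b1, -⟩ | ⟨b1, -⟩ <;> rcases abs_cases β with ⟨b2, -⟩ | ⟨b2, -⟩ <;>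
            rcases abs_cases γ with ⟨b3, -⟩ | ⟨b3, -⟩ <;> linarith
        rw [hxy]
        calc ‖α • P + β • Q + γ • L‖ ≤ |α| * ‖P‖ + |β| * ‖Q‖ + |γ| * ‖L‖ := by
              simpa only [norm_smul, Real.norm_eq_abs] using norm_add₃_le (a := α • P) (b := β • Q) (c := γ • L)
          _ ≤ |α| * M + |β| * M + |γ| * M := by gcongr
          _ = (|α| + |β| + |γ|) * M := by ring
          _ ≤ (1 + 12 * ε) * M := by gcongr
          _ < 1 := by linarith
      · have := pos_of_range k1 k1' h1 h3 s1
        have e : P.1 * y - P.2 * x = D * (2 * β + γ) / 2 + γ * (p - D / 2) := by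
          rw [hx, hy, hD, hp]; ring
        simpa only [e] using this
      · have := pos_of_range k2 k2' h2 h4 s2
        have e : x * Q.2 - y * Q.1 = D * (2 * α + γ) / 2 + γ * (q - D / 2) := by
          rw [hx, hy, hD, hq]; ring
        simpa only [e] using this
    exact triangle_move hε hdet fun x y α β γ hx hy hs h1 h2 h3 h4 =>
      have := hsub x y α β γ hx hy hs h1 h2 h3 h4
      ⟨this, hΓ _ this⟩

end Polylines

/-! ### Straightening star-shaped arcs -/

section Star

/-- The open first quadrant of the square. -/
def quadrant : Set Plane := {v | 0 < v.1 ∧ 0 < v.2 ∧ ‖v‖ < 1}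

/-- Straightening of a star-shaped arc. Near each of its points the arc consists of two segments, so that
the part that has not yet been straightened can be shortened a little by a move in a kite. -/
theorem straighten_arc {c : ℝ → Plane} (hc : IsPL c) (h1 : ∀ θ ∈ Icc (0 : ℝ) 1, 0 ≤ (c θ).1)
    (h2 : ∀ θ ∈ Icc (0 : ℝ) 1, 0 ≤ (c θ).2) (hn : ∀ θ ∈ Icc (0 : ℝ) 1, ‖c θ‖ < 1)
    (hdet : ∀ θ ∈ Icc (0 : ℝ) 1, ∀ θ' ∈ Icc (0 : ℝ) 1, θ < θ' →
      0 < (c θ).1 * (c θ').2 - (c θ).2 * (c θ').1)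
    {Γ₀ : Set Plane} (hΓ : ∀ v ∈ quadrant, v ∉ Γ₀) :
    PlanarMove quadrant (Γ₀ ∪ c '' Icc 0 1) (Γ₀ ∪ segment ℝ (c 0) (c 1)) := by
  have hz : (0 : ℝ) ∈ Icc (0 : ℝ) 1 := ⟨le_rfl, zero_le_one⟩
  have ho : (1 : ℝ) ∈ Icc (0 : ℝ) 1 := ⟨zero_le_one, le_rfl⟩
  set A : ℝ → Set Plane := fun θ => segment ℝ (c 0) (c θ) ∪ c '' Icc θ 1 with hA
  have step : ∀ θ ∈ Icc (0 : ℝ) 1, ∀ θ' ∈ Icc (0 : ℝ) 1, θ < θ' →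
      c '' Icc θ θ' = segment ℝ (c θ) (c θ') → PlanarMove quadrant (Γ₀ ∪ A θ) (Γ₀ ∪ A θ') := by
    intro θ hθ θ' hθ' hlt hseg
    have hsplit : c '' Icc θ 1 = segment ℝ (c θ) (c θ') ∪ c '' Icc θ' 1 := by
      rw [← hseg, ← image_union, Icc_union_Icc_eq_Icc hlt.le hθ'.2]
    rcases hθ.1.eq_or_lt with rfl | h0
    · have : A 0 = A θ' := by
        simp only [hA, hsplit, segment_same]
        rw [← union_assoc, union_eq_self_of_subset_left
          (singleton_subset_iff.2 (left_mem_segment ℝ (c 0) (c θ')))]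
      rw [this]; exact PlanarMove.refl _ _
    · have d1 := hdet 0 hz θ hθ h0
      have d2 := hdet θ hθ θ' hθ' hlt
      have d3 := hdet 0 hz θ' hθ' (h0.trans hlt)
      have hsec : sector (c 0) (c θ') ⊆ quadrant := by
        rintro v ⟨hv, p, q⟩
        have p1 := h1 0 hz
        have p2 := h2 0 hz
        have p3 := h1 θ' hθ'
        have p4 := h2 θ' hθ'
        have i1 : ((c 0).1 * (c θ').2 - (c 0).2 * (c θ').1) * v.1 = (v.1 * (c θ').2 - v.2 * (c θ').1) *
          (c 0).1 + ((c 0).1 * v.2 - (c 0).2 * v.1) * (c θ').1 := by ring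
        have i2 : ((c 0).1 * (c θ').2 - (c 0).2 * (c θ').1) * v.2 = (v.1 * (c θ').2 - v.2 * (c θ').1) *
          (c 0).2 + ((c 0).1 * v.2 - (c 0).2 * v.1) * (c θ').2 := by ring
        have q1 : 0 < (c 0).1 := p1.lt_of_ne fun h => by rw [← h] at d3; nlinarith
        have q2 : 0 < (c θ').2 := p4.lt_of_ne fun h => by rw [← h] at d3; nlinarith
        exact ⟨pos_of_mul_pos_right (a := _) (i1 ▸ by positivity) d3.le, pos_of_mul_pos_right (i2 ▸ by positivity) d3.le, hv⟩
      have hkite := kite_move d1 d2 d3 (hn 0 hz) (hn θ' hθ') (hn θ hθ) (Γ₀ := Γ₀ ∪ c '' Icc θ' 1) (by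
        rintro v hv (h | ⟨τ, hτ, rfl⟩)
        · exact hΓ v (hsec hv) h
        · rcases hτ.1.eq_or_lt with rfl | h'
          · linarith [hv.2.2]
          · linarith [hv.2.2, hdet θ' hθ' τ ⟨hθ'.1.trans hτ.1, hτ.2⟩ h'])
      have e1 : Γ₀ ∪ A θ = Γ₀ ∪ c '' Icc θ' 1 ∪ (segment ℝ (c 0) (c θ) ∪ segment ℝ (c θ) (c θ')) := by
        simp only [hA, hsplit]; ext; simp only [mem_union]; tauto
      have e2 : Γ₀ ∪ A θ' = Γ₀ ∪ c '' Icc θ' 1 ∪ segment ℝ (c 0) (c θ') := by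
        simp only [hA]; ext; simp only [mem_union]; tauto
      rw [e1, e2]
      exact hkite.mono hsec
  have hloc : ∀ θ ∈ Icc (0 : ℝ) 1, ∃ r > 0, ∀ h, |h| ≤ r →
      c '' segment ℝ θ (θ + h) = segment ℝ (c θ) (c (θ + h)) := by
    intro θ _
    obtain ⟨r, hr, h⟩ := (show IsPL fun h => c (θ + h) - c θ by fun_prop).eventually_conical (by simp)
    refine ⟨r, hr, fun x hx => ?_⟩
    rw [segment_eq_image', segment_eq_image', image_image]
    refine image_congr fun s hs => ?_
    have := h x hx s hs
    simp only [smul_eq_mul] at this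
    rw [add_sub_cancel_left, smul_eq_mul, ← this]; abel
  have hall : PlanarMove quadrant (Γ₀ ∪ A 0) (Γ₀ ∪ A 1) := by
    refine isPreconnected_Icc.induction₂ (s := Icc (0 : ℝ) 1)
      (fun θ θ' => PlanarMove quadrant (Γ₀ ∪ A θ) (Γ₀ ∪ A θ')) (fun θ hθ => ?_)
      (fun _ _ _ _ _ _ h h' => h.trans h') (fun _ _ _ _ h => h.symm) hz ho
    obtain ⟨r, hr, h⟩ := hloc θ hθ
    filter_upwards [self_mem_nhdsWithin, mem_nhdsWithin_of_mem_nhds (Metric.closedBall_mem_nhds θ hr)]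
      with θ' hθ' hb
    have hs := h (θ' - θ) (by simpa [Real.dist_eq] using hb)
    rw [add_sub_cancel] at hs
    rcases lt_trichotomy θ θ' with hl | rfl | hl
    · exact step θ hθ θ' hθ' hl (by rw [← hs, segment_eq_Icc hl.le])
    · exact PlanarMove.refl _ _
    · refine (step θ' hθ' θ hθ hl ?_).symm
      rw [segment_symm, ← hs, segment_symm, segment_eq_Icc hl.le]
  have e0 : A 0 = c '' Icc 0 1 := by
    simp only [hA, segment_same]
    exact union_eq_self_of_subset_left (singleton_subset_iff.2 ⟨0, hz, rfl⟩)
  have e1 : A 1 = segment ℝ (c 0) (c 1) := by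
    simp only [hA, Icc_self, image_singleton]
    exact union_eq_self_of_subset_right (singleton_subset_iff.2 (right_mem_segment ℝ _ _))
  rwa [e0, e1] at hall

/-- Rotation by 45 degrees, up to scale: `(q, p) ↦ (x, y)` with `q = x - y` and `p = x + y`. -/
noncomputable def diagonal : Plane ≃ₜ Plane := frame 0 (1 / 2, -1 / 2) (1 / 2, 1 / 2) (by norm_num)

theorem diagonal_apply (q p : ℝ) : diagonal (q, p) = ((p + q) / 2, (p - q) / 2) := by
  rw [diagonal, frame_apply]
  ext <;> simp only [Prod.fst_zero, Prod.snd_zero] <;> ring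

/-- Pushing the two half-axes and a segment that joins them to the corner cut. -/
theorem corner_push {lam mu η : ℝ} (hl : 0 < lam) (hl1 : lam ≤ 1) (hm : 0 < mu) (hm1 : mu ≤ 1)
    (hη : 0 < η) {Γ₁ : Set Plane} (hΓ : ∀ v ∈ box, v ∈ Γ₁ → v.1 + v.2 ≤ -η) :
    PlanarMove box (Γ₁ ∪ {v | |v.1 - v.2| ≤ 1 ∧ v.1 + v.2 =
        max |v.1 - v.2| ((2 * lam * mu + (lam - mu) * (v.1 - v.2)) / (lam + mu))})
      (Γ₁ ∪ {v | |v.1 - v.2| ≤ 1 ∧ v.1 + v.2 = 1}) := by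
  obtain ⟨ε, he0, he1, heη⟩ : ∃ ε, 0 < ε ∧ ε ≤ 1 ∧ ε ≤ η := ⟨min 1 η, by positivity, min_le_left _ _,
    min_le_right _ _⟩
  have hsub : diagonal '' between (fun q => |q| - ε * (1 - |q|)) (fun q => 2 - |q|) ⊆ box := by
    rintro _ ⟨⟨q, p⟩, ⟨h1, h2⟩, rfl⟩
    simp only at h1 h2
    have h3 : |q| < 1 := by nlinarith
    rw [diagonal_apply, mem_box, abs_le, abs_le]
    have h4 := le_abs_self q
    have h5 := neg_abs_le q
    have h6 : ε * (1 - |q|) ≤ 1 := by nlinarith [abs_nonneg q]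
    refine ⟨⟨?_, ?_⟩, ?_, ?_⟩ <;> simp only <;> linarith
  have hreg : ∀ {q p : ℝ}, |q| - ε * (1 - |q|) < p → p < 2 - |q| → |q| < 1 := by
    intro q p h1 h2; nlinarith
  have hnot : ∀ q p : ℝ, |q| - ε * (1 - |q|) < p → p < 2 - |q| → diagonal (q, p) ∉ Γ₁ := by
    intro q p h1 h2 h
    have := hΓ _ (hsub ⟨(q, p), ⟨h1, h2⟩, rfl⟩) h
    rw [diagonal_apply] at this
    have := hreg h1 h2
    nlinarith [abs_nonneg q]
  have hq : ∀ q p : ℝ, (p + q) / 2 - (p - q) / 2 = q := fun q p => by ring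
  have hp : ∀ q p : ℝ, (p + q) / 2 + (p - q) / 2 = p := fun q p => by ring
  have hcv : ∀ q : ℝ, |q| ≤ 1 → (2 * lam * mu + (lam - mu) * q) / (lam + mu) ≤ 1 := by
    intro q hq
    rw [div_le_one (by linarith)]
    have := abs_le.1 hq
    nlinarith [mul_nonneg (by linarith : 0 ≤ 1 - lam) hm.le, mul_nonneg (by linarith : 0 ≤ 1 - mu) hl.le]
  refine (graph_move (isPLHomeo_frame _ _ _ _) (k := ε⁻¹)
    (f := fun q => max |q| ((2 * lam * mu + (lam - mu) * q) / (lam + mu))) (g := fun _ => 1)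
    (l := fun q => |q| - ε * (1 - |q|)) (u := fun q => 2 - |q|) (by fun_prop) (by fun_prop)
    (by fun_prop) (by fun_prop) (inv_pos.2 he0) 1 (fun x h => ?_) (fun x h => ?_) (fun x y h1 h2 => ?_)
    (fun x y h1 h2 => ?_) fun x y h => ?_).mono hsub
  · nlinarith
  · have hx : |x| < 1 := by nlinarith
    have h3 := hcv x hx.le
    have h4 := le_max_left |x| ((2 * lam * mu + (lam - mu) * x) / (lam + mu))
    have h5 : max |x| ((2 * lam * mu + (lam - mu) * x) / (lam + mu)) ≤ 1 := max_le hx.le h3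
    have h6 : 0 < ε * (1 - |x|) := mul_pos he0 (by linarith)
    have h7 : 1 ≤ ε⁻¹ := (one_le_inv₀ he0).2 he1
    refine ⟨h5, by linarith, by linarith, ?_, ?_⟩
    · rw [inv_mul_eq_div, le_div_iff₀ he0]
      nlinarith
    · nlinarith
  · change diagonal (x, y) ∈ _ ↔ _
    rw [mem_union, or_iff_right (hnot x y h1 h2), diagonal_apply, mem_ofPred_eq]
    simp only [hq, hp]
    exact and_iff_right (hreg h1 h2).le
  · change diagonal (x, y) ∈ _ ↔ _
    rw [mem_union, or_iff_right (hnot x y h1 h2), diagonal_apply, mem_ofPred_eq]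
    simp only [hq, hp]
    exact and_iff_right (hreg h1 h2).le
  · change diagonal (x, y) ∈ _ ↔ diagonal (x, y) ∈ _
    rw [mem_union, mem_union, diagonal_apply, mem_ofPred_eq, mem_ofPred_eq]
    simp only [hq, hp]
    refine or_congr Iff.rfl (and_congr_right fun hx => ?_)
    rcases hx.eq_or_lt with h1 | h1
    · have := hcv x hx
      rw [h1, max_eq_left this]
    · have h6 : 0 < ε * (1 - |x|) := mul_pos he0 (by linarith)
      have h4 := le_max_left |x| ((2 * lam * mu + (lam - mu) * x) / (lam + mu))
      have h5 : max |x| ((2 * lam * mu + (lam - mu) * x) / (lam + mu)) ≤ 1 := max_le hx (hcv x hx)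
      constructor <;> intro hy <;> refine absurd ⟨?_, ?_⟩ h <;> linarith

end Star

/-! ### Smoothings in conical coordinates -/

section Corner

/-- Conical coordinate changes near a double point. -/
structure IsConic (ψ : Plane ≃ₜ Plane) : Prop where
  pl : IsPLHomeo ψ
  conical : ∀ v ∈ box, ∀ s ∈ Icc (0 : ℝ) 1, ψ (s • v) = s • ψ v
  subset : ψ '' box ⊆ Metric.ball 0 1
  cross : ∀ v ∈ box, ψ v ∈ cross ↔ v ∈ cross

/-- Coordinate changes that map each quadrant of the square to itself. -/
structure IsOriented (ψ : Plane ≃ₜ Plane) : Prop where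
  fst_pos : ∀ v ∈ box, 0 < v.1 → 0 < (ψ v).1
  fst_neg : ∀ v ∈ box, v.1 < 0 → (ψ v).1 < 0
  snd_pos : ∀ v ∈ box, 0 < v.2 → 0 < (ψ v).2
  snd_neg : ∀ v ∈ box, v.2 < 0 → (ψ v).2 < 0

variable {ψ : Plane ≃ₜ Plane} {Γ : Set Plane}

theorem IsConic.zero (h : IsConic ψ) : ψ 0 = 0 := by
  have := h.conical 0 (mem_of_mem_nhds box_mem_nhds) 0 ⟨le_rfl, zero_le_one⟩
  simpa using this

theorem IsConic.axis_iff (h : IsConic ψ) {v : Plane} (hv : v ∈ box) :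
    (ψ v).1 = 0 ∨ (ψ v).2 = 0 ↔ v.1 = 0 ∨ v.2 = 0 := by
  have h1 := h.cross v hv
  have h2 : ψ v ∈ box := Metric.ball_subset_closedBall (h.subset ⟨v, hv, rfl⟩)
  simp only [PLLink.cross, mem_ofPred_eq] at h1
  tauto

theorem IsConic.fst_eq_zero (h : IsConic ψ) (ho : IsOriented ψ) {v : Plane} (hv : v ∈ box)
    (h0 : v.1 = 0) : (ψ v).1 = 0 := by
  rcases (h.axis_iff hv).2 (Or.inl h0) with h1 | h1
  · exact h1
  · rcases lt_trichotomy v.2 0 with h2 | h2 | h2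
    · exact absurd h1 (ho.snd_neg v hv h2).ne
    · have : v = 0 := Prod.ext h0 h2
      rw [this, h.zero]; rfl
    · exact absurd h1 (ho.snd_pos v hv h2).ne'

theorem IsConic.snd_eq_zero (h : IsConic ψ) (ho : IsOriented ψ) {v : Plane} (hv : v ∈ box)
    (h0 : v.2 = 0) : (ψ v).2 = 0 := by
  rcases (h.axis_iff hv).2 (Or.inr h0) with h1 | h1
  · rcases lt_trichotomy v.1 0 with h2 | h2 | h2
    · exact absurd h1 (ho.fst_neg v hv h2).ne
    · have : v = 0 := Prod.ext h2 h0
      rw [this, h.zero]; rfl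
    · exact absurd h1 (ho.fst_pos v hv h2).ne'
  · exact h1

/-- The segment from `(1,0)` to `(0,1)`. -/
def arc : Set Plane := {v | |v.1 - v.2| ≤ 1 ∧ v.1 + v.2 = 1}

theorem arc_subset_box : arc ⊆ box := fun v hv =>
  corner_subset_box true ⟨by rw [hv.2, abs_one], hv.1⟩

theorem arc_nonneg {v : Plane} (hv : v ∈ arc) : 0 ≤ v.1 ∧ 0 ≤ v.2 := by
  have := abs_le.1 hv.1
  have := hv.2
  constructor <;> linarith

theorem arc_eq : arc = (fun θ : ℝ => ((1 - θ, θ) : Plane)) '' Icc 0 1 := by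
  ext v
  constructor
  · intro hv
    have h1 := arc_nonneg hv
    have h2 := hv.2
    exact ⟨v.2, ⟨h1.2, by linarith⟩, Prod.ext (by simp only; linarith) rfl⟩
  · rintro ⟨θ, hθ, rfl⟩
    refine ⟨abs_le.2 ?_, by simp⟩
    simp only
    constructor <;> linarith [hθ.1, hθ.2]

theorem mem_box_of {x y : ℝ} (h1 : |x| ≤ 1) (h2 : |y| ≤ 1) : ((x, y) : Plane) ∈ box :=
  mem_box.2 ⟨h1, h2⟩

/-- In the first quadrant, the image of the corner cut together with the rest of the half-axes moves to
the standard corner cut. -/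
theorem quadrant_push (h : IsConic ψ) (ho : IsOriented ψ) {Γ₁ : Set Plane} {η : ℝ} (hη : 0 < η)
    (hΓ : ∀ v ∈ box, v ∈ Γ₁ → v.1 + v.2 ≤ -η) :
    PlanarMove box (Γ₁ ∪ {v | v ∈ cross ∧ 0 ≤ v.1 ∧ 0 ≤ v.2 ∧ v ∉ ψ '' box} ∪ ψ '' arc)
      (Γ₁ ∪ arc) := by
  set c : ℝ → Plane := fun θ => ψ (1 - θ, θ) with hc
  have hbox : ∀ θ ∈ Icc (0 : ℝ) 1, ((1 - θ, θ) : Plane) ∈ box := fun θ hθ => mem_box_of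
    (abs_le.2 ⟨by linarith [hθ.1, hθ.2], by linarith [hθ.1]⟩)
    (abs_le.2 ⟨by linarith [hθ.1, hθ.2], by linarith [hθ.2]⟩)
  have hpl : IsPL ψ := h.pl.1
  have hcpl : IsPL c := by fun_prop
  have hc1 : ∀ θ ∈ Icc (0 : ℝ) 1, θ < 1 → 0 < (c θ).1 := fun θ hθ h1 =>
    ho.fst_pos _ (hbox θ hθ) (by simpa using h1)
  have hc2 : ∀ θ ∈ Icc (0 : ℝ) 1, 0 < θ → 0 < (c θ).2 := fun θ hθ h1 =>
    ho.snd_pos _ (hbox θ hθ) (by simpa using h1)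
  have hz : (0 : ℝ) ∈ Icc (0 : ℝ) 1 := ⟨le_rfl, zero_le_one⟩
  have hone : (1 : ℝ) ∈ Icc (0 : ℝ) 1 := ⟨zero_le_one, le_rfl⟩
  have h02 : (c 0).2 = 0 := h.snd_eq_zero ho (hbox 0 hz) rfl
  have h11 : (c 1).1 = 0 := h.fst_eq_zero ho (hbox 1 hone) (by simp)
  have hc1' : ∀ θ ∈ Icc (0 : ℝ) 1, 0 ≤ (c θ).1 := fun θ hθ => by
    rcases hθ.2.lt_or_eq with h1 | rfl
    · exact (hc1 θ hθ h1).le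
    · exact h11.ge
  have hc2' : ∀ θ ∈ Icc (0 : ℝ) 1, 0 ≤ (c θ).2 := fun θ hθ => by
    rcases hθ.1.lt_or_eq with h1 | rfl
    · exact (hc2 θ hθ h1).le
    · exact h02.ge
  have hsum : ∀ θ ∈ Icc (0 : ℝ) 1, 0 < (c θ).1 + (c θ).2 := fun θ hθ => by
    rcases hθ.1.lt_or_eq with h1 | rfl
    · linarith [hc1' θ hθ, hc2 θ hθ h1]
    · linarith [hc2' 0 hθ, hc1 0 hθ one_pos]
  have hn : ∀ θ ∈ Icc (0 : ℝ) 1, ‖c θ‖ < 1 := fun θ hθ => by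
    have := h.subset ⟨_, hbox θ hθ, rfl⟩
    simpa using this
  -- the slope of the arc is injective by conicality, hence monotone
  have hmono : StrictMonoOn (fun θ => (c θ).2 / ((c θ).1 + (c θ).2)) (Icc 0 1) := by
    refine ContinuousOn.strictMonoOn_of_injOn_Icc zero_le_one ?_ ?_ ?_
    · simp only [h02, h11, zero_div, zero_add]
      exact div_nonneg (hc2' 1 hone) (hc2' 1 hone)
    · have hcc := hcpl.continuous
      refine ContinuousOn.div (by fun_prop) (by fun_prop) fun θ hθ => (hsum θ hθ).ne'
    · have key : ∀ θ ∈ Icc (0 : ℝ) 1, ∀ θ' ∈ Icc (0 : ℝ) 1,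
          (c θ).2 / ((c θ).1 + (c θ).2) = (c θ').2 / ((c θ').1 + (c θ').2) →
          (c θ).1 + (c θ).2 ≤ (c θ').1 + (c θ').2 → θ = θ' := by
        intro θ hθ θ' hθ' he hle
        have p1 := hsum θ hθ
        have p2 := hsum θ' hθ'
        rw [div_eq_div_iff p1.ne' p2.ne'] at he
        set s := ((c θ).1 + (c θ).2) / ((c θ').1 + (c θ').2) with hs
        have hs1 : s * ((c θ').1 + (c θ').2) = (c θ).1 + (c θ).2 := div_mul_cancel₀ _ p2.ne'
        have hs01 : s ∈ Icc (0 : ℝ) 1 := ⟨(div_pos p1 p2).le, (div_le_one p2).2 hle⟩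
        have : c θ = s • c θ' := by
          ext <;> simp only [Prod.smul_fst, Prod.smul_snd, smul_eq_mul] <;>
            refine mul_right_cancel₀ p2.ne' ?_
          · linear_combination -he - (c θ').1 * hs1
          · linear_combination he - (c θ').2 * hs1
        rw [hc] at this
        simp only at this
        rw [← h.conical _ (hbox θ' hθ') s hs01] at this
        have := ψ.injective this
        have e1 := congrArg Prod.fst this
        have e2 := congrArg Prod.snd this
        simp only [Prod.smul_fst, Prod.smul_snd, smul_eq_mul] at e1 e2
        have : s = 1 := by linarith
        rw [this, one_mul] at e2
        exact e2
      intro θ hθ θ' hθ' he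
      rcases le_total ((c θ).1 + (c θ).2) ((c θ').1 + (c θ').2) with hle | hle
      · exact key θ hθ θ' hθ' he hle
      · exact (key θ' hθ' θ hθ he.symm hle).symm
  have hdet : ∀ θ ∈ Icc (0 : ℝ) 1, ∀ θ' ∈ Icc (0 : ℝ) 1, θ < θ' →
      0 < (c θ).1 * (c θ').2 - (c θ).2 * (c θ').1 := by
    intro θ hθ θ' hθ' hlt
    have := hmono hθ hθ' hlt
    simp only at this
    rw [div_lt_div_iff₀ (hsum θ hθ) (hsum θ' hθ')] at this
    linarith
  have hq : ∀ v ∈ quadrant, v ∉ Γ₁ ∪ {v | v ∈ cross ∧ 0 ≤ v.1 ∧ 0 ≤ v.2 ∧ v ∉ ψ '' box} := by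
    rintro v ⟨h1, h2, h3⟩ (h4 | ⟨⟨-, h4⟩, -⟩)
    · have := hΓ v (by simpa [box] using h3.le) h4
      linarith
    · rcases h4 with h4 | h4 <;> linarith
  have hst := straighten_arc hcpl hc1' hc2' hn hdet hq
  have harc : c '' Icc 0 1 = ψ '' arc := by rw [arc_eq, image_image]
  rw [harc] at hst
  have hqb : quadrant ⊆ box := fun v hv => by simpa [box] using hv.2.2.le
  refine (hst.mono hqb).trans ?_
  set lam := (c 0).1 with hlam
  set mu := (c 1).2 with hmu
  have hl : 0 < lam := hc1 0 hz one_pos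
  have hm : 0 < mu := hc2 1 hone one_pos
  have hl1 : lam ≤ 1 := (le_abs_self _).trans ((norm_fst_le (c 0)).trans (hn 0 hz).le)
  have hm1 : mu ≤ 1 := (le_abs_self _).trans ((norm_snd_le (c 1)).trans (hn 1 hone).le)
  have hlm : 0 < lam + mu := by linarith
  have e0 : c 0 = (lam, 0) := Prod.ext rfl h02
  have e1 : c 1 = (0, mu) := Prod.ext h11 rfl
  convert corner_push hl hl1 hm hm1 hη hΓ using 1
  swap
  · rfl
  rw [union_assoc]
  congr 1
  have hx : ∀ x ∈ Icc (0 : ℝ) 1, ψ (x, 0) = (x * lam, 0) := by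
    intro x hx
    have := h.conical _ (hbox 0 hz) x hx
    have e : x • ((1 - 0, 0) : Plane) = (x, 0) := by simp
    rw [e] at this
    rw [this]
    change x • c 0 = _
    rw [e0]; simp
  have hy : ∀ x ∈ Icc (0 : ℝ) 1, ψ (0, x) = (0, x * mu) := by
    intro x hx
    have := h.conical _ (hbox 1 hone) x hx
    have e : x • ((1 - 1, 1) : Plane) = (0, x) := by simp
    rw [e] at this
    rw [this]
    change x • c 1 = _
    rw [e1]; simp
  have hdl : ∀ x : ℝ, x ≤ lam → 0 ≤ x → ((x, 0) : Plane) ∈ ψ '' box := fun x h1 h2 => by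
    have hm : x / lam ∈ Icc (0 : ℝ) 1 := ⟨div_nonneg h2 hl.le, (div_le_one hl).2 h1⟩
    refine ⟨(x / lam, 0), mem_box_of (abs_le.2 ⟨by linarith [hm.1], hm.2⟩) (by simp), ?_⟩
    rw [hx _ hm, div_mul_cancel₀ _ hl.ne']
  have hdm : ∀ x : ℝ, x ≤ mu → 0 ≤ x → ((0, x) : Plane) ∈ ψ '' box := fun x h1 h2 => by
    have hm' : x / mu ∈ Icc (0 : ℝ) 1 := ⟨div_nonneg h2 hm.le, (div_le_one hm).2 h1⟩
    refine ⟨(0, x / mu), mem_box_of (by simp) (abs_le.2 ⟨by linarith [hm'.1], hm'.2⟩), ?_⟩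
    rw [hy _ hm', div_mul_cancel₀ _ hm.ne']
  rw [e0, e1]
  ext ⟨x, y⟩
  simp only [mem_union, mem_ofPred_eq]
  constructor
  · rintro (⟨⟨hb, h0⟩, hx0, hy0, hnot⟩ | ⟨s, t, hs, ht, hst, he⟩)
    · rw [mem_box] at hb
      rcases h0 with rfl | rfl
      · have hlt : mu < y := by
          by_contra! hc
          exact hnot (hdm y hc hy0)
        simp only [zero_sub, abs_neg, zero_add, mul_neg, abs_of_nonneg hy0]
        refine ⟨(le_abs_self y).trans hb.2, (max_eq_left ?_).symm⟩
        rw [div_le_iff₀ hlm]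
        nlinarith
      · have hlt : lam < x := by
          by_contra! hc
          exact hnot (hdl x hc hx0)
        simp only [sub_zero, add_zero, abs_of_nonneg hx0]
        refine ⟨(le_abs_self x).trans hb.1, (max_eq_left ?_).symm⟩
        rw [div_le_iff₀ hlm]
        nlinarith
    · have e3 := congrArg Prod.fst he
      have e4 := congrArg Prod.snd he
      simp only [Prod.fst_add, Prod.snd_add, Prod.smul_fst, Prod.smul_snd, smul_eq_mul, mul_zero,
        add_zero, zero_add] at e3 e4
      rw [← e3, ← e4]
      have e5 : 0 ≤ s * lam := mul_nonneg hs hl.le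
      have e6 : 0 ≤ t * mu := mul_nonneg ht hm.le
      have e7 : s * lam ≤ 1 := mul_le_one₀ (by linarith) hl.le hl1
      have e8 : t * mu ≤ 1 := mul_le_one₀ (by linarith) hm.le hm1
      refine ⟨abs_le.2 ⟨by linarith, by linarith⟩, ?_⟩
      have e9 : (2 * lam * mu + (lam - mu) * (s * lam - t * mu)) / (lam + mu) = s * lam + t * mu := by
        rw [div_eq_iff hlm.ne']
        obtain rfl : s = 1 - t := by linarith
        ring
      rw [e9, max_eq_right]
      exact abs_le.2 ⟨by linarith, by linarith⟩
  · rintro ⟨hq1, hp⟩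
    have hq2 := abs_le.1 hq1
    rcases le_or_gt ((2 * lam * mu + (lam - mu) * (x - y)) / (lam + mu)) |x - y| with hle | hlt
    · rw [max_eq_left hle] at hp
      rw [div_le_iff₀ hlm] at hle
      rcases abs_cases (x - y) with ⟨ha, hb⟩ | ⟨ha, hb⟩
      · obtain rfl : y = 0 := by linarith
        rw [ha, sub_zero] at hle
        have hlx : lam ≤ x := by
          have : mu * lam ≤ mu * x := by nlinarith
          exact le_of_mul_le_mul_left this hm
        rcases hlx.eq_or_lt with rfl | hlx
        · exact Or.inr (left_mem_segment ℝ _ _)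
        · left
          refine ⟨⟨mem_box_of (abs_le.2 ⟨by linarith, by linarith⟩) (by simp), Or.inr rfl⟩, by linarith,
            le_rfl, ?_⟩
          rintro ⟨w, hw, he⟩
          have hw2 : w.2 = 0 := by
            rcases lt_trichotomy w.2 0 with h1 | h1 | h1
            · have := ho.snd_neg w hw h1; rw [he] at this; exact absurd this (lt_irrefl _)
            · exact h1
            · have := ho.snd_pos w hw h1; rw [he] at this; exact absurd this (lt_irrefl _)
          have hw1 : 0 ≤ w.1 := by
            by_contra! h1
            have := ho.fst_neg w hw h1
            rw [he] at this
            simp only at this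
            linarith
          have hw3 := (abs_le.1 (mem_box.1 hw).1).2
          have : w = (w.1, 0) := Prod.ext rfl hw2
          rw [this, hx _ ⟨hw1, hw3⟩] at he
          have := congrArg Prod.fst he
          simp only at this
          nlinarith
      · obtain rfl : x = 0 := by linarith
        rw [ha] at hle
        have hly : mu ≤ y := by
          have : lam * mu ≤ lam * y := by nlinarith
          exact le_of_mul_le_mul_left this hl
        rcases hly.eq_or_lt with rfl | hly
        · exact Or.inr (right_mem_segment ℝ _ _)
        · left
          refine ⟨⟨mem_box_of (by simp) (abs_le.2 ⟨by linarith, by linarith⟩), Or.inl rfl⟩, le_rfl,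
            by linarith, ?_⟩
          rintro ⟨w, hw, he⟩
          have hw2 : w.1 = 0 := by
            rcases lt_trichotomy w.1 0 with h1 | h1 | h1
            · have := ho.fst_neg w hw h1; rw [he] at this; exact absurd this (lt_irrefl _)
            · exact h1
            · have := ho.fst_pos w hw h1; rw [he] at this; exact absurd this (lt_irrefl _)
          have hw1 : 0 ≤ w.2 := by
            by_contra! h1
            have := ho.snd_neg w hw h1
            rw [he] at this
            simp only at this
            linarith
          have hw3 := (abs_le.1 (mem_box.1 hw).2).2
          have : w = (0, w.2) := Prod.ext hw2 rfl
          rw [this, hy _ ⟨hw1, hw3⟩] at he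
          have := congrArg Prod.snd he
          simp only at this
          nlinarith
    · rw [max_eq_right hlt.le, eq_div_iff hlm.ne'] at hp
      rw [lt_div_iff₀ hlm, ← hp] at hlt
      have hlt' := abs_lt.1 (lt_of_mul_lt_mul_right hlt hlm.le)
      right
      refine ⟨x / lam, y / mu, div_nonneg (by linarith) hl.le, div_nonneg (by linarith) hm.le, ?_, ?_⟩
      · field_simp; linarith
      · ext <;> simp [hl.ne', hm.ne']

end Corner

/-! ### Symmetries of the smoothings -/

section Corner

variable {ψ σ : Plane ≃ₜ Plane} {Γ : Set Plane}

theorem isPLHomeo_neg : IsPLHomeo (Homeomorph.neg Plane) := ⟨isPL_id.neg, isPL_id.neg⟩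

theorem neg_mem_box {v : Plane} : -v ∈ box ↔ v ∈ box := by simp [mem_box]

theorem neg_mem_cross {v : Plane} : -v ∈ cross ↔ v ∈ cross := by
  simp [cross, neg_mem_box]

theorem mem_corner_true {v : Plane} : v ∈ corner true ↔ v ∈ arc ∨ -v ∈ arc := by
  simp only [corner, arc, mem_ofPred_eq, Prod.fst_neg, Prod.snd_neg, abs_eq zero_le_one,
    neg_sub_neg, abs_sub_comm v.2 v.1]
  constructor
  · rintro ⟨h | h, h'⟩
    · exact Or.inl ⟨h', h⟩
    · exact Or.inr ⟨h', by linarith⟩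
  · rintro (⟨h, h'⟩ | ⟨h, h'⟩)
    · exact ⟨Or.inl h', h⟩
    · exact ⟨Or.inr (by linarith), h⟩

/-- The arcs of the smoothing in the first and the third quadrant are pushed to the standard ones one
after the other; the second push is the first one conjugated by the central symmetry. -/
theorem corner_move_true (h : IsConic ψ) (ho : IsOriented ψ) (hΓ : Γ ∩ box = cross) :
    PlanarMove box (smooth ψ true Γ) (smooth (Homeomorph.refl _) true Γ) := by
  obtain ⟨η, hη, hball⟩ : ∃ η > 0, ∀ v : Plane, ‖v‖ ≤ η → ∃ w : Plane, ‖w‖ ≤ 1 / 4 ∧ ψ w = v := by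
    have : ψ '' Metric.closedBall 0 (1 / 4) ∈ 𝓝 (0 : Plane) := by
      have := ψ.isOpenMap.image_mem_nhds (Metric.closedBall_mem_nhds (0 : Plane)
        (by norm_num : (0 : ℝ) < 1 / 4))
      rwa [h.zero] at this
    obtain ⟨η, hη, hs⟩ := Metric.nhds_basis_closedBall.mem_iff.1 this
    refine ⟨η, hη, fun v hv => ?_⟩
    obtain ⟨w, hw, rfl⟩ := hs (mem_closedBall_zero_iff.2 hv)
    exact ⟨w, mem_closedBall_zero_iff.1 hw, rfl⟩
  have hsum : ∀ v : Plane, v.1 ≤ 0 → v.2 ≤ 0 → η < ‖v‖ → v.1 + v.2 ≤ -η := by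
    intro v h1 h2 h3
    rw [Prod.norm_def, Real.norm_of_nonpos h1, Real.norm_of_nonpos h2, lt_max_iff] at h3
    rcases h3 with h3 | h3 <;> linarith
  have harc : ∀ v ∈ arc, 1 / 4 < ‖v‖ := by
    intro v hv
    have h1 := norm_fst_le v
    have h2 := norm_snd_le v
    have h3 := le_abs_self v.1
    have h4 := le_abs_self v.2
    have := hv.2
    rw [Real.norm_eq_abs] at h1 h2
    linarith
  have hsub : ψ '' box ⊆ box := h.subset.trans Metric.ball_subset_closedBall
  -- the two parts of the picture outside the first quadrant
  set Γ₁ := (Γ \ box) ∪ {v | v ∈ cross ∧ v.1 ≤ 0 ∧ v.2 ≤ 0 ∧ v ∉ ψ '' box} ∪ {v | ∃ w, -w ∈ arc ∧ ψ w = v}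
    with hΓ₁
  have step1 := quadrant_push h ho (Γ₁ := Γ₁) hη (by
    rintro v hv ((h1 | ⟨h1, h2, h3, h4⟩) | ⟨w, h1, rfl⟩)
    · exact absurd hv h1.2
    · refine hsum v h2 h3 ?_
      by_contra! h5
      obtain ⟨w, hw, h6⟩ := hball v h5
      exact h4 ⟨w, by simpa [box] using hw.trans (by norm_num), h6⟩
    · have hw : w ∈ box := neg_mem_box.1 (arc_subset_box h1)
      have h2 := arc_nonneg h1
      simp only [Prod.fst_neg, Prod.snd_neg, Left.nonneg_neg_iff] at h2
      refine hsum _ ?_ ?_ ?_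
      · rcases h2.1.lt_or_eq with h3 | h3
        · exact (ho.fst_neg w hw h3).le
        · exact (h.fst_eq_zero ho hw h3).le
      · rcases h2.2.lt_or_eq with h3 | h3
        · exact (ho.snd_neg w hw h3).le
        · exact (h.snd_eq_zero ho hw h3).le
      · by_contra! h5
        obtain ⟨w', hw', h6⟩ := hball _ h5
        rw [ψ.injective h6] at hw'
        have := harc _ h1
        rw [norm_neg] at this
        linarith)
  set ν := Homeomorph.neg Plane with hν
  have hνa : ∀ v, ν v = -v := fun v => rfl
  have hconj : ∀ v, (ν.trans (ψ.trans ν)) v = -ψ (-v) := fun v => rfl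
  have himg : ∀ v, v ∈ (ν.trans (ψ.trans ν)) '' box ↔ -v ∈ ψ '' box := by
    intro v
    constructor
    · rintro ⟨w, hw, rfl⟩
      exact ⟨-w, neg_mem_box.2 hw, by rw [hconj]; simp⟩
    · rintro ⟨w, hw, he⟩
      exact ⟨-w, neg_mem_box.2 hw, by rw [hconj, neg_neg, he, neg_neg]⟩
  have h' : IsConic (ν.trans (ψ.trans ν)) := by
    refine ⟨isPLHomeo_neg.trans (h.pl.trans isPLHomeo_neg), fun v hv s hs => ?_, ?_, fun v hv => ?_⟩
    · rw [hconj, hconj, ← smul_neg, h.conical _ (neg_mem_box.2 hv) s hs, smul_neg]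
    · intro v hv
      have := h.subset ((himg v).1 hv)
      simpa using this
    · rw [hconj, neg_mem_cross, h.cross _ (neg_mem_box.2 hv), neg_mem_cross]
  have ho' : IsOriented (ν.trans (ψ.trans ν)) := by
    refine ⟨fun v hv h1 => ?_, fun v hv h1 => ?_, fun v hv h1 => ?_, fun v hv h1 => ?_⟩ <;>
      rw [hconj] <;> simp only [Prod.fst_neg, Prod.snd_neg, Left.neg_pos_iff, Left.neg_neg_iff]
    · exact ho.fst_neg _ (neg_mem_box.2 hv) (by simpa)
    · exact ho.fst_pos _ (neg_mem_box.2 hv) (by simpa)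
    · exact ho.snd_neg _ (neg_mem_box.2 hv) (by simpa)
    · exact ho.snd_pos _ (neg_mem_box.2 hv) (by simpa)
  have step2 := (quadrant_push h' ho' (Γ₁ := {v | -v ∈ Γ ∧ v ∉ box} ∪ {v | -v ∈ arc}) one_pos (by
    rintro v hv (h1 | h1)
    · exact absurd hv h1.2
    · have := h1.2
      simp only [Prod.fst_neg, Prod.snd_neg] at this
      linarith)).conj isPLHomeo_neg
  have hnegimg : ∀ S : Set Plane, ∀ v, v ∈ Homeomorph.neg Plane '' S ↔ -v ∈ S := by
    intro S v
    constructor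
    · rintro ⟨w, hw, rfl⟩; simpa using hw
    · intro hv; exact ⟨-v, hv, by simp⟩
  have hbb : Homeomorph.neg Plane '' box = box := by
    ext v; rw [hnegimg, neg_mem_box]
  rw [hbb] at step2
  have e1 : smooth ψ true Γ = Γ₁ ∪ {v | v ∈ cross ∧ 0 ≤ v.1 ∧ 0 ≤ v.2 ∧ v ∉ ψ '' box} ∪ ψ '' arc := by
    ext v
    have h1 : v ∈ ψ '' corner true ↔ v ∈ ψ '' arc ∨ ∃ w, -w ∈ arc ∧ ψ w = v := by
      simp only [mem_image, mem_corner_true, or_and_right, exists_or]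
    have h2 := Set.ext_iff.1 hΓ v
    have h3 := @hsub v
    simp only [smooth, hΓ₁, mem_union, mem_sdiff, h1, mem_ofPred_eq]
    have h4 : v ∈ cross → v ∉ ψ '' box → (v.1 ≤ 0 ∧ v.2 ≤ 0) ∨ (0 ≤ v.1 ∧ 0 ≤ v.2) := by
      rintro ⟨-, h5 | h5⟩ - <;> rw [h5]
      · rcases le_total v.2 0 with h6 | h6 <;> simp [h6]
      · rcases le_total v.1 0 with h6 | h6 <;> simp [h6]
    rw [mem_inter_iff] at h2
    have h5 : v ∈ cross → v ∈ box := And.left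
    by_cases hI : v ∈ ψ '' box
    · have := h3 hI
      simp only [hI, this, not_true, and_false, false_or, or_false]
      exact or_comm
    · by_cases hB : v ∈ box
      · have h6 : v ∈ Γ ↔ v ∈ cross := by rw [← h2]; exact (and_iff_left hB).symm
        by_cases hC : v ∈ cross
        · rcases h4 hC hI with h4 | h4 <;> simp [hI, hB, h6, hC, h4]
        · simp only [hI, hB, h6, hC, not_true, and_false, false_and, false_or, or_false]
          exact or_comm
      · have hC : v ∉ cross := fun h => hB (h5 h)
        simp only [hI, hB, hC, not_false_eq_true, and_true, false_and, or_false]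
        rw [or_assoc, or_comm (a := v ∈ ψ '' arc)]
  have e2 : Γ₁ ∪ arc = Homeomorph.neg Plane '' ({v | -v ∈ Γ ∧ v ∉ box} ∪ {v | -v ∈ arc} ∪
      {v | v ∈ cross ∧ 0 ≤ v.1 ∧ 0 ≤ v.2 ∧ v ∉ (ν.trans (ψ.trans ν)) '' box} ∪
      (ν.trans (ψ.trans ν)) '' arc) := by
    ext v
    have h1 : -v ∈ (ν.trans (ψ.trans ν)) '' arc ↔ ∃ w, -w ∈ arc ∧ ψ w = v := by
      constructor
      · rintro ⟨w, hw, he⟩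
        exact ⟨-w, by simpa, by rw [hconj] at he; exact neg_injective he⟩
      · rintro ⟨w, hw, rfl⟩
        exact ⟨-w, hw, by rw [hconj, neg_neg]⟩
    rw [hnegimg]
    simp only [hΓ₁, mem_union, mem_sdiff, mem_ofPred_eq, himg, h1, neg_neg, neg_mem_box,
      neg_mem_cross, Prod.fst_neg, Prod.snd_neg, Left.nonneg_neg_iff]
    generalize (∃ w, -w ∈ arc ∧ ψ w = v) = A
    tauto
  have e3 : smooth (Homeomorph.refl _) true Γ =
      Homeomorph.neg Plane '' ({v | -v ∈ Γ ∧ v ∉ box} ∪ {v | -v ∈ arc} ∪ arc) := by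
    ext v
    have hr : ∀ S, Homeomorph.refl Plane '' S = S := fun S => image_id S
    rw [hnegimg]
    simp only [smooth, hr, mem_union, mem_sdiff, mem_corner_true,
      mem_ofPred_eq, neg_neg, neg_mem_box]
    tauto
  rw [e1, e3]
  rw [e2] at step1
  exact step1.trans step2

/-- Symmetries of the square and of the cross. -/
structure IsSym (σ : Plane ≃ₜ Plane) (b : Bool) : Prop where
  pl : IsPLHomeo σ
  norm : ∀ v, ‖σ v‖ = ‖v‖
  cross : ∀ v, σ v ∈ cross ↔ v ∈ cross
  smul : ∀ (s : ℝ) (v : Plane), σ (s • v) = s • σ v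
  corner : ∀ s v, σ v ∈ corner (xor b s) ↔ v ∈ corner s

theorem IsSym.box {b : Bool} (h : IsSym σ b) (v : Plane) : σ v ∈ box ↔ v ∈ box := by
  simp [PLLink.box, h.norm]

theorem IsSym.image_box {b : Bool} (h : IsSym σ b) : σ '' PLLink.box = PLLink.box := by
  ext v
  obtain ⟨w, rfl⟩ := σ.surjective v
  rw [σ.injective.mem_set_image, h.box]

theorem IsSym.image_corner {b : Bool} (h : IsSym σ b) (s : Bool) :
    σ '' PLLink.corner s = PLLink.corner (xor b s) := by
  ext v
  obtain ⟨w, rfl⟩ := σ.surjective v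
  rw [σ.injective.mem_set_image, h.corner]

theorem IsSym.smooth {b : Bool} (h : IsSym σ b) (s : Bool) (Γ : Set Plane) :
    PLLink.smooth (σ.trans ψ) s Γ = PLLink.smooth ψ (xor b s) Γ := by
  rw [PLLink.smooth, image_trans, image_trans, h.image_box, h.image_corner]; rfl

theorem IsSym.isConic {b : Bool} (h : IsSym σ b) (hψ : IsConic ψ) : IsConic (σ.trans ψ) := by
  refine ⟨h.pl.trans hψ.pl, fun v hv s hs => ?_, ?_, fun v hv => ?_⟩
  · simp only [Homeomorph.trans_apply, h.smul, hψ.conical _ ((h.box v).2 hv) s hs]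
  · rw [image_trans, h.image_box]; exact hψ.subset
  · rw [Homeomorph.trans_apply, hψ.cross _ ((h.box v).2 hv), h.cross]

theorem IsConic.trans_isSym {b : Bool} (hψ : IsConic ψ) (h : IsSym σ b) : IsConic (ψ.trans σ) := by
  refine ⟨hψ.pl.trans h.pl, fun v hv s hs => ?_, ?_, fun v hv => ?_⟩
  · simp only [Homeomorph.trans_apply, hψ.conical v hv s hs, h.smul]
  · rintro _ ⟨v, hv, rfl⟩
    simpa [h.norm] using hψ.subset ⟨v, hv, rfl⟩
  · rw [Homeomorph.trans_apply, h.cross, hψ.cross v hv]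

/-- Reflection in the vertical axis. -/
noncomputable def reflX : Plane ≃ₜ Plane :=
  plHomeo (fun v => (-v.1, v.2)) (fun v => (-v.1, v.2)) (by fun_prop) (by fun_prop)
    (fun v => by simp) (fun v => by simp)

/-- Reflection in the horizontal axis. -/
noncomputable def reflY : Plane ≃ₜ Plane :=
  plHomeo (fun v => (v.1, -v.2)) (fun v => (v.1, -v.2)) (by fun_prop) (by fun_prop)
    (fun v => by simp) (fun v => by simp)

/-- Reflection in the diagonal. -/
noncomputable def swap : Plane ≃ₜ Plane :=
  plHomeo (fun v => (v.2, v.1)) (fun v => (v.2, v.1)) (by fun_prop) (by fun_prop)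
    (fun v => by simp) (fun v => by simp)

theorem isSym_reflX : IsSym reflX true := by
  refine ⟨isPLHomeo_plHomeo _ _ _ _ _ _, fun v => ?_, fun v => ?_, fun s v => ?_, fun s v => ?_⟩
  · change ‖(-v.1, v.2)‖ = _; simp [Prod.norm_def]
  · change (-v.1, v.2) ∈ _ ↔ _; simp [cross, mem_box]
  · change (-(s • v).1, (s • v).2) = s • (-v.1, v.2); ext <;> simp
  · change (-v.1, v.2) ∈ _ ↔ _
    have h1 : |-v.1 + v.2| = |v.1 - v.2| := by rw [← abs_neg]; ring_nf
    have h2 : |-v.1 - v.2| = |v.1 + v.2| := by rw [← abs_neg]; ring_nf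
    cases s <;> simp [corner, h1, h2]

theorem isSym_reflY : IsSym reflY true := by
  refine ⟨isPLHomeo_plHomeo _ _ _ _ _ _, fun v => ?_, fun v => ?_, fun s v => ?_, fun s v => ?_⟩
  · change ‖(v.1, -v.2)‖ = _; simp [Prod.norm_def]
  · change (v.1, -v.2) ∈ _ ↔ _; simp [cross, mem_box]
  · change ((s • v).1, -(s • v).2) = s • (v.1, -v.2); ext <;> simp
  · change (v.1, -v.2) ∈ _ ↔ _
    cases s <;> simp [corner, ← sub_eq_add_neg]

theorem isSym_swap : IsSym swap false := by
  refine ⟨isPLHomeo_plHomeo _ _ _ _ _ _, fun v => ?_, fun v => ?_, fun s v => ?_, fun s v => ?_⟩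
  · change ‖(v.2, v.1)‖ = _; simp [Prod.norm_def, max_comm]
  · change (v.2, v.1) ∈ _ ↔ _; simp [cross, mem_box, and_comm, or_comm]
  · rfl
  · change (v.2, v.1) ∈ _ ↔ _
    cases s <;> simp [corner, add_comm v.2 v.1, abs_sub_comm v.2 v.1]

theorem reflX_reflX (v : Plane) : reflX (reflX v) = v := by
  change (- -v.1, v.2) = v; simp

/-- Both smoothings in conical coordinates that preserve the quadrants are isotopic to the standard
ones. The second smoothing is the reflection of the first one. -/
theorem corner_move (h : IsConic ψ) (ho : IsOriented ψ) (hΓ : Γ ∩ box = cross) (s : Bool) :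
    PlanarMove box (smooth ψ s Γ) (smooth (Homeomorph.refl _) s Γ) := by
  cases s with
  | true => exact corner_move_true h ho hΓ
  | false =>
    have hσ := isSym_reflX
    have hap : ∀ v, reflX v = (-v.1, v.2) := fun v => rfl
    have hcr : ∀ v, (reflX.trans (ψ.trans reflX)) v = reflX (ψ (reflX v)) := fun v => rfl
    have h' : IsConic (reflX.trans (ψ.trans reflX)) := hσ.isConic (h.trans_isSym hσ)
    have ho' : IsOriented (reflX.trans (ψ.trans reflX)) := by
      have hb : ∀ v ∈ box, reflX v ∈ box := fun v hv => (hσ.box v).2 hv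
      refine ⟨fun v hv h1 => ?_, fun v hv h1 => ?_, fun v hv h1 => ?_, fun v hv h1 => ?_⟩ <;>
        rw [hcr, hap]
      · have := ho.fst_neg _ (hb v hv) (by rw [hap]; simpa)
        simpa
      · have := ho.fst_pos _ (hb v hv) (by rw [hap]; simpa)
        simpa
      · exact ho.snd_pos _ (hb v hv) (by rw [hap]; simpa)
      · exact ho.snd_neg _ (hb v hv) (by rw [hap]; simpa)
    have hΓ' : reflX '' Γ ∩ box = cross := by
      ext v
      obtain ⟨w, rfl⟩ := reflX.surjective v
      have := Set.ext_iff.1 hΓ w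
      rw [mem_inter_iff, reflX.injective.mem_set_image, hσ.box, hσ.cross, ← this, mem_inter_iff]
    have := (corner_move_true h' ho' hΓ').conj hσ.pl
    rw [hσ.image_box, ← smooth_trans, ← smooth_trans, image_image] at this
    simp only [reflX_reflX, image_id'] at this
    have e1 : (reflX.trans (ψ.trans reflX)).trans reflX = reflX.trans ψ := by
      ext1 v
      change reflX (reflX _) = _
      rw [reflX_reflX]; rfl
    have e2 : (Homeomorph.refl Plane).trans reflX = reflX.trans (Homeomorph.refl _) := rfl
    rw [e1, e2, hσ.smooth, hσ.smooth] at this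
    exact this

/-- A continuous function on `[0,1]` without zeros has the same sign at the ends. -/
theorem pos_of_ne_zero {f : ℝ → ℝ} (hf : Continuous f) (h0 : 0 < f 0)
    (hne : ∀ t ∈ Icc (0 : ℝ) 1, f t ≠ 0) : 0 < f 1 := by
  by_contra! h1
  obtain ⟨t, ht, h⟩ := intermediate_value_Icc' zero_le_one hf.continuousOn ⟨h1, h0.le⟩
  exact hne t ht h

theorem IsConic.ne_zero (h : IsConic ψ) {v : Plane} (hv : v ≠ 0) : ψ v ≠ 0 := fun h0 =>
  hv (ψ.injective (h0.trans h.zero.symm))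

/-- Two distinct vectors of norm one are not mapped to the same ray. -/
theorem IsConic.not_same (h : IsConic ψ) {v w : Plane} (hv : ‖v‖ = 1) (hw : ‖w‖ = 1) (hvw : v ≠ w)
    {e : Plane} {a b : ℝ} (ha : 0 < a) (hb : 0 < b) (h1 : ψ v = a • e) (h2 : ψ w = b • e) : False := by
  wlog hab : a ≤ b generalizing v w a b
  · exact this hw hv hvw.symm hb ha h2 h1 (le_of_not_ge hab)
  have hs : a / b ∈ Icc (0 : ℝ) 1 := ⟨(div_pos ha hb).le, (div_le_one hb).2 hab⟩
  have h3 : ψ ((a / b) • w) = ψ v := by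
    rw [h.conical w (by simp [box, hw]) _ hs, h1, h2, smul_smul, div_mul_cancel₀ _ hb.ne']
  have h4 := ψ.injective h3
  have h5 : a / b = 1 := by
    have := congrArg norm h4
    rwa [norm_smul, hw, hv, mul_one, Real.norm_of_nonneg hs.1] at this
  rw [h5, one_smul] at h4
  exact hvw h4.symm

/-- A path in the square that ends on the horizontal axis and does not meet the vertical one shows on
which side of the vertical axis a point is mapped. -/
theorem IsConic.fst_sign (h : IsConic ψ) (h1 : 0 < (ψ (1, 0)).1) (h5 : (ψ (-1, 0)).1 < 0) :
    ∀ v ∈ box, (0 < v.1 → 0 < (ψ v).1) ∧ (v.1 < 0 → (ψ v).1 < 0) := by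
  intro v hv
  have hcont := ψ.continuous
  have hb := abs_le.1 (mem_box.1 hv).1
  have hx : ∀ t ∈ Icc (0 : ℝ) 1, ((v.1, t * v.2) : Plane) ∈ box := by
    intro t ht
    rw [mem_box] at hv
    refine mem_box_of hv.1 ?_
    rw [abs_mul, abs_of_nonneg ht.1]
    exact mul_le_one₀ ht.2 (abs_nonneg _) hv.2
  have px : ∀ x, 0 < x → x ≤ 1 → 0 < (ψ (x, 0)).1 := by
    intro x hx0 hx1
    have := h.conical (1, 0) (mem_box_of (by simp) (by simp)) x ⟨hx0.le, hx1⟩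
    have e : x • ((1, 0) : Plane) = (x, 0) := by simp
    rw [e] at this
    rw [this]; exact mul_pos hx0 h1
  have nx : ∀ x, x < 0 → -1 ≤ x → (ψ (x, 0)).1 < 0 := by
    intro x hx0 hx1
    have := h.conical (-1, 0) (mem_box_of (by simp) (by simp)) (-x) ⟨by linarith, by linarith⟩
    have e : (-x) • ((-1, 0) : Plane) = (x, 0) := by simp
    rw [e] at this
    rw [this]; exact mul_neg_of_pos_of_neg (by linarith) h5
  have xne : v.1 ≠ 0 → ∀ t ∈ Icc (0 : ℝ) 1, (ψ (v.1, t * v.2)).1 ≠ 0 := by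
    intro hne t ht h0
    rcases (h.axis_iff (hx t ht)).1 (Or.inl h0) with h7 | h7
    · exact hne h7
    · simp only at h7
      rw [h7] at h0
      rcases lt_or_gt_of_ne hne with h8 | h8
      · exact (nx _ h8 hb.1).ne h0
      · exact (px _ h8 hb.2).ne' h0
  refine ⟨fun hp => ?_, fun hp => ?_⟩
  · have := pos_of_ne_zero (f := fun t => (ψ (v.1, t * v.2)).1) (by fun_prop)
      (by simpa using px _ hp hb.2) (xne hp.ne')
    simpa using this
  · have := pos_of_ne_zero (f := fun t => -(ψ (v.1, t * v.2)).1) (by fun_prop)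
      (by simpa using nx _ hp hb.1) (fun t ht h0 => xne hp.ne t ht (neg_eq_zero.1 h0))
    simpa using this

/-- If the half-axes are mapped to themselves, then so are the quadrants. -/
theorem IsConic.isOriented (h : IsConic ψ) (h1 : 0 < (ψ (1, 0)).1) (h4 : 0 < (ψ (0, 1)).2)
    (h5 : (ψ (-1, 0)).1 < 0) (h6 : (ψ (0, -1)).2 < 0) : IsOriented ψ := by
  have hx := h.fst_sign h1 h5
  have hy := (isSym_swap.isConic (h.trans_isSym isSym_swap)).fst_sign h4 h6
  have hs : ∀ v ∈ box, swap v ∈ box := fun v hv => (isSym_swap.box v).2 hv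
  exact ⟨fun v hv => (hx v hv).1, fun v hv => (hx v hv).2, fun v hv => (hy _ (hs v hv)).1,
    fun v hv => (hy _ (hs v hv)).2⟩

/-- The images of a horizontal and a vertical half-axis lie on different axes. -/
theorem IsConic.axis_ne (h : IsConic ψ) {x y : ℝ} (hx : |x| = 1) (hy : |y| = 1) :
    ((ψ (x, 0)).2 = 0 → (ψ (0, y)).2 = 0 → False) ∧ ((ψ (x, 0)).1 = 0 → (ψ (0, y)).1 = 0 → False) := by
  -- the two claims correspond to each other under reflection of the target in the diagonal
  suffices H : ∀ {ψ : Plane ≃ₜ Plane}, IsConic ψ → (ψ (x, 0)).2 = 0 → (ψ (0, y)).2 = 0 → False from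
    ⟨H h, H (h.trans_isSym isSym_swap)⟩
  intro ψ h h1 h2
  have hcont := ψ.continuous
  have hx0 : x ≠ 0 := fun h => by rw [h] at hx; simp at hx
  have hy0 : y ≠ 0 := fun h => by rw [h] at hy; simp at hy
  have n1 : ((x, 0) : Plane) ≠ 0 := fun h => hx0 (congrArg Prod.fst h)
  have n2 : ((0, y) : Plane) ≠ 0 := fun h => hy0 (congrArg Prod.snd h)
  have w1 : ‖((x, 0) : Plane)‖ = 1 := by simp [Prod.norm_def, hx]
  have w2 : ‖((0, y) : Plane)‖ = 1 := by simp [Prod.norm_def, hy]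
  have hne12 : ((x, 0) : Plane) ≠ (0, y) := fun h => hx0 (congrArg Prod.fst h)
  have hb : ∀ t ∈ Icc (0 : ℝ) 1, (((1 - t) * x, t * y) : Plane) ∈ box := by
    intro t ht
    refine mem_box_of ?_ ?_ <;> rw [abs_mul] <;> simp only [hx, hy, mul_one]
    · rw [abs_of_nonneg (by linarith [ht.2])]; linarith [ht.1]
    · rw [abs_of_nonneg ht.1]; exact ht.2
  have hends : ∀ t ∈ Icc (0 : ℝ) 1, (ψ ((1 - t) * x, t * y)).1 = 0 ∨ (ψ ((1 - t) * x, t * y)).2 = 0 →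
      t = 0 ∨ t = 1 := by
    intro t ht h0
    rcases (h.axis_iff (hb t ht)).1 h0 with h1 | h1
    · right; have := (mul_eq_zero.1 h1).resolve_right hx0; linarith
    · left; exact (mul_eq_zero.1 h1).resolve_right hy0
  -- by the intermediate value theorem, the signs along the axis agree
  have key : ∀ f : Plane → ℝ, Continuous f → f (ψ (0, y)) ≠ 0 →
      (∀ v, f v = 0 → v.1 = 0 ∨ v.2 = 0) → 0 < f (ψ (x, 0)) → 0 < f (ψ (0, y)) := by
    intro f hf h2 h3 h4
    have := pos_of_ne_zero (f := fun t => f (ψ ((1 - t) * x, t * y))) (by fun_prop) (by simpa using h4)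
      (fun t ht h0 => by
        rcases hends t ht (h3 _ h0) with rfl | rfl
        · simp at h0; exact h4.ne' h0
        · simp at h0; exact h2 h0)
    simpa using this
  have e1 : (ψ (x, 0)).1 ≠ 0 := fun h3 => h.ne_zero n1 (Prod.ext h3 h1)
  have e2 : (ψ (0, y)).1 ≠ 0 := fun h3 => h.ne_zero n2 (Prod.ext h3 h2)
  rcases lt_or_gt_of_ne e1 with h3 | h3
  · have h4 := key (fun v => -v.1) (by fun_prop) (neg_ne_zero.2 e2)
      (fun v hv => Or.inl (neg_eq_zero.1 hv)) (neg_pos.2 h3)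
    exact h.not_same w1 w2 hne12 (e := (-1, 0)) (neg_pos.2 h3) h4 (Prod.ext (by simp) (by simp [h1]))
      (Prod.ext (by simp) (by simp [h2]))
  · have h4 := key (fun v => v.1) (by fun_prop) e2 (fun v hv => Or.inl hv) h3
    exact h.not_same w1 w2 hne12 (e := (1, 0)) h3 h4 (Prod.ext (by simp) (by simp [h1]))
      (Prod.ext (by simp) (by simp [h2]))

/-- Opposite half-axes with images on the horizontal axis are mapped to opposite half-axes. -/
theorem IsConic.opposite (h : IsConic ψ) {v : Plane} (hv : ‖v‖ = 1) (h1 : (ψ v).2 = 0)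
    (h2 : (ψ (-v)).2 = 0) : (ψ v).1 * (ψ (-v)).1 < 0 := by
  have hv0 : v ≠ 0 := fun h => by simp [h] at hv
  have e1 : (ψ v).1 ≠ 0 := fun h3 => h.ne_zero hv0 (Prod.ext h3 h1)
  have e2 : (ψ (-v)).1 ≠ 0 := fun h3 => h.ne_zero (neg_ne_zero.2 hv0) (Prod.ext h3 h2)
  have hne : v ≠ -v := fun h => hv0 (self_eq_neg.1 h)
  rcases lt_or_gt_of_ne e1 with h3 | h3 <;> rcases lt_or_gt_of_ne e2 with h4 | h4
  · exact (h.not_same hv (by rwa [norm_neg]) hne (e := (-1, 0)) (neg_pos.2 h3) (neg_pos.2 h4)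
      (Prod.ext (by simp) (by simp [h1])) (Prod.ext (by simp) (by simp [h2]))).elim
  · exact mul_neg_of_neg_of_pos h3 h4
  · exact mul_neg_of_pos_of_neg h3 h4
  · exact (h.not_same hv (by rwa [norm_neg]) hne (e := (1, 0)) h3 h4
      (Prod.ext (by simp) (by simp [h1])) (Prod.ext (by simp) (by simp [h2]))).elim

/-- Composition with symmetries of the square turns conical coordinates into coordinates that preserve
the quadrants. A symmetry that exchanges the two smoothings only changes their order. -/
theorem cornerMove : CornerMove := by
  intro ψ hpl hcon hsub hcr
  have hψ : IsConic ψ := ⟨hpl, hcon, hsub, hcr⟩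
  clear hpl hcon hsub hcr
  set P : (Plane ≃ₜ Plane) → Prop := fun ψ => ∃ b : Bool, ∀ Γ : Set Plane, Γ ∩ box = cross →
    ∀ s : Bool, PlanarMove box (smooth ψ s Γ) (smooth (Homeomorph.refl _) (xor b s) Γ)
  change P ψ
  have hsym : ∀ {σ b} {ψ : Plane ≃ₜ Plane}, IsSym σ b → P (σ.trans ψ) → P ψ := by
    rintro σ b ψ hσ ⟨b', hb'⟩
    refine ⟨xor b' b, fun Γ hΓ s => ?_⟩
    have := hb' Γ hΓ (xor b s)
    rw [hσ.smooth] at this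
    simpa using this
  have m1 : ((1, 0) : Plane) ∈ box := mem_box_of (by simp) (by simp)
  have m2 : ((0, 1) : Plane) ∈ box := mem_box_of (by simp) (by simp)
  have m3 : ((-1, 0) : Plane) ∈ box := mem_box_of (by simp) (by simp)
  have m4 : ((0, -1) : Plane) ∈ box := mem_box_of (by simp) (by simp)
  have a1 : |(1 : ℝ)| = 1 := abs_one
  have a2 : |(-1 : ℝ)| = 1 := by simp
  have hopp : ∀ ψ : Plane ≃ₜ Plane, IsConic ψ → (ψ (1, 0)).2 = 0 → (ψ (-1, 0)).2 = 0 →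
      (ψ (1, 0)).1 * (ψ (-1, 0)).1 < 0 := fun ψ h h1 h2 => by
    simpa using h.opposite (v := (1, 0)) (by simp [Prod.norm_def]) h1 (by simpa using h2)
  have hopp' : ∀ ψ : Plane ≃ₜ Plane, IsConic ψ → (ψ (0, 1)).1 = 0 → (ψ (0, -1)).1 = 0 →
      (ψ (0, 1)).2 * (ψ (0, -1)).2 < 0 := fun ψ h h1 h2 =>
    hopp _ (isSym_swap.isConic (h.trans_isSym isSym_swap)) h1 h2
  have s3 : ∀ ψ : Plane ≃ₜ Plane, IsConic ψ → (ψ (1, 0)).2 = 0 → 0 < (ψ (1, 0)).1 →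
      0 < (ψ (0, 1)).2 → P ψ := by
    intro ψ h h1 h2 h3
    have h4 : (ψ (0, 1)).1 = 0 := by
      rcases (h.axis_iff m2).2 (Or.inl rfl) with h | h
      · exact h
      · exact absurd h h3.ne'
    have h5 : (ψ (-1, 0)).2 = 0 := by
      rcases (h.axis_iff m3).2 (Or.inr rfl) with h' | h'
      · exact absurd h4 ((h.axis_ne a2 a1).2 h')
      · exact h'
    have h6 : (ψ (0, -1)).1 = 0 := by
      rcases (h.axis_iff m4).2 (Or.inl rfl) with h' | h'
      · exact h'
      · exact absurd h' ((h.axis_ne a1 a2).1 h1)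
    have h7 : (ψ (-1, 0)).1 < 0 := by
      have := hopp ψ h h1 h5
      by_contra! h'
      exact this.not_ge (mul_nonneg h2.le h')
    have h8 : (ψ (0, -1)).2 < 0 := by
      have := hopp' ψ h h4 h6
      by_contra! h'
      exact this.not_ge (mul_nonneg h3.le h')
    have ho := h.isOriented h2 h3 h7 h8
    exact ⟨false, fun Γ hΓ s => by simpa using corner_move h ho hΓ s⟩
  have hdich : ∀ ψ : Plane ≃ₜ Plane, IsConic ψ → (ψ (1, 0)).2 = 0 → (ψ (0, 1)).2 ≠ 0 :=
    fun ψ h h1 h2 => (h.axis_ne a1 a1).1 h1 h2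
  have s2 : ∀ ψ : Plane ≃ₜ Plane, IsConic ψ → (ψ (1, 0)).2 = 0 → 0 < (ψ (1, 0)).1 → P ψ := by
    intro ψ h h1 h2
    rcases lt_or_gt_of_ne (hdich ψ h h1) with h3 | h3
    · have e1 : (reflY.trans ψ) (1, 0) = ψ (1, 0) := by
        change ψ (1, -0) = _; rw [neg_zero]
      have h' := isSym_reflY.isConic h
      have h1' : ((reflY.trans ψ) (1, 0)).2 = 0 := by rw [e1, h1]
      refine hsym isSym_reflY (s3 _ h' h1' (by rwa [e1]) ?_)
      rcases lt_or_gt_of_ne (hdich _ h' h1') with h4 | h4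
      · exfalso
        have e2 : (reflY.trans ψ) (0, 1) = ψ (0, -1) := rfl
        rw [e2] at h4
        have h5 : (ψ (0, 1)).1 = 0 := by
          rcases (h.axis_iff m2).2 (Or.inl rfl) with h | h
          · exact h
          · exact absurd h h3.ne
        have h6 : (ψ (0, -1)).1 = 0 := by
          rcases (h.axis_iff m4).2 (Or.inl rfl) with h | h
          · exact h
          · exact absurd h h4.ne
        exact (hopp' ψ h h5 h6).not_gt (mul_pos_of_neg_of_neg h3 h4)
      · exact h4
    · exact s3 ψ h h1 h2 h3
  have s1 : ∀ ψ : Plane ≃ₜ Plane, IsConic ψ → (ψ (1, 0)).2 = 0 → P ψ := by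
    intro ψ h h1
    have h2 : (ψ (1, 0)).1 ≠ 0 := fun h2 =>
      h.ne_zero (v := (1, 0)) (fun h => by simpa using congrArg Prod.fst h) (Prod.ext h2 h1)
    rcases lt_or_gt_of_ne h2 with h3 | h3
    · have e1 : (reflX.trans ψ) (1, 0) = ψ (-1, 0) := rfl
      have h5 : (ψ (-1, 0)).2 = 0 := by
        rcases (h.axis_iff m3).2 (Or.inr rfl) with h' | h'
        · rcases (h.axis_iff m2).2 (Or.inl rfl) with h'' | h''
          · exact absurd h'' ((h.axis_ne a2 a1).2 h')
          · exact absurd h'' (hdich ψ h h1)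
        · exact h'
      refine hsym isSym_reflX (s2 _ (isSym_reflX.isConic h) (by rw [e1, h5]) ?_)
      rw [e1]
      by_contra! h'
      exact (hopp ψ h h1 h5).not_ge (mul_nonneg_of_nonpos_of_nonpos h3.le h')
    · exact s2 ψ h h1 h3
  rcases (hψ.axis_iff m1).2 (Or.inr rfl) with h | h
  · have e1 : (swap.trans ψ) (1, 0) = ψ (0, 1) := rfl
    refine hsym isSym_swap (s1 _ (isSym_swap.isConic hψ) ?_)
    rw [e1]
    rcases (hψ.axis_iff m2).2 (Or.inl rfl) with h' | h'
    · exact absurd h' ((hψ.axis_ne a1 a1).2 h)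
    · exact h'
  · exact s1 ψ hψ h

end Corner

/-! ### State sums of curves -/

section StateSum

variable {φ ψ : Plane ≃ₜ Plane} {N N' : Set Space} {Γ Γ' : Set Plane} {X : Set Plane} {m : ℕ∞}
  {W : Set Space → Set Plane → ZMod 2} {v v' : ZMod 2}

/-- The state sum of `W` over all smoothings of the curve `Γ` at its double points `X`, in the presence
of the link `N`, has the value `v`. -/
def StateSum (W : Set Space → Set Plane → ZMod 2) (N : Set Space) (Γ X : Set Plane) (v : ZMod 2) :
    Prop :=
  ∃ l : List (Plane ≃ₜ Plane), l.Pairwise Apart ∧ (∀ φ ∈ l, IsChart φ N Γ) ∧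
    (∀ x, (∃ φ ∈ l, φ 0 = x) ↔ x ∈ X) ∧ bracket (W N) l Γ = v

theorem StateSum.finite (h : StateSum W N Γ X v) : X.Finite := by
  obtain ⟨l, -, -, h3, -⟩ := h
  refine ((List.finite_toSet l).image fun φ => φ 0).subset fun x hx => ?_
  obtain ⟨φ, h4, h5⟩ := (h3 x).2 hx
  exact ⟨φ, h4, h5⟩

/-- The state sum does not depend on the charts. -/
theorem StateSum.unique (h : StateSum W N Γ X v) (h' : StateSum W N Γ X v') (hW : Valuation m W)
    (hm : overlayCr N Γ ≤ m) : v = v' := by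
  obtain ⟨l, h1, h2, h3, rfl⟩ := h
  obtain ⟨l', h1', h2', h3', rfl⟩ := h'
  exact bracket_indep cornerMove hW h2 h2' h1 h1' (fun x => by rw [h3, h3']) hm

theorem stateSum_empty : StateSum W N Γ ∅ (W N Γ) :=
  ⟨[], List.Pairwise.nil, by simp, by simp, rfl⟩

theorem StateSum.eq_of_empty (h : StateSum W N Γ ∅ v) (hW : Valuation m W)
    (hm : overlayCr N Γ ≤ m) : v = W N Γ := h.unique stateSum_empty hW hm

/-- Resolution of one double point. -/
theorem StateSum.expand (h : StateSum W N Γ X v) (hW : Valuation m W) (hm : overlayCr N Γ ≤ m)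
    (hφ : IsChart φ N Γ) (h0 : φ 0 ∈ X) (hX : ∀ x ∈ X, x ∈ φ '' box → x = φ 0) :
    ∃ v₁ v₂, v = v₁ + v₂ ∧ StateSum W N (smooth φ true Γ) (X \ {φ 0}) v₁ ∧
      StateSum W N (smooth φ false Γ) (X \ {φ 0}) v₂ := by
  have hfin := h.finite
  obtain ⟨l, h1, h2, h3, h4⟩ := id h
  have hcl : IsClosed (φ '' box) := φ.isClosedMap _ Metric.isClosed_closedBall
  obtain ⟨l', p1, p2, p3⟩ := exists_charts (N := N) (Γ := Γ) (hfin.subset sdiff_subset :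
      (X \ {φ 0}).Finite).toFinset (O := (φ '' box)ᶜ) (fun x hx => by
    rw [Finite.mem_toFinset] at hx
    exact hcl.isOpen_compl.mem_nhds fun hc => hx.2 (hX x hx.1 hc)) (fun x hx => by
    rw [Finite.mem_toFinset] at hx
    obtain ⟨ψ, h5, h6⟩ := (h3 x).2 hx.1
    exact ⟨ψ, h2 ψ h5, h6⟩)
  have hap : ∀ ψ ∈ l', Apart φ ψ := fun ψ hψ =>
    disjoint_right.2 fun x hx => (p2 ψ hψ).2 hx
  have hs : ∀ s, StateSum W N (smooth φ s Γ) (X \ {φ 0}) (bracket (W N) l' (smooth φ s Γ)) :=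
    fun s => ⟨l', p1, fun ψ hψ => (p2 ψ hψ).1.smooth (hap ψ hψ) s, fun x => by
      rw [p3, Finite.mem_toFinset], rfl⟩
  refine ⟨_, _, ?_, hs true, hs false⟩
  refine h.unique (v' := bracket (W N) (φ :: l') Γ) ⟨φ :: l', List.pairwise_cons.2 ⟨hap, p1⟩, ?_, ?_, rfl⟩
    hW hm
  · intro ψ hψ
    rcases List.mem_cons.1 hψ with rfl | hψ
    · exact hφ
    · exact (p2 ψ hψ).1
  · intro x
    have := p3 x
    rw [Finite.mem_toFinset] at this
    simp only [List.mem_cons, exists_eq_or_imp, this, mem_sdiff, mem_singleton_iff]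
    constructor
    · rintro (rfl | h)
      · exact h0
      · exact h.1
    · intro hx
      by_cases hc : x = φ 0
      · exact Or.inl hc.symm
      · exact Or.inr ⟨hx, hc⟩

theorem IsChart.trans (h : IsChart φ N Γ) {F : Plane ≃ₜ Plane} (hF : IsPLHomeo F)
    (hN : ∀ a ∈ N', ∃ b ∈ N, F b.1 = a.1) : IsChart (φ.trans F) N' (F '' Γ) := by
  refine ⟨h.pl.trans hF, ?_, fun a ha hc => ?_⟩
  · rw [← h.cross]
    ext v
    simp [F.injective.mem_set_image]
  · obtain ⟨b, hb, hab⟩ := hN a ha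
    rw [image_trans, ← hab, F.injective.mem_set_image] at hc
    exact h.free b hb hc

/-- Transport of state sums by a homeomorphism of the plane. -/
theorem StateSum.map {W' : Set Space → Set Plane → ZMod 2} (h : StateSum W N Γ X v) {F : Plane ≃ₜ Plane}
    (hF : IsPLHomeo F) (hN : ∀ a ∈ N', ∃ b ∈ N, F b.1 = a.1) (hm : overlayCr N Γ ≤ m)
    (hW : ∀ C, overlayCr N C ≤ m → W N C = W' N' (F '' C)) :
    StateSum W' N' (F '' Γ) (F '' X) v := by
  obtain ⟨l, h1, h2, h3, rfl⟩ := h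
  refine ⟨l.map fun φ => φ.trans F, ?_, ?_, ?_, ?_⟩
  · rw [List.pairwise_map]
    refine h1.imp fun h => ?_
    rw [Apart, image_trans, image_trans]
    exact (disjoint_image_iff F.injective).2 h
  · intro ψ hψ
    obtain ⟨φ, hφ, rfl⟩ := List.mem_map.1 hψ
    exact (h2 φ hφ).trans hF hN
  · intro x
    simp only [List.mem_map, exists_exists_and_eq_and, Homeomorph.trans_apply, mem_image, ← h3]
  · exact (bracket_map F hW (fun φ hφ _ => (h2 φ hφ).free) (fun φ hφ => (h2 φ hφ).pl) hm).symm

/-- Invariance under isotopies of the plane. -/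
theorem StateSum.planar (h : StateSum W N Γ X v) (hW : Valuation m W) (hm : overlayCr N Γ ≤ m)
    (hN : IsCompact N) (F : Isotopy Plane) :
    StateSum W (liftH (F.homeo 1) '' N) (F 1 '' Γ) (F 1 '' X) v :=
  h.map (F.isPLHomeo_homeo 1) (by rintro _ ⟨b, hb, rfl⟩; exact ⟨b, hb, rfl⟩) hm
    fun _ hC => hW.inv (Iso.of_planar F hN hC)

/-- Invariance under isotopies of the curve that do not move the double points. -/
theorem StateSum.move (h : StateSum W N Γ X v) (hW : Valuation m W) (hm : overlayCr N Γ ≤ m)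
    {R : Set Plane} (hR : PlanarMove R Γ Γ') (hN : ∀ a ∈ N, a.1 ∉ R) (hX : ∀ x ∈ X, x ∉ R) :
    StateSum W N Γ' X v := by
  obtain ⟨F, h1, rfl⟩ := hR
  have hfix : F.homeo 1 '' X = X := by
    refine (image_congr fun x hx => h1 1 x (hX x hx)).trans (image_id _)
  have := h.map (F.isPLHomeo_homeo 1) (N' := N) (fun a ha => ⟨a, ha, h1 1 _ (hN a ha)⟩) hm
    (W' := W) fun C hC => hW.inv (Iso.of_curve F (fun t a ha => h1 t _ (hN a ha)) hC)
  rwa [hfix] at this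

theorem overlayCr_move {R : Set Plane} (hR : PlanarMove R Γ Γ') (hN : ∀ a ∈ N, a.1 ∉ R) :
    overlayCr N Γ' = overlayCr N Γ := by
  obtain ⟨F, h1, rfl⟩ := hR
  have := overlayCr_image (Θ := id) (M := N) (φ := F 1) (C := Γ) (fun a ha => (h1 1 _ (hN a ha)).symm)
    (fun _ _ _ _ _ h => h) (F.homeo 1).injective
  rwa [image_id] at this

/-- The double points of the projection. -/
def dbl (U : Set Space) : Set Plane := {x | ∃ a ∈ U, ∃ b ∈ U, a ≠ b ∧ a.1 = x ∧ b.1 = x}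

/-- Replacing the strands `T` by the strands `T'` in the square does not change state sums. The strands
with index in `I` belong to the link, the other ones to the curve; only the double points of the latter
are smoothed, so that this applies to curves whose double points outside the square are smoothed. -/
def LocalInv {n : ℕ} (T T' : Fin n → Set Space) : Prop :=
  ∀ {m : ℕ∞} {W : Set Space → Set Plane → ZMod 2}, Valuation m W → ∀ (I : Set (Fin n))
    {N N' : Set Space} {Γ Γ' : Set Plane} {v v' : ZMod 2}, IsCompact N → IsCompact N' →
    N ∩ cyl = ⋃ i ∈ I, T i → N' ∩ cyl = ⋃ i ∈ I, T' i → N \ cyl = N' \ cyl →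
    Γ ∩ box = ⋃ i ∈ Iᶜ, Prod.fst '' T i → Γ' ∩ box = ⋃ i ∈ Iᶜ, Prod.fst '' T' i →
    Γ \ box = Γ' \ box → overlayCr N Γ ≤ m → overlayCr N' Γ' ≤ m →
    StateSum W N Γ (dbl (⋃ i ∈ Iᶜ, T i)) v → StateSum W N' Γ' (dbl (⋃ i ∈ Iᶜ, T' i)) v' → v = v'

theorem LocalInv.symm {n : ℕ} {T T' : Fin n → Set Space} (h : LocalInv T T') : LocalInv T' T := by
  intro m W hW I N N' Γ Γ' v v' h1 h2 h3 h4 h5 h6 h7 h8 h9 h10 h11 h12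
  exact (h hW I h2 h1 h4 h3 h5.symm h7 h6 h8.symm h10 h9 h12 h11).symm

end StateSum

/-! ### Strands and tents -/

section Strand

variable {N N₀ : Set Space} {A Γ Γ₀ : Set Plane} {h : ℝ} {m : ℕ∞}

/-- The lift of a planar set to a given height. -/
def strand (A : Set Plane) (h : ℝ) : Set Space := {a | a.1 ∈ A ∧ a.2 = h}

theorem strand_eq_image : strand A h = (fun x => (x, h)) '' A := by
  ext a
  constructor
  · rintro ⟨h1, rfl⟩; exact ⟨a.1, h1, rfl⟩
  · rintro ⟨x, hx, rfl⟩; exact ⟨hx, rfl⟩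

theorem strand_union (A B : Set Plane) (h : ℝ) : strand (A ∪ B) h = strand A h ∪ strand B h := by
  simp only [strand_eq_image, image_union]

theorem segment_eq_strand (p q : Plane) (h : ℝ) :
    segment ℝ ((p, h) : Space) (q, h) = strand (segment ℝ p q) h := by
  rw [strand_eq_image, Prod.image_mk_segment_left]

theorem fst_image_strand : Prod.fst '' strand A h = A := by
  rw [strand_eq_image, image_image]; simp

/-- The overlay count for a link with one more strand. -/
theorem overlayCr_union_strand (hne : ∀ a ∈ N₀, a.1 ∈ A → a.2 ≠ h) (Γ : Set Plane) :
    overlayCr (N₀ ∪ strand A h) Γ =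
      overlayCr N₀ Γ + ({a | a ∈ N₀ ∧ a.1 ∈ A}.encard + (A ∩ Γ).encard) := by
  have e1 : crossings (N₀ ∪ strand A h) = crossings N₀ ∪
      (fun a : Space => if a.2 < h then (a, (a.1, h)) else ((a.1, h), a)) '' {a | a ∈ N₀ ∧ a.1 ∈ A} := by
    ext ⟨p, q⟩
    constructor
    · rintro ⟨hp | hp, hq | hq, h3, h4⟩
      · exact Or.inl ⟨hp, hq, h3, h4⟩
      · right
        change p.1 = q.1 at h3
        change p.2 < q.2 at h4
        have : p.2 < h := by rw [← hq.2]; exact h4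
        refine ⟨p, ⟨hp, by rw [h3]; exact hq.1⟩, ?_⟩
        simp only [if_pos this]
        exact Prod.ext rfl (Prod.ext h3 hq.2.symm)
      · right
        change p.1 = q.1 at h3
        change p.2 < q.2 at h4
        have : ¬ q.2 < h := by rw [← hp.2]; exact not_lt.2 h4.le
        refine ⟨q, ⟨hq, by rw [← h3]; exact hp.1⟩, ?_⟩
        simp only [if_neg this]
        exact Prod.ext (Prod.ext h3.symm hp.2.symm) rfl
      · have h4' : p.2 < q.2 := h4
        rw [hp.2, hq.2] at h4'
        exact absurd h4' (lt_irrefl _)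
    · rintro (h1 | ⟨a, ⟨ha, haA⟩, he⟩)
      · exact crossings_mono subset_union_left h1
      · by_cases hlt : a.2 < h
        · simp only [if_pos hlt, Prod.mk.injEq] at he
          obtain ⟨rfl, rfl⟩ := he
          exact ⟨Or.inl ha, Or.inr ⟨haA, rfl⟩, rfl, hlt⟩
        · simp only [if_neg hlt, Prod.mk.injEq] at he
          obtain ⟨rfl, rfl⟩ := he
          exact ⟨Or.inr ⟨haA, rfl⟩, Or.inl ha, rfl, lt_of_le_of_ne (not_lt.1 hlt) (hne a ha haA).symm⟩
  have d1 : Disjoint (crossings N₀)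
      ((fun a : Space => if a.2 < h then (a, (a.1, h)) else ((a.1, h), a)) '' {a | a ∈ N₀ ∧ a.1 ∈ A}) := by
    rw [disjoint_left]
    rintro _ h1 ⟨a, ⟨ha, haA⟩, rfl⟩
    by_cases hlt : a.2 < h
    · simp only [if_pos hlt] at h1
      exact hne _ h1.2.1 haA rfl
    · simp only [if_neg hlt] at h1
      exact hne _ h1.1 haA rfl
  have i1 : InjOn (fun a : Space => if a.2 < h then (a, ((a.1, h) : Space)) else ((a.1, h), a))
      {a | a ∈ N₀ ∧ a.1 ∈ A} := by
    intro a ha b hb hab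
    by_cases h1 : a.2 < h <;> by_cases h2 : b.2 < h <;> simp only [h1, h2, if_true, if_false,
      Prod.mk.injEq] at hab
    · exact hab.1
    · exact absurd (congrArg Prod.snd hab.1) (hne a ha.1 ha.2)
    · exact absurd (congrArg Prod.snd hab.2) (hne a ha.1 ha.2)
    · exact hab.2
  have e2 : {a | a ∈ N₀ ∪ strand A h ∧ a.1 ∈ Γ} = {a | a ∈ N₀ ∧ a.1 ∈ Γ} ∪
      (fun x => ((x, h) : Space)) '' (A ∩ Γ) := by
    ext a
    constructor
    · rintro ⟨h1 | h1, h2⟩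
      · exact Or.inl ⟨h1, h2⟩
      · exact Or.inr ⟨a.1, ⟨h1.1, h2⟩, Prod.ext rfl h1.2.symm⟩
    · rintro (⟨h1, h2⟩ | ⟨x, hx, rfl⟩)
      · exact ⟨Or.inl h1, h2⟩
      · exact ⟨Or.inr ⟨hx.1, rfl⟩, hx.2⟩
  have d2 : Disjoint {a | a ∈ N₀ ∧ a.1 ∈ Γ} ((fun x => ((x, h) : Space)) '' (A ∩ Γ)) := by
    rw [disjoint_left]
    rintro _ h1 ⟨x, hx, rfl⟩
    exact hne _ h1.1 hx.1 rfl
  have i2 : Function.Injective fun x : Plane => ((x, h) : Space) := fun a b hab => congrArg Prod.fst hab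
  rw [overlayCr, overlayCr, e1, e2, encard_union_eq d1, encard_union_eq d2, i1.encard_image,
    i2.encard_image]
  ring

/-- The overlay count for a curve with one more arc. -/
theorem overlayCr_union_curve (hd : ∀ a ∈ N, a.1 ∈ A → a.1 ∉ Γ₀) :
    overlayCr N (Γ₀ ∪ A) = overlayCr N Γ₀ + {a | a ∈ N ∧ a.1 ∈ A}.encard := by
  have e : {a | a ∈ N ∧ a.1 ∈ Γ₀ ∪ A} = {a | a ∈ N ∧ a.1 ∈ Γ₀} ∪ {a | a ∈ N ∧ a.1 ∈ A} := by
    ext a; simp only [mem_union, mem_ofPred_eq]; tauto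
  rw [overlayCr, overlayCr, e, encard_union_eq, add_assoc]
  rw [disjoint_left]
  rintro a h1 h2
  exact hd a h1.1 h2.2 h1.2

/-- The graph of `x ↦ c max(0, t - |x|)`. -/
def tent (c t : ℝ) : Set Plane := {v | |v.1| ≤ 1 ∧ v.2 = c * max 0 (t - |v.1|)}

/-- A neighbourhood of the tents, thinning out at the ends. -/
def kite (c ε : ℝ) : Set Plane := between (fun x => -ε * (1 - |x|)) (fun x => (c + ε) * (1 - |x|))

/-- An isotopy supported in the kite raises the tents from height `0`. -/
theorem exists_tent {c ε : ℝ} (hc : 0 < c) (hε : 0 < ε) : ∃ F : Isotopy Plane,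
    (∀ t, ∀ v ∉ kite c ε, F t v = v) ∧ ∀ t ∈ Icc (0 : ℝ) 1, F t '' tent c 0 = tent c t := by
  obtain ⟨F, h1, h2, h3⟩ := exists_push (B := ℝ) (k := c / ε + 1) (by positivity)
    (d := fun q => c * (clampT q.1 - |q.2|)) (l := fun x => -ε * (1 - |x|))
    (u := fun x => (c + ε) * (1 - |x|)) (by fun_prop) (by fun_prop) (by fun_prop) (fun b => by
      simp only [clampT, min_eq_right zero_le_one, max_self, zero_sub]
      nlinarith [abs_nonneg b]) (by
      refine ⟨Icc (-1) 1 ×ˢ Icc (-ε) (c + ε), isCompact_Icc.prod isCompact_Icc, ?_⟩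
      intro t b y _ h1 h2
      have hb : |b| < 1 := by nlinarith
      have := abs_le.1 hb.le
      have h0 := abs_nonneg b
      refine ⟨this, ?_, ?_⟩ <;> nlinarith)
  refine ⟨F, fun t v hv => ?_, fun t ht => ?_⟩
  · have : ¬(-ε * (1 - |v.1|) < v.2 ∧ v.2 < (c + ε) * (1 - |v.1|)) := hv
    refine h3 t v.1 v.2 (Or.inr ?_)
    by_contra! hcon
    exact this hcon
  · have hF : ∀ x, |x| ≤ 1 → F t (x, 0) = (x, c * max 0 (t - |x|)) := by
      intro x hx
      have e1 : c * (t - |x|) ≤ c * (1 - |x|) := by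
        have := ht.2; gcongr
      have e2 : 0 ≤ c * (1 - |x|) := mul_nonneg hc.le (by linarith)
      have e3 : 0 ≤ ε * (1 - |x|) := mul_nonneg hε.le (by linarith)
      have e4 : (c / ε + 1) * (ε * (1 - |x|)) = c * (1 - |x|) + ε * (1 - |x|) := by
        field_simp
      rw [h2]
      · simp only [clampT_of_mem ht, zero_add]
        rw [mul_max_of_nonneg _ _ hc.le, mul_zero]
      · simp only [clampT_of_mem ht, sub_neg_eq_add, zero_add, neg_mul]
        rw [e4]; linarith
      · simp only [clampT_of_mem ht, sub_zero]
        have : (c / ε + 1) * (ε * (1 - |x|)) ≤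
            (c / ε + 1) * ((c + ε) * (1 - |x|) - c * (t - |x|)) := by
          refine mul_le_mul_of_nonneg_left ?_ (by positivity)
          linarith
        linarith
    ext ⟨x, y⟩
    constructor
    · rintro ⟨⟨x', y'⟩, ⟨hx, hy⟩, he⟩
      simp only at hx hy
      have : y' = 0 := by
        rw [hy, max_eq_left (by linarith [abs_nonneg x']), mul_zero]
      rw [this, hF x' hx] at he
      rw [← he]
      exact ⟨hx, rfl⟩
    · rintro ⟨hx, hy⟩
      simp only at hx hy
      refine ⟨(x, 0), ⟨hx, ?_⟩, ?_⟩
      · simp only; rw [max_eq_left (by linarith [abs_nonneg x]), mul_zero]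
      · rw [hF x hx, hy]

variable {e : Plane ≃ₜ Plane} {c ε : ℝ}

/-- Raising a tent of a strand that lies above all other strands. -/
theorem Iso.tent_strand (he : IsPLHomeo e) (hc : 0 < c) (hε : 0 < ε)
    (hN : ∀ a ∈ N₀, a.1 ∈ e '' kite c ε → a.2 ≤ h - 1)
    (hm : ∀ t ∈ Icc (0 : ℝ) 1, overlayCr (N₀ ∪ strand (e '' tent c t) h) Γ ≤ m) :
    Iso m (N₀ ∪ strand (e '' tent c 0) h) Γ (N₀ ∪ strand (e '' tent c 1) h) Γ := by
  obtain ⟨F, h1, h2⟩ := exists_tent hc hε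
  set f := F.conj e he with hf
  have f1 : ∀ t, ∀ v ∉ e '' kite c ε, f t v = v := by
    intro t v hv
    rw [hf, Isotopy.conj_apply, h1 t _ fun hk => hv ⟨_, hk, e.apply_symm_apply v⟩, e.apply_symm_apply]
  have f2 : ∀ t ∈ Icc (0 : ℝ) 1, f t '' (e '' tent c 0) = e '' tent c t := by
    intro t ht
    rw [← h2 t ht]
    simp only [hf, image_image, Isotopy.conj_apply, e.symm_apply_apply]
  set τ : ℝ × ℝ → ℝ := fun q => max 0 (min q.1 (1 - |q.2 - h|)) with hτ
  set Φ := f.lift τ (by fun_prop) (fun z => by simp [hτ]) ⟨|h| + 1, fun t z hz => by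
    have : |z| ≤ |z - h| + |h| := by
      calc |z| = |(z - h) + h| := by ring_nf
        _ ≤ _ := abs_add_le _ _
    exact max_eq_left ((min_le_right _ _).trans (by linarith))⟩ with hΦ
  have hap : ∀ t a, Φ t a = (f (τ (t, a.2)) a.1, a.2) := fun _ _ => rfl
  have himg : ∀ t ∈ Icc (0 : ℝ) 1, Φ t '' (N₀ ∪ strand (e '' tent c 0) h) =
      N₀ ∪ strand (e '' tent c t) h := by
    intro t ht
    have p1 : Φ t '' N₀ = N₀ := by
      refine (image_congr fun a ha => ?_).trans (image_id _)
      rw [hap]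
      by_cases hk : a.1 ∈ e '' kite c ε
      · have := hN a ha hk
        have h0 : τ (t, a.2) = 0 := by
          refine max_eq_left ((min_le_right _ _).trans ?_)
          have := neg_le_abs (a.2 - h)
          simp only
          linarith
        rw [h0, f.start]; rfl
      · rw [f1 _ _ hk]; rfl
    have p2 : Φ t '' strand (e '' tent c 0) h = strand (e '' tent c t) h := by
      rw [← f2 t ht, strand_eq_image, strand_eq_image]
      simp only [image_image]
      refine image_congr fun x _ => ?_
      rw [hap]
      have : τ (t, h) = t := by
        simp [hτ, ht.1, ht.2]
      simp only [this]
    rw [image_union, p1, p2]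
  refine ⟨Φ, Isotopy.refl _, himg 1 ⟨zero_le_one, le_rfl⟩, Isotopy.refl_image _ _, fun t ht => ?_⟩
  rw [himg t ht, Isotopy.refl_image]
  exact hm t ht

/-- Raising a tent of the curve. -/
theorem Iso.tent_curve (he : IsPLHomeo e) (hc : 0 < c) (hε : 0 < ε)
    (hΓ : ∀ v ∈ Γ₀, v ∉ e '' kite c ε)
    (hm : ∀ t ∈ Icc (0 : ℝ) 1, overlayCr N (Γ₀ ∪ e '' tent c t) ≤ m) :
    Iso m N (Γ₀ ∪ e '' tent c 0) N (Γ₀ ∪ e '' tent c 1) := by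
  obtain ⟨F, h1, h2⟩ := exists_tent hc hε
  have himg : ∀ t ∈ Icc (0 : ℝ) 1, F.conj e he t '' (Γ₀ ∪ e '' tent c 0) = Γ₀ ∪ e '' tent c t := by
    intro t ht
    have p1 : F.conj e he t '' Γ₀ = Γ₀ := by
      refine (image_congr fun v hv => ?_).trans (image_id _)
      rw [Isotopy.conj_apply, h1 t _ fun hk => hΓ v hv ⟨_, hk, e.apply_symm_apply v⟩,
        e.apply_symm_apply]; rfl
    rw [image_union, p1, ← h2 t ht]
    simp only [image_image, Isotopy.conj_apply, e.symm_apply_apply]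
  refine ⟨Isotopy.refl _, F.conj e he, Isotopy.refl_image _ _, himg 1 ⟨zero_le_one, le_rfl⟩,
    fun t ht => ?_⟩
  rw [himg t ht, Isotopy.refl_image]
  exact hm t ht

end Strand

/-! ### Smoothings of polygonal lines -/

section Polylines

/-- Removal of a vertex of a polygonal line, in the presence of other arcs `S` in the region `R`. The
width `1 / 100` of the neighbourhood of the triangle suits all applications. -/
theorem poly_move {P Q L : Plane} {R Γ₀ S : Set Plane} (l₁ : List Plane) {l₂ : List Plane}
    (hΓ : ∀ v ∈ R, v ∉ Γ₀)
    (hdet : (Q.1 - P.1) * (L.2 - P.2) - (Q.2 - P.2) * (L.1 - P.1) ≠ 0)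
    (h : ∀ x y α β γ : ℝ, x = α * P.1 + β * Q.1 + γ * L.1 → y = α * P.2 + β * Q.2 + γ * L.2 →
      α + β + γ = 1 → 0 < γ + 1 / 100 * (2 * β + γ) → 0 < γ + 1 / 100 * (2 * α + γ) →
      γ < (1 + 1 / 100) * (2 * β + γ) → γ < (1 + 1 / 100) * (2 * α + γ) → (x, y) ∈ R ∧
        ((x, y) ∉ S ∧ (x, y) ∉ poly (l₁ ++ [P]) ∧ (x, y) ∉ poly (Q :: l₂))) :
    PlanarMove R (Γ₀ ∪ (S ∪ poly (l₁ ++ P :: L :: Q :: l₂))) (Γ₀ ∪ (S ∪ poly (l₁ ++ P :: Q :: l₂))) := by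
  have := triangle_move (ε := 1 / 100) (by norm_num) hdet (R := R) (Γ₀ := Γ₀ ∪ (S ∪ (poly (l₁ ++ [P]) ∪ poly (Q :: l₂))))
    fun x y α β γ hx hy hs h1 h2 h3 h4 => by
      obtain ⟨p1, p2, p3, p4⟩ := h x y α β γ hx hy hs h1 h2 h3 h4
      refine ⟨p1, ?_⟩
      rintro (h | h | h | h)
      · exact hΓ _ p1 h
      · exact p2 h
      · exact p3 h
      · exact p4 h
  convert this using 1
  · rw [poly_append]
    simp only [poly]
    ext; simp only [mem_union]; tauto
  · rw [poly_append]
    simp only [poly]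
    ext; simp only [mem_union]; tauto

/-- Smoothing of a transverse intersection of two segments. -/
theorem smooth_frame {c a b : Plane} {h : a.1 * b.2 - a.2 * b.1 ≠ 0} {A B C D : ℝ} {Γ₀ : Set Plane} {N : Set Space}
    {pA pB pC pD q₁ q₂ q₃ q₄ : Plane} (hΓ : ∀ v ∈ box, frame c a b h v ∉ Γ₀)
    (hN : ∀ a' ∈ N, a'.1 ∉ frame c a b h '' box)
    (hA : 1 ≤ A := by norm_num) (hB : 1 ≤ B := by norm_num) (hC : 1 ≤ C := by norm_num)
    (hD : 1 ≤ D := by norm_num)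
    (eA : frame c a b h (-A, 0) = pA := by rw [frame_apply]; norm_num)
    (eB : frame c a b h (B, 0) = pB := by rw [frame_apply]; norm_num)
    (eC : frame c a b h (0, -C) = pC := by rw [frame_apply]; norm_num)
    (eD : frame c a b h (0, D) = pD := by rw [frame_apply]; norm_num)
    (e₁ : frame c a b h (-1, 0) = q₁ := by rw [frame_apply]; norm_num)
    (e₂ : frame c a b h (1, 0) = q₂ := by rw [frame_apply]; norm_num)
    (e₃ : frame c a b h (0, -1) = q₃ := by rw [frame_apply]; norm_num)
    (e₄ : frame c a b h (0, 1) = q₄ := by rw [frame_apply]; norm_num) :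
    IsChart (frame c a b h) N (Γ₀ ∪ (segment ℝ pA pB ∪ segment ℝ pC pD)) ∧
    smooth (frame c a b h) true (Γ₀ ∪ (segment ℝ pA pB ∪ segment ℝ pC pD)) =
      Γ₀ ∪ (poly [pA, q₁, q₃, pC] ∪ poly [pB, q₂, q₄, pD]) ∧
    smooth (frame c a b h) false (Γ₀ ∪ (segment ℝ pA pB ∪ segment ℝ pC pD)) =
      Γ₀ ∪ (poly [pA, q₁, q₄, pD] ∪ poly [pB, q₂, q₃, pC]) := by
  set φ := frame c a b h with hφ
  have hseg : ∀ {p q v}, φ v ∈ segment ℝ (φ p) (φ q) ↔ v ∈ segment ℝ p q := frame_mem_segment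
  have hl : ∀ {X Y : ℝ}, X ≤ Y → ∀ x y : ℝ, ((x, y) : Plane) ∈ segment ℝ (X, 0) (Y, 0) ↔
      y = 0 ∧ X ≤ x ∧ x ≤ Y := fun h x y => by
    rw [← Prod.image_mk_segment_left, segment_eq_Icc h]
    simp [and_comm, eq_comm]
  have hr : ∀ {X Y : ℝ}, X ≤ Y → ∀ x y : ℝ, ((x, y) : Plane) ∈ segment ℝ (0, X) (0, Y) ↔
      x = 0 ∧ X ≤ y ∧ y ≤ Y := fun h x y => by
    rw [← Prod.image_mk_segment_right, segment_eq_Icc h]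
    simp [and_comm, eq_comm]
  have hax := hl (show -A ≤ B by linarith)
  have hay := hr (show -C ≤ D by linarith)
  have hbox : ∀ v, φ v ∈ φ '' box ↔ v ∈ box := fun v => φ.injective.mem_set_image
  have hcor : ∀ s v, φ v ∈ φ '' corner s ↔ v ∈ corner s := fun s v => φ.injective.mem_set_image
  -- the arms outside the square and the corner cuts, in coordinates
  have s1 : ∀ x y : ℝ, ((x, y) : Plane) ∈ segment ℝ (-A, 0) (-1, 0) ↔ y = 0 ∧ 1 ≤ -x ∧ -x ≤ A := fun x y => by
    rw [hl (by linarith), le_neg, neg_le, and_comm (a := 1 ≤ -x)]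
  have s2 := fun x y => (segment_symm ℝ ((B, 0) : Plane) (1, 0)) ▸ hl hB x y
  have s3 : ∀ x y : ℝ, ((x, y) : Plane) ∈ segment ℝ (0, -1) (0, -C) ↔ x = 0 ∧ 1 ≤ -y ∧ -y ≤ C := fun x y => by
    rw [segment_symm, hr (by linarith), le_neg, neg_le, and_comm (a := 1 ≤ -y)]
  have s4 := hr hD
  have dg : ∀ σ τ : ℝ, σ * σ = 1 → τ * τ = 1 → ∀ x y : ℝ,
      ((x, y) : Plane) ∈ segment ℝ (σ, 0) (0, τ) ↔ 0 ≤ σ * x ∧ 0 ≤ τ * y ∧ σ * x + τ * y = 1 := by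
    intro σ τ h1 h2 x y
    rw [mem_segment_plane]
    simp only
    constructor
    · rintro ⟨θ, h0, h3, rfl, rfl⟩
      have e1 : σ * ((1 - θ) * σ + θ * 0) = 1 - θ := by linear_combination (1 - θ) * h1
      have e2 : τ * ((1 - θ) * 0 + θ * τ) = θ := by linear_combination θ * h2
      rw [e1, e2]
      refine ⟨by linarith, h0, by ring⟩
    · rintro ⟨h3, h4, h5⟩
      refine ⟨τ * y, h4, by linarith, ?_, ?_⟩
      · linear_combination (-x) * h1 + σ * h5
      · linear_combination (-y) * h2
  have d1 := dg (-1) (-1) (by norm_num) (by norm_num)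
  have d2 := dg 1 1 (by norm_num) (by norm_num)
  have d3 := dg (-1) 1 (by norm_num) (by norm_num)
  have d4 := dg 1 (-1) (by norm_num) (by norm_num)
  have hpull : ∀ {S T : Set Plane}, (∀ v, φ v ∈ S ↔ φ v ∈ T) → S = T := by
    intro S T hST
    ext v
    obtain ⟨w, rfl⟩ := φ.surjective v
    exact hST w
  subst eA eB eC eD e₁ e₂ e₃ e₄
  refine ⟨⟨isPLHomeo_frame c a b h, ?_, hN⟩, hpull ?_, hpull ?_⟩
  · ext ⟨x, y⟩
    simp only [mem_inter_iff, mem_preimage, mem_union, hseg, hax, hay, cross, mem_ofPred_eq]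
    constructor
    · rintro ⟨h1 | h1 | h1, h2⟩
      · exact absurd h1 (hΓ _ h2)
      · exact ⟨h2, Or.inr h1.1⟩
      · exact ⟨h2, Or.inl h1.1⟩
    · rintro ⟨h1, h2⟩
      have h3 := abs_le.1 (mem_box.1 h1).1
      have h4 := abs_le.1 (mem_box.1 h1).2
      simp only at h3 h4
      refine ⟨?_, h1⟩
      rcases h2 with h2 | h2
      · exact Or.inr (Or.inr ⟨h2, by linarith, by linarith⟩)
      · exact Or.inr (Or.inl ⟨h2, by linarith, by linarith⟩)
  all_goals
    rintro ⟨x, y⟩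
    simp only [smooth, poly, mem_union, mem_sdiff, hbox, hcor, hseg, hax, hay, s1, s2, s3, s4, d1, d2, d3,
      d4, union_empty, mem_box, not_and_or, not_le]
    have hΓ' : φ (x, y) ∈ Γ₀ → ¬ (|x| ≤ 1 ∧ |y| ≤ 1) := fun h1 h2 => hΓ _ (mem_box.2 h2) h1
    rw [not_and_or, not_le, not_le] at hΓ'
    simp only [corner, mem_ofPred_eq, abs_le, lt_abs, abs_eq zero_le_one] at *
    constructor
    · rintro (⟨h1 | h1 | h1, h2⟩ | h1)
      · exact Or.inl h1
      · obtain ⟨rfl, h3, h4⟩ := h1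
        simp only [neg_zero, or_self] at h2
        rcases h2 with (h2 | h2) | h2
        · exact Or.inr (Or.inr (Or.inl ⟨rfl, h2.le, h4⟩))
        · exact Or.inr (Or.inl (Or.inl ⟨rfl, h2.le, by linarith⟩))
        · linarith
      · obtain ⟨rfl, h3, h4⟩ := h1
        simp only [neg_zero, or_self] at h2
        rcases h2 with h2 | h2 | h2
        · linarith
        · first
            | exact Or.inr (Or.inr (Or.inr (Or.inr ⟨rfl, h2.le, h4⟩)))
            | exact Or.inr (Or.inl (Or.inr (Or.inr ⟨rfl, h2.le, h4⟩)))
        · first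
            | exact Or.inr (Or.inl (Or.inr (Or.inr ⟨rfl, h2.le, by linarith⟩)))
            | exact Or.inr (Or.inr (Or.inr (Or.inr ⟨rfl, h2.le, by linarith⟩)))
      · obtain ⟨h1 | h1, h2, h3⟩ := h1
        · exact Or.inr (Or.inr (Or.inr (Or.inl ⟨by linarith, by linarith, by linarith⟩)))
        · exact Or.inr (Or.inl (Or.inr (Or.inl ⟨by linarith, by linarith, by linarith⟩)))
    · rintro (h1 | (h1 | h1 | h1) | h1 | h1 | h1)
      · exact Or.inl ⟨Or.inl h1, hΓ' h1⟩
      · obtain ⟨rfl, h2, h3⟩ := h1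
        rcases h2.eq_or_lt with h4 | h4
        · exact Or.inr ⟨Or.inr (by linarith), by linarith, by linarith⟩
        · exact Or.inl ⟨Or.inr (Or.inl ⟨rfl, by linarith, by linarith⟩), Or.inl (Or.inr h4)⟩
      · exact Or.inr ⟨Or.inr (by linarith), by linarith, by linarith⟩
      · obtain ⟨rfl, h2, h3⟩ := h1
        rcases h2.eq_or_lt with h4 | h4
        · exact Or.inr ⟨Or.inr (by linarith), by linarith, by linarith⟩
        · exact Or.inl ⟨Or.inr (Or.inr ⟨rfl, by linarith, by linarith⟩),
            Or.inr (by first | exact Or.inr h4 | exact Or.inl h4)⟩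
      · obtain ⟨rfl, h2, h3⟩ := h1
        rcases h2.eq_or_lt with h4 | h4
        · exact Or.inr ⟨Or.inl (by linarith), by linarith, by linarith⟩
        · exact Or.inl ⟨Or.inr (Or.inl ⟨rfl, by linarith, by linarith⟩), Or.inl (Or.inl h4)⟩
      · exact Or.inr ⟨Or.inl (by linarith), by linarith, by linarith⟩
      · obtain ⟨rfl, h2, h3⟩ := h1
        rcases h2.eq_or_lt with h4 | h4
        · exact Or.inr ⟨Or.inl (by linarith), by linarith, by linarith⟩
        · exact Or.inl ⟨Or.inr (Or.inr ⟨rfl, by linarith, by linarith⟩),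
            Or.inr (by first | exact Or.inl h4 | exact Or.inr h4)⟩

theorem not_mem_union {A B : Set Plane} {v : Plane} (h : v ∉ A) (h' : v ∉ B) : v ∉ A ∪ B :=
  fun hc => hc.elim h h'

end Polylines

/-! ### Segments, and curves with a closed loop -/

section Loops

/-- The open square `(-1,1)²`. -/
def openBox : Set Plane := {v | (-1 < v.1 ∧ v.1 < 1) ∧ -1 < v.2 ∧ v.2 < 1}

theorem openBox_subset_box : openBox ⊆ box := fun _ h =>
  mem_box.2 ⟨abs_le.2 ⟨h.1.1.le, h.1.2.le⟩, abs_le.2 ⟨h.2.1.le, h.2.2.le⟩⟩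

theorem mem_segment_space {p q a : Space} : a ∈ segment ℝ p q ↔
    ∃ θ : ℝ, 0 ≤ θ ∧ θ ≤ 1 ∧ a.1.1 = (1 - θ) * p.1.1 + θ * q.1.1 ∧
      a.1.2 = (1 - θ) * p.1.2 + θ * q.1.2 ∧ a.2 = (1 - θ) * p.2 + θ * q.2 := by
  constructor
  · rintro ⟨x, y, hx, hy, hxy, rfl⟩
    refine ⟨y, hy, by linarith, ?_, ?_, ?_⟩ <;> simp [← hxy]
  · rintro ⟨θ, h0, h1, h2, h3, h4⟩
    exact ⟨1 - θ, θ, by linarith, h0, by ring, Prod.ext (Prod.ext h2.symm h3.symm) h4.symm⟩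

theorem image_fst_segment (p q : Space) : Prod.fst '' segment ℝ p q = segment ℝ p.1 q.1 :=
  image_segment ℝ (AffineMap.fst : Space →ᵃ[ℝ] Plane) p q

/-- A set that meets two disjoint open sets and is covered by them is disconnected. -/
theorem not_isPreconnected {C O O' : Set Plane} (h1 : IsOpen O) (h2 : IsOpen O') (h3 : C ⊆ O ∪ O')
    (h4 : (C ∩ O).Nonempty) (h5 : (C ∩ O').Nonempty) (h6 : Disjoint O O') : ¬ IsPreconnected C := by
  intro h
  obtain ⟨x, -, hx, hx'⟩ := h O O' h1 h2 h3 h4 h5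
  exact disjoint_left.1 h6 hx hx'

theorem not_mem_poly_cons {x y : ℝ} {p q : Plane} {l : List Plane}
    (h : ∀ θ : ℝ, 0 ≤ θ → θ ≤ 1 → x = (1 - θ) * p.1 + θ * q.1 → y = (1 - θ) * p.2 + θ * q.2 → False)
    (h' : (x, y) ∉ poly (q :: l)) : (x, y) ∉ poly (p :: q :: l) :=
  fun h1 => h1.elim (not_mem_segment h) h'

theorem not_mem_poly_single {v p : Plane} : v ∉ poly [p] := id

theorem iUnion_fin_one {α : Type*} (f : Fin 1 → Set α) : ⋃ i, f i = f 0 := by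
  ext; simp [Fin.exists_fin_one]

theorem dbl_strand {A : Set Plane} {h : ℝ} : dbl (strand A h) = ∅ := by
  rw [eq_empty_iff_forall_notMem]
  rintro x ⟨a, ha, b, hb, hab, h1, h2⟩
  exact hab (Prod.ext (h1.trans h2.symm) (ha.2.trans hb.2.symm))

end Loops

/-! ### The first Reidemeister move -/

section MoveI

variable {N : Set Space} {Γ : Set Plane} {W : Set Space → Set Plane → ZMod 2} {m : ℕ∞} {v : ZMod 2}

theorem kinked_zero : kinked 0 = segment ℝ ((-1, 0), 0) ((1 / 2, 0), 0) ∪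
    segment ℝ ((1 / 2, 0), 0) ((0, 1 / 2), 1) ∪
    segment ℝ ((0, 1 / 2), 1) ((0, -1 / 2), 1) ∪ segment ℝ ((0, -1 / 2), 1) ((1, 0), 0) := rfl

theorem dbl_kinked : dbl (kinked 0) = {0} := by
  ext x
  rw [mem_singleton_iff]
  constructor
  · rintro ⟨a, ha, b, hb, hab, rfl, h2⟩
    have key : a.2 = b.2 ∨ (a.1.1 = 0 ∧ a.1.2 = 0) := by
      have h3 : b.1.1 = a.1.1 := congrArg Prod.fst h2
      have h4 : b.1.2 = a.1.2 := congrArg Prod.snd h2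
      simp only [kinked_zero, mem_union, mem_segment_space] at ha hb
      clear h2 hab
      rcases ha with ((ha | ha) | ha) | ha <;> rcases hb with ((hb | hb) | hb) | hb <;>
      obtain ⟨s, a0, a1, a2, a3, a4⟩ := ha <;> obtain ⟨t, b0, b1, b2, b3, b4⟩ := hb <;>
      first
        | (left; linarith)
        | (right; constructor <;> linarith)
    rcases key with h | h
    · exact absurd (Prod.ext h2.symm h) hab
    · exact Prod.ext h.1 h.2
  · rintro rfl
    refine ⟨((0, 0), 0), ?_, ((0, 0), 1), ?_, by simp, rfl, rfl⟩
    · rw [kinked_zero]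
      refine Or.inl (Or.inl (Or.inl (mem_segment_space.2 ⟨2 / 3, ?_⟩))); norm_num
    · rw [kinked_zero]
      refine Or.inl (Or.inr (mem_segment_space.2 ⟨1 / 2, ?_⟩)); norm_num

theorem fst_kinked : Prod.fst '' kinked 0 = segment ℝ (-1, 0) (1 / 2, 0) ∪ segment ℝ (1 / 2, 0) (0, 1 / 2) ∪
    segment ℝ (0, 1 / 2) (0, -1 / 2) ∪ segment ℝ (0, -1 / 2) (1, 0) := by
  simp only [kinked_zero, image_union, image_fst_segment]

/-- One smoothing of a kink splits off a loop. -/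
theorem kink_loop {Γ₀ : Set Plane} (hΓ : ∀ v ∈ box, v ∉ Γ₀) : ¬ IsPreconnected
    (Γ₀ ∪ (segment ℝ (1 / 2, 0) (0, 1 / 2) ∪ segment ℝ (0, -1 / 2) (1, 0)) ∪
      (poly [(-1, 0), (-1 / 8, 0), (0, -1 / 8), (0, -1 / 2)] ∪
        poly [(1 / 2, 0), (1 / 8, 0), (0, 1 / 8), (0, 1 / 2)])) := by
  refine not_isPreconnected
    (O := {v | (-1 / 32 < v.1 ∧ -1 / 32 < v.2) ∧ 1 / 16 < v.1 + v.2 ∧ v.1 + v.2 < 3 / 4})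
    (O' := {v | (-1 / 32 ≤ v.1 ∧ -1 / 32 ≤ v.2) ∧ 1 / 16 ≤ v.1 + v.2 ∧ v.1 + v.2 ≤ 3 / 4}ᶜ) ?_ ?_ ?_
    ⟨(1 / 8, 0), ?_⟩ ⟨(-1, 0), ?_⟩ ?_
  · refine ((isOpen_lt continuous_const continuous_fst).inter
      (isOpen_lt continuous_const continuous_snd)).inter (IsOpen.inter ?_ ?_)
    · exact isOpen_lt continuous_const (continuous_fst.add continuous_snd)
    · exact isOpen_lt (continuous_fst.add continuous_snd) continuous_const
  · refine (IsClosed.inter (IsClosed.inter ?_ ?_) (IsClosed.inter ?_ ?_)).isOpen_compl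
    · exact isClosed_le continuous_const continuous_fst
    · exact isClosed_le continuous_const continuous_snd
    · exact isClosed_le continuous_const (continuous_fst.add continuous_snd)
    · exact isClosed_le (continuous_fst.add continuous_snd) continuous_const
  · rintro ⟨x, y⟩ hv
    simp only [mem_union, poly, mem_segment_plane, mem_empty_iff_false, or_false] at hv
    rcases hv with (hv | hv | ⟨θ, t0, t1, t2, t3⟩) |
      (⟨θ, t0, t1, t2, t3⟩ | ⟨θ, t0, t1, t2, t3⟩ | ⟨θ, t0, t1, t2, t3⟩) |
      (⟨θ, t0, t1, t2, t3⟩ | ⟨θ, t0, t1, t2, t3⟩ | ⟨θ, t0, t1, t2, t3⟩)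
    · refine Or.inr fun h => hΓ _ ?_ hv
      obtain ⟨⟨g1, g2⟩, g3, g4⟩ := h
      exact mem_box.2 ⟨abs_le.2 ⟨by linarith, by linarith⟩, abs_le.2 ⟨by linarith, by linarith⟩⟩
    · obtain ⟨θ, t0, t1, t2, t3⟩ := hv
      refine Or.inl ⟨⟨?_, ?_⟩, ?_, ?_⟩ <;> simp only at * <;> linarith
    iterate 4
      refine Or.inr ?_
      rintro ⟨⟨g1, g2⟩, g3, g4⟩
      simp only at *; linarith
    all_goals refine Or.inl ⟨⟨?_, ?_⟩, ?_, ?_⟩ <;> simp only at * <;> linarith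
  · refine ⟨Or.inr (Or.inr (Or.inr (Or.inl (left_mem_segment ℝ _ _)))), ⟨?_, ?_⟩, ?_, ?_⟩ <;> norm_num
  · refine ⟨Or.inr (Or.inl (Or.inl (left_mem_segment ℝ _ _))), ?_⟩
    rintro ⟨⟨h, -⟩, -⟩
    norm_num at h
  · exact disjoint_left.2 fun v h h' => h' ⟨⟨h.1.1.le, h.1.2.le⟩, h.2.1.le, h.2.2.le⟩

/-- The other smoothing of a kink is isotopic to a straight line. -/
theorem kink_path {Γ₀ : Set Plane} (hΓ : ∀ v ∈ box, v ∉ Γ₀) : PlanarMove openBox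
    (Γ₀ ∪ (∅ ∪ poly ([(-1, 0), (-1 / 8, 0), (0, 1 / 8), (0, 1 / 2)] ++
      (1 / 2, 0) :: (1 / 8, 0) :: (0, -1 / 8) :: [(0, -1 / 2), (1, 0)])))
    (Γ₀ ∪ (∅ ∪ poly [(-1, 0), (-1 / 8, 0), (1, 0)])) := by
  have hΓ' : ∀ v ∈ openBox, v ∉ Γ₀ := fun v hv => hΓ v (openBox_subset_box hv)
  refine .trans (poly_move [(-1, 0), (-1 / 8, 0), (0, 1 / 8), (0, 1 / 2)] hΓ' ?_ ?_) <|
    .trans (poly_move [(-1, 0)] hΓ' ?_ ?_) <|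
    .trans (poly_move [(-1, 0), (-1 / 8, 0)] hΓ' ?_ ?_) <|
    .trans (poly_move [(-1, 0)] hΓ' ?_ ?_) <|
    .trans (poly_move [(-1, 0), (-1 / 8, 0)] hΓ' ?_ ?_) <|
    (poly_move [(-1, 0)] hΓ' ?_ ?_)
  all_goals first
    | (intro x y α β γ hx hy hs h1 h2 h3 h4
       refine ⟨⟨⟨by linarith, by linarith⟩, by linarith, by linarith⟩, ?_, ?_, ?_⟩ <;> repeat' first
         | exact id
         | exact not_mem_poly_single
         | refine not_mem_poly_cons (fun θ t0 t1 t2 t3 => by linarith) ?_)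
    | norm_num

/-- Resolving the double point of a kink of the curve: one smoothing splits off a loop, the other one is
isotopic to a straight line. -/
theorem kink_curve {Γ₀ : Set Plane} (hΓ : ∀ v ∈ box, v ∉ Γ₀) (hW : Valuation m W)
    (hN : ∀ a ∈ N, a.1 ∉ box) (hm : overlayCr N (Γ₀ ∪ Prod.fst '' kinked 0) ≤ m)
    (h : StateSum W N (Γ₀ ∪ Prod.fst '' kinked 0) {0} v) :
    v = W N (Γ₀ ∪ segment ℝ (-1, 0) (1, 0)) := by
  have hne : ((1 / 8 : ℝ), (0 : ℝ)).1 * ((0 : ℝ), (1 / 8 : ℝ)).2 -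
    ((1 / 8 : ℝ), (0 : ℝ)).2 * ((0 : ℝ), (1 / 8 : ℝ)).1 ≠ 0 := by norm_num
  have hsub : frame 0 (1 / 8, 0) (0, 1 / 8) hne '' box ⊆ openBox := by
    rintro _ ⟨⟨x, y⟩, hx, rfl⟩
    have h1 := abs_le.1 (mem_box.1 hx).1
    have h2 := abs_le.1 (mem_box.1 hx).2
    simp only [openBox, frame_apply, mem_ofPred_eq, Prod.fst_zero, Prod.snd_zero] at h1 h2 ⊢
    refine ⟨⟨?_, ?_⟩, ?_, ?_⟩ <;> linarith
  have e0 : Γ₀ ∪ Prod.fst '' kinked 0 =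
      (Γ₀ ∪ (segment ℝ (1 / 2, 0) (0, 1 / 2) ∪ segment ℝ (0, -1 / 2) (1, 0))) ∪
        (segment ℝ (-1, 0) (1 / 2, 0) ∪ segment ℝ (0, -1 / 2) (0, 1 / 2)) := by
    rw [fst_kinked, segment_symm ℝ (0, -1 / 2) (0, (1 / 2 : ℝ))]
    ext; simp only [mem_union]; tauto
  obtain ⟨c1, c2, c3⟩ := smooth_frame (c := 0) (a := (1 / 8, 0)) (b := (0, 1 / 8)) (h := hne) (A := 8)
    (B := 4) (C := 4) (D := 4)
    (Γ₀ := Γ₀ ∪ (segment ℝ (1 / 2, 0) (0, 1 / 2) ∪ segment ℝ (0, -1 / 2) (1, 0))) (N := N)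
    (pA := (-1, 0)) (pB := (1 / 2, 0)) (pC := (0, -1 / 2)) (pD := (0, 1 / 2)) (q₁ := (-1 / 8, 0))
    (q₂ := (1 / 8, 0)) (q₃ := (0, -1 / 8)) (q₄ := (0, 1 / 8)) (by
      rintro ⟨x, y⟩ hx (h | h | h)
      · exact hΓ _ (openBox_subset_box (hsub (mem_image_of_mem _ hx))) h
      all_goals
        revert h
        rw [frame_apply]
        have h1 := abs_le.1 (mem_box.1 hx).1
        have h2 := abs_le.1 (mem_box.1 hx).2
        refine not_mem_segment fun θ t0 t1 t2 t3 => ?_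
        norm_num at *; linarith)
    (fun a ha hc => hN a ha (openBox_subset_box (hsub hc)))
  rw [← e0] at c1 c2 c3
  set φ := frame 0 (1 / 8, 0) (0, 1 / 8) hne with hφ
  have hφ0 : φ 0 = 0 := by
    change frame _ _ _ _ (0, 0) = _
    rw [frame_apply]; ext <;> simp
  obtain ⟨v₁, v₂, rfl, h1, h2⟩ := h.expand hW hm c1 (by rw [hφ0]; rfl) (fun x hx _ => by rw [hφ0]; exact hx)
  have hX : ({0} : Set Plane) \ {φ 0} = ∅ := by rw [hφ0, Set.sdiff_self]
  rw [hX] at h1 h2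
  rw [h1.eq_of_empty hW (by rwa [overlayCr_smooth c1.free] ), h2.eq_of_empty hW
    (by rwa [overlayCr_smooth c1.free])]
  have hz : W N (smooth φ true (Γ₀ ∪ Prod.fst '' kinked 0)) = 0 := by
    rw [c2]
    exact hW.disc (kink_loop hΓ)
  rw [hz, zero_add, c3]
  have hm' := overlayCr_smooth c1.free false (Γ₀ ∪ Prod.fst '' kinked 0)
  rw [c3] at hm'
  have e1 : Γ₀ ∪ (segment ℝ (1 / 2, 0) (0, 1 / 2) ∪ segment ℝ (0, -1 / 2) (1, 0)) ∪
      (poly [(-1, 0), (-1 / 8, 0), (0, 1 / 8), (0, 1 / 2)] ∪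
        poly [(1 / 2, 0), (1 / 8, 0), (0, -1 / 8), (0, -1 / 2)]) =
      Γ₀ ∪ (∅ ∪ poly ([(-1, 0), (-1 / 8, 0), (0, 1 / 8), (0, 1 / 2)] ++
        (1 / 2, 0) :: (1 / 8, 0) :: (0, -1 / 8) :: [(0, -1 / 2), (1, 0)])) := by
    simp only [poly, List.cons_append, List.nil_append, union_empty, empty_union]
    rw [segment_symm ℝ ((1 / 2, 0) : Plane) (0, 1 / 2)]
    ext; simp only [mem_union]; tauto
  have e2 : segment ℝ ((-1, 0) : Plane) (1, 0) = ∅ ∪ poly [(-1, 0), (-1 / 8, 0), (1, 0)] := by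
    ext ⟨x, y⟩
    simp only [poly, union_empty, empty_union, mem_union, mem_segment_plane]
    constructor
    · rintro ⟨θ, t0, t1, t2, t3⟩
      rcases le_total x (-1 / 8) with h | h
      · exact Or.inl ⟨(x + 1) * (8 / 7), by linarith, by linarith, by linarith, by linarith⟩
      · exact Or.inr ⟨(x + 1 / 8) * (8 / 9), by linarith, by linarith, by linarith, by linarith⟩
    · rintro (⟨θ, t0, t1, t2, t3⟩ | ⟨θ, t0, t1, t2, t3⟩) <;>
        exact ⟨(x + 1) / 2, by linarith, by linarith, by linarith, by linarith⟩
  rw [e1, e2]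
  rw [e1] at hm'
  exact hW.of_move (kink_path hΓ)
    (fun a ha hc => hN a ha (openBox_subset_box hc)) (hm'.le.trans hm)

/-- Planar isotopies of a strand of constant height, away from everything else. -/
theorem Iso.of_planarMove {R A A' : Set Plane} {N₀ : Set Space} {h : ℝ} (hR : PlanarMove R A A')
    (h₁ : ∀ a ∈ N₀, a.1 ∉ R) (h₂ : ∀ v ∈ Γ, v ∉ R) (hN : IsCompact (N₀ ∪ strand A h))
    (hm : overlayCr (N₀ ∪ strand A h) Γ ≤ m) :
    Iso m (N₀ ∪ strand A h) Γ (N₀ ∪ strand A' h) Γ := by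
  obtain ⟨F, f1, rfl⟩ := hR
  convert Iso.of_planar F hN hm using 1
  · rw [image_union]
    congr 1
    · refine (image_congr fun a ha => ?_).trans (image_id _) |>.symm
      exact Prod.ext (f1 1 _ (h₁ a ha)) rfl
    · rw [strand_eq_image, strand_eq_image, image_image, image_image]
      rfl
  · exact ((image_congr fun v hv => f1 1 v (h₂ v hv)).trans (image_id _)).symm

/-- Overlay counts may be compared inside a disc outside which the overlays agree. -/
theorem overlayCr_le_of_local {S : Set Plane} {M M' : Set Space} {C C' : Set Plane}
    (h₁ : M \ Prod.fst ⁻¹' S = M' \ Prod.fst ⁻¹' S) (h₂ : C \ S = C' \ S)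
    (h : overlayCr (M ∩ Prod.fst ⁻¹' S) (C ∩ S) ≤ overlayCr (M' ∩ Prod.fst ⁻¹' S) (C' ∩ S)) :
    overlayCr M C ≤ overlayCr M' C' := by
  rw [overlayCr_split S, overlayCr_split S M', h₁, h₂]
  gcongr

/-- The coordinates of space, with the first one at the end. -/
noncomputable def rotate : Space ≃ₜ Space :=
  plHomeo (fun a => ((a.1.2, a.2), a.1.1)) (fun a => ((a.2, a.1.1), a.1.2)) (by fun_prop) (by fun_prop)
    (fun _ => rfl) (fun _ => rfl)

theorem isPLHomeo_rotate : IsPLHomeo rotate := isPLHomeo_plHomeo _ _ _ _ _ _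

/-- The isotopy of space that shifts the points at height `z` by `7/8 min(z,t)` to the right. -/
theorem exists_shift : ∃ Φ : Isotopy Space, (∀ t, ∀ a ∉ cyl, Φ t a = a) ∧
    ∀ t ∈ Icc (0 : ℝ) 1, ∀ a ∈ kinked 0, Φ t a = ((a.1.1 + 7 / 8 * min a.2 t, a.1.2), a.2) := by
  obtain ⟨F, f1, f2, f3⟩ := exists_push (B := ℝ × ℝ) (k := 7) (by norm_num)
    (d := fun q => 7 / 8 * min (min q.2.2 (clampT q.1)) (min (2 - 2 * |q.2.1|) (2 - q.2.2)))
    (l := fun _ => -1) (u := fun _ => 1) (by fun_prop) (by fun_prop) (by fun_prop) (fun b => by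
      have : min (min b.2 (clampT 0)) (min (2 - 2 * |b.1|) (2 - b.2)) ≤ 0 :=
        (min_le_left _ _).trans ((min_le_right _ _).trans (by simp [clampT]))
      simp only; linarith) (by
      refine ⟨(Icc (-1) 1 ×ˢ Icc 0 2) ×ˢ Icc (-1) 1, (isCompact_Icc.prod isCompact_Icc).prod isCompact_Icc, ?_⟩
      rintro t ⟨y, z⟩ x h1 h2 h3
      simp only [mul_pos_iff_of_pos_left (by norm_num : (0 : ℝ) < 7 / 8), lt_min_iff] at h1
      obtain ⟨⟨h4, -⟩, h5, h6⟩ := h1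
      have := abs_le.1 (by linarith : |y| ≤ 1)
      exact ⟨⟨this, h4.le, by linarith⟩, h2.le, h3.le⟩)
  refine ⟨F.conj rotate.symm isPLHomeo_rotate.symm, fun t a ha => ?_,
    fun t ht a ha => ?_⟩
  · have e : F t (rotate a) = rotate a := by
      refine f3 t (a.1.2, a.2) a.1.1 ?_
      by_contra! hc
      refine ha ?_
      change a.1 ∈ box
      obtain ⟨h1, h2, h3⟩ := hc
      simp only [mul_pos_iff_of_pos_left (by norm_num : (0 : ℝ) < 7 / 8), lt_min_iff] at h1
      obtain ⟨⟨h4, -⟩, h5, h6⟩ := h1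
      exact mem_box.2 ⟨abs_le.2 ⟨h2.le, h3.le⟩, by linarith⟩
    rw [Isotopy.conj_apply, Homeomorph.symm_symm, e, Homeomorph.symm_apply_apply]
  · have hk : (0 ≤ a.2 ∧ a.2 ≤ 1) ∧ |a.1.2| ≤ 1 / 2 ∧ -1 ≤ a.1.1 ∧ a.1.1 ≤ 1 - a.2 ∧
        (a.2 ≤ 8 / 7 * (a.1.1 + 1)) := by
      simp only [kinked_zero, mem_union, mem_segment_space] at ha
      rcases ha with ((ha | ha) | ha) | ha <;> obtain ⟨s, a0, a1, a2, a3, a4⟩ := ha <;>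
        refine ⟨⟨?_, ?_⟩, abs_le.2 ⟨?_, ?_⟩, ?_, ?_, ?_⟩ <;> linarith
    obtain ⟨⟨k1, k2⟩, k3, k4, k5, k6⟩ := hk
    have e1 : min (min a.2 (clampT t)) (min (2 - 2 * |a.1.2|) (2 - a.2)) = min a.2 t := by
      rw [clampT_of_mem ht, min_eq_left]
      exact (min_le_left _ _).trans (le_min (by linarith) (by linarith))
    have e2 : 0 ≤ min a.2 t := le_min k1 ht.1
    have e3 : min a.2 t ≤ a.2 := min_le_left _ _
    have e : F t (rotate a) = ((a.1.2, a.2), a.1.1 + max 0 (7 / 8 * min a.2 t)) := by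
      have := f2 t (a.1.2, a.2) a.1.1 (by simp only [e1]; linarith) (by simp only [e1]; linarith)
      simp only [e1] at this
      exact this
    rw [Isotopy.conj_apply, Homeomorph.symm_symm, e, max_eq_right (by positivity)]
    rfl

/-- During the shift the loop of the kink has at most one crossing. -/
theorem crossings_shift {t : ℝ} (ht : t ∈ Icc (0 : ℝ) 1) :
    (crossings ((fun a : Space => ((a.1.1 + 7 / 8 * min a.2 t, a.1.2), a.2)) '' kinked 0)).encard ≤
      (crossings (kinked 0)).encard := by
  have h1 : (crossings (kinked 0)).Nonempty := by
    refine ⟨(((0, 0), 0), ((0, 0), 1)), ?_, ?_, rfl, zero_lt_one⟩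
    · rw [kinked_zero]
      refine Or.inl (Or.inl (Or.inl (mem_segment_space.2 ⟨2 / 3, ?_⟩))); norm_num
    · rw [kinked_zero]
      refine Or.inl (Or.inr (mem_segment_space.2 ⟨1 / 2, ?_⟩)); norm_num
  refine (encard_le_one_iff_subsingleton.2 ?_).trans (one_le_encard_iff_nonempty.2 h1)
  -- a crossing lies on the third side, which is vertical
  have key : ∀ p q : Space, (p, q) ∈ crossings
      ((fun a : Space => ((a.1.1 + 7 / 8 * min a.2 t, a.1.2), a.2)) '' kinked 0) →
      (p.1.1 = 7 / 8 * t ∧ p.1.2 = max 0 ((7 * t - 4) / 6) ∧ p.2 = max 0 ((7 * t - 4) / 3)) ∧ q.2 = 1 := by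
    rintro _ _ ⟨⟨a, ha, rfl⟩, ⟨b, hb, rfl⟩, h3, h4⟩
    simp only [Prod.mk.injEq] at h3
    have h5 : a.2 < b.2 := h4
    obtain ⟨h6, h7⟩ := h3
    simp only
    clear h4
    obtain ⟨t0, t1⟩ := ht
    have n1 : min a.2 t ≤ min b.2 t := by gcongr
    have n2 : min b.2 t - min a.2 t ≤ b.2 - a.2 := by
      rcases min_cases a.2 t with ⟨n1, n2⟩ | ⟨n1, n2⟩ <;>
      rcases min_cases b.2 t with ⟨n3, n4⟩ | ⟨n3, n4⟩ <;> linarith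
    have n3 := min_cases a.2 t
    have n4 := min_cases b.2 t
    have n5 := max_cases 0 ((7 * t - 4) / 6)
    have n6 := max_cases 0 ((7 * t - 4) / 3)
    generalize min a.2 t = μ at *
    generalize min b.2 t = ν at *
    generalize max 0 ((7 * t - 4) / 6) = κ at *
    generalize max 0 ((7 * t - 4) / 3) = ξ at *
    simp only [kinked_zero, mem_union, mem_segment_space] at ha hb
    rcases ha with ((ha | ha) | ha) | ha <;> rcases hb with ((hb | hb) | hb) | hb <;>
    obtain ⟨s, a0, a1, a2, a3, a4⟩ := ha <;> obtain ⟨r, b0, b1, b2, b3, b4⟩ := hb <;>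
    try (exfalso; linarith)
    all_goals
      have n4' : ν = t := by rcases n4 with ⟨n4, n4'⟩ | ⟨n4, n4'⟩ <;> linarith
      rcases n3 with ⟨n3, n3'⟩ | ⟨n3, n3'⟩ <;> rcases n5 with ⟨n5, n5'⟩ | ⟨n5, n5'⟩ <;>
      rcases n6 with ⟨n6, n6'⟩ | ⟨n6, n6'⟩ <;>
      first
        | (exfalso; linarith)
        | (refine ⟨⟨?_, ?_, ?_⟩, ?_⟩ <;> linarith)
  rintro ⟨p, q⟩ h ⟨p', q'⟩ h'
  obtain ⟨⟨h1, h2, h3⟩, h4⟩ := key p q h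
  obtain ⟨⟨h1', h2', h3'⟩, h4'⟩ := key p' q' h'
  have e1 : p = p' := Prod.ext (Prod.ext (h1.trans h1'.symm) (h2.trans h2'.symm)) (h3.trans h3'.symm)
  have e2 : p.1 = q.1 := h.2.2.1
  have e3 : p'.1 = q'.1 := h'.2.2.1
  have e4 : q = q' := Prod.ext (by rw [← e2, ← e3, e1]) (h4.trans h4'.symm)
  rw [e1, e4]

theorem image_shift_one : (fun a : Space => (((a.1.1 + 7 / 8 * min a.2 1, a.1.2), a.2) : Space)) '' kinked 0 =
    segment ℝ ((-1, 0), 0) ((1 / 2, 0), 0) ∪ segment ℝ ((1 / 2, 0), 0) ((7 / 8, 1 / 2), 1) ∪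
    segment ℝ ((7 / 8, 1 / 2), 1) ((7 / 8, -1 / 2), 1) ∪ segment ℝ ((7 / 8, -1 / 2), 1) ((1, 0), 0) := by
  have key : ∀ p q : Space, p.2 ≤ 1 → q.2 ≤ 1 →
      (fun a : Space => (((a.1.1 + 7 / 8 * min a.2 1, a.1.2), a.2) : Space)) '' segment ℝ p q =
      segment ℝ ((p.1.1 + 7 / 8 * p.2, p.1.2), p.2) ((q.1.1 + 7 / 8 * q.2, q.1.2), q.2) := by
    intro p q hp hq
    ext b
    rw [mem_segment_space]
    constructor
    · rintro ⟨a, ha, rfl⟩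
      obtain ⟨θ, h0, h1, h2, h3, h4⟩ := mem_segment_space.1 ha
      have h5 : a.2 ≤ 1 := by
        have : (1 - θ) * p.2 ≤ (1 - θ) * 1 := mul_le_mul_of_nonneg_left hp (by linarith)
        have : θ * q.2 ≤ θ * 1 := mul_le_mul_of_nonneg_left hq h0
        linarith
      refine ⟨θ, h0, h1, ?_, h3, h4⟩
      simp only
      rw [min_eq_left h5, h2, h4]; ring
    · rintro ⟨θ, h0, h1, h2, h3, h4⟩
      simp only at h2 h3 h4
      have h5 : b.2 ≤ 1 := by
        have : (1 - θ) * p.2 ≤ (1 - θ) * 1 := mul_le_mul_of_nonneg_left hp (by linarith)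
        have : θ * q.2 ≤ θ * 1 := mul_le_mul_of_nonneg_left hq h0
        linarith
      refine ⟨((b.1.1 - 7 / 8 * b.2, b.1.2), b.2), mem_segment_space.2 ⟨θ, h0, h1, ?_, h3, h4⟩, ?_⟩
      · simp only; rw [h2, h4]; ring
      · simp only
        rw [min_eq_left h5]
        ext <;> simp
  simp only [kinked_zero, image_union]
  rw [key _ _ (by norm_num) (by norm_num), key _ _ (by norm_num) (by norm_num),
    key _ _ (by norm_num) (by norm_num), key _ _ (by norm_num) (by norm_num)]
  norm_num

/-- A lowering of space that flattens the shifted kink. -/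
noncomputable def lower : Space ≃ₜ Space :=
  plHomeo (fun a => (a.1, a.2 - max 0 (min (min ((8 * a.1.1 - 4) / 3) (8 - 8 * a.1.1)) (2 - 2 * |a.1.2|))))
    (fun a => (a.1, a.2 + max 0 (min (min ((8 * a.1.1 - 4) / 3) (8 - 8 * a.1.1)) (2 - 2 * |a.1.2|))))
    (by have : IsPL fun a : Space => (8 * a.1.1 - 4) / 3 := by
          simp only [div_eq_inv_mul]; fun_prop
        fun_prop)
    (by have : IsPL fun a : Space => (8 * a.1.1 - 4) / 3 := by
          simp only [div_eq_inv_mul]; fun_prop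
        fun_prop)
    (fun a => by simp) (fun a => by simp)

theorem covers_lower : Covers lower id :=
  ⟨isPLHomeo_plHomeo _ _ _ _ _ _, fun _ => rfl, fun _ _ _ h => sub_lt_sub_right h _⟩

theorem lower_of_not_mem {a : Space} (ha : a ∉ cyl) : lower a = a := by
  refine Prod.ext rfl ?_
  change a.2 - max 0 _ = a.2
  rw [max_eq_left, sub_zero]
  by_contra! h
  simp only [lt_min_iff] at h
  obtain ⟨⟨h1, h2⟩, h3⟩ := h
  exact ha (mem_box.2 ⟨abs_le.2 ⟨by linarith, by linarith⟩, by linarith⟩)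

theorem image_lower : lower ''
    (segment ℝ ((-1, 0), 0) ((1 / 2, 0), 0) ∪ segment ℝ ((1 / 2, 0), 0) ((7 / 8, 1 / 2), 1) ∪
      segment ℝ ((7 / 8, 1 / 2), 1) ((7 / 8, -1 / 2), 1) ∪ segment ℝ ((7 / 8, -1 / 2), 1) ((1, 0), 0)) =
    strand (poly ([(-1, 0)] ++ (1 / 2, 0) :: (7 / 8, 1 / 2) :: (7 / 8, -1 / 2) :: [(1, 0)])) 0 := by
  have hp : ∀ a ∈ segment ℝ (((-1, 0), 0) : Space) ((1 / 2, 0), 0) ∪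
      segment ℝ ((1 / 2, 0), 0) ((7 / 8, 1 / 2), 1) ∪
      segment ℝ ((7 / 8, 1 / 2), 1) ((7 / 8, -1 / 2), 1) ∪ segment ℝ ((7 / 8, -1 / 2), 1) ((1, 0), 0),
      lower a = (a.1, 0) := by
    intro a ha
    refine Prod.ext rfl ?_
    change a.2 - max 0 _ = 0
    simp only [mem_union, mem_segment_space] at ha
    rcases ha with ((ha | ha) | ha) | ha <;> obtain ⟨s, a0, a1, a2, a3, a4⟩ := ha
    · rw [max_eq_left (((min_le_left _ _).trans (min_le_left _ _)).trans (by linarith))]; linarith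
    all_goals
      have h5 : |a.1.2| ≤ 1 / 2 := abs_le.2 ⟨by linarith, by linarith⟩
      have h6 : min (min ((8 * a.1.1 - 4) / 3) (8 - 8 * a.1.1)) (2 - 2 * |a.1.2|) = a.2 := by
        refine le_antisymm ((min_le_left _ _).trans ?_) (le_min (le_min ?_ ?_) ?_)
        · first
            | exact (min_le_left _ _).trans (by linarith)
            | exact (min_le_right _ _).trans (by linarith)
        all_goals linarith
      rw [h6, max_eq_right (by linarith)]; linarith
  rw [image_congr hp, strand_eq_image]
  have : (fun a : Space => ((a.1, 0) : Space)) = (fun x => (x, 0)) ∘ Prod.fst := rfl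
  rw [this, image_comp]
  simp only [image_union, image_fst_segment, poly, List.cons_append, List.nil_append, union_empty,
    union_assoc]

theorem flatten_path : PlanarMove openBox
    (∅ ∪ (∅ ∪ poly [(-1, 0), (1 / 2, 0), (7 / 8, 1 / 2), (7 / 8, -1 / 2), (1, 0)]))
    (∅ ∪ (∅ ∪ segment ℝ (-1, 0) (1, 0))) := by
  rw [union_segment_poly (r := (1 / 2, 0)) (mem_segment_plane.2 ⟨3 / 4, by norm_num⟩)]
  refine .trans (poly_move [(-1, 0)] (fun _ _ => id) ?_ ?_) <|
    (poly_move [(-1, 0)] (fun _ _ => id) ?_ ?_)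
  all_goals first
    | (intro x y α β γ hx hy hs h1 h2 h3 h4
       refine ⟨⟨⟨by linarith, by linarith⟩, by linarith, by linarith⟩, ?_, ?_, ?_⟩ <;> repeat' first
         | exact id
         | exact not_mem_poly_single
         | refine not_mem_poly_cons (fun θ t0 t1 t2 t3 => by linarith) ?_)
    | norm_num

/-- A kink of the link is removed by shifting its upper part to the right until the crossing has
disappeared, then lowering it to constant height and straightening it in the plane. -/
theorem kink_strand {N₀ : Set Space} (hN₀ : ∀ a ∈ N₀, a ∉ cyl) (hΓ : ∀ v ∈ Γ, v ∉ box)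
    (hN : IsCompact (N₀ ∪ kinked 0)) (hm : overlayCr (N₀ ∪ kinked 0) Γ ≤ m) :
    Iso m (N₀ ∪ kinked 0) Γ (N₀ ∪ strand (segment ℝ (-1, 0) (1, 0)) 0) Γ := by
  obtain ⟨Φ, h1, h2⟩ := exists_shift
  have himg : ∀ t ∈ Icc (0 : ℝ) 1, Φ t '' (N₀ ∪ kinked 0) =
      N₀ ∪ (fun a : Space => (((a.1.1 + 7 / 8 * min a.2 t, a.1.2), a.2) : Space)) '' kinked 0 := by
    intro t ht
    rw [image_union, image_congr (h2 t ht), image_congr (fun a ha => h1 t a (hN₀ a ha)), image_id']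
  have hcyl : kinked 0 ⊆ cyl := by
    intro a ha
    simp only [kinked_zero, mem_union, mem_segment_space] at ha
    refine mem_box.2 ?_
    rcases ha with ((ha | ha) | ha) | ha <;> obtain ⟨s, a0, a1, a2, a3, a4⟩ := ha <;>
      exact ⟨abs_le.2 ⟨by linarith, by linarith⟩, abs_le.2 ⟨by linarith, by linarith⟩⟩
  have hcyl' : ∀ t, ∀ a ∈ cyl, Φ t a ∈ cyl := by
    intro t a ha
    by_contra hc
    have := (Φ.homeo t).injective (h1 t _ hc)
    exact hc (by change Φ.homeo t a ∈ cyl; rwa [this])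
  have hΓe : Γ ∩ box = ∅ := by
    rw [eq_empty_iff_forall_notMem]; exact fun v hv => hΓ v hv.1 hv.2
  have hin : ∀ S ⊆ cyl, (N₀ ∪ S) ∩ Prod.fst ⁻¹' box = S ∧ (N₀ ∪ S) \ Prod.fst ⁻¹' box = N₀ := by
    intro S hS
    constructor
    · ext a
      constructor
      · rintro ⟨h | h, h'⟩
        · exact absurd h' (hN₀ a h)
        · exact h
      · exact fun h => ⟨Or.inr h, hS h⟩
    · ext a
      constructor
      · rintro ⟨h | h, h'⟩
        · exact h
        · exact absurd (hS h) h'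
      · exact fun h => ⟨Or.inl h, hN₀ a h⟩
  have s1 : Iso m (N₀ ∪ kinked 0) Γ (Φ 1 '' (N₀ ∪ kinked 0)) Γ := by
    refine ⟨Φ, Isotopy.refl _, rfl, Isotopy.refl_image _ _, fun t ht => ?_⟩
    have hsub : (fun a : Space => (((a.1.1 + 7 / 8 * min a.2 t, a.1.2), a.2) : Space)) '' kinked 0 ⊆ cyl := by
      rw [← image_congr (h2 t ht)]
      rintro _ ⟨a, ha, rfl⟩
      exact hcyl' t a (hcyl ha)
    rw [Isotopy.refl_image, himg t ht]
    refine le_trans (overlayCr_le_of_local (S := box) ?_ rfl ?_) hm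
    · rw [(hin _ hsub).2, (hin _ hcyl).2]
    · rw [(hin _ hsub).1, (hin _ hcyl).1, hΓe, overlayCr, overlayCr]
      simpa using crossings_shift ht
  have hN1 : IsCompact (Φ 1 '' (N₀ ∪ kinked 0)) := hN.image (Φ.homeo 1).continuous
  have s2 := Iso.of_covers_id covers_lower hN1 s1.overlay_right
  have e : lower '' (Φ 1 '' (N₀ ∪ kinked 0)) = N₀ ∪ strand
      (poly ([(-1, 0)] ++ (1 / 2, 0) :: (7 / 8, 1 / 2) :: (7 / 8, -1 / 2) :: [(1, 0)])) 0 := by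
    rw [himg 1 ⟨zero_le_one, le_rfl⟩, image_shift_one, image_union, image_lower,
      image_congr (fun a ha => lower_of_not_mem (hN₀ a ha)), image_id']
  have hN2 := hN1.image lower.continuous
  rw [e] at s2 hN2
  exact (s1.trans s2).trans (Iso.of_planarMove (by
    simpa only [empty_union, List.cons_append, List.nil_append] using flatten_path)
    (fun a ha h => hN₀ a ha (openBox_subset_box h)) (fun v hv h => hΓ v hv (openBox_subset_box h)) hN2
    s2.overlay_right)

/-- Invariance under the first move. -/
theorem localInv_kink : LocalInv flat kinked := by
  intro m W hW I N N' Γ Γ' v v' hN hN' h1 h2 h3 h4 h5 h6 hm hm' hv hv'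
  have hflat : flat 0 = strand (segment ℝ (-1, 0) (1, 0)) 0 := segment_eq_strand _ _ _
  by_cases hI : (0 : Fin 1) ∈ I
  · have hI : I = univ := by ext i; fin_cases i; simpa using hI
    subst hI
    simp only [mem_univ, iUnion_true, compl_univ, mem_empty_iff_false, iUnion_of_empty, iUnion_empty,
      iUnion_fin_one] at h1 h2 h4 h5 hv hv'
    have e : Γ = Γ' := by rw [← sdiff_union_inter Γ box, ← sdiff_union_inter Γ' box, h4, h5, h6]
    subst e
    have hd : dbl (∅ : Set Space) = ∅ := by simp [dbl]
    rw [hd] at hv hv'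
    rw [hv.eq_of_empty hW hm, hv'.eq_of_empty hW hm']
    have e1 : N = N \ cyl ∪ strand (segment ℝ (-1, 0) (1, 0)) 0 := by
      rw [← hflat, ← h1, sdiff_union_inter]
    have e2 : N' = N \ cyl ∪ kinked 0 := by rw [h3, ← h2, sdiff_union_inter]
    rw [e1, e2]
    refine (hW.inv (kink_strand (fun a ha => ha.2) (fun v hv hb => ?_) (by rwa [← e2]) (by rwa [← e2]))).symm
    have : v ∈ Γ ∩ box := ⟨hv, hb⟩
    rwa [h4] at this
  · have hI : I = ∅ := by ext i; fin_cases i; simpa using hI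
    subst hI
    simp only [mem_univ, iUnion_true, compl_empty, mem_empty_iff_false, iUnion_of_empty, iUnion_empty,
      iUnion_fin_one] at h1 h2 h4 h5 hv hv'
    have e : N = N' := by rw [← sdiff_union_inter N cyl, ← sdiff_union_inter N' cyl, h1, h2, h3]
    subst e
    rw [hflat, dbl_strand] at hv
    rw [hflat, fst_image_strand] at h4
    rw [dbl_kinked] at hv'
    have e1 : Γ = Γ' \ box ∪ segment ℝ (-1, 0) (1, 0) := by rw [← h6, ← h4, sdiff_union_inter]
    have e2 : Γ' = Γ' \ box ∪ Prod.fst '' kinked 0 := by rw [← h5, sdiff_union_inter]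
    rw [hv.eq_of_empty hW hm, e1]
    rw [e2] at hm' hv'
    refine (kink_curve (fun v hb hv => hv.2 hb) hW (fun a ha hb => ?_) hm' hv').symm
    have : a ∈ N ∩ cyl := ⟨ha, hb⟩
    rwa [h1] at this

end MoveI

/-! ### Removal of a bigon -/

section Bigon

variable {N : Set Space} {Γ₀ : Set Plane} {W : Set Space → Set Plane → ZMod 2} {m : ℕ∞} {v : ZMod 2}

/-- A disc containing the bigon cut off from the graph of `1 - |x|` by the horizontal axis. -/
def bigonDisc : Set Plane :=
  {v | (-2 < v.1 ∧ v.1 < 2) ∧ -1 / 8 < v.2 ∧ v.2 + v.1 / 2 < 3 / 2 ∧ v.2 - v.1 / 2 < 3 / 2}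

/-- A line and a graph that crosses it twice. -/
abbrev bigonCurve : Set Plane :=
  segment ℝ (-2, 0) (2, 0) ∪ poly [(-9 / 8, -1 / 8), (0, 1), (9 / 8, -1 / 8)]

/-- The state of `bigonCurve` in which the graph has become a finger of the left half of the line. -/
abbrev bigonLeft : Set Plane :=
  poly [(2, 0), (17 / 16, 0), (17 / 16, -1 / 16), (9 / 8, -1 / 8)] ∪
    poly ([(-2, 0), (-17 / 16, 0)] ++ (-15 / 16, 1 / 16) :: (0, 1) :: (15 / 16, 1 / 16) ::
      [(15 / 16, 0), (-15 / 16, 0), (-17 / 16, -1 / 16), (-9 / 8, -1 / 8)])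

/-- The mirror image of `bigonLeft`. -/
abbrev bigonRight : Set Plane :=
  poly [(-2, 0), (-17 / 16, 0), (-17 / 16, -1 / 16), (-9 / 8, -1 / 8)] ∪
    poly ([(2, 0), (17 / 16, 0)] ++ (15 / 16, 1 / 16) :: (0, 1) :: (-15 / 16, 1 / 16) ::
      [(-15 / 16, 0), (15 / 16, 0), (17 / 16, -1 / 16), (9 / 8, -1 / 8)])

/-- The state of `bigonCurve` that consists of an upper and a lower arc. -/
abbrev bigonLower : Set Plane :=
  poly [(-2, 0), (-17 / 16, 0), (-15 / 16, 1 / 16), (0, 1), (15 / 16, 1 / 16), (17 / 16, 0), (2, 0)] ∪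
    poly ([(-9 / 8, -1 / 8)] ++ (-17 / 16, -1 / 16) :: (-15 / 16, 0) :: (15 / 16, 0) ::
      [(17 / 16, -1 / 16), (9 / 8, -1 / 8)])

theorem image_poly {F : Plane → Plane} (h : ∀ p q, F '' segment ℝ p q = segment ℝ (F p) (F q)) :
    ∀ l : List Plane, F '' poly l = poly (l.map F)
  | [] => image_empty F
  | [_] => image_empty F
  | a :: b :: l => by
    have := image_poly h (b :: l)
    rw [List.map_cons] at this
    simp only [poly, image_union, List.map_cons, h, this]

theorem reflX_image_segment (p q : Plane) :
    reflX '' segment ℝ p q = segment ℝ (reflX p) (reflX q) := by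
  have key : ∀ p q : Plane, reflX '' segment ℝ p q ⊆ segment ℝ (reflX p) (reflX q) := by
    rintro p q _ ⟨⟨x, y⟩, hx, rfl⟩
    obtain ⟨θ, h0, h1, h2, h3⟩ := mem_segment_plane.1 hx
    refine mem_segment_plane.2 ⟨θ, h0, h1, ?_, h3⟩
    change -x = (1 - θ) * -p.1 + θ * -q.1
    simp only at h2
    linarith
  refine (key p q).antisymm fun v hv => ?_
  have := key _ _ ⟨v, hv, rfl⟩
  rw [reflX_reflX, reflX_reflX] at this
  exact ⟨_, this, reflX_reflX v⟩

/-- A finger is pulled back. -/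
theorem bigon_finger (hΓ : ∀ v ∈ bigonDisc, v ∉ Γ₀) : PlanarMove bigonDisc (Γ₀ ∪ bigonLeft)
    (Γ₀ ∪ (poly [(2, 0), (17 / 16, 0), (17 / 16, -1 / 16), (9 / 8, -1 / 8)] ∪
      poly [(-2, 0), (-17 / 16, 0), (-17 / 16, -1 / 16), (-9 / 8, -1 / 8)])) := by
  refine .trans (poly_move [(-2, 0), (-17 / 16, 0)] hΓ ?_ ?_) <|
    .trans (poly_move [(-2, 0), (-17 / 16, 0)] hΓ ?_ ?_) <|
    .trans (poly_move [(-2, 0), (-17 / 16, 0)] hΓ ?_ ?_) <|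
    .trans (poly_move [(-2, 0)] hΓ ?_ ?_) <|
    (poly_move [(-2, 0)] hΓ ?_ ?_)
  all_goals first
    | (intro x y α β γ hx hy hs h1 h2 h3 h4
       refine ⟨⟨⟨by linarith, by linarith⟩, by linarith, by linarith, by linarith⟩, ?_, ?_, ?_⟩ <;> repeat' first
         | exact not_mem_poly_single
         | refine not_mem_poly_cons (fun θ t0 t1 t2 t3 => by linarith) ?_)
    | norm_num

/-- The two arcs are straightened. -/
theorem bigon_lower (hΓ : ∀ v ∈ bigonDisc, v ∉ Γ₀) : PlanarMove bigonDisc (Γ₀ ∪ bigonLower)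
    (Γ₀ ∪ (poly [(-2, 0), (-17 / 16, 0), (17 / 16, 0), (2, 0)] ∪
      poly [(-9 / 8, -1 / 8), (-17 / 16, -1 / 16), (17 / 16, -1 / 16), (9 / 8, -1 / 8)])) := by
  refine .trans (poly_move [(-9 / 8, -1 / 8)] hΓ ?_ ?_) <|
    .trans (poly_move [(-9 / 8, -1 / 8)] hΓ ?_ ?_) ?_
  on_goal -1 =>
    rw [union_comm (poly _) (poly _)]
    refine .trans (poly_move [(-2, 0), (-17 / 16, 0)] hΓ ?_ ?_) <|
      .trans (poly_move [(-2, 0)] hΓ ?_ ?_) <|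
      .trans (poly_move [(-2, 0)] hΓ ?_ ?_) ?_
  on_goal -1 =>
    rw [union_comm (poly _) (poly _)]
    exact .refl _ _
  all_goals first
    | (intro x y α β γ hx hy hs h1 h2 h3 h4
       refine ⟨⟨⟨by linarith, by linarith⟩, by linarith, by linarith, by linarith⟩, ?_, ?_, ?_⟩ <;> repeat' first
         | exact not_mem_poly_single
         | refine not_mem_poly_cons (fun θ t0 t1 t2 t3 => by linarith) ?_)
    | norm_num

/-- The state with a closed loop between the two smoothings is disconnected. -/
theorem bigon_loop (hΓ : ∀ v ∈ bigonDisc, v ∉ Γ₀) : ¬ IsPreconnected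
    ((Γ₀ ∪ (poly [(15 / 16, 0), (15 / 16, 1 / 16), (0, 1)] ∪
        poly [(2, 0), (17 / 16, 0), (17 / 16, -1 / 16), (9 / 8, -1 / 8)])) ∪
      (poly [(15 / 16, 0), (-15 / 16, 0), (-15 / 16, 1 / 16), (0, 1)] ∪
        poly [(-2, 0), (-17 / 16, 0), (-17 / 16, -1 / 16), (-9 / 8, -1 / 8)])) := by
  refine not_isPreconnected
    (O := {v | (-1 < v.1 ∧ v.1 < 1) ∧ -1 / 32 < v.2 ∧ v.2 + v.1 / 2 < 5 / 4 ∧ v.2 - v.1 / 2 < 5 / 4})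
    (O' := {v | (-1 ≤ v.1 ∧ v.1 ≤ 1) ∧ -1 / 32 ≤ v.2 ∧ v.2 + v.1 / 2 ≤ 5 / 4 ∧ v.2 - v.1 / 2 ≤ 5 / 4}ᶜ)
    ?_ ?_ ?_ ⟨(0, 1), ?_⟩ ⟨(2, 0), ?_⟩ ?_
  · refine (IsOpen.inter ?_ ?_).inter (IsOpen.inter ?_ (IsOpen.inter ?_ ?_))
    · exact isOpen_lt continuous_const continuous_fst
    · exact isOpen_lt continuous_fst continuous_const
    · exact isOpen_lt continuous_const continuous_snd
    · exact isOpen_lt (f := fun v : Plane => v.2 + v.1 / 2) (by fun_prop) continuous_const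
    · exact isOpen_lt (f := fun v : Plane => v.2 - v.1 / 2) (by fun_prop) continuous_const
  · refine (IsClosed.inter (IsClosed.inter ?_ ?_)
      (IsClosed.inter ?_ (IsClosed.inter ?_ ?_))).isOpen_compl
    · exact isClosed_le continuous_const continuous_fst
    · exact isClosed_le continuous_fst continuous_const
    · exact isClosed_le continuous_const continuous_snd
    · exact isClosed_le (f := fun v : Plane => v.2 + v.1 / 2) (by fun_prop) continuous_const
    · exact isClosed_le (f := fun v : Plane => v.2 - v.1 / 2) (by fun_prop) continuous_const
  · rintro ⟨x, y⟩ hv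
    simp only [mem_union, poly, mem_segment_plane, mem_empty_iff_false, or_false] at hv
    rcases hv with (hv | (⟨θ, t0, t1, t2, t3⟩ | ⟨θ, t0, t1, t2, t3⟩) |
      (⟨θ, t0, t1, t2, t3⟩ | ⟨θ, t0, t1, t2, t3⟩ | ⟨θ, t0, t1, t2, t3⟩)) |
      (⟨θ, t0, t1, t2, t3⟩ | ⟨θ, t0, t1, t2, t3⟩ | ⟨θ, t0, t1, t2, t3⟩) |
      (⟨θ, t0, t1, t2, t3⟩ | ⟨θ, t0, t1, t2, t3⟩ | ⟨θ, t0, t1, t2, t3⟩)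
    · refine Or.inr fun h => hΓ _ ?_ hv
      obtain ⟨⟨g1, g2⟩, g3, g4, g5⟩ := h
      exact ⟨⟨by linarith, by linarith⟩, by linarith, by linarith, by linarith⟩
    all_goals first
      | exact Or.inl ⟨⟨by linarith, by linarith⟩, by linarith, by linarith, by linarith⟩
      | (refine Or.inr ?_
         rintro ⟨⟨g1, g2⟩, g3, g4, g5⟩
         simp only at *; linarith)
  · refine ⟨Or.inr (Or.inl (Or.inr (Or.inr (Or.inl (right_mem_segment ℝ _ _))))), ⟨?_, ?_⟩, ?_, ?_, ?_⟩ <;>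
      norm_num
  · refine ⟨Or.inl (Or.inr (Or.inr (Or.inl (left_mem_segment ℝ _ _)))), ?_⟩
    rintro ⟨⟨-, h⟩, -⟩
    norm_num at h
  · exact disjoint_left.2 fun v h h' =>
      h' ⟨⟨h.1.1.le, h.1.2.le⟩, h.2.1.le, h.2.2.1.le, h.2.2.2.le⟩

theorem bigon_state_left : ((Γ₀ ∪ (poly [(15 / 16, 0), (15 / 16, 1 / 16), (0, 1)] ∪
        poly [(2, 0), (17 / 16, 0), (17 / 16, -1 / 16), (9 / 8, -1 / 8)])) ∪
      (poly [(15 / 16, 0), (-15 / 16, 0), (-17 / 16, -1 / 16), (-9 / 8, -1 / 8)] ∪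
        poly [(-2, 0), (-17 / 16, 0), (-15 / 16, 1 / 16), (0, 1)])) = (Γ₀ ∪ bigonLeft) := by
  simp only [bigonLeft, poly, union_empty, List.cons_append, List.nil_append]
  rw [segment_symm ℝ ((15 / 16, 0) : Plane) (15 / 16, 1 / 16),
    segment_symm ℝ ((15 / 16, 1 / 16) : Plane) (0, 1)]
  ext; simp only [mem_union]; tauto

theorem bigon_state_right : ((Γ₀ ∪ (poly [(2, 0), (17 / 16, 0), (15 / 16, 1 / 16), (0, 1)] ∪
        poly [(15 / 16, 0), (17 / 16, -1 / 16), (9 / 8, -1 / 8)])) ∪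
      (poly [(15 / 16, 0), (-15 / 16, 0), (-15 / 16, 1 / 16), (0, 1)] ∪
        poly [(-2, 0), (-17 / 16, 0), (-17 / 16, -1 / 16), (-9 / 8, -1 / 8)])) = (Γ₀ ∪ bigonRight) := by
  simp only [bigonRight, poly, union_empty, List.cons_append, List.nil_append]
  rw [segment_symm ℝ ((0, 1) : Plane) (-15 / 16, 1 / 16),
    segment_symm ℝ ((-15 / 16, 1 / 16) : Plane) (-15 / 16, 0),
    segment_symm ℝ ((-15 / 16, 0) : Plane) (15 / 16, 0)]
  ext; simp only [mem_union]; tauto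

theorem bigon_state_lower : ((Γ₀ ∪ (poly [(2, 0), (17 / 16, 0), (15 / 16, 1 / 16), (0, 1)] ∪
        poly [(15 / 16, 0), (17 / 16, -1 / 16), (9 / 8, -1 / 8)])) ∪
      (poly [(15 / 16, 0), (-15 / 16, 0), (-17 / 16, -1 / 16), (-9 / 8, -1 / 8)] ∪
        poly [(-2, 0), (-17 / 16, 0), (-15 / 16, 1 / 16), (0, 1)])) = (Γ₀ ∪ bigonLower) := by
  simp only [bigonLower, poly, union_empty, List.cons_append, List.nil_append]
  rw [segment_symm ℝ ((2, 0) : Plane) (17 / 16, 0), segment_symm ℝ ((0, 1) : Plane) (15 / 16, 1 / 16),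
    segment_symm ℝ ((15 / 16, 1 / 16) : Plane) (17 / 16, 0),
    segment_symm ℝ ((-9 / 8, -1 / 8) : Plane) (-17 / 16, -1 / 16),
    segment_symm ℝ ((-17 / 16, -1 / 16) : Plane) (-15 / 16, 0),
    segment_symm ℝ ((-15 / 16, 0) : Plane) (15 / 16, 0)]
  ext; simp only [mem_union]; tauto

set_option maxHeartbeats 400000 in
/-- Expansion of the state sum at the two double points. The fourth state vanishes by `bigon_loop`. -/
theorem bigon_expand (hΓ : ∀ v ∈ bigonDisc, v ∉ Γ₀) (hW : Valuation m W) (hN : ∀ a ∈ N, a.1 ∉ bigonDisc)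
    (hm : overlayCr N (Γ₀ ∪ bigonCurve) ≤ m)
    (h : StateSum W N (Γ₀ ∪ bigonCurve) {(1, 0), (-1, 0)} v) :
    v = W N (Γ₀ ∪ bigonLeft) + (W N (Γ₀ ∪ bigonRight) + W N (Γ₀ ∪ bigonLower)) ∧
    overlayCr N (Γ₀ ∪ bigonLeft) ≤ m ∧ overlayCr N (Γ₀ ∪ bigonRight) ≤ m ∧
    overlayCr N (Γ₀ ∪ bigonLower) ≤ m := by
  have hd : ((1 / 16 : ℝ), (0 : ℝ)).1 * ((1 / 16 : ℝ), (-1 / 16 : ℝ)).2 -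
    ((1 / 16 : ℝ), (0 : ℝ)).2 * ((1 / 16 : ℝ), (-1 / 16 : ℝ)).1 ≠ 0 := by norm_num
  have hd' : ((-1 / 16 : ℝ), (0 : ℝ)).1 * ((-1 / 16 : ℝ), (-1 / 16 : ℝ)).2 -
    ((-1 / 16 : ℝ), (0 : ℝ)).2 * ((-1 / 16 : ℝ), (-1 / 16 : ℝ)).1 ≠ 0 := by norm_num
  have hsub : frame (1, 0) (1 / 16, 0) (1 / 16, -1 / 16) hd '' box ⊆ bigonDisc ∩ {v | 0 < v.1} := by
    rintro _ ⟨⟨x, y⟩, hx, rfl⟩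
    have h1 := abs_le.1 (mem_box.1 hx).1
    have h2 := abs_le.1 (mem_box.1 hx).2
    simp only [bigonDisc, frame_apply, mem_inter_iff, mem_ofPred_eq] at h1 h2 ⊢
    refine ⟨⟨⟨?_, ?_⟩, ?_, ?_, ?_⟩, ?_⟩ <;> linarith
  have hsub' : frame (-1, 0) (-1 / 16, 0) (-1 / 16, -1 / 16) hd' '' box ⊆ bigonDisc ∩ {v | v.1 < 0} := by
    rintro _ ⟨⟨x, y⟩, hx, rfl⟩
    have h1 := abs_le.1 (mem_box.1 hx).1
    have h2 := abs_le.1 (mem_box.1 hx).2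
    simp only [bigonDisc, frame_apply, mem_inter_iff, mem_ofPred_eq] at h1 h2 ⊢
    refine ⟨⟨⟨?_, ?_⟩, ?_, ?_, ?_⟩, ?_⟩ <;> linarith
  -- the chart at the right double point
  have e0 : Γ₀ ∪ bigonCurve =
      (Γ₀ ∪ poly [(-9 / 8, -1 / 8), (0, 1)]) ∪
        (segment ℝ (-2, 0) (2, 0) ∪ segment ℝ (0, 1) (9 / 8, -1 / 8)) := by
    simp only [bigonCurve, poly, union_empty]
    ext; simp only [mem_union]; tauto
  obtain ⟨c1, c2, c3⟩ := smooth_frame (c := (1, 0)) (a := (1 / 16, 0)) (b := (1 / 16, -1 / 16)) (h := hd)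
    (A := 48) (B := 16) (C := 16) (D := 2)
    (Γ₀ := Γ₀ ∪ poly [(-9 / 8, -1 / 8), (0, 1)]) (N := N)
    (pA := (-2, 0)) (pB := (2, 0)) (pC := (0, 1)) (pD := (9 / 8, -1 / 8)) (q₁ := (15 / 16, 0))
    (q₂ := (17 / 16, 0)) (q₃ := (15 / 16, 1 / 16)) (q₄ := (17 / 16, -1 / 16)) (by
      rintro ⟨x, y⟩ hx (h | h)
      · exact hΓ _ (hsub (mem_image_of_mem _ hx)).1 h
      · revert h
        rw [frame_apply]
        have h1 := abs_le.1 (mem_box.1 hx).1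
        have h2 := abs_le.1 (mem_box.1 hx).2
        simp only at h1 h2
        exact not_mem_poly_cons (fun θ t0 t1 t2 t3 => by linarith) not_mem_poly_single)
    (fun a ha hc => hN a ha (hsub hc).1)
  rw [← e0] at c1 c2 c3
  set φ := frame (1, 0) (1 / 16, 0) (1 / 16, -1 / 16) hd with hφ
  have hφ0 : φ 0 = (1, 0) := by
    change frame _ _ _ _ (0, 0) = _
    rw [frame_apply]; norm_num
  set ψ := frame (-1, 0) (-1 / 16, 0) (-1 / 16, -1 / 16) hd' with hψ
  have hψ0 : ψ 0 = (-1, 0) := by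
    change frame _ _ _ _ (0, 0) = _
    rw [frame_apply]; norm_num
  obtain ⟨v₁, v₂, rfl, h1, h2⟩ := h.expand hW hm c1 (by rw [hφ0]; simp) (fun x hx hx' => by
    rcases hx with rfl | rfl
    · exact hφ0.symm
    · have := (hsub hx').2
      norm_num at this)
  have hX : ({(1, 0), (-1, 0)} : Set Plane) \ {φ 0} = {(-1, 0)} := by
    rw [hφ0]
    ext x
    simp only [mem_sdiff, mem_insert_iff, mem_singleton_iff]
    constructor
    · rintro ⟨h | h, h'⟩
      · exact absurd h h'
      · exact h
    · rintro rfl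
      refine ⟨Or.inr rfl, fun h => ?_⟩
      have := congrArg Prod.fst h
      norm_num at this
  have hX' : ({(-1, 0)} : Set Plane) \ {ψ 0} = ∅ := by rw [hψ0, Set.sdiff_self]
  rw [hX] at h1 h2
  have hm1 := (overlayCr_smooth c1.free true _).trans_le hm
  have hm2 := (overlayCr_smooth c1.free false _).trans_le hm
  -- the chart at the left double point, in the presence of other arcs `S`
  have key : ∀ S : Set Plane, (∀ x y : ℝ, -9 / 8 ≤ x → x ≤ -7 / 8 → |y| ≤ 1 / 16 → (x, y) ∉ S) →
      IsChart ψ N ((Γ₀ ∪ S) ∪ (segment ℝ (15 / 16, 0) (-2, 0) ∪ segment ℝ (0, 1) (-9 / 8, -1 / 8))) ∧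
      smooth ψ true ((Γ₀ ∪ S) ∪ (segment ℝ (15 / 16, 0) (-2, 0) ∪ segment ℝ (0, 1) (-9 / 8, -1 / 8))) =
        (Γ₀ ∪ S) ∪ (poly [(15 / 16, 0), (-15 / 16, 0), (-15 / 16, 1 / 16), (0, 1)] ∪
          poly [(-2, 0), (-17 / 16, 0), (-17 / 16, -1 / 16), (-9 / 8, -1 / 8)]) ∧
      smooth ψ false ((Γ₀ ∪ S) ∪ (segment ℝ (15 / 16, 0) (-2, 0) ∪ segment ℝ (0, 1) (-9 / 8, -1 / 8))) =
        (Γ₀ ∪ S) ∪ (poly [(15 / 16, 0), (-15 / 16, 0), (-17 / 16, -1 / 16), (-9 / 8, -1 / 8)] ∪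
          poly [(-2, 0), (-17 / 16, 0), (-15 / 16, 1 / 16), (0, 1)]) := by
    intro S hS
    refine smooth_frame (A := 31) (B := 16) (C := 16) (D := 2) ?_ (fun a ha hc => hN a ha (hsub' hc).1)
    rintro ⟨x, y⟩ hx (h | h)
    · exact hΓ _ (hsub' (mem_image_of_mem _ hx)).1 h
    · revert h
      rw [frame_apply]
      have h1 := abs_le.1 (mem_box.1 hx).1
      have h2 := abs_le.1 (mem_box.1 hx).2
      simp only at h1 h2
      exact hS _ _ (by simp only; linarith) (by simp only; linarith)
        (abs_le.2 ⟨by simp only; linarith, by simp only; linarith⟩)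
  have e1 : smooth φ true (Γ₀ ∪ bigonCurve) =
      (Γ₀ ∪ (poly [(15 / 16, 0), (15 / 16, 1 / 16), (0, 1)] ∪
        poly [(2, 0), (17 / 16, 0), (17 / 16, -1 / 16), (9 / 8, -1 / 8)])) ∪
      (segment ℝ (15 / 16, 0) (-2, 0) ∪ segment ℝ (0, 1) (-9 / 8, -1 / 8)) := by
    rw [c2]
    simp only [poly, union_empty]
    rw [segment_symm ℝ ((15 / 16, 0) : Plane) (-2, 0), segment_symm ℝ ((0, 1) : Plane) (-9 / 8, -1 / 8)]
    ext; simp only [mem_union]; tauto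
  have e2 : smooth φ false (Γ₀ ∪ bigonCurve) =
      (Γ₀ ∪ (poly [(2, 0), (17 / 16, 0), (15 / 16, 1 / 16), (0, 1)] ∪
        poly [(15 / 16, 0), (17 / 16, -1 / 16), (9 / 8, -1 / 8)])) ∪
      (segment ℝ (15 / 16, 0) (-2, 0) ∪ segment ℝ (0, 1) (-9 / 8, -1 / 8)) := by
    rw [c3]
    simp only [poly, union_empty]
    rw [segment_symm ℝ ((15 / 16, 0) : Plane) (-2, 0), segment_symm ℝ ((0, 1) : Plane) (-9 / 8, -1 / 8)]
    ext; simp only [mem_union]; tauto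
  rw [e1] at h1 hm1
  rw [e2] at h2 hm2
  obtain ⟨k1, k2, k3⟩ := key (poly [(15 / 16, 0), (15 / 16, 1 / 16), (0, 1)] ∪
    poly [(2, 0), (17 / 16, 0), (17 / 16, -1 / 16), (9 / 8, -1 / 8)]) (fun x y h1 h2 h3 => by
    have := abs_le.1 h3
    rintro (h | h) <;> revert h <;> repeat' first
        | exact not_mem_poly_single
        | refine not_mem_poly_cons (fun θ t0 t1 t2 t3 => by linarith) ?_)
  obtain ⟨k1', k2', k3'⟩ := key (poly [(2, 0), (17 / 16, 0), (15 / 16, 1 / 16), (0, 1)] ∪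
    poly [(15 / 16, 0), (17 / 16, -1 / 16), (9 / 8, -1 / 8)]) (fun x y h1 h2 h3 => by
    have := abs_le.1 h3
    rintro (h | h) <;> revert h <;> repeat' first
        | exact not_mem_poly_single
        | refine not_mem_poly_cons (fun θ t0 t1 t2 t3 => by linarith) ?_)
  obtain ⟨w₁, w₂, rfl, p1, p2⟩ := h1.expand hW hm1 k1 (by rw [hψ0]; rfl)
    (fun x hx _ => by rw [hψ0]; exact hx)
  obtain ⟨w₃, w₄, rfl, p3, p4⟩ := h2.expand hW hm2 k1' (by rw [hψ0]; rfl)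
    (fun x hx _ => by rw [hψ0]; exact hx)
  rw [hX'] at p1 p2 p3 p4
  have n1 := (overlayCr_smooth k1.free true _).trans_le hm1
  have n2 := (overlayCr_smooth k1.free false _).trans_le hm1
  have n3 := (overlayCr_smooth k1'.free true _).trans_le hm2
  have n4 := (overlayCr_smooth k1'.free false _).trans_le hm2
  rw [p1.eq_of_empty hW n1, p2.eq_of_empty hW n2, p3.eq_of_empty hW n3, p4.eq_of_empty hW n4]
  rw [k2] at n1 ⊢
  rw [k3] at n2 ⊢
  rw [k2'] at n3 ⊢
  rw [k3'] at n4 ⊢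
  rw [hW.disc (bigon_loop hΓ), zero_add]
  rw [bigon_state_left] at n2 ⊢
  rw [bigon_state_right] at n3 ⊢
  rw [bigon_state_lower] at n4 ⊢
  exact ⟨rfl, n2, n3, n4⟩

theorem reflX_image_bigonDisc : reflX '' bigonDisc = bigonDisc := by
  have key : ∀ w ∈ bigonDisc, reflX w ∈ bigonDisc := by
    rintro ⟨x, y⟩ ⟨⟨h1, h2⟩, h3, h4, h5⟩
    change ((-x, y) : Plane) ∈ bigonDisc
    simp only at h1 h2 h3 h4 h5
    refine ⟨⟨?_, ?_⟩, ?_, ?_, ?_⟩ <;> simp only <;> linarith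
  ext v
  constructor
  · rintro ⟨w, hw, rfl⟩
    exact key w hw
  · exact fun h => ⟨_, key v h, reflX_reflX v⟩

/-- The mirror image of `bigon_finger`. -/
theorem bigon_finger_right (hΓ : ∀ v ∈ bigonDisc, v ∉ Γ₀) : PlanarMove bigonDisc (Γ₀ ∪ bigonRight)
    (Γ₀ ∪ (poly [(-2, 0), (-17 / 16, 0), (-17 / 16, -1 / 16), (-9 / 8, -1 / 8)] ∪
      poly [(2, 0), (17 / 16, 0), (17 / 16, -1 / 16), (9 / 8, -1 / 8)])) := by
  have hΓ' : ∀ v ∈ bigonDisc, v ∉ reflX '' Γ₀ := by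
    rintro _ hv ⟨w, hw, rfl⟩
    rw [← reflX_image_bigonDisc, reflX.injective.mem_set_image] at hv
    exact hΓ w hv hw
  have hrefl : ∀ a b : ℝ, reflX (a, b) = (-a, b) := fun _ _ => rfl
  have h : PlanarMove (reflX '' bigonDisc) (reflX '' _) (reflX '' _) :=
    (bigon_finger hΓ').conj isSym_reflX.pl
  have hrr : reflX '' (reflX '' Γ₀) = Γ₀ := by
    rw [image_image]; simp only [reflX_reflX, image_id']
  simp only [bigonLeft, image_union, image_poly reflX_image_segment, List.map_cons, List.map_append, List.map_nil,
    hrr, reflX_image_bigonDisc] at h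
  simp only [hrefl] at h
  rw [bigonRight]
  convert h using 6 <;> norm_num

/-- A disc that contains a line and a graph that cuts off a bigon: the state sum is the value of the curve
with the bigon removed. One of the four states contains a closed loop, two others are isotopic and
cancel. -/
theorem bigon (hΓ : ∀ v ∈ bigonDisc, v ∉ Γ₀) (hW : Valuation m W) (hN : ∀ a ∈ N, a.1 ∉ bigonDisc)
    (hm : overlayCr N (Γ₀ ∪ bigonCurve) ≤ m)
    (h : StateSum W N (Γ₀ ∪ bigonCurve) {(1, 0), (-1, 0)} v) :
    v = W N (Γ₀ ∪ (poly [(-2, 0), (-17 / 16, 0), (17 / 16, 0), (2, 0)] ∪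
      poly [(-9 / 8, -1 / 8), (-17 / 16, -1 / 16), (17 / 16, -1 / 16), (9 / 8, -1 / 8)])) := by
  obtain ⟨rfl, h1, h2, h3⟩ := bigon_expand hΓ hW hN hm h
  rw [hW.of_move (bigon_finger hΓ) hN h1, hW.of_move (bigon_finger_right hΓ) hN h2,
    hW.of_move (bigon_lower hΓ) hN h3, union_comm (poly [(-2, 0), _, (-17 / 16, -1 / 16), _]),
    ← add_assoc, CharTwo.add_self_eq_zero, zero_add]

end Bigon

/-! ### The second Reidemeister move -/

section MoveII

variable {N : Set Space} {Γ Γ₀ : Set Plane} {W : Set Space → Set Plane → ZMod 2} {m : ℕ∞} {v : ZMod 2}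

theorem frame_image_segment (c a b : Plane) (h) (p q : Plane) :
    frame c a b h '' segment ℝ p q = segment ℝ (frame c a b h p) (frame c a b h q) := by
  ext v
  obtain ⟨w, rfl⟩ := (frame c a b h).surjective v
  rw [(frame c a b h).injective.mem_set_image, frame_mem_segment]

/-- Pulling back a state sum by a homeomorphism of the plane. -/
theorem StateSum.comap {φ : Plane ≃ₜ Plane} (hφ : IsPLHomeo φ) {X : Set Plane}
    (hm : overlayCr N (φ '' Γ) ≤ m) (h : StateSum W N (φ '' Γ) (φ '' X) v) :
    StateSum (fun M C => W (liftH φ '' M) (φ '' C)) ((liftH φ).symm '' N) Γ X v := by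
  have := h.map (F := φ.symm) hφ.symm (N' := (liftH φ).symm '' N)
    (W' := fun M C => W (liftH φ '' M) (φ '' C)) (by rintro _ ⟨b, hb, rfl⟩; exact ⟨b, hb, rfl⟩) hm
    fun C _ => by simp only [image_image, Homeomorph.apply_symm_apply, image_id']
  simpa only [image_image, Homeomorph.symm_apply_apply, image_id'] using this

theorem overlayCr_symm {φ : Plane ≃ₜ Plane} (hφ : IsPLHomeo φ) :
    overlayCr ((liftH φ).symm '' N) Γ = overlayCr N (φ '' Γ) := by
  rw [← Covers.overlayCr (covers_liftH hφ) φ.injective, image_image]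
  simp only [Homeomorph.apply_symm_apply, image_id']

/-- The lemma on bigons in other coordinates. -/
theorem bigon_image {φ : Plane ≃ₜ Plane} (hφ : IsPLHomeo φ) (hΓ : ∀ v ∈ bigonDisc, φ v ∉ Γ₀)
    (hW : Valuation m W) (hN : ∀ a ∈ N, a.1 ∉ φ '' bigonDisc)
    (hm : overlayCr N (Γ₀ ∪ φ '' bigonCurve) ≤ m)
    (h : StateSum W N (Γ₀ ∪ φ '' bigonCurve) {φ (1, 0), φ (-1, 0)} v) :
    v = W N (Γ₀ ∪ φ '' (poly [(-2, 0), (-17 / 16, 0), (17 / 16, 0), (2, 0)] ∪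
      poly [(-9 / 8, -1 / 8), (-17 / 16, -1 / 16), (17 / 16, -1 / 16), (9 / 8, -1 / 8)])) := by
  have e : ∀ C, Γ₀ ∪ φ '' C = φ '' (φ.symm '' Γ₀ ∪ C) := fun C => by
    rw [image_union, image_image]; simp
  have e' : ({φ (1, 0), φ (-1, 0)} : Set Plane) = φ '' {(1, 0), (-1, 0)} := by rw [image_pair]
  rw [e, e'] at h
  rw [e] at hm ⊢
  have := bigon (Γ₀ := φ.symm '' Γ₀) (N := (liftH φ).symm '' N) (by
    rintro v hv ⟨w, hw, rfl⟩
    exact hΓ _ hv (by rwa [φ.apply_symm_apply])) (hW.comap hφ (covers_liftH hφ)) (by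
    rintro _ ⟨a, ha, rfl⟩ hc
    exact hN a ha ⟨_, hc, φ.apply_symm_apply _⟩) (by rwa [overlayCr_symm hφ]) (h.comap hφ hm)
  rw [this]
  simp only [image_image, Homeomorph.apply_symm_apply, image_id']

theorem apart_zero : apart 0 = strand (segment ℝ (-1 / 2, -1) (-1 / 2, 1)) 0 := segment_eq_strand _ _ _
theorem apart_one : apart 1 = strand (segment ℝ (1 / 2, -1) (1 / 2, 1)) 1 := segment_eq_strand _ _ _
theorem overlapping_zero : overlapping 0 = strand (segment ℝ (-1 / 2, -1) (-1 / 2, 1)) 0 :=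
  segment_eq_strand _ _ _
theorem overlapping_one : overlapping 1 = strand (poly [(1 / 2, -1), (-3 / 4, 0), (1 / 2, 1)]) 1 := by
  simp only [poly, union_empty, strand_union, ← segment_eq_strand]
  rfl

/-- The double points of a pair of strands at different heights. -/
theorem dbl_union_strand {A B : Set Plane} {s t : ℝ} (h : s ≠ t) :
    dbl (strand A s ∪ strand B t) = A ∩ B := by
  ext x
  constructor
  · rintro ⟨a, ha, b, hb, hab, rfl, h2⟩
    rcases ha with ha | ha <;> rcases hb with hb | hb
    · exact absurd (Prod.ext h2.symm (ha.2.trans hb.2.symm)) hab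
    · exact ⟨ha.1, by rw [← h2]; exact hb.1⟩
    · exact ⟨by rw [← h2]; exact hb.1, ha.1⟩
    · exact absurd (Prod.ext h2.symm (ha.2.trans hb.2.symm)) hab
  · rintro ⟨hA, hB⟩
    exact ⟨(x, s), Or.inl ⟨hA, rfl⟩, (x, t), Or.inr ⟨hB, rfl⟩, fun he => h (congrArg Prod.snd he), rfl, rfl⟩

theorem segment_subset_box {p q : Plane} (hp : p ∈ box) (hq : q ∈ box) : segment ℝ p q ⊆ box :=
  (convex_closedBall (0 : Plane) 1).segment_subset hp hq

theorem poly_subset_box : ∀ {l : List Plane}, (∀ p ∈ l, p ∈ box) → poly l ⊆ box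
  | [], _ => empty_subset _
  | [_], _ => empty_subset _
  | a :: b :: l, h => union_subset (segment_subset_box (h a (by simp)) (h b (by simp)))
      (poly_subset_box fun p hp => h p (List.mem_cons_of_mem _ hp))

theorem overlayCr_union_free {S T : Set Plane} (hN : ∀ a ∈ N, a.1 ∉ S) (hT : T ⊆ S) :
    overlayCr N (Γ₀ ∪ T) = overlayCr N Γ₀ := by
  rw [overlayCr, overlayCr]
  congr 2
  ext a
  exact ⟨fun h => ⟨h.1, h.2.resolve_right fun hc => hN a h.1 (hT hc)⟩, fun h => ⟨h.1, Or.inl h.2⟩⟩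

theorem iUnion_fin_two {α : Type*} (f : Fin 2 → Set α) : ⋃ i, f i = f 0 ∪ f 1 := by
  ext; simp [Fin.exists_fin_two]

theorem set_fin_two (I : Set (Fin 2)) : I = ∅ ∨ I = {0} ∨ I = {1} ∨ I = univ := by
  by_cases h0 : (0 : Fin 2) ∈ I <;> by_cases h1 : (1 : Fin 2) ∈ I
  · refine Or.inr (Or.inr (Or.inr ?_)); ext i; fin_cases i <;> simpa
  · refine Or.inr (Or.inl ?_); ext i; fin_cases i <;> simpa
  · refine Or.inr (Or.inr (Or.inl ?_)); ext i; fin_cases i <;> simpa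
  · refine Or.inl ?_; ext i; fin_cases i <;> simpa

/-- The arc left by the removal of the bigon is straightened. -/
theorem overlap_path (hΓ : ∀ v ∈ box, v ∉ Γ₀) : PlanarMove openBox
    (Γ₀ ∪ (segment ℝ (-1 / 2, -1) (-1 / 2, 1) ∪ poly ([(1 / 2, -1), (-15 / 32, -9 / 40)] ++
        (-31 / 64, -17 / 80) :: (-31 / 64, 17 / 80) :: (-15 / 32, 9 / 40) :: [(1 / 2, 1)])))
    (Γ₀ ∪ (segment ℝ (-1 / 2, -1) (-1 / 2, 1) ∪ segment ℝ (1 / 2, -1) (1 / 2, 1))) := by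
  have hΓ' : ∀ v ∈ openBox, v ∉ Γ₀ := fun v hv => hΓ v (openBox_subset_box hv)
  have e : segment ℝ ((1 / 2, -1) : Plane) (1 / 2, 1) = poly [(1 / 2, -1), (1 / 2, 1)] := by simp [poly]
  rw [e]
  refine .trans (poly_move [(1 / 2, -1), (-15 / 32, -9 / 40)] hΓ' ?_ ?_) <|
    .trans (poly_move [(1 / 2, -1)] hΓ' ?_ ?_) <|
    .trans (poly_move [] hΓ' ?_ ?_) <|
    (poly_move [] hΓ' ?_ ?_)
  all_goals first
    | (intro x y α β γ hx hy hs h1 h2 h3 h4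
       refine ⟨⟨⟨by linarith, by linarith⟩, by linarith, by linarith⟩, ?_, ?_, ?_⟩ <;> repeat' first
         | exact not_mem_segment fun θ t0 t1 t2 t3 => by linarith
         | exact not_mem_poly_single
         | refine not_mem_poly_cons (fun θ t0 t1 t2 t3 => by linarith) ?_)
    | norm_num

/-- The second move for two strands of the curve. -/
theorem overlap_curve (hΓ : ∀ v ∈ box, v ∉ Γ₀) (hW : Valuation m W) (hN : ∀ a ∈ N, a.1 ∉ box)
    (hm : overlayCr N (Γ₀ ∪ (segment ℝ (-1 / 2, -1) (-1 / 2, 1) ∪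
      poly [(1 / 2, -1), (-3 / 4, 0), (1 / 2, 1)])) ≤ m)
    (h : StateSum W N (Γ₀ ∪ (segment ℝ (-1 / 2, -1) (-1 / 2, 1) ∪
      poly [(1 / 2, -1), (-3 / 4, 0), (1 / 2, 1)])) {(-1 / 2, 1 / 5), (-1 / 2, -1 / 5)} v) :
    v = W N (Γ₀ ∪ (segment ℝ (-1 / 2, -1) (-1 / 2, 1) ∪ segment ℝ (1 / 2, -1) (1 / 2, 1))) := by
  have hd : ((0 : ℝ), (1 / 5 : ℝ)).1 * ((-1 / 4 : ℝ), (0 : ℝ)).2 -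
    ((0 : ℝ), (1 / 5 : ℝ)).2 * ((-1 / 4 : ℝ), (0 : ℝ)).1 ≠ 0 := by norm_num
  set φ := frame (-1 / 2, 0) (0, 1 / 5) (-1 / 4, 0) hd with hφ
  have hap : ∀ s t : ℝ, φ (s, t) = (-1 / 2 - t / 4, s / 5) := fun s t => by
    rw [hφ, frame_apply]; ext <;> simp only <;> ring
  have himg : ∀ l : List Plane, φ '' poly l = poly (l.map φ) := image_poly (frame_image_segment _ _ _ _)
  have hsub : φ '' bigonDisc ⊆ openBox := by
    rintro _ ⟨⟨x, y⟩, ⟨⟨h1, h2⟩, h3, h4, h5⟩, rfl⟩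
    rw [hap]
    simp only at h1 h2 h3 h4 h5
    refine ⟨⟨?_, ?_⟩, ?_, ?_⟩ <;> simp only <;> linarith
  have q0 : segment ℝ ((-1 / 2, -1) : Plane) (-1 / 2, 1) =
      poly [(-1 / 2, -1), (-1 / 2, -2 / 5), (-1 / 2, 2 / 5), (-1 / 2, 1)] := by
    rw [union_segment_poly (r := (-1 / 2, -2 / 5)) (mem_segment_plane.2 ⟨3 / 10, by norm_num⟩)]
    simp only [poly]
    rw [union_segment_poly (p := (-1 / 2, -2 / 5)) (r := (-1 / 2, 2 / 5))
      (mem_segment_plane.2 ⟨4 / 7, by norm_num⟩)]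
    simp only [poly, union_empty]
  have q1 : segment ℝ ((-1 / 2, -2 / 5) : Plane) (-1 / 2, 2 / 5) =
      poly [(-1 / 2, -2 / 5), (-1 / 2, -17 / 80), (-1 / 2, 17 / 80), (-1 / 2, 2 / 5)] := by
    rw [union_segment_poly (r := (-1 / 2, -17 / 80)) (mem_segment_plane.2 ⟨15 / 64, by norm_num⟩)]
    simp only [poly]
    rw [union_segment_poly (p := (-1 / 2, -17 / 80)) (r := (-1 / 2, 17 / 80))
      (mem_segment_plane.2 ⟨34 / 49, by norm_num⟩)]
    simp only [poly, union_empty]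
  have q2 : segment ℝ ((1 / 2, -1) : Plane) (-3 / 4, 0) = poly [(1 / 2, -1), (-15 / 32, -9 / 40), (-3 / 4, 0)] :=
    union_segment_poly (mem_segment_plane.2 ⟨31 / 40, by norm_num⟩)
  have q3 : segment ℝ ((-3 / 4, 0) : Plane) (1 / 2, 1) = poly [(-3 / 4, 0), (-15 / 32, 9 / 40), (1 / 2, 1)] :=
    union_segment_poly (mem_segment_plane.2 ⟨9 / 40, by norm_num⟩)
  have p1 : φ (-2, 0) = (-1 / 2, -2 / 5) := by rw [hap]; norm_num
  have p2 : φ (2, 0) = (-1 / 2, 2 / 5) := by rw [hap]; norm_num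
  have p3 : φ (0, 1) = (-3 / 4, 0) := by rw [hap]; norm_num
  have p4 : φ (-9 / 8, -1 / 8) = (-15 / 32, -9 / 40) := by rw [hap]; norm_num
  have p5 : φ (9 / 8, -1 / 8) = (-15 / 32, 9 / 40) := by rw [hap]; norm_num
  have p6 : φ (-17 / 16, 0) = (-1 / 2, -17 / 80) := by rw [hap]; norm_num
  have p7 : φ (17 / 16, 0) = (-1 / 2, 17 / 80) := by rw [hap]; norm_num
  have p8 : φ (-17 / 16, -1 / 16) = (-31 / 64, -17 / 80) := by rw [hap]; norm_num
  have p9 : φ (17 / 16, -1 / 16) = (-31 / 64, 17 / 80) := by rw [hap]; norm_num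
  obtain ⟨R, hR⟩ : ∃ R, R = Γ₀ ∪ (segment ℝ (-1 / 2, -1) (-1 / 2, -2 / 5) ∪ segment ℝ (-1 / 2, 2 / 5) (-1 / 2, 1) ∪
      (segment ℝ (1 / 2, -1) (-15 / 32, -9 / 40) ∪ segment ℝ (-15 / 32, 9 / 40) (1 / 2, 1))) := ⟨_, rfl⟩
  have e0 : Γ₀ ∪ (segment ℝ (-1 / 2, -1) (-1 / 2, 1) ∪ poly [(1 / 2, -1), (-3 / 4, 0), (1 / 2, 1)]) =
      R ∪
      φ '' bigonCurve := by
    have : segment ℝ ((-2, 0) : Plane) (2, 0) = poly [(-2, 0), (2, 0)] := by simp [poly]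
    rw [bigonCurve, this, image_union, himg, himg, q0]
    simp only [List.map_cons, List.map_nil, p1, p2, p3, p4, p5]
    simp only [hR, poly, union_empty, q2, q3]
    ext; simp only [mem_union]; tauto
  have hbox : ∀ v ∈ bigonDisc, φ v ∉ R := by
    rintro ⟨x, y⟩ hv hc
    rw [hR] at hc
    have hv' := hsub ⟨_, hv, rfl⟩
    obtain ⟨⟨h1, h2⟩, h3, h4, h5⟩ := hv
    simp only at h1 h2 h3 h4 h5
    rcases hc with h | (h | h) | (h | h)
    · exact hΓ _ (openBox_subset_box hv') h
    all_goals
      revert h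
      rw [hap]
      exact not_mem_segment fun θ t0 t1 t2 t3 => by linarith
  have e1 : ({(-1 / 2, 1 / 5), (-1 / 2, -1 / 5)} : Set Plane) = {φ (1, 0), φ (-1, 0)} := by
    rw [hap, hap]; norm_num
  rw [e0] at hm h
  rw [e1] at h
  have hN' : ∀ a ∈ N, a.1 ∉ φ '' bigonDisc := fun a ha hc => hN a ha (openBox_subset_box (hsub hc))
  have key := bigon_image (isPLHomeo_frame _ _ _ _) hbox hW hN' hm h
  have e2 : R ∪
      φ '' (poly [(-2, 0), (-17 / 16, 0), (17 / 16, 0), (2, 0)] ∪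
      poly [(-9 / 8, -1 / 8), (-17 / 16, -1 / 16), (17 / 16, -1 / 16), (9 / 8, -1 / 8)]) =
      Γ₀ ∪ (segment ℝ (-1 / 2, -1) (-1 / 2, 1) ∪ poly ([(1 / 2, -1), (-15 / 32, -9 / 40)] ++
        (-31 / 64, -17 / 80) :: (-31 / 64, 17 / 80) :: (-15 / 32, 9 / 40) :: [(1 / 2, 1)])) := by
    rw [image_union, himg, himg, q0]
    simp only [List.map_cons, List.map_nil, p1, p2, p4, p5, p6, p7, p8, p9]
    simp only [hR, poly, union_empty, q1, List.cons_append, List.nil_append]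
    ext; simp only [mem_union]; tauto
  rw [e2] at key
  rw [key]
  have hN₁ : ∀ a ∈ N, a.1 ∉ openBox := fun a ha hc => hN a ha (openBox_subset_box hc)
  refine hW.of_move (overlap_path hΓ) hN₁ ?_
  rw [← overlayCr_move (overlap_path hΓ) hN₁, overlayCr_union_free hN]
  · rw [← e0, overlayCr_union_free hN] at hm
    · exact hm
    · refine union_subset (segment_subset_box ?_ ?_) (poly_subset_box ?_) <;> norm_num [mem_box, abs_le]
  · refine union_subset (segment_subset_box ?_ ?_) (segment_subset_box ?_ ?_) <;>
      norm_num [mem_box, abs_le]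

/-- The coordinates in which the right strand is raised over the left one. -/
noncomputable def pushFrame : Plane ≃ₜ Plane := frame (1 / 2, 0) (0, 1) (-1, 0) (by norm_num)

theorem pushFrame_apply (s t : ℝ) : pushFrame (s, t) = (1 / 2 - t, s) := by
  rw [pushFrame, frame_apply]; ext <;> simp only <;> ring

theorem pushFrame_tent_zero : pushFrame '' tent (5 / 4) 0 = segment ℝ (1 / 2, -1) (1 / 2, 1) := by
  ext ⟨x, y⟩
  rw [mem_segment_plane]
  constructor
  · rintro ⟨⟨s, t⟩, ⟨h1, h2⟩, h3⟩
    rw [pushFrame_apply] at h3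
    simp only at h1 h2
    have h4 : t = 0 := by
      rw [h2, max_eq_left (by linarith [abs_nonneg s])]; ring
    obtain ⟨h5, h6⟩ := abs_le.1 h1
    simp only [Prod.mk.injEq] at h3
    exact ⟨(y + 1) / 2, by linarith, by linarith, by linarith, by linarith⟩
  · rintro ⟨θ, t0, t1, t2, t3⟩
    refine ⟨(y, 0), ⟨abs_le.2 ⟨by simp only at *; linarith, by simp only at *; linarith⟩, ?_⟩, ?_⟩
    · simp only; rw [max_eq_left (by linarith [abs_nonneg y])]; ring
    · rw [pushFrame_apply]; ext <;> simp only at * <;> linarith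

theorem pushFrame_tent_one :
    pushFrame '' tent (5 / 4) 1 = poly [(1 / 2, -1), (-3 / 4, 0), (1 / 2, 1)] := by
  ext ⟨x, y⟩
  simp only [poly, union_empty, mem_union, mem_segment_plane]
  constructor
  · rintro ⟨⟨s, t⟩, ⟨h1, h2⟩, h3⟩
    rw [pushFrame_apply] at h3
    simp only at h1 h2
    rw [max_eq_right (by linarith)] at h2
    simp only [Prod.mk.injEq] at h3
    rcases abs_cases s with ⟨h4, h5⟩ | ⟨h4, h5⟩ <;> rw [h4] at h1 h2
    · exact Or.inr ⟨s, by linarith, by linarith, by linarith, by linarith⟩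
    · exact Or.inl ⟨1 + s, by linarith, by linarith, by linarith, by linarith⟩
  · intro h
    have h' : |y| ≤ 1 ∧ x = 1 / 2 - 5 / 4 * (1 - |y|) := by
      rcases h with ⟨θ, t0, t1, t2, t3⟩ | ⟨θ, t0, t1, t2, t3⟩
      · rw [abs_of_nonpos (by linarith)]
        constructor <;> linarith
      · rw [abs_of_nonneg (by linarith)]
        constructor <;> linarith
    refine ⟨(y, 1 / 2 - x), ⟨h'.1, ?_⟩, ?_⟩
    · simp only; rw [max_eq_right (by linarith)]; linarith
    · rw [pushFrame_apply]; ext <;> simp only <;> linarith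

theorem pushFrame_tent_subset {t : ℝ} (ht : t ≤ 1) : pushFrame '' tent (5 / 4) t ⊆ box := by
  rintro _ ⟨⟨x, y⟩, ⟨h1, h2⟩, rfl⟩
  rw [pushFrame_apply]
  simp only at h1 h2
  refine mem_box.2 ⟨?_, h1⟩
  rcases max_cases 0 (t - |x|) with ⟨h3, h4⟩ | ⟨h3, h4⟩ <;> rw [h3] at h2 <;> have := abs_nonneg x <;>
    exact abs_le.2 ⟨by simp only; linarith, by simp only; linarith⟩

theorem pushFrame_kite : pushFrame '' kite (5 / 4) (1 / 8) ⊆ box := by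
  rintro _ ⟨⟨x, y⟩, ⟨h1, h2⟩, rfl⟩
  rw [pushFrame_apply]
  simp only at h1 h2
  have h3 : |x| < 1 := by nlinarith
  have := abs_nonneg x
  exact mem_box.2 ⟨abs_le.2 ⟨by simp only; linarith, by simp only; linarith⟩, h3.le⟩

/-- While the right strand is being pushed, it meets the left one at most as often as at the end. -/
theorem encard_meet_le {t : ℝ} : (segment ℝ (-1 / 2, -1) (-1 / 2, 1) ∩ pushFrame '' tent (5 / 4) t).encard ≤
    (segment ℝ (-1 / 2, -1) (-1 / 2, 1) ∩ pushFrame '' tent (5 / 4) 1).encard := by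
  have h1 : segment ℝ (-1 / 2, -1) (-1 / 2, 1) ∩ pushFrame '' tent (5 / 4) t ⊆
      {(-1 / 2, t - 4 / 5), (-1 / 2, 4 / 5 - t)} := by
    rintro v ⟨h1, ⟨⟨x, y⟩, ⟨h2, h3⟩, rfl⟩⟩
    rw [pushFrame_apply] at h1 ⊢
    obtain ⟨θ, t0, t1, t2, t3⟩ := mem_segment_plane.1 h1
    simp only at t2 t3 h2 h3
    rcases max_cases 0 (t - |x|) with ⟨h4, h5⟩ | ⟨h4, h5⟩
    · rw [h4] at h3; exfalso; linarith
    · rw [h4] at h3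
      have h6 : |x| = t - 4 / 5 := by linarith
      rcases abs_cases x with ⟨h7, -⟩ | ⟨h7, -⟩
      · left; ext <;> simp only <;> linarith
      · right; ext <;> simp only <;> linarith
  have h2 : ({(-1 / 2, 1 / 5), (-1 / 2, -1 / 5)} : Set Plane) ⊆
      segment ℝ (-1 / 2, -1) (-1 / 2, 1) ∩ pushFrame '' tent (5 / 4) 1 := by
    rintro _ (rfl | rfl)
    · refine ⟨mem_segment_plane.2 ⟨3 / 5, by norm_num⟩, (1 / 5, 1), ⟨?_, ?_⟩, ?_⟩
      · norm_num [abs_le]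
      · norm_num [abs_of_pos]
      · rw [pushFrame_apply]; norm_num
    · refine ⟨mem_segment_plane.2 ⟨2 / 5, by norm_num⟩, (-1 / 5, 1), ⟨?_, ?_⟩, ?_⟩
      · norm_num [abs_le]
      · norm_num [abs_of_neg]
      · rw [pushFrame_apply]; norm_num
  calc _ ≤ _ := encard_le_encard h1
    _ ≤ 2 := (encard_insert_le _ _).trans (by rw [encard_singleton, one_add_one_eq_two])
    _ = ({(-1 / 2, 1 / 5), (-1 / 2, -1 / 5)} : Set Plane).encard :=
      (encard_pair fun h => by have := congrArg Prod.snd h; norm_num at this).symm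
    _ ≤ _ := encard_le_encard h2

theorem overlap_inter : segment ℝ ((-1 / 2, -1) : Plane) (-1 / 2, 1) ∩
    poly [(1 / 2, -1), (-3 / 4, 0), (1 / 2, 1)] = {(-1 / 2, 1 / 5), (-1 / 2, -1 / 5)} := by
  ext ⟨x, y⟩
  simp only [poly, union_empty, mem_inter_iff, mem_union, mem_segment_plane, mem_insert_iff,
    mem_singleton_iff, Prod.mk.injEq]
  constructor
  · rintro ⟨⟨s, s0, s1, s2, s3⟩, ⟨t, t0, t1, t2, t3⟩ | ⟨t, t0, t1, t2, t3⟩⟩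
    · right; constructor <;> linarith
    · left; constructor <;> linarith
  · rintro (⟨rfl, rfl⟩ | ⟨rfl, rfl⟩)
    · exact ⟨⟨3 / 5, by norm_num⟩, Or.inr ⟨1 / 5, by norm_num⟩⟩
    · exact ⟨⟨2 / 5, by norm_num⟩, Or.inl ⟨4 / 5, by norm_num⟩⟩

/-- Raising a tent of a strand that lies above all other strands, if this meets the other strands and the
curve most often at the end. -/
theorem Iso.tent_strand_local {e : Plane ≃ₜ Plane} {c ε h : ℝ} (he : IsPLHomeo e) (hc : 0 < c) (hε : 0 < ε)
    (hk : e '' kite c ε ⊆ box) (hT : ∀ t ∈ Icc (0 : ℝ) 1, e '' tent c t ⊆ box)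
    (hN : ∀ a ∈ N, a.1 ∈ box → a.2 ≤ h - 1)
    (hmeet : ∀ t ∈ Icc (0 : ℝ) 1, {a | a ∈ N ∧ a.1 ∈ e '' tent c t}.encard + (e '' tent c t ∩ Γ).encard ≤
      {a | a ∈ N ∧ a.1 ∈ e '' tent c 1}.encard + (e '' tent c 1 ∩ Γ).encard)
    (hm : overlayCr (N ∪ strand (e '' tent c 1) h) Γ ≤ m) :
    Iso m (N ∪ strand (e '' tent c 0) h) Γ (N ∪ strand (e '' tent c 1) h) Γ := by
  have hne : ∀ t ∈ Icc (0 : ℝ) 1, ∀ a ∈ N, a.1 ∈ e '' tent c t → a.2 ≠ h := fun t ht a ha h1 => by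
    have := hN a ha (hT t ht h1)
    exact ne_of_lt (by linarith)
  refine Iso.tent_strand he hc hε (fun a ha h1 => hN a ha (hk h1)) fun t ht => le_trans ?_ hm
  rw [overlayCr_union_strand (hne t ht), overlayCr_union_strand (hne 1 ⟨zero_le_one, le_rfl⟩)]
  exact add_le_add le_rfl (hmeet t ht)

/-- Raising a tent of the curve, if this meets the projection of the link most often at the end. -/
theorem Iso.tent_curve_local {e : Plane ≃ₜ Plane} {c ε : ℝ} (he : IsPLHomeo e) (hc : 0 < c) (hε : 0 < ε)
    (hk : e '' kite c ε ⊆ box) (hT : ∀ t ∈ Icc (0 : ℝ) 1, e '' tent c t ⊆ box)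
    (hΓ : ∀ v ∈ box, v ∉ Γ₀)
    (hmeet : ∀ t ∈ Icc (0 : ℝ) 1, {a | a ∈ N ∧ a.1 ∈ e '' tent c t}.encard ≤
      {a | a ∈ N ∧ a.1 ∈ e '' tent c 1}.encard)
    (hm : overlayCr N (Γ₀ ∪ e '' tent c 1) ≤ m) :
    Iso m N (Γ₀ ∪ e '' tent c 0) N (Γ₀ ∪ e '' tent c 1) := by
  refine Iso.tent_curve he hc hε (fun v hv h1 => hΓ v (hk h1) hv) fun t ht => le_trans ?_ hm
  rw [overlayCr_union_curve fun a _ h1 => hΓ _ (hT t ht h1),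
    overlayCr_union_curve fun a _ h1 => hΓ _ (hT 1 ⟨zero_le_one, le_rfl⟩ h1)]
  exact add_le_add le_rfl (hmeet t ht)

theorem encard_over_strand {A T : Set Plane} {h : ℝ} (hN : N ∩ cyl = strand A h) (hT : T ⊆ box) :
    {a | a ∈ N ∧ a.1 ∈ T}.encard = (A ∩ T).encard := by
  have : {a | a ∈ N ∧ a.1 ∈ T} = (fun x => ((x, h) : Space)) '' (A ∩ T) := by
    ext a
    constructor
    · rintro ⟨h1, h2⟩
      have h3 : a ∈ N ∩ cyl := ⟨h1, hT h2⟩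
      rw [hN] at h3
      exact ⟨a.1, ⟨h3.1, h2⟩, Prod.ext rfl h3.2.symm⟩
    · rintro ⟨x, ⟨h1, h2⟩, rfl⟩
      have h3 : ((x, h) : Space) ∈ N ∩ cyl := by rw [hN]; exact ⟨h1, rfl⟩
      exact ⟨h3.1, h2⟩
  rw [this, Function.Injective.encard_image]
  exact fun a b hab => congrArg Prod.fst hab

/-- Invariance under the second move. -/
theorem localInv_overlap : LocalInv apart overlapping := by
  intro m W hW I N N' Γ Γ' v v' hN hN' h1 h2 h3 h4 h5 h6 hm hm' hv hv'
  set A : Set Plane := segment ℝ (-1 / 2, -1) (-1 / 2, 1) with hA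
  have hAb : A ⊆ box := by
    refine segment_subset_box ?_ ?_ <;> norm_num [mem_box, abs_le]
  have a0 : apart 0 = strand A 0 := apart_zero
  have a1 : apart 1 = strand (pushFrame '' tent (5 / 4) 0) 1 := by rw [apart_one, pushFrame_tent_zero]
  have b0 : overlapping 0 = strand A 0 := overlapping_zero
  have b1 : overlapping 1 = strand (pushFrame '' tent (5 / 4) 1) 1 := by
    rw [overlapping_one, pushFrame_tent_one]
  have hout : ∀ a ∈ N' \ cyl, a.1 ∉ box := fun a ha => ha.2
  rcases set_fin_two I with rfl | rfl | rfl | rfl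
  · -- both strands belong to the curve
    simp only [biUnion_empty, compl_empty, biUnion_univ, iUnion_fin_two] at h1 h2 h4 h5 hv hv'
    have e : N = N' := by rw [← sdiff_union_inter N cyl, ← sdiff_union_inter N' cyl, h1, h2, h3]
    subst e
    have hd : dbl (apart 0 ∪ apart 1) = ∅ := by
      rw [apart_zero, apart_one, dbl_union_strand zero_ne_one, eq_empty_iff_forall_notMem]
      rintro ⟨x, y⟩ ⟨p1, p2⟩
      obtain ⟨s, s0, s1, s2, s3⟩ := mem_segment_plane.1 p1
      obtain ⟨t, t0, t1, t2, t3⟩ := mem_segment_plane.1 p2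
      linarith
    have hd' : dbl (overlapping 0 ∪ overlapping 1) = {(-1 / 2, 1 / 5), (-1 / 2, -1 / 5)} := by
      rw [overlapping_zero, overlapping_one, dbl_union_strand zero_ne_one, overlap_inter]
    rw [hd] at hv
    rw [hd'] at hv'
    rw [apart_zero, apart_one, fst_image_strand, fst_image_strand] at h4
    rw [overlapping_zero, overlapping_one, fst_image_strand, fst_image_strand] at h5
    have e1 : Γ = Γ' \ box ∪ (segment ℝ (-1 / 2, -1) (-1 / 2, 1) ∪ segment ℝ (1 / 2, -1) (1 / 2, 1)) := by
      rw [← h6, ← h4, sdiff_union_inter]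
    have e2 : Γ' = Γ' \ box ∪ (segment ℝ (-1 / 2, -1) (-1 / 2, 1) ∪
        poly [(1 / 2, -1), (-3 / 4, 0), (1 / 2, 1)]) := by rw [← h5, sdiff_union_inter]
    rw [hv.eq_of_empty hW hm, e1]
    rw [e2] at hm' hv'
    refine (overlap_curve (fun v hb hv => hv.2 hb) hW (fun a ha hb => ?_) hm' hv').symm
    have : a ∈ N ∩ cyl := ⟨ha, hb⟩
    rwa [h1] at this
  · -- the right strand belongs to the curve
    have hc : ({0} : Set (Fin 2))ᶜ = {1} := by ext i; fin_cases i <;> simp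
    simp only [hc, biUnion_singleton, a0, a1, b0, b1, fst_image_strand, dbl_strand] at h1 h2 h4 h5 hv hv'
    have e : N = N' := by rw [← sdiff_union_inter N cyl, ← sdiff_union_inter N' cyl, h1, h2, h3]
    subst e
    have e1 : Γ = Γ' \ box ∪ pushFrame '' tent (5 / 4) 0 := by rw [← h6, ← h4, sdiff_union_inter]
    have e2 : Γ' = Γ' \ box ∪ pushFrame '' tent (5 / 4) 1 := by rw [← h5, sdiff_union_inter]
    rw [hv.eq_of_empty hW hm, hv'.eq_of_empty hW hm', e1]
    nth_rewrite 2 [e2]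
    refine hW.inv (Iso.tent_curve_local (isPLHomeo_frame _ _ _ _) (by norm_num) (by norm_num)
      pushFrame_kite (fun t ht => pushFrame_tent_subset ht.2) (fun v hb hv => hv.2 hb) (fun t ht => ?_)
      (by rwa [← e2]))
    rw [encard_over_strand h1 (pushFrame_tent_subset ht.2), encard_over_strand h1 (pushFrame_tent_subset le_rfl)]
    exact encard_meet_le
  · -- the left strand belongs to the curve
    have hc : ({1} : Set (Fin 2))ᶜ = {0} := by ext i; fin_cases i <;> simp
    simp only [hc, biUnion_singleton, a0, a1, b0, b1, fst_image_strand, dbl_strand] at h1 h2 h4 h5 hv hv'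
    have e : Γ = Γ' := by rw [← sdiff_union_inter Γ box, ← sdiff_union_inter Γ' box, h4, h5, h6]
    subst e
    have e1 : N = N' \ cyl ∪ strand (pushFrame '' tent (5 / 4) 0) 1 := by
      rw [← h3, ← h1, sdiff_union_inter]
    have e2 : N' = N' \ cyl ∪ strand (pushFrame '' tent (5 / 4) 1) 1 := by rw [← h2, sdiff_union_inter]
    rw [hv.eq_of_empty hW hm, hv'.eq_of_empty hW hm', e1]
    nth_rewrite 2 [e2]
    have hz : ∀ T ⊆ box, {a | a ∈ N' \ cyl ∧ a.1 ∈ T}.encard = 0 := fun T hT =>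
      encard_eq_zero.2 (eq_empty_iff_forall_notMem.2 fun a ha => ha.1.2 (hT ha.2))
    have hi : ∀ T ⊆ box, T ∩ Γ = A ∩ T := fun T hT => by
      rw [← h4, inter_comm Γ, inter_comm box, inter_assoc, inter_eq_right.2 hT, inter_comm]
    refine hW.inv (Iso.tent_strand_local (isPLHomeo_frame _ _ _ _) (by norm_num) (by norm_num)
      pushFrame_kite (fun t ht => pushFrame_tent_subset ht.2) (fun a ha hb => absurd hb ha.2) (fun t ht => ?_)
      (by rwa [← e2]))
    rw [hz _ (pushFrame_tent_subset ht.2), hz _ (pushFrame_tent_subset le_rfl),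
      hi _ (pushFrame_tent_subset ht.2), hi _ (pushFrame_tent_subset le_rfl)]
    exact add_le_add le_rfl encard_meet_le
  · -- both strands belong to the link
    simp only [compl_univ, biUnion_empty, biUnion_univ, iUnion_fin_two, a0, a1, b0, b1] at h1 h2 h4 h5 hv hv'
    have e : Γ = Γ' := by rw [← sdiff_union_inter Γ box, ← sdiff_union_inter Γ' box, h4, h5, h6]
    subst e
    have hd : dbl (∅ : Set Space) = ∅ := by simp [dbl]
    rw [hd] at hv hv'
    have e1 : N = (N' \ cyl ∪ strand A 0) ∪ strand (pushFrame '' tent (5 / 4) 0) 1 := by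
      rw [← h3, union_assoc, ← h1, sdiff_union_inter]
    have e2 : N' = (N' \ cyl ∪ strand A 0) ∪ strand (pushFrame '' tent (5 / 4) 1) 1 := by
      rw [union_assoc, ← h2, sdiff_union_inter]
    rw [hv.eq_of_empty hW hm, hv'.eq_of_empty hW hm', e1]
    nth_rewrite 2 [e2]
    have hcyl : (N' \ cyl ∪ strand A 0) ∩ cyl = strand A 0 := by
      ext a
      constructor
      · rintro ⟨p | p, q⟩
        · exact absurd q p.2
        · exact p
      · exact fun p => ⟨Or.inr p, hAb p.1⟩
    have hz : ∀ T ⊆ box, T ∩ Γ = ∅ := fun T hT => by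
      rw [eq_empty_iff_forall_notMem]
      intro v hv
      have : v ∈ Γ ∩ box := ⟨hv.2, hT hv.1⟩
      rwa [h4] at this
    refine hW.inv (Iso.tent_strand_local (isPLHomeo_frame _ _ _ _) (by norm_num) (by norm_num)
      pushFrame_kite (fun t ht => pushFrame_tent_subset ht.2) (fun a ha hb => ?_) (fun t ht => ?_)
      (by rwa [← e2]))
    · rcases ha with ha | ha
      · exact absurd hb ha.2
      · rw [ha.2]; norm_num
    · rw [encard_over_strand hcyl (pushFrame_tent_subset ht.2),
        encard_over_strand hcyl (pushFrame_tent_subset le_rfl), hz _ (pushFrame_tent_subset ht.2),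
        hz _ (pushFrame_tent_subset le_rfl)]
      exact add_le_add encard_meet_le le_rfl

end MoveII

/-! ### A strand of the link beside a double point of the curve -/

section CrossTent

variable {N N' : Set Space} {Γ Γ' Γ₀ : Set Plane} {W : Set Space → Set Plane → ZMod 2} {m : ℕ∞}
  {v v' : ZMod 2} {h : ℝ}

/-- The coordinates for the double point of the two diagonals. -/
noncomputable def crossFrame : Plane ≃ₜ Plane := frame 0 (1 / 8, 1 / 8) (1 / 8, -1 / 8) (by norm_num)

theorem isPLHomeo_crossFrame : IsPLHomeo crossFrame := isPLHomeo_frame _ _ _ _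

theorem crossFrame_apply (s t : ℝ) : crossFrame (s, t) = ((s + t) / 8, (s - t) / 8) := by
  rw [crossFrame, frame_apply]; ext <;> simp only [Prod.fst_zero, Prod.snd_zero] <;> ring

theorem mem_crossFrame_image {S : Set Plane} {x y : ℝ} :
    (x, y) ∈ crossFrame '' S ↔ (4 * (x + y), 4 * (x - y)) ∈ S := by
  have e : crossFrame (4 * (x + y), 4 * (x - y)) = (x, y) := by
    rw [crossFrame_apply]; ext <;> simp only <;> ring
  conv_lhs => rw [← e]
  exact crossFrame.injective.mem_set_image

theorem mem_smooth_crossFrame {ψ : Plane ≃ₜ Plane} {x y : ℝ} (s : Bool) :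
    ψ (x, y) ∈ smooth (crossFrame.trans ψ) s Γ ↔
      (ψ (x, y) ∈ Γ ∧ ¬ ((4 * (x + y), 4 * (x - y)) : Plane) ∈ box) ∨
        ((4 * (x + y), 4 * (x - y)) : Plane) ∈ corner s := by
  rw [smooth, image_trans, image_trans, mem_union, mem_sdiff, ψ.injective.mem_set_image,
    ψ.injective.mem_set_image, mem_crossFrame_image, mem_crossFrame_image]

/-- A tent meets the smoothings of the diagonals at most twice, symmetrically. -/
theorem abs_eq_of_tent {x y t : ℝ} (hy : y = 1 / 2 * max 0 (t - |x|)) (s : Bool)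
    (h : (|x| = |y| ∧ ¬ ((4 * (x + y), 4 * (x - y)) : Plane) ∈ box) ∨
        ((4 * (x + y), 4 * (x - y)) : Plane) ∈ corner s) :
    |x| = if t ≤ 3 / 8 then (if s then 1 / 8 else t - 1 / 4) else t / 3 := by
  have hy0 : 0 ≤ y := by rw [hy]; positivity
  rcases h with ⟨h1, h2⟩ | h1
  · rw [abs_of_nonneg hy0] at h1
    have h3 : 1 / 8 < |x| := by
      by_contra! hc
      have := abs_le.1 hc
      exact h2 (mem_box.2 ⟨abs_le.2 ⟨by simp only; linarith, by simp only; linarith⟩,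
        abs_le.2 ⟨by simp only; linarith, by simp only; linarith⟩⟩)
    rcases max_cases 0 (t - |x|) with ⟨h4, h5⟩ | ⟨h4, h5⟩ <;> rw [h4] at hy
    · linarith
    · rw [if_neg (by linarith)]; linarith
  · cases s
    · obtain ⟨h2, h3⟩ := h1
      have e1 : |4 * (x + y) - 4 * (x - y)| = 8 * y := by
        rw [show 4 * (x + y) - 4 * (x - y) = 8 * y by ring, abs_of_nonneg (by linarith)]
      have e2 : |4 * (x + y) + 4 * (x - y)| = 8 * |x| := by
        rw [show 4 * (x + y) + 4 * (x - y) = 8 * x by ring, abs_mul, abs_of_pos (by norm_num)]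
      simp only at h2 h3
      rw [e1] at h2
      rw [e2] at h3
      rcases max_cases 0 (t - |x|) with ⟨h4, h5⟩ | ⟨h4, h5⟩ <;> rw [h4] at hy
      · linarith
      · rw [if_pos (by linarith)]
        simp only [Bool.false_eq_true, if_false]; linarith
    · obtain ⟨h2, h3⟩ := h1
      have e1 : |4 * (x + y) - 4 * (x - y)| = 8 * y := by
        rw [show 4 * (x + y) - 4 * (x - y) = 8 * y by ring, abs_of_nonneg (by linarith)]
      have e2 : |4 * (x + y) + 4 * (x - y)| = 8 * |x| := by
        rw [show 4 * (x + y) + 4 * (x - y) = 8 * x by ring, abs_mul, abs_of_pos (by norm_num)]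
      simp only at h2 h3
      rw [e1] at h3
      rw [e2] at h2
      have : t ≤ 3 / 8 := by
        have := le_max_right 0 (t - |x|)
        linarith
      rw [if_pos this]
      simp only [if_true]; linarith

theorem abs_le_of_mem_box {x y : ℝ} (hxy : ((4 * (x + y), 4 * (x - y)) : Plane) ∈ box) :
    |x| ≤ 1 / 4 ∧ |y| ≤ 1 / 4 := by
  have h1 := abs_le.1 (mem_box.1 hxy).1
  have h2 := abs_le.1 (mem_box.1 hxy).2
  simp only at h1 h2
  exact ⟨abs_le.2 ⟨by linarith, by linarith⟩, abs_le.2 ⟨by linarith, by linarith⟩⟩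

/-- A strand of the link that passes beside a double point of the curve is pulled to the middle between
the arcs of each smoothing. -/
theorem cross_tent {ψ : Plane ≃ₜ Plane} (hψ : IsPLHomeo ψ) (hW : Valuation m W)
    (hΓ : ∀ x y, |x| ≤ 1 → |y| ≤ 5 / 8 * (1 - |x|) → (ψ (x, y) ∈ Γ ↔ |x| = |y|))
    (hN : ∀ a ∈ N, ∀ x y, |x| ≤ 1 → |y| ≤ 5 / 8 * (1 - |x|) → a.1 ≠ ψ (x, y))
    (hm : overlayCr (N ∪ strand (ψ '' tent (1 / 2) 1) h) Γ ≤ m)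
    (hv : StateSum W (N ∪ strand (ψ '' tent (1 / 2) 1) h) Γ {ψ 0} v) :
    (∀ s, overlayCr (N ∪ strand (ψ '' tent (1 / 2) 0) h) (smooth (crossFrame.trans ψ) s Γ) ≤ m) ∧
    v = W (N ∪ strand (ψ '' tent (1 / 2) 0) h) (smooth (crossFrame.trans ψ) true Γ) +
      W (N ∪ strand (ψ '' tent (1 / 2) 0) h) (smooth (crossFrame.trans ψ) false Γ) := by
  have htent : ∀ t ≤ (1 : ℝ), ∀ x y, ((x, y) : Plane) ∈ tent (1 / 2) t →
      |x| ≤ 1 ∧ |y| ≤ 5 / 8 * (1 - |x|) := by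
    rintro t ht x y ⟨h1, h2⟩
    simp only at h1 h2
    refine ⟨h1, ?_⟩
    rcases max_cases 0 (t - |x|) with ⟨h4, h5⟩ | ⟨h4, h5⟩ <;> rw [h4] at h2
    · rw [h2]; norm_num; linarith
    · rw [abs_of_nonneg (by linarith)]; linarith
  have hN' : ∀ t ≤ (1 : ℝ), ∀ a ∈ N, a.1 ∉ ψ '' tent (1 / 2) t := by
    rintro t ht a ha ⟨⟨x, y⟩, hxy, he⟩
    obtain ⟨h1, h2⟩ := htent t ht x y hxy
    exact hN a ha x y h1 h2 he.symm
  have hchart : IsChart (crossFrame.trans ψ) (N ∪ strand (ψ '' tent (1 / 2) 1) h) Γ := by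
    refine ⟨isPLHomeo_crossFrame.trans hψ, ?_, ?_⟩
    · ext ⟨s, t⟩
      simp only [mem_inter_iff, mem_preimage, Homeomorph.trans_apply, crossFrame_apply, cross, mem_ofPred_eq]
      rw [and_comm]
      refine and_congr_right fun hb => ?_
      have h3 := abs_le_of_mem_box (x := (s + t) / 8) (y := (s - t) / 8) (by convert hb using 2 <;> ring)
      rw [hΓ _ _ (by linarith) (by linarith), abs_eq_abs]
      constructor
      · rintro (h4 | h4)
        · right; linarith
        · left; linarith
      · rintro (rfl | rfl)
        · right; ring
        · left; ring
    · rintro a ha hc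
      rw [image_trans] at hc
      obtain ⟨⟨x, y⟩, hxy, he⟩ := hc
      rw [mem_crossFrame_image] at hxy
      obtain ⟨h3, h4⟩ := abs_le_of_mem_box hxy
      rcases ha with ha | ha
      · exact hN a ha x y (by linarith) (by linarith) he.symm
      · have h5 := ha.1
        rw [← he, ψ.injective.mem_set_image] at h5
        obtain ⟨h6, h7⟩ := h5
        simp only at h6 h7
        rw [max_eq_right (by linarith)] at h7
        have h8 := abs_le.1 (mem_box.1 hxy).1
        have h9 := abs_le.1 (mem_box.1 hxy).2
        have := le_abs_self y
        simp only at h8 h9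
        rcases abs_cases x with ⟨e1, e2⟩ | ⟨e1, e2⟩ <;> rw [e1] at h7 <;> linarith
  have h0 : crossFrame.trans ψ 0 = ψ 0 := by
    rw [Homeomorph.trans_apply]
    congr 1
    change crossFrame (0, 0) = _
    rw [crossFrame_apply]; norm_num
  obtain ⟨v₁, v₂, rfl, k1, k2⟩ := hv.expand hW hm hchart (by rw [h0]; rfl) fun x hx _ => by rw [h0]; exact hx
  have hX : ({ψ 0} : Set Plane) \ {crossFrame.trans ψ 0} = ∅ := by rw [h0, Set.sdiff_self]
  rw [hX] at k1 k2
  have key : ∀ s, Iso m (N ∪ strand (ψ '' tent (1 / 2) 0) h) (smooth (crossFrame.trans ψ) s Γ)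
      (N ∪ strand (ψ '' tent (1 / 2) 1) h) (smooth (crossFrame.trans ψ) s Γ) := by
    intro s
    have hm' := (overlayCr_smooth hchart.free s Γ).trans_le hm
    refine Iso.tent_strand hψ (by norm_num) (ε := 1 / 8) (by norm_num) ?_ fun t ht => le_trans ?_ hm'
    · rintro a ha ⟨⟨x, y⟩, ⟨h1, h2⟩, he⟩
      simp only at h1 h2
      have hx : |x| < 1 := by nlinarith
      exact absurd he.symm (hN a ha x y hx.le (abs_le.2 ⟨by linarith, by linarith⟩))
    have hz : ∀ t ≤ (1 : ℝ), {a | a ∈ N ∧ a.1 ∈ ψ '' tent (1 / 2) t} = ∅ := fun t ht =>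
      eq_empty_iff_forall_notMem.2 fun a ha => hN' t ht a ha.1 ha.2
    rw [overlayCr_union_strand fun a ha h1 => absurd h1 (hN' t ht.2 a ha),
      overlayCr_union_strand fun a ha h1 => absurd h1 (hN' 1 le_rfl a ha), hz t ht.2, hz 1 le_rfl]
    refine add_le_add le_rfl (add_le_add le_rfl ?_)
    obtain ⟨κ, hκ⟩ : ∃ κ : ℝ, ∀ x y, ((x, y) : Plane) ∈ tent (1 / 2) t →
        ψ (x, y) ∈ smooth (crossFrame.trans ψ) s Γ → |x| = κ := by
      refine ⟨_, fun x y h1 h2 => abs_eq_of_tent h1.2 s ?_⟩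
      obtain ⟨h3, h4⟩ := htent t ht.2 x y h1
      rw [mem_smooth_crossFrame, hΓ x y h3 h4] at h2
      exact h2
    have h1 : ψ '' tent (1 / 2) t ∩ smooth (crossFrame.trans ψ) s Γ ⊆
        {ψ (κ, 1 / 2 * max 0 (t - |κ|)), ψ (-κ, 1 / 2 * max 0 (t - |-κ|))} := by
      rintro _ ⟨⟨⟨x, y⟩, h1, rfl⟩, h2⟩
      have h3 := h1.2
      simp only at h3
      rcases abs_choice x with h4 | h4 <;> rw [hκ x y h1 h2] at h4
      · left; rw [h3, h4]
      · right; rw [mem_singleton_iff, h3, h4, neg_neg]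
    have h2 : ({ψ (1 / 3, 1 / 3), ψ (-1 / 3, 1 / 3)} : Set Plane) ⊆
        ψ '' tent (1 / 2) 1 ∩ smooth (crossFrame.trans ψ) s Γ := by
      rintro _ (rfl | rfl)
      · refine ⟨⟨_, ⟨?_, ?_⟩, rfl⟩, (mem_smooth_crossFrame s).2 (Or.inl ⟨(hΓ _ _ ?_ ?_).2 ?_, ?_⟩)⟩ <;>
          norm_num [abs_of_pos, mem_box]
      · refine ⟨⟨_, ⟨?_, ?_⟩, rfl⟩, (mem_smooth_crossFrame s).2 (Or.inl ⟨(hΓ _ _ ?_ ?_).2 ?_, ?_⟩)⟩ <;>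
          norm_num [abs_of_neg, abs_of_pos, mem_box]
    calc _ ≤ _ := encard_le_encard h1
      _ ≤ 2 := (encard_insert_le _ _).trans (by rw [encard_singleton, one_add_one_eq_two])
      _ = ({ψ (1 / 3, 1 / 3), ψ (-1 / 3, 1 / 3)} : Set Plane).encard :=
        (encard_pair fun h => by have := congrArg Prod.fst (ψ.injective h); norm_num at this).symm
      _ ≤ _ := encard_le_encard h2
  refine ⟨fun s => (key s).overlay_left, ?_⟩
  rw [k1.eq_of_empty hW (key true).overlay_right, k2.eq_of_empty hW (key false).overlay_right,
    hW.inv (key true), hW.inv (key false)]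

end CrossTent

/-! ### Evaluation of a picture in a disc -/

section Evaluates

variable {A A' A₁ A₂ : Set Space} {B X B₁ B₂ X₁ X₂ : Set Plane} {L : List (Set Plane × Set Plane)}
  {φ : Plane ≃ₜ Plane}

/-- State sums over the pictures that agree in the disc with the strands `A` of the link and the part
`B` of the curve, with double points `X`, are sums of state sums over pictures with strands `A'`, one
for every pair in `L`. Such a pair consists of the part of the curve in the disc and its
double points there. -/
def Evaluates (A : Set Space) (B X : Set Plane) (A' : Set Space) (L : List (Set Plane × Set Plane)) :
    Prop :=
  ∀ ⦃m : ℕ∞⦄ ⦃W : Set Space → Set Plane → ZMod 2⦄, Valuation m W →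
    ∀ ⦃N : Set Space⦄ ⦃Γ : Set Plane⦄ ⦃v : ZMod 2⦄, IsCompact N → N ∩ cyl = A → Γ ∩ box = B →
    overlayCr N Γ ≤ m → StateSum W N Γ X v →
    ∃ vs : List (ZMod 2), List.Forall₂ (fun q w => overlayCr (N \ cyl ∪ A') (Γ \ box ∪ q.1) ≤ m ∧
      StateSum W (N \ cyl ∪ A') (Γ \ box ∪ q.1) q.2 w) L vs ∧ v = vs.sum

theorem forall₂_right_unique {α β : Type*} {R : α → β → Prop} (h : ∀ a b b', R a b → R a b' → b = b') :
    ∀ {l : List α} {r r' : List β}, List.Forall₂ R l r → List.Forall₂ R l r' → r = r'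
  | _, _, _, .nil, .nil => rfl
  | _, _, _, .cons h1 t1, .cons h2 t2 => by rw [h _ _ _ h1 h2, forall₂_right_unique h t1 t2]

/-- Two pictures that are evaluated by the same list have the same state sum. -/
theorem Evaluates.eq (h : Evaluates A₁ B₁ X₁ A' L) (h' : Evaluates A₂ B₂ X₂ A' L) {m : ℕ∞}
    {W : Set Space → Set Plane → ZMod 2} (hW : Valuation m W) {N N' : Set Space} {Γ Γ' : Set Plane}
    {v v' : ZMod 2} (hN : IsCompact N) (hN' : IsCompact N') (h1 : N ∩ cyl = A₁) (h2 : N' ∩ cyl = A₂)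
    (h3 : N \ cyl = N' \ cyl) (h4 : Γ ∩ box = B₁) (h5 : Γ' ∩ box = B₂) (h6 : Γ \ box = Γ' \ box)
    (hm : overlayCr N Γ ≤ m) (hm' : overlayCr N' Γ' ≤ m) (hv : StateSum W N Γ X₁ v)
    (hv' : StateSum W N' Γ' X₂ v') : v = v' := by
  obtain ⟨vs, k1, rfl⟩ := h hW hN h1 h4 hm hv
  obtain ⟨vs', k2, rfl⟩ := h' hW hN' h2 h5 hm' hv'
  rw [← h3, ← h6] at k2
  rw [forall₂_right_unique (fun q w w' hw hw' => hw.2.unique hw'.2 hW hw.1) k1 k2]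

theorem liftH_image_cyl (hb : φ '' box = box) : liftH φ '' cyl = cyl := by
  ext a
  obtain ⟨b, rfl⟩ := (liftH φ).surjective a
  rw [(liftH φ).injective.mem_set_image]
  change b.1 ∈ box ↔ φ b.1 ∈ box
  conv_rhs => rw [← hb]
  exact φ.injective.mem_set_image.symm

theorem liftH_image_strand (S : Set Plane) (h : ℝ) : liftH φ '' strand S h = strand (φ '' S) h := by
  ext a
  obtain ⟨b, rfl⟩ := (liftH φ).surjective a
  rw [(liftH φ).injective.mem_set_image]
  change b.1 ∈ S ∧ b.2 = h ↔ φ b.1 ∈ φ '' S ∧ b.2 = h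
  rw [φ.injective.mem_set_image]

/-- Evaluation in other coordinates of the disc. -/
theorem Evaluates.image (h : Evaluates A B X A' L) (hφ : IsPLHomeo φ) (hb : φ '' box = box) :
    Evaluates (liftH φ '' A) (φ '' B) (φ '' X) (liftH φ '' A') (L.map fun q => (φ '' q.1, φ '' q.2)) := by
  intro m W hW N Γ v hN h1 h2 hm hv
  have hc := liftH_image_cyl hb
  set N₀ := (liftH φ).symm '' N with hN₀
  set Γ₀ := φ.symm '' Γ with hΓ₀
  have eN : liftH φ '' N₀ = N := by simp only [hN₀, image_image, Homeomorph.apply_symm_apply, image_id']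
  have eΓ : φ '' Γ₀ = Γ := by simp only [hΓ₀, image_image, Homeomorph.apply_symm_apply, image_id']
  have k1 : N₀ ∩ cyl = A := by
    refine (liftH φ).injective.image_injective ?_
    rw [image_inter (liftH φ).injective, eN, hc, h1]
  have k2 : Γ₀ ∩ box = B := by
    refine φ.injective.image_injective ?_
    rw [image_inter φ.injective, eΓ, hb, h2]
  rw [← eΓ] at hv hm
  obtain ⟨vs, k3, rfl⟩ := h (hW.comap hφ (covers_liftH hφ)) (hN.image (liftH φ).symm.continuous) k1 k2
    (by rw [overlayCr_symm hφ]; exact hm) (hv.comap hφ hm)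
  refine ⟨vs, List.forall₂_map_left_iff.2 (k3.imp ?_), rfl⟩
  rintro q w ⟨h5, h6⟩
  have e1 : liftH φ '' (N₀ \ cyl ∪ A') = N \ cyl ∪ liftH φ '' A' := by
    rw [image_union, image_sdiff (liftH φ).injective, eN, hc]
  have e2 : φ '' (Γ₀ \ box ∪ q.1) = Γ \ box ∪ φ '' q.1 := by
    rw [image_union, image_sdiff φ.injective, eΓ, hb]
  refine ⟨by rwa [← e1, ← e2, Covers.overlayCr (covers_liftH hφ) φ.injective], ?_⟩
  have := h6.map (W' := W) hφ (N' := N \ cyl ∪ liftH φ '' A')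
    (by rw [← e1]; rintro _ ⟨b, hb, rfl⟩; exact ⟨b, hb, rfl⟩) h5 fun C _ => by rw [← e1]
  rwa [e2] at this

end Evaluates

/-! ### Simple cases of the third move -/

section Triangle

/-- The first diagonal of the square. -/
def rising : Set Plane := segment ℝ (-1, -1) (1, 1)

/-- The second diagonal of the square. -/
def falling : Set Plane := segment ℝ (1, -1) (-1, 1)

theorem mem_rising {x y : ℝ} : ((x, y) : Plane) ∈ rising ↔ |x| ≤ 1 ∧ y = x := by
  rw [rising, mem_segment_plane, abs_le]
  constructor
  · rintro ⟨θ, t0, t1, t2, t3⟩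
    refine ⟨⟨?_, ?_⟩, ?_⟩ <;> simp only at t2 t3 <;> linarith
  · rintro ⟨⟨h1, h2⟩, rfl⟩
    exact ⟨(y + 1) / 2, by linarith, by linarith, by ring, by ring⟩

theorem mem_falling {x y : ℝ} : ((x, y) : Plane) ∈ falling ↔ |x| ≤ 1 ∧ y = -x := by
  rw [falling, mem_segment_plane, abs_le]
  constructor
  · rintro ⟨θ, t0, t1, t2, t3⟩
    refine ⟨⟨?_, ?_⟩, ?_⟩ <;> simp only at t2 t3 <;> linarith
  · rintro ⟨⟨h1, h2⟩, rfl⟩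
    exact ⟨(1 - x) / 2, by linarith, by linarith, by ring, by ring⟩

theorem rising_subset_box : rising ⊆ box := by
  refine segment_subset_box ?_ ?_ <;> norm_num [mem_box]

theorem falling_subset_box : falling ⊆ box := by
  refine segment_subset_box ?_ ?_ <;> norm_num [mem_box]

theorem tent_subset_box {c t : ℝ} (hc : 0 ≤ c) (hc1 : c ≤ 1) (ht : t ≤ 1) : tent c t ⊆ box := by
  rintro ⟨x, y⟩ ⟨h1, h2⟩
  simp only at h1 h2
  refine mem_box.2 ⟨h1, ?_⟩
  have h3 : max 0 (t - |x|) ≤ 1 := max_le zero_le_one (by linarith [abs_nonneg x])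
  have h4 := le_max_left 0 (t - |x|)
  simp only
  rw [h2, abs_of_nonneg (by positivity)]
  nlinarith

theorem kite_subset_box : kite (1 / 2) (1 / 8) ⊆ box := by
  rintro ⟨x, y⟩ ⟨h1, h2⟩
  simp only at h1 h2
  have h3 : |x| < 1 := by nlinarith
  have := abs_nonneg x
  exact mem_box.2 ⟨h3.le, abs_le.2 ⟨by simp only; linarith, by simp only; linarith⟩⟩

/-- A set that meets all tents in as many points. -/
def Steady (S : Set Plane) : Prop :=
  ∀ t ∈ Icc (0 : ℝ) 1, (S ∩ tent (1 / 2) t).encard = (S ∩ tent (1 / 2) 1).encard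

theorem steady_empty : Steady ∅ := fun t _ => by simp

/-- A diagonal meets each tent in one point. -/
theorem inter_tent_of_abs {S : Set Plane} {σ : ℝ} (hσ : |σ| = 1)
    (hS : ∀ x y, ((x, y) : Plane) ∈ S ↔ |x| ≤ 1 ∧ y = σ * x) {t : ℝ} (ht : t ∈ Icc (0 : ℝ) 1) :
    S ∩ tent (1 / 2) t = {(σ * (t / 3), t / 3)} := by
  have h1 : σ * σ = 1 := by rw [← abs_mul_abs_self, hσ, one_mul]
  obtain ⟨t0, t1⟩ := ht
  ext ⟨x, y⟩
  rw [mem_inter_iff, hS, mem_singleton_iff, Prod.mk.injEq]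
  constructor
  · rintro ⟨⟨h2, rfl⟩, -, h3⟩
    simp only at h3
    have h4 : |x| = σ * x := by
      have h5 : 0 ≤ σ * x := by rw [h3]; positivity
      rw [← abs_of_nonneg h5, abs_mul, hσ, one_mul]
    have h6 : σ * x = t / 3 := by
      rcases max_cases 0 (t - |x|) with ⟨e, h5⟩ | ⟨e, h5⟩ <;> rw [e] at h3 <;> linarith [abs_nonneg x]
    exact ⟨by rw [← h6, ← mul_assoc, h1, one_mul], h6⟩
  · rintro ⟨rfl, rfl⟩
    have h2 : |σ * (t / 3)| = t / 3 := by rw [abs_mul, hσ, one_mul, abs_of_nonneg (by positivity)]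
    refine ⟨⟨by rw [h2]; linarith, by rw [← mul_assoc, h1, one_mul]⟩, by simp only; rw [h2]; linarith, ?_⟩
    simp only
    rw [h2, max_eq_right (by linarith)]
    ring

theorem inter_tent_rising {t : ℝ} (ht : t ∈ Icc (0 : ℝ) 1) :
    rising ∩ tent (1 / 2) t = {(1 * (t / 3), t / 3)} :=
  inter_tent_of_abs (by norm_num) (fun x y => by rw [mem_rising, one_mul]) ht

theorem inter_tent_falling {t : ℝ} (ht : t ∈ Icc (0 : ℝ) 1) :
    falling ∩ tent (1 / 2) t = {(-1 * (t / 3), t / 3)} :=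
  inter_tent_of_abs (by norm_num) (fun x y => by rw [mem_falling, neg_one_mul]) ht

theorem steady_rising : Steady rising := fun t ht => by
  rw [inter_tent_rising ht, inter_tent_rising ⟨zero_le_one, le_rfl⟩, encard_singleton, encard_singleton]

theorem steady_falling : Steady falling := fun t ht => by
  rw [inter_tent_falling ht, inter_tent_falling ⟨zero_le_one, le_rfl⟩, encard_singleton, encard_singleton]

variable {A B C : Set Plane}

theorem encard_over_strands {N : Set Space} {T : Set Plane} (hT : T ⊆ box) :
    {a | a ∈ N \ cyl ∪ (strand A 0 ∪ strand B 1) ∧ a.1 ∈ T}.encard = (A ∩ T).encard + (B ∩ T).encard := by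
  have : {a | a ∈ N \ cyl ∪ (strand A 0 ∪ strand B 1) ∧ a.1 ∈ T} =
      (fun x => ((x, 0) : Space)) '' (A ∩ T) ∪ (fun x => ((x, 1) : Space)) '' (B ∩ T) := by
    ext a
    constructor
    · rintro ⟨h1 | h1 | h1, h2⟩
      · exact absurd (hT h2) h1.2
      · exact Or.inl ⟨a.1, ⟨h1.1, h2⟩, Prod.ext rfl h1.2.symm⟩
      · exact Or.inr ⟨a.1, ⟨h1.1, h2⟩, Prod.ext rfl h1.2.symm⟩
    · rintro (⟨x, ⟨h1, h2⟩, rfl⟩ | ⟨x, ⟨h1, h2⟩, rfl⟩)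
      · exact ⟨Or.inr (Or.inl ⟨h1, rfl⟩), h2⟩
      · exact ⟨Or.inr (Or.inr ⟨h1, rfl⟩), h2⟩
  rw [this, encard_union_eq, Function.Injective.encard_image, Function.Injective.encard_image]
  · exact fun a b hab => congrArg Prod.fst hab
  · exact fun a b hab => congrArg Prod.fst hab
  · rw [disjoint_left]
    rintro _ ⟨x, -, rfl⟩ ⟨y, -, h⟩
    exact one_ne_zero (congrArg Prod.snd h)

/-- The third move if the top strand belongs to the link and the curve has no double point in the disc. -/
theorem evaluates_strand (sA : Steady A) (sB : Steady B) (sC : Steady C) :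
    Evaluates ((strand A 0 ∪ strand B 1) ∪ strand (tent (1 / 2) 1) 2) C ∅
      ((strand A 0 ∪ strand B 1) ∪ strand (tent (1 / 2) 0) 2) [(C, ∅)] := by
  intro m W hW N Γ v hN h1 h2 hm hv
  have hT : ∀ t ∈ Icc (0 : ℝ) 1, tent (1 / 2) t ⊆ box := fun t ht =>
    tent_subset_box (by norm_num) (by norm_num) ht.2
  have eN : N = (N \ cyl ∪ (strand A 0 ∪ strand B 1)) ∪ strand (tent (1 / 2) 1) 2 := by
    rw [union_assoc, ← h1, sdiff_union_inter]
  have eΓ : Γ \ box ∪ C = Γ := by rw [← h2, sdiff_union_inter]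
  have hi : ∀ T ⊆ box, T ∩ Γ = C ∩ T := fun T hT => by
    rw [← h2, inter_assoc, inter_eq_right.2 hT, inter_comm]
  have key : Iso m ((N \ cyl ∪ (strand A 0 ∪ strand B 1)) ∪ strand (tent (1 / 2) 0) 2) Γ
      ((N \ cyl ∪ (strand A 0 ∪ strand B 1)) ∪ strand (tent (1 / 2) 1) 2) Γ := by
    have := Iso.tent_strand_local (e := Homeomorph.refl Plane) (c := 1 / 2) (ε := 1 / 8) (h := 2) (m := m)
      (N := N \ cyl ∪ (strand A 0 ∪ strand B 1)) (Γ := Γ) isPLHomeo_refl (by norm_num) (by norm_num)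
    simp only [Homeomorph.refl_apply, id, image_id'] at this
    refine this kite_subset_box hT ?_ (fun t ht => ?_) (by rwa [← eN])
    · rintro a (ha | ha | ha) hb
      · exact absurd hb ha.2
      · rw [ha.2]; norm_num
      · rw [ha.2]; norm_num
    · have h1' : (1 : ℝ) ∈ Icc (0 : ℝ) 1 := ⟨zero_le_one, le_rfl⟩
      rw [encard_over_strands (hT t ht), encard_over_strands (hT 1 h1'), hi _ (hT t ht),
        hi _ (hT 1 h1'), sA t ht, sB t ht, sC t ht]
  refine ⟨[v], .cons ?_ .nil, by simp⟩
  have e : W N Γ = W ((N \ cyl ∪ (strand A 0 ∪ strand B 1)) ∪ strand (tent (1 / 2) 0) 2) Γ := by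
    rw [hW.inv key, ← eN]
  rw [eΓ, ← union_assoc, hv.eq_of_empty hW hm, e]
  exact ⟨key.overlay_left, stateSum_empty⟩

/-- The third move if only the top strand belongs to the curve. -/
theorem evaluates_curve (sA : Steady A) (sB : Steady B) :
    Evaluates (strand A 0 ∪ strand B 1) (tent (1 / 2) 1) ∅ (strand A 0 ∪ strand B 1)
      [(tent (1 / 2) 0, ∅)] := by
  intro m W hW N Γ v hN h1 h2 hm hv
  have hT : ∀ t ∈ Icc (0 : ℝ) 1, tent (1 / 2) t ⊆ box := fun t ht =>
    tent_subset_box (by norm_num) (by norm_num) ht.2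
  have eN : N \ cyl ∪ (strand A 0 ∪ strand B 1) = N := by rw [← h1, sdiff_union_inter]
  have eΓ : Γ = Γ \ box ∪ tent (1 / 2) 1 := by rw [← h2, sdiff_union_inter]
  have key : Iso m N (Γ \ box ∪ tent (1 / 2) 0) N (Γ \ box ∪ tent (1 / 2) 1) := by
    have := Iso.tent_curve_local (e := Homeomorph.refl Plane) (c := 1 / 2) (ε := 1 / 8) (m := m)
      (N := N) (Γ₀ := Γ \ box) isPLHomeo_refl (by norm_num) (by norm_num)
    simp only [Homeomorph.refl_apply, id, image_id'] at this
    refine this kite_subset_box hT (fun v hb hv => hv.2 hb) (fun t ht => ?_) (by rwa [← eΓ])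
    have h1' : (1 : ℝ) ∈ Icc (0 : ℝ) 1 := ⟨zero_le_one, le_rfl⟩
    rw [← eN, encard_over_strands (hT t ht), encard_over_strands (hT 1 h1'),
      sA t ht, sB t ht]
  refine ⟨[v], .cons ?_ .nil, by simp⟩
  have e : W N Γ = W N (Γ \ box ∪ tent (1 / 2) 0) := by rw [hW.inv key, ← eΓ]
  rw [eN, hv.eq_of_empty hW hm, e]
  exact ⟨key.overlay_left, stateSum_empty⟩

theorem smooth_union {φ : Plane ≃ₜ Plane} (h : φ '' box ⊆ box) (s : Bool) {Γ B : Set Plane} :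
    smooth φ s (Γ \ box ∪ B) = Γ \ box ∪ smooth φ s B := by
  rw [smooth, smooth, union_sdiff_distrib, union_assoc]
  congr 1
  exact sdiff_eq_left.2 (disjoint_left.2 fun v hv hc => hv.2 (h hc))

/-- The third move in coordinates in which the two strands of the curve are the diagonals. -/
theorem evaluates_cross {ψ : Plane ≃ₜ Plane} (hψ : IsPLHomeo ψ) {N₀ : Set Space} {h : ℝ}
    (hbox : ∀ x y, |x| ≤ 1 → |y| ≤ 5 / 8 * (1 - |x|) → ψ (x, y) ∈ box)
    (hB : ∀ x y, |x| ≤ 1 → |y| ≤ 5 / 8 * (1 - |x|) → (ψ (x, y) ∈ B ↔ |x| = |y|))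
    (hN₀ : ∀ a ∈ N₀, ∀ x y, |x| ≤ 1 → |y| ≤ 5 / 8 * (1 - |x|) → a.1 ≠ ψ (x, y)) :
    Evaluates (N₀ ∪ strand (ψ '' tent (1 / 2) 1) h) B {ψ 0} (N₀ ∪ strand (ψ '' tent (1 / 2) 0) h)
      [(smooth (crossFrame.trans ψ) true B, ∅), (smooth (crossFrame.trans ψ) false B, ∅)] := by
  intro m W hW N Γ v hN h1 h2 hm hv
  have eN : N = (N \ cyl ∪ N₀) ∪ strand (ψ '' tent (1 / 2) 1) h := by
    rw [union_assoc, ← h1, sdiff_union_inter]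
  have eΓ : Γ \ box ∪ B = Γ := by rw [← h2, sdiff_union_inter]
  have hsub : crossFrame.trans ψ '' box ⊆ box := by
    rw [image_trans]
    rintro _ ⟨⟨x, y⟩, hxy, rfl⟩
    obtain ⟨h3, h4⟩ := abs_le_of_mem_box (mem_crossFrame_image.1 hxy)
    exact hbox x y (by linarith) (by linarith)
  rw [eN] at hm hv
  obtain ⟨k1, k2⟩ := cross_tent hψ hW (fun x y hx hy => by
      rw [← hB x y hx hy, ← h2]
      exact ⟨fun h => ⟨h, hbox x y hx hy⟩, fun h => h.1⟩) (fun a ha x y hx hy => by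
      rcases ha with ha | ha
      · exact fun hc => ha.2 (show a.1 ∈ box by rw [hc]; exact hbox x y hx hy)
      · exact hN₀ a ha x y hx hy) hm hv
  have e : ∀ s, Γ \ box ∪ smooth (crossFrame.trans ψ) s B = smooth (crossFrame.trans ψ) s Γ := fun s => by
    rw [← smooth_union hsub, eΓ]
  refine ⟨[_, _], .cons ⟨?_, stateSum_empty⟩ (.cons ⟨?_, stateSum_empty⟩ .nil), ?_⟩
  · rw [e, ← union_assoc]; exact k1 true
  · rw [e, ← union_assoc]; exact k1 false
  · rw [k2]; simp only [e, List.sum_cons, List.sum_nil, add_zero, union_assoc]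

/-- An evaluation may begin with an isotopy of the plane in the disc. -/
theorem Evaluates.planar {A A' : Set Space} {B X : Set Plane} {L : List (Set Plane × Set Plane)}
    (F : Isotopy Plane) (hF : ∀ v ∉ box, F 1 v = v)
    (h : Evaluates (liftH (F.homeo 1) '' A) (F 1 '' B) (F 1 '' X) A' L) : Evaluates A B X A' L := by
  intro m W hW N Γ v hN h1 h2 hm hv
  have hm' : overlayCr (liftH (F.homeo 1) '' N) (F 1 '' Γ) ≤ m :=
    (Covers.overlayCr (covers_liftH (F.isPLHomeo_homeo 1)) (F.homeo 1).injective N Γ).trans_le hm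
  have e1 : F.homeo 1 '' boxᶜ = boxᶜ := (image_congr (g := id) fun v hv => hF v hv).trans (image_id _)
  have hb : F.homeo 1 '' box = box := by
    rw [← compl_compl box, image_compl_eq (F.homeo 1).bijective, e1]
  have hc : liftH (F.homeo 1) '' cyl = cyl := liftH_image_cyl hb
  have e2 : liftH (F.homeo 1) '' N \ cyl = N \ cyl := by
    conv_lhs => rw [← hc, ← image_sdiff (liftH (F.homeo 1)).injective]
    have (a) (ha : a ∈ N \ cyl) : liftH (F.homeo 1) a = id a :=
      Prod.ext (show F 1 a.1 = a.1 from hF a.1 ha.2) rfl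
    rw [image_congr this, image_id]
  have e3 : F.homeo 1 '' Γ \ box = Γ \ box := by
    conv_lhs => rw [← hb, ← image_sdiff (F.homeo 1).injective]
    exact (image_congr (g := id) (s := Γ \ box) fun a ha => hF a ha.2).trans (image_id _)
  have := h hW (hN.image (liftH (F.homeo 1)).continuous)
    (by rw [← h1, image_inter (liftH (F.homeo 1)).injective, hc])
    (show F.homeo 1 '' Γ ∩ box = F.homeo 1 '' B by rw [← h2, image_inter (F.homeo 1).injective, hb]) hm'
    (hv.planar hW hm hN F)
  rwa [e2, e3] at this

end Triangle

/-! ### The third move with the top strand and another strand on the curve -/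

section Slide

/-- The coordinates in which the first diagonal is vertical and points down. -/
noncomputable def tilt : Plane ≃ₜ Plane := frame 0 (1 / 2, -1 / 2) (-1 / 2, -1 / 2) (by norm_num)

theorem tilt_apply (q y : ℝ) : tilt (q, y) = ((q - y) / 2, (-q - y) / 2) := by
  rw [tilt, frame_apply]; ext <;> simp only [Prod.fst_zero, Prod.snd_zero] <;> ring

/-- The coordinates in which the first diagonal and the horizontal line are the diagonals. -/
noncomputable def skew : Plane ≃ₜ Plane := frame 0 (1 / 2, -1 / 2) (-3 / 2, -1 / 2) (by norm_num)

theorem skew_apply (x y : ℝ) : skew (x, y) = ((x - 3 * y) / 2, (-x - y) / 2) := by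
  rw [skew, frame_apply]; ext <;> simp only [Prod.fst_zero, Prod.snd_zero] <;> ring

theorem isPLHomeo_skew : IsPLHomeo skew := isPLHomeo_frame _ _ _ _

/-- The ends of the second diagonal. -/
def fallingEnds : Set Plane := {v | v ∈ falling ∧ 1 / 2 < |v.1|}

/-- How far points are pushed along the first diagonal. -/
noncomputable def slideDist (q : ℝ) : ℝ := min (2 * q + 2) ((2 - 2 * q) / 3)

theorem forall_tilt {P : Plane → Prop} (h : ∀ q y, P (tilt (q, y))) (v : Plane) : P v := by
  obtain ⟨⟨q, y⟩, rfl⟩ := tilt.surjective v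
  exact h q y

theorem tilt_mem_falling {q y : ℝ} : tilt (q, y) ∈ falling ↔ |q| ≤ 2 ∧ y = 0 := by
  rw [tilt_apply, mem_falling, abs_le, abs_le]
  constructor
  · rintro ⟨⟨h1, h2⟩, h3⟩; exact ⟨⟨by linarith, by linarith⟩, by linarith⟩
  · rintro ⟨⟨h1, h2⟩, rfl⟩; exact ⟨⟨by linarith, by linarith⟩, by linarith⟩

theorem tilt_mem_rising {q y : ℝ} : tilt (q, y) ∈ rising ↔ |y| ≤ 2 ∧ q = 0 := by
  rw [tilt_apply, mem_rising, abs_le, abs_le]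
  constructor
  · rintro ⟨⟨h1, h2⟩, h3⟩; exact ⟨⟨by linarith, by linarith⟩, by linarith⟩
  · rintro ⟨⟨h1, h2⟩, rfl⟩; exact ⟨⟨by linarith, by linarith⟩, by linarith⟩

theorem tilt_mem_box {q y : ℝ} (h : |q| + |y| ≤ 2) : tilt (q, y) ∈ box := by
  rw [tilt_apply]
  have h1 := le_abs_self q
  have h2 := neg_abs_le q
  have h3 := le_abs_self y
  have h4 := neg_abs_le y
  exact mem_box.2 ⟨abs_le.2 ⟨by simp only; linarith, by simp only; linarith⟩,
    abs_le.2 ⟨by simp only; linarith, by simp only; linarith⟩⟩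

theorem tilt_mem_tent_one {q y : ℝ} :
    tilt (q, y) ∈ tent (1 / 2) 1 ↔ |q| ≤ 1 ∧ y = -q - slideDist q := by
  rw [tilt_apply, slideDist]
  constructor
  · rintro ⟨h1, h2⟩
    simp only at h1 h2
    rw [max_eq_right (by linarith)] at h2
    rw [abs_le]
    rcases abs_cases ((q - y) / 2) with ⟨e, h3⟩ | ⟨e, h3⟩ <;> rw [e] at h1 h2
    · refine ⟨⟨by linarith, by linarith⟩, ?_⟩
      rw [min_eq_right (by linarith)]; linarith
    · refine ⟨⟨by linarith, by linarith⟩, ?_⟩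
      rw [min_eq_left (by linarith)]; linarith
  · rintro ⟨h1, rfl⟩
    obtain ⟨h1, h2⟩ := abs_le.1 h1
    have h3 : |(q - (-q - min (2 * q + 2) ((2 - 2 * q) / 3))) / 2| ≤ 1 ∧
        |(q - (-q - min (2 * q + 2) ((2 - 2 * q) / 3))) / 2| =
          1 - min (2 * q + 2) ((2 - 2 * q) / 3) := by
      rcases min_cases (2 * q + 2) ((2 - 2 * q) / 3) with ⟨e, h4⟩ | ⟨e, h4⟩ <;> rw [e]
      · rw [abs_of_nonpos (by linarith)]; constructor <;> linarith
      · rw [abs_of_nonneg (by linarith)]; constructor <;> linarith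
    refine ⟨h3.1, ?_⟩
    simp only
    rw [h3.2, max_eq_right (by linarith [h3.1])]
    ring

theorem tilt_mem_tent_zero {q y : ℝ} : tilt (q, y) ∈ tent (1 / 2) 0 ↔ |q| ≤ 1 ∧ y = -q := by
  rw [tilt_apply]
  constructor
  · rintro ⟨h1, h2⟩
    simp only at h1 h2
    rw [max_eq_left (by linarith [abs_nonneg ((q - y) / 2)])] at h2
    obtain rfl : y = -q := by linarith
    rw [show (q - -q) / 2 = q by ring] at h1
    exact ⟨h1, rfl⟩
  · rintro ⟨h1, rfl⟩
    refine ⟨by simp only; rwa [show (q - -q) / 2 = q by ring], ?_⟩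
    simp only
    rw [max_eq_left (by linarith [abs_nonneg ((q - -q) / 2)])]
    ring

theorem tilt_eq_skew (q y : ℝ) : tilt (q, y) = skew (q + y / 2, y / 2) := by
  rw [tilt_apply, skew_apply]; ext <;> simp only <;> ring

theorem tilt_mem_fallingEnds {q y : ℝ} : tilt (q, y) ∈ fallingEnds ↔ (1 < |q| ∧ |q| ≤ 2) ∧ y = 0 := by
  rw [fallingEnds, mem_ofPred_eq, tilt_mem_falling, tilt_apply]
  constructor
  · rintro ⟨⟨h1, rfl⟩, h2⟩
    simp only [sub_zero, abs_div, abs_two] at h2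
    exact ⟨⟨by linarith, h1⟩, rfl⟩
  · rintro ⟨⟨h1, h2⟩, rfl⟩
    refine ⟨⟨h2, rfl⟩, ?_⟩
    simp only [sub_zero, abs_div, abs_two]
    linarith

/-- The image of the second diagonal under the push. -/
theorem falling_slide {q y : ℝ} : (|q| ≤ 2 ∧ y = max 0 (slideDist q)) ↔
    tilt (q, y) ∈ fallingEnds ∪ skew '' tent (1 / 2) 1 := by
  rw [mem_union, tilt_mem_fallingEnds, tilt_eq_skew, skew.injective.mem_set_image, slideDist]
  constructor
  · rintro ⟨h1, h2⟩
    by_cases h3 : 1 < |q|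
    · refine Or.inl ⟨⟨h3, h1⟩, ?_⟩
      rw [h2]
      rcases abs_cases q with ⟨e, -⟩ | ⟨e, -⟩ <;> rw [e] at h3
      · exact max_eq_left ((min_le_right _ _).trans (by linarith))
      · exact max_eq_left ((min_le_left _ _).trans (by linarith))
    · obtain ⟨h4, h5⟩ := abs_le.1 (not_lt.1 h3)
      right
      rcases min_cases (2 * q + 2) ((2 - 2 * q) / 3) with ⟨e, h6⟩ | ⟨e, h6⟩ <;>
        rw [e, max_eq_right (by linarith)] at h2
      · have h7 : |q + y / 2| = -(q + y / 2) := abs_of_nonpos (by linarith)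
        refine ⟨by simp only; rw [h7]; linarith, ?_⟩
        simp only
        rw [h7, max_eq_right (by linarith)]; linarith
      · have h7 : |q + y / 2| = q + y / 2 := abs_of_nonneg (by linarith)
        refine ⟨by simp only; rw [h7]; linarith, ?_⟩
        simp only
        rw [h7, max_eq_right (by linarith)]; linarith
  · rintro (⟨⟨h1, h2⟩, rfl⟩ | ⟨h1, h2⟩)
    · refine ⟨h2, ?_⟩
      rcases abs_cases q with ⟨e, -⟩ | ⟨e, -⟩ <;> rw [e] at h1
      · exact (max_eq_left ((min_le_right _ _).trans (by linarith))).symm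
      · exact (max_eq_left ((min_le_left _ _).trans (by linarith))).symm
    · simp only at h1 h2
      rw [max_eq_right (by linarith)] at h2
      rcases abs_cases (q + y / 2) with ⟨e, h3⟩ | ⟨e, h3⟩ <;> rw [e] at h1 h2
      · refine ⟨abs_le.2 ⟨by linarith, by linarith⟩, ?_⟩
        rw [min_eq_right (by linarith), max_eq_right (by linarith)]; linarith
      · refine ⟨abs_le.2 ⟨by linarith, by linarith⟩, ?_⟩
        rw [min_eq_left (by linarith), max_eq_right (by linarith)]; linarith

/-- The top strand is straightened by a push along the first diagonal. -/
theorem exists_slide : ∃ F : Isotopy Plane, (∀ v ∉ box, F 1 v = v) ∧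
    F 1 '' falling = fallingEnds ∪ skew '' tent (1 / 2) 1 ∧
    F 1 '' (rising ∪ tent (1 / 2) 1) = rising ∪ tent (1 / 2) 0 ∧ F 1 (1 / 3, 1 / 3) = 0 := by
  have hD : ∀ q, 0 < slideDist q → |q| ≤ 1 := fun q h =>
    abs_le.2 ⟨by linarith [(lt_min_iff.1 h).1], by linarith [(lt_min_iff.1 h).2]⟩
  have hD1 : ∀ q, slideDist q ≤ 4 := fun q => by
    rw [slideDist, min_le_iff]
    rcases le_total q 0 with h | h
    · left; linarith
    · right; linarith
  obtain ⟨F, k1, k2, k3⟩ := exists_push (B := ℝ) (k := 2) (by norm_num)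
    (d := fun q => min (slideDist q.2) (4 * q.1)) (l := fun q => -(2 - |q|)) (u := fun q => 2 - |q|)
    (by
      have : IsPL fun q : ℝ × ℝ => (2 - 2 * q.2) / 3 := by simp only [div_eq_inv_mul]; fun_prop
      unfold slideDist; fun_prop) (by fun_prop) (by fun_prop) (fun q => by simp)
    ⟨Metric.closedBall 0 2, isCompact_closedBall 0 2, fun t q y h1 h2 h3 => by
      have h4 := hD q (lt_min_iff.1 h1).1
      rw [mem_closedBall_zero_iff, Prod.norm_def, Real.norm_eq_abs, Real.norm_eq_abs]
      have := abs_nonneg q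
      exact max_le (by linarith) (abs_le.2 ⟨by linarith, by linarith⟩)⟩
  have hd1 : ∀ q, min (slideDist q) (4 * (1 : ℝ)) = slideDist q := fun q => min_eq_left (by linarith [hD1 q])
  set G := F.conj tilt (isPLHomeo_frame _ _ _ _)
  have hG : ∀ q y, G 1 (tilt (q, y)) = tilt (F 1 (q, y)) := fun q y => by
    change tilt (F 1 (tilt.symm (tilt (q, y)))) = _
    rw [tilt.symm_apply_apply]
  -- the push is a full translation on the second diagonal and on the top strand
  have hfall : ∀ q, |q| ≤ 2 → G 1 (tilt (q, 0)) = tilt (q, max 0 (slideDist q)) := fun q hq => by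
    rw [hG]
    by_cases h : slideDist q ≤ 0
    · rw [k3 1 q 0 (Or.inl (by simp only; rwa [hd1])), max_eq_left h]
    · push Not at h
      have h1 := hD q h
      have h2 := lt_min_iff.1 h
      rw [k2 1 q 0, hd1, zero_add]
      · simp only; rw [hd1]; linarith [min_le_left (2 * q + 2) ((2 - 2 * q) / 3),
          min_le_right (2 * q + 2) ((2 - 2 * q) / 3), show slideDist q = min (2 * q + 2) ((2 - 2 * q) / 3) from rfl]
      · simp only; rw [hd1]
        rcases abs_cases q with ⟨e, h3⟩ | ⟨e, h3⟩ <;> rw [e] <;>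
        linarith [min_le_left (2 * q + 2) ((2 - 2 * q) / 3),
          min_le_right (2 * q + 2) ((2 - 2 * q) / 3), show slideDist q = min (2 * q + 2) ((2 - 2 * q) / 3) from rfl]
  have htent : ∀ q, |q| ≤ 1 → G 1 (tilt (q, -q - slideDist q)) = tilt (q, -q) := fun q hq => by
    obtain ⟨h1, h2⟩ := abs_le.1 hq
    have h0 : 0 ≤ slideDist q := le_min (by linarith) (by linarith)
    have h3 := min_le_left (2 * q + 2) ((2 - 2 * q) / 3)
    have h4 := min_le_right (2 * q + 2) ((2 - 2 * q) / 3)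
    have h5 : slideDist q = min (2 * q + 2) ((2 - 2 * q) / 3) := rfl
    rw [hG, k2 1 q _, hd1, max_eq_right h0, sub_add_cancel]
    · simp only; rw [hd1]
      rcases abs_cases q with ⟨e, h3⟩ | ⟨e, h3⟩ <;> rw [e] <;> linarith
    · simp only; rw [hd1]
      rcases abs_cases q with ⟨e, h3⟩ | ⟨e, h3⟩ <;> rw [e] <;> linarith
  have hbox : ∀ v ∉ box, G 1 v = v := forall_tilt fun q y hv => by
    rw [hG, k3 1 q y]
    have : 2 < |q| + |y| := by
      by_contra! h
      exact hv (tilt_mem_box h)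
    rcases abs_cases y with ⟨e, -⟩ | ⟨e, -⟩ <;> rw [e] at this
    · exact Or.inr (Or.inr (by linarith))
    · exact Or.inr (Or.inl (by linarith))
  refine ⟨G, hbox, ?_, ?_, ?_⟩
  · ext v
    revert v
    refine forall_tilt fun q y => ?_
    rw [← falling_slide]
    constructor
    · rintro ⟨v, hv, he⟩
      revert hv he
      revert v
      refine forall_tilt fun q' y' hv he => ?_
      obtain ⟨h1, rfl⟩ := tilt_mem_falling.1 hv
      rw [hfall q' h1] at he
      obtain ⟨rfl, rfl⟩ := Prod.mk.injEq .. ▸ tilt.injective he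
      exact ⟨h1, rfl⟩
    · rintro ⟨h1, rfl⟩
      exact ⟨_, tilt_mem_falling.2 ⟨h1, rfl⟩, hfall q h1⟩
  · rw [image_union]
    congr 1
    · have hr : ∀ q y, tilt (q, y) ∈ rising ↔ tilt (q, y) ∈ box ∧ q = 0 := fun q y => by
        constructor
        · exact fun h => ⟨rising_subset_box h, (tilt_mem_rising.1 h).2⟩
        · rintro ⟨h, rfl⟩
          refine tilt_mem_rising.2 ⟨?_, rfl⟩
          rw [tilt_apply] at h
          have := abs_le.1 (mem_box.1 h).1
          simp only at this
          exact abs_le.2 ⟨by linarith, by linarith⟩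
      have hb : ∀ v, G 1 v ∈ box ↔ v ∈ box := fun v => by
        constructor
        · intro h; by_contra hc; rw [hbox v hc] at h; exact hc h
        · intro h; by_contra hc
          have := hbox _ hc
          have h2 := (G.homeo 1).injective this
          rw [h2] at hc
          exact hc h
      ext v
      obtain ⟨w, rfl⟩ : ∃ w, G 1 w = v := ⟨_, G.right_inv 1 v⟩
      rw [(G.homeo 1).injective.mem_set_image (f := G 1)]
      revert w
      refine forall_tilt fun q y => ?_
      have h1 : G 1 (tilt (q, y)) = tilt (q, (F 1 (q, y)).2) := by
        rw [hG]; congr 1; exact Prod.ext (k1 1 (q, y)) rfl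
      rw [hr, ← hb, h1, hr]
    · ext v
      revert v
      refine forall_tilt fun q y => ?_
      rw [tilt_mem_tent_zero]
      constructor
      · rintro ⟨v, hv, he⟩
        revert hv he
        revert v
        refine forall_tilt fun q' y' hv he => ?_
        obtain ⟨h1, rfl⟩ := tilt_mem_tent_one.1 hv
        rw [htent q' h1] at he
        obtain ⟨rfl, rfl⟩ := Prod.mk.injEq .. ▸ tilt.injective he
        exact ⟨h1, rfl⟩
      · rintro ⟨h1, rfl⟩
        exact ⟨_, tilt_mem_tent_one.2 ⟨h1, rfl⟩, htent q h1⟩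
  · have := htent 0 (by norm_num)
    rw [tilt_apply, tilt_apply, show slideDist 0 = 2 / 3 by rw [slideDist, min_eq_right] <;> norm_num] at this
    norm_num at this
    exact this

/-- The third move if the top strand and one other strand belong to the curve. -/
theorem evaluates_slide (h : ℝ) : Evaluates (strand falling h) (rising ∪ tent (1 / 2) 1) {(1 / 3, 1 / 3)}
    (strand falling h)
    [(smooth (crossFrame.trans skew) true (rising ∪ tent (1 / 2) 0), ∅),
      (smooth (crossFrame.trans skew) false (rising ∪ tent (1 / 2) 0), ∅)] := by
  obtain ⟨F, k1, k2, k3, k4⟩ := exists_slide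
  have key := evaluates_cross (B := rising ∪ tent (1 / 2) 0) (N₀ := strand fallingEnds h) (h := h)
    isPLHomeo_skew (fun x y hx hy => by
      rw [skew_apply]
      have h1 := abs_le.1 hy
      refine mem_box.2 ⟨abs_le.2 ?_, abs_le.2 ?_⟩ <;> simp only <;>
      rcases abs_cases x with ⟨e, h3⟩ | ⟨e, h3⟩ <;> rw [e] at hx h1 <;> constructor <;> linarith)
    (fun x y hx hy => by
      have e : skew (x, y) = tilt (x - y, 2 * y) := by rw [tilt_eq_skew]; congr 2 <;> ring
      have h1 := abs_le.1 hy
      have hx' := abs_le.1 hx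
      rw [e, mem_union, tilt_mem_rising, tilt_mem_tent_zero, abs_eq_abs]
      constructor
      · rintro (⟨-, h2⟩ | ⟨-, h2⟩)
        · left; linarith
        · right; linarith
      · rintro (rfl | rfl)
        · refine Or.inl ⟨abs_le.2 ⟨?_, ?_⟩, by ring⟩ <;> linarith [abs_nonneg x]
        · refine Or.inr ⟨abs_le.2 ?_, by ring⟩
          rcases abs_cases (-y) with ⟨e, h3⟩ | ⟨e, h3⟩ <;> rw [e] at h1 <;> constructor <;> linarith)
    (fun a ha x y hx hy hc => by
      have e : skew (x, y) = tilt (x - y, 2 * y) := by rw [tilt_eq_skew]; congr 2 <;> ring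
      have h1 := ha.1
      rw [hc, e, tilt_mem_fallingEnds] at h1
      obtain ⟨⟨h2, -⟩, h3⟩ := h1
      obtain rfl : y = 0 := by linarith
      rw [sub_zero] at h2
      linarith)
  refine Evaluates.planar F k1 ?_
  have e0 : skew 0 = 0 := by
    change skew (0, 0) = _
    rw [skew_apply]; norm_num
  have e1 : liftH (F.homeo 1) '' strand falling h = strand fallingEnds h ∪ strand (skew '' tent (1 / 2) 1) h := by
    rw [liftH_image_strand, ← strand_union, ← k2]; rfl
  have e2 : strand falling h = strand fallingEnds h ∪ strand (skew '' tent (1 / 2) 0) h := by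
    rw [← strand_union]
    congr 1
    ext v
    revert v
    refine forall_tilt fun q y => ?_
    rw [mem_union, tilt_mem_falling, tilt_mem_fallingEnds, tilt_eq_skew, skew.injective.mem_set_image]
    constructor
    · rintro ⟨h1, rfl⟩
      by_cases h2 : 1 < |q|
      · exact Or.inl ⟨⟨h2, h1⟩, rfl⟩
      · refine Or.inr ⟨?_, ?_⟩
        · simp only [zero_div, add_zero]; exact not_lt.1 h2
        · simp only [zero_div, add_zero]
          rw [max_eq_left (by linarith [abs_nonneg q]), mul_zero]
    · rintro (⟨⟨-, h1⟩, rfl⟩ | ⟨h1, h2⟩)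
      · exact ⟨h1, rfl⟩
      · simp only at h1 h2
        rw [max_eq_left (by linarith [abs_nonneg (q + y / 2)]), mul_zero] at h2
        obtain rfl : y = 0 := by linarith
        rw [zero_div, add_zero] at h1
        exact ⟨by linarith, rfl⟩
  rw [e1, k3, image_singleton, k4]
  rw [e0, ← e2] at key
  exact key

end Slide

/-! ### The third move with all strands on the curve -/

section ThreeCurves

variable {N : Set Space} {Γ Γ₀ : Set Plane} {W : Set Space → Set Plane → ZMod 2} {m : ℕ∞} {v : ZMod 2}

theorem not_mem_pair {x y : ℝ} {p q : Plane} (h : x = p.1 → y = p.2 → False)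
    (h' : x = q.1 → y = q.2 → False) : ((x, y) : Plane) ∉ ({p, q} : Set Plane) := by
  rintro (rfl | rfl)
  · exact h rfl rfl
  · exact h' rfl rfl

set_option maxHeartbeats 1000000 in
/-- In the first smoothing of the double point of the diagonals the two arcs are pulled apart, up to the
remaining double points. -/
theorem part_path (hΓ : ∀ v ∈ box, v ∉ Γ₀) : PlanarMove (openBox \ {(1 / 3, -1 / 3), (-1 / 3, -1 / 3)})
    (Γ₀ ∪ ((poly [(-1, -1), (-1 / 3, -1 / 3), (-1 / 8, -1 / 8), (-1 / 8, 1 / 8), (-1, 1)] ∪ poly [(-1, 0), (-1 / 3, -1 / 3), (0, -1 / 2), (1 / 3, -1 / 3), (1, 0)]) ∪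
      poly [(1, 1), (1 / 8, 1 / 8), (1 / 8, -1 / 8), (1 / 3, -1 / 3), (1, -1)]))
    (Γ₀ ∪ ((poly [(1, 1), (1 / 3, -1 / 3), (1, -1)] ∪ poly [(-1, -1), (-1 / 3, -1 / 3), (-1, 1)]) ∪
      poly [(-1, 0), (-1 / 3, -1 / 3), (1 / 3, -1 / 3), (1, 0)])) := by
  have hΓ' : ∀ v ∈ openBox \ {(1 / 3, -1 / 3), (-1 / 3, -1 / 3)}, v ∉ Γ₀ :=
    fun v hv => hΓ v (openBox_subset_box hv.1)
  have e : ∀ A B C : Set Plane, Γ₀ ∪ ((A ∪ B) ∪ C) = Γ₀ ∪ ((C ∪ B) ∪ A) := fun A B C => by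
    rw [union_comm A, union_right_comm, union_comm C, union_right_comm B]
  have e' : ∀ A B C : Set Plane, Γ₀ ∪ ((A ∪ B) ∪ C) = Γ₀ ∪ ((A ∪ C) ∪ B) := fun A B C => by
    rw [union_right_comm A]
  refine .trans (poly_move [] hΓ' ?_ ?_) <|
    .trans (poly_move [] hΓ' ?_ ?_) ?_
  on_goal -1 =>
    rw [e (poly ((-1, -1) :: _))]
    refine .trans (poly_move [(-1, -1), (-1 / 3, -1 / 3)] hΓ' ?_ ?_) <|
      .trans (poly_move [(-1, -1)] hΓ' ?_ ?_) ?_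
  on_goal -1 =>
    simp only [List.nil_append, List.cons_append]
    rw [e' (poly ((1, 1) :: _))]
    refine (poly_move [(-1, 0)] hΓ' ?_ ?_)
  all_goals first
    | (intro x y α β γ hx hy hs h1 h2 h3 h4
       refine ⟨⟨⟨⟨by linarith, by linarith⟩, by linarith, by linarith⟩,
         not_mem_pair (fun _ _ => by linarith) fun _ _ => by linarith⟩, ?_, ?_, ?_⟩ <;> repeat' first
         | exact not_mem_poly_single
         | refine not_mem_poly_cons (fun θ t0 t1 t2 t3 => by linarith) ?_
         | refine not_mem_union ?_ ?_)
    | norm_num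

/-- In the second smoothing the top strand is pulled to the middle between the two arcs. -/
theorem middle_path (hΓ : ∀ v ∈ box, v ∉ Γ₀) : PlanarMove openBox
    (Γ₀ ∪ ((poly [(1, 1), (1 / 8, 1 / 8), (-1 / 8, 1 / 8), (-1, 1)] ∪ poly [(-1, -1), (-1 / 8, -1 / 8), (0, 0), (1 / 8, -1 / 8), (1, -1)]) ∪
      poly [(-1, 0), (-3 / 8, -5 / 16), (-17 / 48, -31 / 96), (0, 1 / 32), (17 / 48, -31 / 96), (3 / 8, -5 / 16), (1, 0)]))
    (Γ₀ ∪ ((poly [(1, 1), (1 / 8, 1 / 8), (-1 / 8, 1 / 8), (-1, 1)] ∪ poly [(-1, -1), (-1 / 8, -1 / 8), (1 / 8, -1 / 8), (1, -1)]) ∪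
      poly [(-1, 0), (1, 0)])) := by
  have hΓ' : ∀ v ∈ openBox, v ∉ Γ₀ := fun v hv => hΓ v (openBox_subset_box hv)
  have e : ∀ A B C : Set Plane, Γ₀ ∪ ((A ∪ B) ∪ C) = Γ₀ ∪ ((A ∪ C) ∪ B) := fun A B C => by
    rw [union_right_comm A]
  refine .trans (poly_move [(-1, 0), (-3 / 8, -5 / 16), (-17 / 48, -31 / 96)] hΓ' ?_ ?_) <|
    .trans (poly_move [(-1, 0), (-3 / 8, -5 / 16), (-17 / 48, -31 / 96)] hΓ' ?_ ?_) <|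
    .trans (poly_move [(-1, 0)] hΓ' ?_ ?_) <|
    .trans (poly_move [] hΓ' ?_ ?_) ?_
  on_goal -1 =>
    rw [e (poly ((1, 1) :: _)) (poly ((-1, -1) :: _))]
    refine .trans (poly_move [(-1, -1)] hΓ' ?_ ?_) ?_
  on_goal -1 =>
    simp only [List.nil_append, List.cons_append]
    rw [e (poly ((1, 1) :: _)) (poly ((-1, 0) :: _))]
    refine (poly_move [] hΓ' ?_ ?_)
  all_goals first
    | (intro x y α β γ hx hy hs h1 h2 h3 h4
       refine ⟨⟨⟨by linarith, by linarith⟩, by linarith, by linarith⟩, ?_, ?_, ?_⟩ <;> repeat' first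
         | exact not_mem_poly_single
         | refine not_mem_poly_cons (fun θ t0 t1 t2 t3 => by linarith) ?_
         | refine not_mem_union ?_ ?_)
    | norm_num

/-- A notch at the centre of the lower arc, which makes the bigon under the top strand standard. -/
theorem notch_path (hΓ : ∀ v ∈ box, v ∉ Γ₀) : PlanarMove (openBox \ {(1 / 3, -1 / 3), (-1 / 3, -1 / 3)})
    (Γ₀ ∪ ((poly [(1, 1), (1 / 8, 1 / 8), (-1 / 8, 1 / 8), (-1, 1)] ∪ poly [(-1, 0), (0, -1 / 2), (1, 0)]) ∪
      poly [(-1, -1), (-1 / 8, -1 / 8), (0, 0), (1 / 8, -1 / 8), (1, -1)]))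
    (Γ₀ ∪ ((poly [(1, 1), (1 / 8, 1 / 8), (-1 / 8, 1 / 8), (-1, 1)] ∪ poly [(-1, 0), (0, -1 / 2), (1, 0)]) ∪
      poly [(-1, -1), (-1 / 8, -1 / 8), (1 / 8, -1 / 8), (1, -1)])) := by
  have hΓ' : ∀ v ∈ openBox \ {(1 / 3, -1 / 3), (-1 / 3, -1 / 3)}, v ∉ Γ₀ :=
    fun v hv => hΓ v (openBox_subset_box hv.1)
  refine (poly_move [(-1, -1)] hΓ' ?_ ?_)
  all_goals first
    | (intro x y α β γ hx hy hs h1 h2 h3 h4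
       refine ⟨⟨⟨⟨by linarith, by linarith⟩, by linarith, by linarith⟩,
         not_mem_pair (fun _ _ => by linarith) fun _ _ => by linarith⟩, ?_, ?_, ?_⟩ <;> repeat' first
         | exact not_mem_poly_single
         | refine not_mem_poly_cons (fun θ t0 t1 t2 t3 => by linarith) ?_
         | refine not_mem_union ?_ ?_)
    | norm_num

end ThreeCurves

section ThreeCurves

variable {N : Set Space} {Γ Γ₀ : Set Plane} {W : Set Space → Set Plane → ZMod 2} {m : ℕ∞} {v : ZMod 2}

theorem image_segment_of {F : Plane → Plane} {p q p' q' : Plane}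
    (h : ∀ θ : ℝ, 0 ≤ θ → θ ≤ 1 → F ((1 - θ) * p.1 + θ * q.1, (1 - θ) * p.2 + θ * q.2) =
      ((1 - θ) * p'.1 + θ * q'.1, (1 - θ) * p'.2 + θ * q'.2)) :
    F '' segment ℝ p q = segment ℝ p' q' := by
  ext v
  constructor
  · rintro ⟨⟨x, y⟩, hw, rfl⟩
    obtain ⟨θ, h0, h1, h2, h3⟩ := mem_segment_plane.1 hw
    simp only at h2 h3
    rw [h2, h3, h θ h0 h1]
    exact mem_segment_plane.2 ⟨θ, h0, h1, rfl, rfl⟩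
  · intro hv
    obtain ⟨θ, h0, h1, h2, h3⟩ := mem_segment_plane.1 hv
    exact ⟨_, mem_segment_plane.2 ⟨θ, h0, h1, rfl, rfl⟩, by rw [h θ h0 h1, ← h2, ← h3]⟩

/-- Two arcs that touch the horizontal line from the right and from the left. -/
def touching : Set Plane :=
  poly [(1, 1), (1 / 3, 0), (1, -1)] ∪ poly [(-1, -1), (-1 / 3, 0), (-1, 1)] ∪
    poly [(-1, 0), (-1 / 3, 0), (1 / 3, 0), (1, 0)]

/-- An arc above and an arc below the horizontal line. -/
def separated : Set Plane :=
  poly [(1, 1), (1 / 8, 1 / 8), (-1 / 8, 1 / 8), (-1, 1)] ∪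
    poly [(-1, -1), (-1 / 8, -1 / 8), (1 / 8, -1 / 8), (1, -1)] ∪ poly [(-1, 0), (1, 0)]

theorem exists_rise : ∃ F : Isotopy Plane, (∀ v ∉ box, F 1 v = v) ∧
    F 1 '' ((poly [(1, 1), (1 / 3, -1 / 3), (1, -1)] ∪ poly [(-1, -1), (-1 / 3, -1 / 3), (-1, 1)]) ∪
      poly [(-1, 0), (-1 / 3, -1 / 3), (1 / 3, -1 / 3), (1, 0)]) = touching ∧
    F 1 (1 / 3, -1 / 3) = (1 / 3, 0) ∧ F 1 (-1 / 3, -1 / 3) = (-1 / 3, 0) := by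
  obtain ⟨F, k1, k2, k3⟩ := exists_push (B := ℝ) (k := 1) one_pos
    (d := fun q => min (min (1 / 3) ((1 - |q.2|) / 2)) q.1) (l := fun _ => -1) (u := fun _ => 1)
    (by
      have : IsPL fun q : ℝ × ℝ => (1 - |q.2|) / 2 := by simp only [div_eq_inv_mul]; fun_prop
      fun_prop) (by fun_prop) (by fun_prop) (fun q => by simp)
    ⟨box, isCompact_closedBall 0 1, fun t q y h1 h2 h3 => by
      have h4 := (lt_min_iff.1 (lt_min_iff.1 h1).1).2
      exact mem_box.2 ⟨by simp only; linarith, abs_le.2 ⟨h2.le, h3.le⟩⟩⟩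
  have hF : ∀ x y δ : ℝ, δ = min (1 / 3) ((1 - |x|) / 2) → 0 ≤ δ → δ ≤ y + 1 → 2 * δ ≤ 1 - y →
      F 1 (x, y) = (x, y + δ) := fun x y δ h1 h2 h3 h4 => by
    have h5 : min (min (1 / 3) ((1 - |x|) / 2)) 1 = δ := by
      rw [← h1, min_eq_left]
      rw [h1]
      exact (min_le_left _ _).trans (by norm_num)
    rw [k2 1 x y, h5, max_eq_right h2]
    · rw [h5]; linarith
    · rw [h5]; linarith
  have hmid : ∀ x y : ℝ, |x| ≤ 1 / 3 → -2 / 3 ≤ y → y ≤ 1 / 3 → F 1 (x, y) = (x, y + 1 / 3) :=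
    fun x y h1 h2 h3 => hF x y _ (min_eq_left (by linarith)).symm (by norm_num) (by linarith) (by linarith)
  have hr : ∀ x y : ℝ, 1 / 3 ≤ x → x ≤ 1 → y ≤ x → (1 - x) / 2 ≤ y + 1 →
      F 1 (x, y) = (x, y + (1 - x) / 2) := fun x y h1 h2 h3 h4 => by
    have e : |x| = x := abs_of_nonneg (by linarith)
    exact hF x y _ (by rw [e, min_eq_right (by linarith)]) (by linarith) h4 (by linarith)
  have hl : ∀ x y : ℝ, x ≤ -1 / 3 → -1 ≤ x → y ≤ -x → (1 + x) / 2 ≤ y + 1 →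
      F 1 (x, y) = (x, y + (1 + x) / 2) := fun x y h1 h2 h3 h4 => by
    have e : |x| = -x := abs_of_nonpos (by linarith)
    exact hF x y _ (by rw [e, sub_neg_eq_add, min_eq_right (by linarith)]) (by linarith) h4 (by linarith)
  refine ⟨F, fun v hv => k3 1 v.1 v.2 ?_, ?_, ?_, ?_⟩
  · by_cases hx : |v.1| ≤ 1
    · have hy : ¬ |v.2| ≤ 1 := fun hy => hv (mem_box.2 ⟨hx, hy⟩)
      rw [abs_le, not_and_or, not_le, not_le] at hy
      rcases hy with hy | hy
      · exact Or.inr (Or.inl hy.le)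
      · exact Or.inr (Or.inr hy.le)
    · exact Or.inl ((min_le_left _ _).trans ((min_le_right _ _).trans (by simp only; linarith)))
  · have hsr : ∀ p q : Plane, (1 / 3 ≤ p.1 ∧ p.1 ≤ 1 ∧ p.2 ≤ p.1 ∧ (1 - p.1) / 2 ≤ p.2 + 1) →
        (1 / 3 ≤ q.1 ∧ q.1 ≤ 1 ∧ q.2 ≤ q.1 ∧ (1 - q.1) / 2 ≤ q.2 + 1) →
        F 1 '' segment ℝ p q = segment ℝ (p.1, p.2 + (1 - p.1) / 2) (q.1, q.2 + (1 - q.1) / 2) :=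
      fun p q hp hq => image_segment_of fun θ h0 h1 => by
        rw [hr]
        · ext <;> simp only; ring
        all_goals nlinarith
    have hsl : ∀ p q : Plane, (p.1 ≤ -1 / 3 ∧ -1 ≤ p.1 ∧ p.2 ≤ -p.1 ∧ (1 + p.1) / 2 ≤ p.2 + 1) →
        (q.1 ≤ -1 / 3 ∧ -1 ≤ q.1 ∧ q.2 ≤ -q.1 ∧ (1 + q.1) / 2 ≤ q.2 + 1) →
        F 1 '' segment ℝ p q = segment ℝ (p.1, p.2 + (1 + p.1) / 2) (q.1, q.2 + (1 + q.1) / 2) :=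
      fun p q hp hq => image_segment_of fun θ h0 h1 => by
        rw [hl]
        · ext <;> simp only; ring
        all_goals nlinarith
    have hsm : F 1 '' segment ℝ (-1 / 3, -1 / 3) (1 / 3, -1 / 3) = segment ℝ (-1 / 3, 0) (1 / 3, 0) :=
      image_segment_of fun θ h0 h1 => by
        rw [hmid _ _ (abs_le.2 ⟨by simp only; linarith, by simp only; linarith⟩) (by simp only; linarith)
          (by simp only; linarith)]
        ext <;> simp only; ring
    simp only [touching, poly, union_empty, image_union]
    rw [hsm, hsr (1, 1), hsr (1 / 3, -1 / 3) (1, -1), hsl (-1, -1), hsl (-1 / 3, -1 / 3) (-1, 1), hsl (-1, 0),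
      hsr (1 / 3, -1 / 3) (1, 0)]
    all_goals norm_num
  · rw [hr] <;> norm_num
  · rw [hl] <;> norm_num

end ThreeCurves

section ThreeCurves

variable {N : Set Space} {Γ Γ₀ : Set Plane} {W : Set Space → Set Plane → ZMod 2} {m : ℕ∞} {v : ZMod 2}

/-- The coordinates in which the bigon between the top strand and the lower arc of the second smoothing
is the standard one. -/
noncomputable def fold : Plane ≃ₜ Plane :=
  plHomeo (fun v => (v.1 / 3, -(v.2 / 2 + |v.1| / 3))) (fun v => (3 * v.1, -2 * v.2 - 2 * |v.1|))
    (by fun_prop) (by fun_prop)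
    (fun v => by
      have : |v.1 / 3| = |v.1| / 3 := by rw [abs_div, abs_of_pos (by norm_num : (0 : ℝ) < 3)]
      ext <;> simp only [this] <;> ring)
    (fun v => by
      have : |3 * v.1| = 3 * |v.1| := by rw [abs_mul, abs_of_pos (by norm_num : (0 : ℝ) < 3)]
      ext <;> simp only [this] <;> ring)

theorem isPLHomeo_fold : IsPLHomeo fold := isPLHomeo_plHomeo _ _ _ _ _ _

theorem fold_apply (x y : ℝ) : fold (x, y) = (x / 3, -(y / 2 + |x| / 3)) := rfl

theorem fold_image_right {p q : Plane} (hp : 0 ≤ p.1) (hq : 0 ≤ q.1) :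
    fold '' segment ℝ p q = segment ℝ (p.1 / 3, -(p.2 / 2 + p.1 / 3)) (q.1 / 3, -(q.2 / 2 + q.1 / 3)) :=
  image_segment_of fun θ h0 h1 => by
    rw [fold_apply, abs_of_nonneg (by nlinarith)]
    ext <;> simp only <;> ring

theorem fold_image_left {p q : Plane} (hp : p.1 ≤ 0) (hq : q.1 ≤ 0) :
    fold '' segment ℝ p q = segment ℝ (p.1 / 3, -(p.2 / 2 - p.1 / 3)) (q.1 / 3, -(q.2 / 2 - q.1 / 3)) :=
  image_segment_of fun θ h0 h1 => by
    rw [fold_apply, abs_of_nonpos (by nlinarith)]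
    ext <;> simp only <;> ring

theorem fold_image_line : fold '' segment ℝ (-2, 0) (2, 0) = poly [(-2 / 3, -2 / 3), (0, 0), (2 / 3, -2 / 3)] := by
  rw [union_segment_poly (r := (0, 0)) (mem_segment_plane.2 ⟨1 / 2, by norm_num⟩)]
  simp only [poly, union_empty, image_union]
  rw [fold_image_left, fold_image_right] <;> norm_num

theorem line_eq_poly : poly [((-2, 0) : Plane), (-17 / 16, 0), (17 / 16, 0), (2, 0)] =
    segment ℝ (-2, 0) (2, 0) := by
  rw [union_segment_poly (p := (-2, 0)) (r := (-17 / 16, 0)) (mem_segment_plane.2 ⟨15 / 64, by norm_num⟩)]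
  simp only [poly]
  rw [union_segment_poly (p := (-17 / 16, 0)) (q := (2, 0)) (r := (17 / 16, 0))
    (mem_segment_plane.2 ⟨34 / 49, by norm_num⟩)]
  simp only [poly, union_empty]

theorem fold_image_roof : fold '' poly [(-9 / 8, -1 / 8), (0, 1), (9 / 8, -1 / 8)] =
    poly [(-3 / 8, -5 / 16), (0, -1 / 2), (3 / 8, -5 / 16)] := by
  simp only [poly, union_empty, image_union]
  rw [fold_image_left, fold_image_right] <;> norm_num

theorem fold_image_floor :
    fold '' poly [(-9 / 8, -1 / 8), (-17 / 16, -1 / 16), (17 / 16, -1 / 16), (9 / 8, -1 / 8)] =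
    poly [(-3 / 8, -5 / 16), (-17 / 48, -31 / 96), (0, 1 / 32), (17 / 48, -31 / 96), (3 / 8, -5 / 16)] := by
  simp only [poly, union_empty, image_union]
  rw [union_segment_poly (p := (-17 / 16, -1 / 16)) (r := (0, -1 / 16))
    (mem_segment_plane.2 ⟨1 / 2, by norm_num⟩)]
  simp only [poly, union_empty, image_union]
  rw [fold_image_left, fold_image_left, fold_image_right, fold_image_right]
  all_goals norm_num [union_assoc]

/-- The sets in the disc of a picture that agree with the strands outside the bigon. -/
def foldRest : Set Plane :=
  (poly [(1, 1), (1 / 8, 1 / 8), (-1 / 8, 1 / 8), (-1, 1)] ∪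
    (segment ℝ (-1, -1) (-2 / 3, -2 / 3) ∪ segment ℝ (2 / 3, -2 / 3) (1, -1))) ∪
    (segment ℝ (-1, 0) (-3 / 8, -5 / 16) ∪ segment ℝ (3 / 8, -5 / 16) (1, 0))

theorem lower_arc : poly [((-1, -1) : Plane), (-1 / 8, -1 / 8), (0, 0), (1 / 8, -1 / 8), (1, -1)] =
    poly [(-1, -1), (-2 / 3, -2 / 3), (0, 0), (2 / 3, -2 / 3), (1, -1)] := by
  have e1 := union_segment_poly (p := (-1, -1)) (q := (0, 0)) (r := (-1 / 8, -1 / 8))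
    (mem_segment_plane.2 ⟨7 / 8, by norm_num⟩)
  have e2 := union_segment_poly (p := (0, 0)) (q := (1, -1)) (r := (1 / 8, -1 / 8))
    (mem_segment_plane.2 ⟨1 / 8, by norm_num⟩)
  rw [union_segment_poly (r := (-2 / 3, -2 / 3)) (mem_segment_plane.2 ⟨1 / 3, by norm_num⟩)] at e1
  rw [union_segment_poly (r := (2 / 3, -2 / 3)) (mem_segment_plane.2 ⟨2 / 3, by norm_num⟩)] at e2
  simp only [poly, union_empty] at e1 e2 ⊢
  rw [e2, ← union_assoc, ← e1, union_assoc]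

theorem lower_strand : poly [((-1, 0) : Plane), (0, -1 / 2), (1, 0)] =
    poly [(-1, 0), (-3 / 8, -5 / 16), (0, -1 / 2), (3 / 8, -5 / 16), (1, 0)] := by
  simp only [poly, union_empty]
  rw [union_segment_poly (r := (-3 / 8, -5 / 16)) (mem_segment_plane.2 ⟨5 / 8, by norm_num⟩),
    union_segment_poly (p := (0, -1 / 2)) (r := (3 / 8, -5 / 16)) (mem_segment_plane.2 ⟨3 / 8, by norm_num⟩)]
  simp only [poly, union_empty, union_assoc]

theorem fold_before : Γ₀ ∪ ((poly [(1, 1), (1 / 8, 1 / 8), (-1 / 8, 1 / 8), (-1, 1)] ∪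
      poly [(-1, 0), (0, -1 / 2), (1, 0)]) ∪
      poly [(-1, -1), (-1 / 8, -1 / 8), (0, 0), (1 / 8, -1 / 8), (1, -1)]) =
    (Γ₀ ∪ foldRest) ∪ fold '' (segment ℝ (-2, 0) (2, 0) ∪ poly [(-9 / 8, -1 / 8), (0, 1), (9 / 8, -1 / 8)]) := by
  rw [image_union, fold_image_line, fold_image_roof, lower_arc, lower_strand, foldRest]
  simp only [poly, union_empty]
  ext; simp only [mem_union]; tauto

theorem fold_after : (Γ₀ ∪ foldRest) ∪ fold '' (poly [(-2, 0), (-17 / 16, 0), (17 / 16, 0), (2, 0)] ∪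
      poly [(-9 / 8, -1 / 8), (-17 / 16, -1 / 16), (17 / 16, -1 / 16), (9 / 8, -1 / 8)]) =
    Γ₀ ∪ ((poly [(1, 1), (1 / 8, 1 / 8), (-1 / 8, 1 / 8), (-1, 1)] ∪
      poly [(-1, -1), (-1 / 8, -1 / 8), (0, 0), (1 / 8, -1 / 8), (1, -1)]) ∪
      poly [(-1, 0), (-3 / 8, -5 / 16), (-17 / 48, -31 / 96), (0, 1 / 32), (17 / 48, -31 / 96),
        (3 / 8, -5 / 16), (1, 0)]) := by
  rw [image_union, line_eq_poly, fold_image_line, fold_image_floor, lower_arc, foldRest]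
  simp only [poly, union_empty]
  ext; simp only [mem_union]; tauto

theorem fold_mem_openBox {v : Plane} (hv : v ∈ bigonDisc) : fold v ∈ openBox := by
  obtain ⟨x, y⟩ := v
  obtain ⟨⟨h1, h2⟩, h3, h4, h5⟩ := hv
  rw [fold_apply]
  simp only at h1 h2 h3 h4 h5
  rcases abs_cases x with ⟨e, h6⟩ | ⟨e, h6⟩ <;> rw [e] <;>
    exact ⟨⟨by simp only; linarith, by simp only; linarith⟩, by simp only; linarith, by simp only; linarith⟩

theorem fold_not_mem_rest {v : Plane} (hv : v ∈ bigonDisc) : fold v ∉ foldRest := by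
  obtain ⟨x, y⟩ := v
  obtain ⟨⟨h1, h2⟩, h3, h4, h5⟩ := hv
  rw [fold_apply]
  simp only at h1 h2 h3 h4 h5
  rcases abs_cases x with ⟨e, h6⟩ | ⟨e, h6⟩ <;> rw [e] <;>
    refine not_mem_union (not_mem_union ?_ (not_mem_union ?_ ?_)) (not_mem_union ?_ ?_) <;>
    first
      | exact not_mem_segment fun θ t0 t1 t2 t3 => by simp only at t2 t3; linarith
      | (repeat' first
          | exact not_mem_poly_single
          | refine not_mem_poly_cons (fun θ t0 t1 t2 t3 => by simp only at t2 t3; linarith) ?_)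

/-- The second smoothing of the double point of the diagonals. -/
theorem smoothing_separated (hΓ : ∀ v ∈ box, v ∉ Γ₀) (hW : Valuation m W) (hN : ∀ a ∈ N, a.1 ∉ box)
    (hm : ∀ T ⊆ box, overlayCr N (Γ₀ ∪ T) ≤ m)
    (hv : StateSum W N (Γ₀ ∪ ((poly [(1, 1), (1 / 8, 1 / 8), (-1 / 8, 1 / 8), (-1, 1)] ∪
      poly [(-1, 0), (0, -1 / 2), (1, 0)]) ∪
      poly [(-1, -1), (-1 / 8, -1 / 8), (1 / 8, -1 / 8), (1, -1)])) {(1 / 3, -1 / 3), (-1 / 3, -1 / 3)} v) :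
    v = W N (Γ₀ ∪ separated) := by
  have hN' : ∀ a ∈ N, a.1 ∉ openBox := fun a ha hc => hN a ha (openBox_subset_box hc)
  have hb1 : poly [((1, 1) : Plane), (1 / 8, 1 / 8), (-1 / 8, 1 / 8), (-1, 1)] ⊆ box := by
    refine poly_subset_box ?_; norm_num [mem_box, abs_le]
  have hb2 : poly [((-1, -1) : Plane), (-1 / 8, -1 / 8), (0, 0), (1 / 8, -1 / 8), (1, -1)] ⊆ box := by
    refine poly_subset_box ?_; norm_num [mem_box, abs_le]
  have hb3 : poly [((-1, -1) : Plane), (-1 / 8, -1 / 8), (1 / 8, -1 / 8), (1, -1)] ⊆ box := by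
    refine poly_subset_box ?_; norm_num [mem_box, abs_le]
  have hb4 : poly [((-1, 0) : Plane), (0, -1 / 2), (1, 0)] ⊆ box := by
    refine poly_subset_box ?_; norm_num [mem_box, abs_le]
  have hb5 : poly [((-1, 0) : Plane), (-3 / 8, -5 / 16), (-17 / 48, -31 / 96), (0, 1 / 32), (17 / 48, -31 / 96),
      (3 / 8, -5 / 16), (1, 0)] ⊆ box := by
    refine poly_subset_box ?_; norm_num [mem_box, abs_le]
  have k1 := hv.move hW (hm _ (union_subset (union_subset hb1 hb4) hb3)) (notch_path hΓ).symm
    (fun a ha hc => hN' a ha hc.1) fun x hx hc => hc.2 hx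
  have hm1 := hm _ (union_subset (union_subset hb1 hb4) hb2)
  have e : ({(1 / 3, -1 / 3), (-1 / 3, -1 / 3)} : Set Plane) = {fold (1, 0), fold (-1, 0)} := by
    rw [fold_apply, fold_apply]; norm_num
  rw [fold_before] at k1 hm1
  rw [e] at k1
  rw [bigon_image isPLHomeo_fold (fun v hv => not_mem_union (fun hc =>
    hΓ _ (openBox_subset_box (fold_mem_openBox hv)) hc) (fold_not_mem_rest hv)) hW
    (by rintro a ha ⟨v, hv, he⟩; exact hN' a ha (he ▸ fold_mem_openBox hv)) hm1 k1, fold_after]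
  exact hW.of_move (middle_path hΓ) hN' (hm _ (union_subset (union_subset hb1 hb2) hb5))

/-- The first smoothing of the double point of the diagonals. -/
theorem smoothing_touching (hΓ : ∀ v ∈ box, v ∉ Γ₀) (hW : Valuation m W) (hN : ∀ a ∈ N, a.1 ∉ box)
    (hNc : IsCompact N) (hm : ∀ T ⊆ box, overlayCr N (Γ₀ ∪ T) ≤ m)
    (hv : StateSum W N (Γ₀ ∪ ((poly [(-1, -1), (-1 / 8, -1 / 8), (-1 / 8, 1 / 8), (-1, 1)] ∪
      poly [(-1, 0), (0, -1 / 2), (1, 0)]) ∪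
      poly [(1, 1), (1 / 8, 1 / 8), (1 / 8, -1 / 8), (1, -1)])) {(1 / 3, -1 / 3), (-1 / 3, -1 / 3)} v) :
    StateSum W N (Γ₀ ∪ touching) {(1 / 3, 0), (-1 / 3, 0)} v := by
  have e1 : poly [((-1, -1) : Plane), (-1 / 8, -1 / 8), (-1 / 8, 1 / 8), (-1, 1)] =
      poly [(-1, -1), (-1 / 3, -1 / 3), (-1 / 8, -1 / 8), (-1 / 8, 1 / 8), (-1, 1)] := by
    rw [poly, union_segment_poly (p := (-1, -1)) (r := (-1 / 3, -1 / 3))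
      (mem_segment_plane.2 ⟨16 / 21, by norm_num⟩)]
    simp only [poly, union_empty, union_assoc]
  have e2 : poly [((1, 1) : Plane), (1 / 8, 1 / 8), (1 / 8, -1 / 8), (1, -1)] =
      poly [(1, 1), (1 / 8, 1 / 8), (1 / 8, -1 / 8), (1 / 3, -1 / 3), (1, -1)] := by
    simp only [poly]
    rw [union_segment_poly (p := (1 / 8, -1 / 8)) (r := (1 / 3, -1 / 3))
      (mem_segment_plane.2 ⟨5 / 21, by norm_num⟩)]
    simp only [poly, union_empty]
  have e3 : poly [((-1, 0) : Plane), (0, -1 / 2), (1, 0)] =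
      poly [(-1, 0), (-1 / 3, -1 / 3), (0, -1 / 2), (1 / 3, -1 / 3), (1, 0)] := by
    simp only [poly, union_empty]
    rw [union_segment_poly (r := (-1 / 3, -1 / 3)) (mem_segment_plane.2 ⟨2 / 3, by norm_num⟩),
      union_segment_poly (p := (0, -1 / 2)) (r := (1 / 3, -1 / 3)) (mem_segment_plane.2 ⟨1 / 3, by norm_num⟩)]
    simp only [poly, union_empty, union_assoc]
  rw [e1, e2, e3] at hv
  have k1 := hv.move hW (hm _ (union_subset (union_subset (poly_subset_box ?_) (poly_subset_box ?_))
    (poly_subset_box ?_))) (part_path hΓ) (fun a ha hc => hN a ha (openBox_subset_box hc.1))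
    fun x hx hc => hc.2 hx
  · obtain ⟨F, f1, f2, f3, f4⟩ := exists_rise
    have k2 := k1.planar hW (hm _ (union_subset (union_subset (poly_subset_box ?_) (poly_subset_box ?_))
      (poly_subset_box ?_))) hNc F
    · have g1 : liftH (F.homeo 1) '' N = N := by
        have (a) (ha : a ∈ N) : liftH (F.homeo 1) a = id a :=
          Prod.ext (show F 1 a.1 = a.1 from f1 _ (hN a ha)) rfl
        rw [image_congr this, image_id]
      have g2 : F 1 '' Γ₀ = Γ₀ := by
        have (v) (hv : v ∈ Γ₀) : F 1 v = id v := f1 _ fun hc => hΓ v hc hv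
        rw [image_congr this, image_id]
      rwa [g1, image_union, g2, f2, image_pair, f3, f4] at k2
    all_goals norm_num [mem_box, abs_le]
  all_goals norm_num [mem_box, abs_le]

end ThreeCurves

section ThreeCurves

/-- The third move if all strands belong to the curve. -/
theorem evaluates_curves : Evaluates ∅ (rising ∪ falling ∪ poly [(-1, 0), (0, -1 / 2), (1, 0)])
    {0, (1 / 3, -1 / 3), (-1 / 3, -1 / 3)} ∅
    [(touching, {(1 / 3, 0), (-1 / 3, 0)}), (separated, ∅)] := by
  intro m W hW N Γ v hNc h1 h2 hm hv
  have hN : ∀ a ∈ N, a.1 ∉ box := fun a ha hc => by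
    have : a ∈ N ∩ cyl := ⟨ha, hc⟩
    rwa [h1] at this
  have hΓ : ∀ v ∈ box, v ∉ Γ \ box := fun v hb hv => hv.2 hb
  have hroof : poly [((-1, 0) : Plane), (0, -1 / 2), (1, 0)] ⊆ box := by
    refine poly_subset_box ?_; norm_num [mem_box, abs_le]
  have eN : N \ cyl ∪ ∅ = N := by
    rw [union_empty, sdiff_eq_left, disjoint_left]; exact fun a ha hc => hN a ha hc
  have hfree : ∀ T ⊆ box, overlayCr N (Γ \ box ∪ T) = overlayCr N (Γ \ box) := fun T hT =>
    overlayCr_union_free hN hT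
  have eΓ : Γ = Γ \ box ∪ (rising ∪ falling ∪ poly [(-1, 0), (0, -1 / 2), (1, 0)]) := by
    rw [← h2, sdiff_union_inter]
  have hm1 : ∀ T ⊆ box, overlayCr N (Γ \ box ∪ T) ≤ m := fun T hT => by
    rw [hfree T hT, ← hfree _ (union_subset (union_subset rising_subset_box falling_subset_box) hroof), ← eΓ]
    exact hm
  have eΓ' : Γ = (Γ \ box ∪ poly [(-1, 0), (0, -1 / 2), (1, 0)]) ∪
      (segment ℝ (-1, -1) (1, 1) ∪ segment ℝ (-1, 1) (1, -1)) := by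
    rw [segment_symm ℝ (-1, 1), union_assoc, union_comm (poly _)]; exact eΓ
  have hsub : crossFrame '' box ⊆ box := by
    rintro ⟨x, y⟩ h
    obtain ⟨h3, h4⟩ := abs_le_of_mem_box (mem_crossFrame_image.1 h)
    exact mem_box.2 ⟨by simp only; linarith, by simp only; linarith⟩
  obtain ⟨c1, c2, c3⟩ := smooth_frame (c := 0) (a := (1 / 8, 1 / 8)) (b := (1 / 8, -1 / 8)) (h := by norm_num)
    (A := 8) (B := 8) (C := 8) (D := 8)
    (Γ₀ := Γ \ box ∪ poly [(-1, 0), (0, -1 / 2), (1, 0)]) (N := N)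
    (pA := (-1, -1)) (pB := (1, 1)) (pC := (-1, 1)) (pD := (1, -1)) (q₁ := (-1 / 8, -1 / 8))
    (q₂ := (1 / 8, 1 / 8)) (q₃ := (-1 / 8, 1 / 8)) (q₄ := (1 / 8, -1 / 8)) (by
      rintro ⟨x, y⟩ hx
      refine not_mem_union (hΓ _ (hsub ⟨_, hx, rfl⟩)) ?_
      have h1 := abs_le.1 (mem_box.1 hx).1
      have h2 := abs_le.1 (mem_box.1 hx).2
      rw [frame_apply]
      refine not_mem_poly_cons (fun θ t0 t1 t2 t3 => ?_) (not_mem_poly_cons (fun θ t0 t1 t2 t3 => ?_)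
        not_mem_poly_single) <;> norm_num at * <;> linarith)
    (fun a ha hc => hN a ha (hsub hc))
  rw [← eΓ'] at c1 c2 c3
  change IsChart crossFrame N Γ at c1
  change smooth crossFrame _ _ = _ at c2 c3
  have h0 : crossFrame 0 = 0 := by
    change crossFrame (0, 0) = _
    rw [crossFrame_apply]; norm_num
  obtain ⟨v₁, v₂, rfl, k1, k2⟩ := hv.expand hW hm c1 (by rw [h0]; exact mem_insert _ _) (by
    rw [h0]
    rintro x (rfl | rfl | rfl) hx
    · rfl
    all_goals
      rw [mem_crossFrame_image] at hx
      norm_num [mem_box, abs_of_pos, abs_of_neg] at hx)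
  have hX : ({0, (1 / 3, -1 / 3), (-1 / 3, -1 / 3)} : Set Plane) \ {crossFrame 0} =
      {(1 / 3, -1 / 3), (-1 / 3, -1 / 3)} := by
    rw [h0, insert_sdiff_of_mem _ (mem_singleton _), sdiff_singleton_eq_self]
    rintro (h | h) <;>
    · have := congrArg Prod.fst h
      norm_num at this
  rw [hX, c2] at k1
  rw [hX, c3] at k2
  have s1 : StateSum W N (Γ \ box ∪ touching) {(1 / 3, 0), (-1 / 3, 0)} v₁ :=
    smoothing_touching hΓ hW hN hNc hm1 (by
      convert k1 using 1
      ext; simp only [mem_union]; tauto)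
  have s2 : v₂ = W N (Γ \ box ∪ separated) :=
    smoothing_separated hΓ hW hN hm1 (by
      convert k2 using 1
      ext; simp only [mem_union]; tauto)
  refine ⟨[v₁, v₂], .cons ?_ (.cons ?_ .nil), by simp⟩
  · rw [eN]
    refine ⟨hm1 _ (union_subset (union_subset (poly_subset_box ?_) (poly_subset_box ?_)) (poly_subset_box ?_)), s1⟩ <;>
      norm_num [mem_box, abs_le]
  · rw [eN, s2]
    refine ⟨hm1 _ (union_subset (union_subset (poly_subset_box ?_) (poly_subset_box ?_)) (poly_subset_box ?_)),
      stateSum_empty⟩ <;> norm_num [mem_box, abs_le]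

end ThreeCurves

/-! ### The third Reidemeister move -/

section MoveIII

local notation "ν" => Homeomorph.neg Plane

theorem neg_image_segment (p q : Plane) : ν '' segment ℝ p q = segment ℝ (ν p) (ν q) :=
  image_segment_of fun θ _ _ => by
    simp only [Homeomorph.coe_neg, Prod.neg_mk, Prod.fst_neg, Prod.snd_neg]
    ext <;> simp only <;> ring

theorem isSym_neg : IsSym ν false where
  pl := isPLHomeo_neg
  norm v := norm_neg v
  cross _ := neg_mem_cross
  smul s v := by simp
  corner s v := by
    have h1 : |(-v).1 + (-v).2| = |v.1 + v.2| := by rw [← abs_neg]; congr 1; simp; ring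
    have h2 : |(-v).1 - (-v).2| = |v.1 - v.2| := by rw [← abs_neg]; congr 1; simp; ring
    rw [Bool.false_xor]
    cases s <;> simp only [corner, mem_ofPred_eq, Homeomorph.coe_neg, h1, h2]

/-- The two smoothings of a symmetric picture at its centre are symmetric. -/
theorem neg_image_smooth {χ : Plane ≃ₜ Plane} (hχ : ∀ v, χ (-v) = -χ v) {B : Set Plane} (hB : ν '' B = B)
    (s : Bool) : ν '' smooth χ s B = smooth χ s B := by
  rw [← smooth_trans, hB, ← Bool.false_xor s, ← isSym_neg.smooth, Bool.false_xor]
  congr 1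
  ext1 v
  change -χ (-v) = χ v
  rw [hχ, neg_neg]

theorem neg_image_rising : ν '' rising = rising := by
  rw [rising, neg_image_segment, segment_symm]; norm_num

theorem neg_image_falling : ν '' falling = falling := by
  rw [falling, neg_image_segment, segment_symm]; norm_num

theorem tent_one_eq : tent (1 / 2) 1 = poly [(-1, 0), (0, 1 / 2), (1, 0)] := by
  ext ⟨x, y⟩
  simp only [poly, union_empty, mem_union, mem_segment_plane]
  constructor
  · rintro ⟨h1, h2⟩
    simp only at h1 h2
    rw [max_eq_right (by linarith)] at h2
    rcases abs_cases x with ⟨h4, h5⟩ | ⟨h4, h5⟩ <;> rw [h4] at h1 h2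
    · exact Or.inr ⟨x, by linarith, by linarith, by linarith, by linarith⟩
    · exact Or.inl ⟨1 + x, by linarith, by linarith, by linarith, by linarith⟩
  · intro h
    have h' : |x| ≤ 1 ∧ y = 1 / 2 * (1 - |x|) := by
      rcases h with ⟨θ, t0, t1, t2, t3⟩ | ⟨θ, t0, t1, t2, t3⟩
      · rw [abs_of_nonpos (by linarith)]
        constructor <;> linarith
      · rw [abs_of_nonneg (by linarith)]
        constructor <;> linarith
    exact ⟨h'.1, by simp only; rw [max_eq_right (by linarith)]; exact h'.2⟩

theorem mem_tent_zero {x y : ℝ} : ((x, y) : Plane) ∈ tent (1 / 2) 0 ↔ |x| ≤ 1 ∧ y = 0 := by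
  change _ ∧ y = 1 / 2 * max 0 (0 - |x|) ↔ _
  rw [max_eq_left (by linarith [abs_nonneg x]), mul_zero]

theorem neg_image_tent_zero : ν '' tent (1 / 2) 0 = tent (1 / 2) 0 := by
  ext v
  obtain ⟨⟨x, y⟩, rfl⟩ := (ν).surjective v
  rw [(ν).injective.mem_set_image, Homeomorph.coe_neg, Prod.neg_mk, mem_tent_zero, mem_tent_zero, abs_neg,
    neg_eq_zero]

theorem neg_image_poly (l : List Plane) : ν '' poly l = poly (l.map ν) := image_poly neg_image_segment l

theorem poly_four_symm (p q r s : Plane) : poly [p, q, r, s] = poly [s, r, q, p] := by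
  simp only [poly, union_empty]
  rw [segment_symm ℝ p q, segment_symm ℝ q r, segment_symm ℝ r s]
  ext; simp only [mem_union]; tauto

theorem poly_two_symm (p q : Plane) : poly [p, q] = poly [q, p] := by
  simp only [poly, segment_symm]

theorem neg_image_touching : ν '' touching = touching := by
  rw [touching, image_union, image_union, neg_image_poly, neg_image_poly, neg_image_poly,
    poly_four_symm (-1, 0), union_comm (poly _)]
  norm_num

theorem neg_image_separated : ν '' separated = separated := by
  rw [separated, image_union, image_union, neg_image_poly, neg_image_poly, neg_image_poly, union_comm (poly _)]
  rw [poly_two_symm (-1, 0)]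
  norm_num

theorem liftH_neg_triangle (s : ℝ) (i : Fin 3) : liftH ν '' triangle s i = triangle (-s) i := by
  fin_cases i
  · change liftH ν '' segment ℝ _ _ = segment ℝ _ _
    rw [segment_eq_strand, liftH_image_strand, neg_image_segment, segment_symm]; norm_num
  · change liftH ν '' segment ℝ _ _ = segment ℝ _ _
    rw [segment_eq_strand, liftH_image_strand, neg_image_segment, segment_symm]; norm_num
  · change liftH ν '' (segment ℝ _ _ ∪ segment ℝ _ _) = segment ℝ _ _ ∪ segment ℝ _ _
    rw [image_union, union_comm]
    simp only [segment_eq_strand, liftH_image_strand, neg_image_segment]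
    norm_num
    rw [segment_symm ℝ (0, -s), segment_symm ℝ (1, 0)]

theorem Covers.image_dbl {Θ : Space ≃ₜ Space} {φ : Plane ≃ₜ Plane} (h : Covers Θ φ) (U : Set Space) :
    φ '' dbl U = dbl (Θ '' U) := by
  ext x
  constructor
  · rintro ⟨_, ⟨a, ha, b, hb, hab, rfl, h2⟩, rfl⟩
    exact ⟨_, ⟨a, ha, rfl⟩, _, ⟨b, hb, rfl⟩, fun e => hab (Θ.injective e), h.proj a, by rw [h.proj, h2]⟩
  · rintro ⟨_, ⟨a, ha, rfl⟩, _, ⟨b, hb, rfl⟩, hab, rfl, h2⟩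
    rw [h.proj, h.proj] at h2
    exact ⟨a.1, ⟨a, ha, b, hb, fun e => hab (e ▸ rfl), rfl, φ.injective h2⟩, (h.proj a).symm⟩

/-- The evaluation by `A'` and `L` of one side of the third move, where the strands with index in `I`
belong to the link and the other ones to the curve. -/
def TriangleEval (s : ℝ) (I : Set (Fin 3)) (A' : Set Space) (L : List (Set Plane × Set Plane)) : Prop :=
  Evaluates (⋃ i ∈ I, triangle s i) (⋃ i ∈ Iᶜ, Prod.fst '' triangle s i) (dbl (⋃ i ∈ Iᶜ, triangle s i)) A' L

/-- By symmetry, both sides of the third move have the same evaluation. -/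
theorem TriangleEval.neg {s : ℝ} {I : Set (Fin 3)} {A' : Set Space} {L : List (Set Plane × Set Plane)}
    (h : TriangleEval s I A' L) (hA : liftH ν '' A' = A') (hL : ∀ q ∈ L, ν '' q.1 = q.1 ∧ ν '' q.2 = q.2) :
    TriangleEval (-s) I A' L := by
  have h1 := Evaluates.image h isPLHomeo_neg isSym_neg.image_box
  have h2 : ∀ J : Set (Fin 3), liftH ν '' (⋃ i ∈ J, triangle s i) = ⋃ i ∈ J, triangle (-s) i := fun J => by
    simp only [image_iUnion, liftH_neg_triangle]
  have h3 : ∀ S : Set Space, ν '' (Prod.fst '' S) = Prod.fst '' (liftH ν '' S) := fun S => by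
    rw [image_image, image_image]; rfl
  have h4 : L.map (fun q => (ν '' q.1, ν '' q.2)) = L := by
    conv_rhs => rw [← List.map_id L]
    exact List.map_congr_left fun q hq => Prod.ext (hL q hq).1 (hL q hq).2
  rw [h2, hA, h4, (covers_liftH isPLHomeo_neg).image_dbl, h2] at h1
  simp only [image_iUnion, h3, liftH_neg_triangle] at h1
  exact h1

/-- The set `A` if `p` holds, and the empty set otherwise. -/
def sel (p : Prop) (A : Set Plane) : Set Plane := {x | p ∧ x ∈ A}

theorem sel_true {p : Prop} (h : p) (A : Set Plane) : sel p A = A := by simp [sel, h]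
theorem sel_false {p : Prop} (h : ¬ p) (A : Set Plane) : sel p A = ∅ := by simp [sel, h]

theorem iUnion_triangle (s : ℝ) (I : Set (Fin 3)) : ⋃ i ∈ I, triangle s i =
    (strand (sel (0 ∈ I) rising) 0 ∪ strand (sel (1 ∈ I) falling) 1) ∪
      strand (sel (2 ∈ I) (poly [(-1, 0), (0, s), (1, 0)])) 2 := by
  have e0 : triangle s 0 = strand rising 0 := segment_eq_strand _ _ _
  have e1 : triangle s 1 = strand falling 1 := segment_eq_strand _ _ _
  have e2 : triangle s 2 = strand (poly [(-1, 0), (0, s), (1, 0)]) 2 := by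
    simp only [poly, union_empty, strand_union, ← segment_eq_strand]; rfl
  ext a
  constructor
  · intro h
    obtain ⟨i, hi, h⟩ := mem_iUnion₂.1 h
    fin_cases i
    · change a ∈ triangle s 0 at h
      rw [e0] at h
      exact Or.inl (Or.inl ⟨⟨hi, h.1⟩, h.2⟩)
    · change a ∈ triangle s 1 at h
      rw [e1] at h
      exact Or.inl (Or.inr ⟨⟨hi, h.1⟩, h.2⟩)
    · change a ∈ triangle s 2 at h
      rw [e2] at h
      exact Or.inr ⟨⟨hi, h.1⟩, h.2⟩
  · rintro ((⟨⟨hi, h⟩, h'⟩ | ⟨⟨hi, h⟩, h'⟩) | ⟨⟨hi, h⟩, h'⟩)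
    · exact mem_iUnion₂.2 ⟨0, hi, by rw [e0]; exact ⟨h, h'⟩⟩
    · exact mem_iUnion₂.2 ⟨1, hi, by rw [e1]; exact ⟨h, h'⟩⟩
    · exact mem_iUnion₂.2 ⟨2, hi, by rw [e2]; exact ⟨h, h'⟩⟩

theorem strand_empty (h : ℝ) : strand ∅ h = ∅ := by ext; simp [strand]

theorem iUnion_fst_triangle (s : ℝ) (I : Set (Fin 3)) : ⋃ i ∈ I, Prod.fst '' triangle s i =
    (sel (0 ∈ I) rising ∪ sel (1 ∈ I) falling) ∪ sel (2 ∈ I) (poly [(-1, 0), (0, s), (1, 0)]) := by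
  simp only [← image_iUnion, iUnion_triangle, image_union, fst_image_strand]

/-- The double points of three strands at different heights. -/
theorem dbl_three (A B C : Set Plane) : dbl ((strand A 0 ∪ strand B 1) ∪ strand C 2) =
    (A ∩ B) ∪ (A ∩ C) ∪ (B ∩ C) := by
  ext x
  constructor
  · rintro ⟨a, ha, b, hb, hab, rfl, h2⟩
    have hz : a.2 ≠ b.2 := fun hc => hab (Prod.ext h2.symm hc)
    rcases ha with (⟨ha, za⟩ | ⟨ha, za⟩) | ⟨ha, za⟩ <;> rcases hb with (⟨hb, zb⟩ | ⟨hb, zb⟩) | ⟨hb, zb⟩ <;>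
      rw [h2] at hb <;> first
        | exact absurd (za.trans zb.symm) hz
        | exact Or.inl (Or.inl ⟨ha, hb⟩)
        | exact Or.inl (Or.inl ⟨hb, ha⟩)
        | exact Or.inl (Or.inr ⟨ha, hb⟩)
        | exact Or.inl (Or.inr ⟨hb, ha⟩)
        | exact Or.inr ⟨ha, hb⟩
        | exact Or.inr ⟨hb, ha⟩
  · rintro ((⟨ha, hb⟩ | ⟨ha, hb⟩) | ⟨ha, hb⟩)
    · exact ⟨(x, 0), Or.inl (Or.inl ⟨ha, rfl⟩), (x, 1), Or.inl (Or.inr ⟨hb, rfl⟩),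
        fun h => by simpa using congrArg Prod.snd h, rfl, rfl⟩
    · exact ⟨(x, 0), Or.inl (Or.inl ⟨ha, rfl⟩), (x, 2), Or.inr ⟨hb, rfl⟩,
        fun h => by simpa using congrArg Prod.snd h, rfl, rfl⟩
    · exact ⟨(x, 1), Or.inl (Or.inr ⟨ha, rfl⟩), (x, 2), Or.inr ⟨hb, rfl⟩,
        fun h => by simpa using congrArg Prod.snd h, rfl, rfl⟩

theorem rising_inter_falling : rising ∩ falling = {0} := by
  ext ⟨x, y⟩
  rw [mem_inter_iff, mem_rising, mem_falling, mem_singleton_iff, Prod.mk_eq_zero]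
  constructor
  · rintro ⟨⟨h1, h2⟩, h3, h4⟩
    exact ⟨by linarith, by linarith⟩
  · rintro ⟨rfl, rfl⟩
    norm_num

theorem triangleEval_iff {s : ℝ} {I : Set (Fin 3)} {A' : Set Space} {L : List (Set Plane × Set Plane)} :
    TriangleEval s I A' L ↔ Evaluates
      ((strand (sel (0 ∈ I) rising) 0 ∪ strand (sel (1 ∈ I) falling) 1) ∪
        strand (sel (2 ∈ I) (poly [(-1, 0), (0, s), (1, 0)])) 2)
      ((sel (0 ∉ I) rising ∪ sel (1 ∉ I) falling) ∪ sel (2 ∉ I) (poly [(-1, 0), (0, s), (1, 0)]))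
      ((sel (0 ∉ I) rising ∩ sel (1 ∉ I) falling) ∪
        (sel (0 ∉ I) rising ∩ sel (2 ∉ I) (poly [(-1, 0), (0, s), (1, 0)])) ∪
        (sel (1 ∉ I) falling ∩ sel (2 ∉ I) (poly [(-1, 0), (0, s), (1, 0)]))) A' L := by
  rw [TriangleEval, iUnion_triangle, iUnion_triangle, iUnion_fst_triangle, dbl_three]
  rfl

theorem steady_sel {p : Prop} {A : Set Plane} (h : Steady A) : Steady (sel p A) := by
  by_cases hp : p
  · rwa [sel_true hp]
  · rw [sel_false hp]; exact steady_empty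

theorem neg_image_sel {p : Prop} {A : Set Plane} (h : ν '' A = A) : ν '' sel p A = sel p A := by
  by_cases hp : p
  · rwa [sel_true hp]
  · rw [sel_false hp, image_empty]

theorem reflX_image_rising : reflX '' rising = falling := by
  rw [rising, falling, reflX_image_segment]
  change segment ℝ (- -1, -1) (-1, 1) = _
  rw [neg_neg]

theorem reflX_image_falling : reflX '' falling = rising := by
  rw [← reflX_image_rising, image_image]
  simp only [reflX_reflX, image_id']

theorem reflX_image_tent (c t : ℝ) : reflX '' tent c t = tent c t := by
  ext ⟨x, y⟩
  have e : ((x, y) : Plane) = reflX (-x, y) := by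
    change _ = (- -x, y)
    rw [neg_neg]
  rw [e, reflX.injective.mem_set_image, ← e]
  change |-x| ≤ 1 ∧ y = c * max 0 (t - |-x|) ↔ _
  rw [abs_neg]
  rfl

/-- The third move if the curve has the two lower strands. -/
theorem evaluates_diagonals : Evaluates (strand (tent (1 / 2) 1) 2) (rising ∪ falling) {0}
    (strand (tent (1 / 2) 0) 2)
    [(smooth (crossFrame.trans (Homeomorph.refl Plane)) true (rising ∪ falling), ∅),
      (smooth (crossFrame.trans (Homeomorph.refl Plane)) false (rising ∪ falling), ∅)] := by
  have := evaluates_cross (ψ := Homeomorph.refl Plane) (N₀ := ∅) (B := rising ∪ falling) (h := 2)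
    isPLHomeo_refl (fun x y hx hy => mem_box.2 ⟨hx, hy.trans (by linarith [abs_nonneg x])⟩)
    (fun x y hx hy => by
      change (x, y) ∈ _ ↔ _
      rw [mem_union, mem_rising, mem_falling, abs_eq_abs]
      constructor
      · rintro (⟨-, rfl⟩ | ⟨-, rfl⟩)
        · exact Or.inl rfl
        · right; ring
      · rintro (rfl | rfl)
        · exact Or.inl ⟨hx, rfl⟩
        · exact Or.inr ⟨hx, by ring⟩) (fun a ha => ha.elim)
  have e : ∀ S : Set Plane, Homeomorph.refl Plane '' S = S := fun S => image_id S
  rw [e, e, empty_union, empty_union] at this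
  exact this

set_option maxHeartbeats 1600000 in
/-- Both sides of the third move have a common evaluation. -/
theorem exists_triangleEval (I : Set (Fin 3)) :
    ∃ A' L, TriangleEval (1 / 2) I A' L ∧ TriangleEval (-1 / 2) I A' L := by
  have key : ∀ A' L, TriangleEval (1 / 2) I A' L → liftH ν '' A' = A' →
      (∀ q ∈ L, ν '' q.1 = q.1 ∧ ν '' q.2 = q.2) →
      ∃ A' L, TriangleEval (1 / 2) I A' L ∧ TriangleEval (-1 / 2) I A' L := fun A' L h hA hL =>
    ⟨A', L, h, by rw [neg_div]; exact h.neg hA hL⟩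
  have hskew : ∀ v, skew (-v) = -skew v := fun v => by
    change skew (-v.1, -v.2) = -skew (v.1, v.2)
    rw [skew_apply, skew_apply]; ext <;> simp <;> ring
  have hcross : ∀ v, crossFrame (-v) = -crossFrame v := fun v => by
    change crossFrame (-v.1, -v.2) = -crossFrame (v.1, v.2)
    rw [crossFrame_apply, crossFrame_apply]; ext <;> simp <;> ring
  have hline : ν '' (rising ∪ tent (1 / 2) 0) = rising ∪ tent (1 / 2) 0 := by
    rw [image_union, neg_image_rising, neg_image_tent_zero]
  have hslide : ∀ s, ν '' smooth (crossFrame.trans skew) s (rising ∪ tent (1 / 2) 0) =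
      smooth (crossFrame.trans skew) s (rising ∪ tent (1 / 2) 0) :=
    neg_image_smooth (fun v => by simp only [Homeomorph.trans_apply, hcross, hskew]) hline
  have hrefl : ∀ S : Set Plane, ν '' S = S → ν '' (reflX '' S) = reflX '' S := fun S hS => by
    conv_rhs => rw [← hS]
    rw [image_image, image_image]
    refine image_congr fun v _ => ?_
    exact Prod.ext rfl rfl
  have hpt : rising ∩ tent (1 / 2) 1 = {(1 / 3, 1 / 3)} := by
    rw [inter_tent_rising ⟨zero_le_one, le_rfl⟩, one_mul]
  have hpt' : falling ∩ tent (1 / 2) 1 = {(-1 / 3, 1 / 3)} := by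
    rw [inter_tent_falling ⟨zero_le_one, le_rfl⟩]; norm_num
  by_cases h2 : (2 : Fin 3) ∈ I
  · by_cases h01 : (0 : Fin 3) ∈ I ∨ (1 : Fin 3) ∈ I
    · -- the curve has at most one strand
      have sC : Steady (sel (0 ∉ I) rising ∪ sel (1 ∉ I) falling) := by
        rcases h01 with h | h
        · rw [sel_false (not_not.2 h), empty_union]; exact steady_sel steady_falling
        · rw [sel_false (not_not.2 h), union_empty]; exact steady_sel steady_rising
      have hX : sel (0 ∉ I) rising ∩ sel (1 ∉ I) falling = ∅ := by
        rcases h01 with h | h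
        · rw [sel_false (not_not.2 h), empty_inter]
        · rw [sel_false (p := 1 ∉ I) (not_not.2 h), inter_empty]
      refine key ?_ ?_ (triangleEval_iff.2 ?_) ?_ ?_
      rotate_left 2
      · rw [sel_true h2, sel_false (not_not.2 h2), ← tent_one_eq, hX]
        simp only [inter_empty, union_empty]
        exact evaluates_strand (steady_sel steady_rising) (steady_sel steady_falling) sC
      · rw [image_union, image_union, liftH_image_strand, liftH_image_strand, liftH_image_strand,
          neg_image_sel neg_image_rising, neg_image_sel neg_image_falling, neg_image_tent_zero]
      · rintro q hq
        obtain rfl := List.mem_singleton.1 hq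
        refine ⟨?_, image_empty _⟩
        simp only
        rw [image_union, neg_image_sel neg_image_rising, neg_image_sel neg_image_falling]
    · -- the curve has the two lower strands
      rw [not_or] at h01
      refine key ?_ ?_ (triangleEval_iff.2 ?_) ?_ ?_
      rotate_left 2
      · rw [sel_true h2, sel_false (not_not.2 h2), sel_false h01.1, sel_false h01.2, sel_true h01.1,
          sel_true h01.2, ← tent_one_eq, rising_inter_falling]
        simp only [inter_empty, union_empty, strand_empty]
        rw [empty_union]
        exact evaluates_diagonals
      · rw [liftH_image_strand, neg_image_tent_zero]
      · have hs : ∀ s, ν '' smooth (crossFrame.trans (Homeomorph.refl Plane)) s (rising ∪ falling) =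
            smooth (crossFrame.trans (Homeomorph.refl Plane)) s (rising ∪ falling) :=
          neg_image_smooth (fun v => hcross v) (by rw [image_union, neg_image_rising, neg_image_falling])
        rintro q hq
        simp only [List.mem_cons, List.not_mem_nil, or_false] at hq
        rcases hq with rfl | rfl <;> exact ⟨hs _, image_empty _⟩
  · by_cases h0 : (0 : Fin 3) ∈ I <;> by_cases h1 : (1 : Fin 3) ∈ I
    · -- the curve has the top strand only
      refine key ?_ ?_ (triangleEval_iff.2 ?_) ?_ ?_
      rotate_left 2
      · rw [sel_false h2, sel_true h2, sel_false (not_not.2 h0), sel_false (not_not.2 h1), ← tent_one_eq]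
        simp only [empty_inter, union_empty, empty_union, strand_empty]
        exact evaluates_curve (steady_sel steady_rising) (steady_sel steady_falling)
      · rw [image_union, liftH_image_strand, liftH_image_strand,
          neg_image_sel neg_image_rising, neg_image_sel neg_image_falling]
      · rintro q hq
        obtain rfl := List.mem_singleton.1 hq
        exact ⟨neg_image_tent_zero, image_empty _⟩
    · have h := (evaluates_slide 0).image isSym_reflX.pl isSym_reflX.image_box
      have e : reflX (1 / 3, 1 / 3) = (-1 / 3, 1 / 3) := by
        change (-(1 / 3), _) = _
        norm_num
      rw [liftH_image_strand, reflX_image_falling, image_union, reflX_image_rising, reflX_image_tent,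
        image_singleton, e, ← hpt'] at h
      refine key ?_ ?_ (triangleEval_iff.2 ?_) ?_ ?_
      rotate_left 2
      · rw [sel_false h2, sel_true h2, sel_false (not_not.2 h0), sel_true h1, sel_true h0, sel_false h1,
          ← tent_one_eq]
        simp only [empty_inter, union_empty, empty_union, strand_empty]
        exact h
      · rw [liftH_image_strand, neg_image_rising]
      · rintro q hq
        simp only [List.map_cons, List.map_nil, List.mem_cons, List.not_mem_nil, or_false] at hq
        rcases hq with rfl | rfl <;> exact ⟨hrefl _ (hslide _), by simp⟩
    · have h := evaluates_slide 1
      rw [← hpt] at h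
      refine key ?_ ?_ (triangleEval_iff.2 ?_) ?_ ?_
      rotate_left 2
      · rw [sel_false h2, sel_true h2, sel_false (not_not.2 h1), sel_true h1, sel_true h0, sel_false h0,
          ← tent_one_eq]
        simp only [empty_inter, inter_empty, union_empty, empty_union, strand_empty]
        exact h
      · rw [liftH_image_strand, neg_image_falling]
      · rintro q hq
        simp only [List.mem_cons, List.not_mem_nil, or_false] at hq
        rcases hq with rfl | rfl <;> exact ⟨hslide _, image_empty _⟩
    · -- all strands belong to the curve
      have h := evaluates_curves
      have hX : ({0, (1 / 3, -1 / 3), (-1 / 3, -1 / 3)} : Set Plane) = {0} ∪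
          (rising ∩ poly [(-1, 0), (0, -1 / 2), (1, 0)]) ∪
          (falling ∩ poly [(-1, 0), (0, -1 / 2), (1, 0)]) := by
        have e : poly [(-1, 0), (0, -1 / 2), (1, 0)] = ν '' tent (1 / 2) 1 := by
          rw [tent_one_eq, neg_image_poly]
          simp only [poly, union_empty, List.map_cons, List.map_nil]
          rw [union_comm, segment_symm ℝ _ (0, -1 / 2), segment_symm ℝ (0, -1 / 2)]
          norm_num
        rw [e, ← neg_image_rising, ← neg_image_falling, ← image_inter (ν).injective,
          ← image_inter (ν).injective, hpt, hpt', image_singleton, image_singleton]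
        ext v
        simp only [mem_insert_iff, mem_singleton_iff, mem_union, Homeomorph.coe_neg, Prod.neg_mk]
        norm_num
        tauto
      rw [hX] at h
      have h' : TriangleEval (-1 / 2) I ∅ _ := triangleEval_iff.2 (by
        rw [sel_false h2, sel_true h2, sel_true h1, sel_true h0, sel_false h0, sel_false h1,
          rising_inter_falling]
        simp only [union_empty, strand_empty]
        exact h)
      have h'' := h'.neg (image_empty _) (by
        rintro q hq
        simp only [List.mem_cons, List.not_mem_nil, or_false] at hq
        rcases hq with rfl | rfl
        · refine ⟨neg_image_touching, ?_⟩
          rw [image_pair, pair_comm]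
          norm_num
        · exact ⟨neg_image_separated, image_empty _⟩)
      rw [neg_div, neg_neg] at h''
      exact ⟨_, _, h'', h'⟩

/-- Invariance under the third move. -/
theorem localInv_triangle : LocalInv (triangle (1 / 2)) (triangle (-1 / 2)) := by
  intro m W hW I N N' Γ Γ' v v' hN hN' h1 h2 h3 h4 h5 h6 hm hm' hv hv'
  obtain ⟨A', L, k1, k2⟩ := exists_triangleEval I
  exact k1.eq k2 hW hN hN' h1 h2 h3 h4 h5 h6 hm hm' hv hv'

end MoveIII

/-! ### The state sum of a diagram -/

section Diagrams

variable {m : ℕ∞} {W : Set Space → Set Plane → ZMod 2} {v v' : ZMod 2}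
  {N N' A A' : Set Space} {Γ Γ' : Set Plane}

theorem isCompact_of_isPLCircle {K : Set Space} (h : IsPLCircle K) : IsCompact K := by
  obtain ⟨c, h1, -, rfl⟩ := h
  exact (isCompact_sphere 0 1).image_of_continuousOn h1.1

theorem isCompact_of_isPLLink {M : Set Space} (h : IsPLLink M) : IsCompact M := by
  obtain ⟨K, h1, h2, -, rfl⟩ := h
  exact h1.isCompact_sUnion fun k hk => isCompact_of_isPLCircle (h2 k hk)

/-- The crossings of the overlay of `M` and the projection of `U` inject into the crossings of the
diagram. -/
theorem Diagram.overlayCr_le (D : Diagram) : overlayCr D.M (Prod.fst '' D.U) ≤ D.cr := by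
  choose! u hu h1 using fun (a : Space) (h : a.1 ∈ Prod.fst '' D.U) => h
  -- an intersection of the two projections is a crossing of a point of `M` with one of `U`
  let g : Space → Space × Space := fun a => if a.2 < (u a).2 then (a, u a) else (u a, a)
  have hMU : ∀ a ∈ D.M, a ∉ D.U := fun a h h' => disjoint_left.1 D.disj h h'
  have hg : InjOn g {a | a ∈ D.M ∧ a.1 ∈ Prod.fst '' D.U} := by
    rintro a ⟨ha, ha'⟩ b ⟨hb, hb'⟩ h
    simp only [g] at h
    split_ifs at h
    · exact (Prod.ext_iff.1 h).1
    · exact absurd (hu b hb') ((show a = u b from (Prod.ext_iff.1 h).1) ▸ hMU a ha)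
    · exact absurd (hu a ha') ((show u a = b from (Prod.ext_iff.1 h).1) ▸ hMU b hb)
    · exact (Prod.ext_iff.1 h).2
  rw [overlayCr, ← hg.encard_image, ← encard_union_eq, Diagram.cr]
  · refine encard_le_encard (union_subset (crossings_mono subset_union_left) ?_)
    rintro _ ⟨a, ⟨ha, ha'⟩, rfl⟩
    simp only [g]
    split_ifs with hlt
    · exact ⟨Or.inl ha, Or.inr (hu a ha'), (h1 a ha').symm, hlt⟩
    · refine ⟨Or.inr (hu a ha'), Or.inl ha, h1 a ha', lt_of_le_of_ne (not_lt.1 hlt) fun e => ?_⟩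
      exact hMU a ha (Prod.ext (h1 a ha') e ▸ hu a ha')
  · refine disjoint_left.2 ?_
    rintro _ ⟨h2, h3, -⟩ ⟨a, ⟨ha, ha'⟩, rfl⟩
    simp only [g] at h2 h3
    split_ifs at h2 h3
    · exact hMU _ h3 (hu a ha')
    · exact hMU _ h2 (hu a ha')

theorem dbl_mono {U V : Set Space} (h : U ⊆ V) : dbl U ⊆ dbl V :=
  fun _ ⟨a, ha, b, hb, hab⟩ => ⟨a, h ha, b, h hb, hab⟩

theorem Diagram.finite_dbl (D : Diagram) (h : D.cr ≠ ⊤) : (dbl D.U).Finite := by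
  refine ((encard_ne_top_iff.1 h).image fun q => q.1.1).subset ?_
  rintro x ⟨a, ha, b, hb, hab, rfl, h2⟩
  rcases lt_trichotomy a.2 b.2 with hlt | he | hlt
  · exact ⟨(a, b), ⟨Or.inr ha, Or.inr hb, h2.symm, hlt⟩, rfl⟩
  · exact absurd (Prod.ext h2.symm he) hab
  · exact ⟨(b, a), ⟨Or.inr hb, Or.inr ha, h2, hlt⟩, h2⟩

theorem IsChart.congr {φ : Plane ≃ₜ Plane} {S : Set Plane} (h : IsChart φ N Γ) (hS : φ '' box ⊆ S)
    (hΓ : Γ' ∩ S = Γ ∩ S) (hN : ∀ a ∈ N', a.1 ∈ S → a ∈ N) : IsChart φ N' Γ' := by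
  refine ⟨h.pl, ?_, fun a ha hb => h.free a (hN a ha (hS hb)) hb⟩
  rw [← h.cross]
  ext v
  refine and_congr_left fun hv => ?_
  have hv' := hS ⟨v, hv, rfl⟩
  have := Set.ext_iff.1 hΓ (φ v)
  simpa [hv'] using this

/-- The coordinates at a crossing of two strands of `U` in the definition of a regular projection are a
chart for smoothing. -/
theorem Diagram.exists_chart (D : Diagram) {x : Plane} (hx : x ∈ dbl D.U) :
    ∃ φ, IsChart φ D.M (Prod.fst '' D.U) ∧ φ 0 = x := by
  obtain ⟨a, ha, b, hb, hab, rfl, hba⟩ := hx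
  obtain ⟨φ, Θ, hφ, hΘ, h0, h⟩ := D.regular a (Or.inr ha) b (Or.inr hb) hab hba.symm
  have hproj : ∀ p, (Θ.symm p).1 = φ.symm p.1 := fun p => by
    rw [← φ.symm_apply_apply (Θ.symm p).1, ← hΘ.proj, Θ.apply_symm_apply]
  have hmem : ∀ y ∈ box, ∀ z, ((y, z) ∈ Θ ⁻¹' (D.M ∪ D.U) ↔
      (y.2 = 0 ∧ z = -1) ∨ (y.1 = 0 ∧ z = 1)) := by
    intro y hy z
    have := Set.ext_iff.1 h (y, z)
    rw [mem_inter_iff, and_iff_left (show ((y, z) : Space) ∈ cyl from hy)] at this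
    rw [this, mem_union, segment_eq_strand, segment_eq_strand]
    simp only [strand, mem_ofPred_eq, mem_segment_plane]
    obtain ⟨h1, h2⟩ := mem_box.1 hy
    rw [abs_le] at h1 h2
    refine or_congr (and_congr_left fun _ => ⟨?_, fun h => ?_⟩)
      (and_congr_left fun _ => ⟨?_, fun h => ?_⟩)
    · rintro ⟨θ, -, -, -, h⟩; linarith
    · exact ⟨(1 + y.1) / 2, by linarith, by linarith, by ring, by rw [h]; ring⟩
    · rintro ⟨θ, -, -, h, -⟩; linarith
    · exact ⟨(1 + y.2) / 2, by linarith, by linarith, by rw [h]; ring, by ring⟩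
  have hpre : ∀ p ∈ D.M ∪ D.U, ∀ y ∈ box, (Θ.symm p).1 = y →
      (y.2 = 0 ∧ (Θ.symm p).2 = -1) ∨ (y.1 = 0 ∧ (Θ.symm p).2 = 1) := by
    rintro p hp _ hy rfl
    exact (hmem _ hy _).1 (by rwa [mem_preimage, Prod.mk.eta, Θ.apply_symm_apply])
  -- both points over the crossing belong to `U`, so `M` avoids a neighbourhood of it
  have hM : a.1 ∉ Prod.fst '' D.M := by
    rintro ⟨c, hc, hca⟩
    have h0b : (0 : Plane) ∈ box := mem_of_mem_nhds box_mem_nhds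
    have key : ∀ p : Space, p ∈ D.M ∪ D.U → p.1 = a.1 → Θ.symm p = (0, -1) ∨ Θ.symm p = (0, 1) := by
      intro p hp hpa
      have h1 : (Θ.symm p).1 = 0 := by rw [hproj, hpa, ← h0, φ.symm_apply_apply]
      exact (hpre p hp 0 h0b h1).imp (fun h => Prod.ext h1 h.2) fun h => Prod.ext h1 h.2
    have hac : a ≠ c := fun e => disjoint_left.1 D.disj hc (e ▸ ha)
    have hbc : b ≠ c := fun e => disjoint_left.1 D.disj hc (e ▸ hb)
    have i : ∀ p q : Space, p ≠ q → Θ.symm p ≠ Θ.symm q := fun p q h e => h (Θ.symm.injective e)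
    have i1 := i a b hab
    have i2 := i a c hac
    have i3 := i b c hbc
    rcases key a (Or.inr ha) rfl with e1 | e1 <;> rcases key b (Or.inr hb) hba with e2 | e2 <;>
      rcases key c (Or.inl hc) hca with e3 | e3 <;> simp_all
  have hchart : IsChart φ ∅ (Prod.fst '' (D.M ∪ D.U)) := by
    refine ⟨hφ, ?_, by simp⟩
    ext y
    rw [mem_inter_iff, and_comm]
    refine and_congr_right fun hy => ?_
    constructor
    · rintro ⟨p, hp, hpy⟩
      have h1 : (Θ.symm p).1 = y := by rw [hproj, hpy, φ.symm_apply_apply]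
      exact (hpre p hp y hy h1).symm.imp And.left And.left
    · rintro (hy0 | hy0)
      · exact ⟨_, (hmem y hy 1).2 (Or.inr ⟨hy0, rfl⟩), hΘ.proj _⟩
      · exact ⟨_, (hmem y hy (-1)).2 (Or.inl ⟨hy0, rfl⟩), hΘ.proj _⟩
  have hcl : IsClosed (Prod.fst '' D.M) :=
    ((isCompact_of_isPLLink D.link_M).image continuous_fst).isClosed
  obtain ⟨ε, h1, h2, h3⟩ := ((eventually_image_subset φ.continuous
    (hcl.isOpen_compl.mem_nhds (h0 ▸ hM))).and (Ioc_mem_nhdsGT one_pos)).exists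
  refine ⟨(scale ε).trans φ, (hchart.scale h2 h3).congr h1 ?_ fun c hc hc' => (hc' ⟨c, hc, rfl⟩).elim, ?_⟩
  · rw [image_union, union_inter_distrib_right, inter_compl_self, empty_union]
  · simp [scale_apply h2, h0]

theorem Diagram.exists_stateSum (D : Diagram) (h : D.cr ≠ ⊤) :
    ∃ v, StateSum W D.M (Prod.fst '' D.U) (dbl D.U) v := by
  obtain ⟨l, h1, h2, h3⟩ := exists_charts (D.finite_dbl h).toFinset (O := univ)
    (fun _ _ => Filter.univ_mem) fun x hx => D.exists_chart ((D.finite_dbl h).mem_toFinset.1 hx)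
  exact ⟨_, l, h1, fun φ hφ => (h2 φ hφ).1, by simpa using h3, rfl⟩

theorem Covers.image_fst {Θ : Space ≃ₜ Space} {φ : Plane ≃ₜ Plane} (h : Covers Θ φ) (U : Set Space) :
    φ '' (Prod.fst '' U) = Prod.fst '' (Θ '' U) := by
  rw [image_image, image_image]
  exact image_congr fun a _ => (h.proj a).symm

/-- The links in two lifts of one decorated diagram are isotopic. -/
theorem Iso.of_covers {Θ Θ' : Space ≃ₜ Space} {φ : Plane ≃ₜ Plane} (hΘ : Covers Θ φ)
    (hΘ' : Covers Θ' φ) (hN : IsCompact N) {C : Set Plane} (h : PLLink.overlayCr (Θ '' N) C ≤ m) :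
    Iso m (Θ '' N) C (Θ' '' N) C := by
  have hproj : ∀ p, (Θ.symm p).1 = φ.symm p.1 := fun p => by
    rw [← φ.symm_apply_apply (Θ.symm p).1, ← hΘ.proj, Θ.apply_symm_apply]
  have hc : Covers (Θ.symm.trans Θ') id := by
    refine ⟨hΘ.pl.symm.trans hΘ'.pl, fun a => ?_, fun x z z' hz => ?_⟩
    · change (Θ' (Θ.symm a)).1 = a.1
      rw [hΘ'.proj, hproj, φ.apply_symm_apply]
    · have e : ∀ z, Θ.symm (x, z) = (φ.symm x, (Θ.symm (x, z)).2) := fun z => Prod.ext (hproj _) rfl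
      change (Θ' (Θ.symm (x, z))).2 < (Θ' (Θ.symm (x, z'))).2
      rw [e z, e z']
      refine hΘ'.mono _ ((hΘ.mono (φ.symm x)).lt_iff_lt.1 ?_)
      rwa [← e, ← e, Θ.apply_symm_apply, Θ.apply_symm_apply]
  have := Iso.of_covers_id hc (hN.image Θ.continuous) h
  rwa [image_image, show (fun x => (Θ.symm.trans Θ') (Θ x)) = Θ' from
    funext fun x => congrArg Θ' (Θ.symm_apply_apply x)] at this

end Diagrams

/-! ### Invariance under the moves of diagrams -/

section Moves

variable {m : ℕ∞} {W : Set Space → Set Plane → ZMod 2} {v v' : ZMod 2}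
  {N N' A A' : Set Space} {Γ Γ' : Set Plane}

theorem StateSum.planarIsotopic {D D' : Diagram} (h : PlanarIsotopic D D') (hW : Valuation m W)
    (hm : D.cr ≤ m) (hv : StateSum W D.M (Prod.fst '' D.U) (dbl D.U) v) :
    StateSum W D'.M (Prod.fst '' D'.U) (dbl D'.U) v := by
  obtain ⟨f, Θ, hf, hΘ, h1, h2⟩ := h
  obtain ⟨F, hF⟩ := Isotopy.exists_eq hf
  have hΘ' : Covers Θ (F.homeo 1) :=
    ⟨hΘ.pl, fun a => (hΘ.proj a).trans (hF 1 (by norm_num) _).symm, hΘ.mono⟩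
  have hM := isCompact_of_isPLLink D.link_M
  rw [← h1, ← h2, ← hΘ'.image_dbl, ← hΘ'.image_fst]
  refine hv.map (F.isPLHomeo_homeo 1) ?_ (D.overlayCr_le.trans hm) fun C hC => hW.inv ?_
  · rintro _ ⟨b, hb, rfl⟩
    exact ⟨b, hb, (hΘ'.proj b).symm⟩
  · have i := Iso.of_planar F hM hC
    exact i.trans (Iso.of_covers (covers_liftH (F.isPLHomeo_homeo 1)) hΘ' hM i.overlay_right)

theorem dbl_inter_box (A : Set Space) : dbl A ∩ box = dbl (A ∩ cyl) ∧ dbl A \ box = dbl (A \ cyl) := by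
  constructor <;> ext x <;> constructor
  · rintro ⟨⟨a, ha, b, hb, hab, rfl, h⟩, hx⟩
    exact ⟨a, ⟨ha, hx⟩, b, ⟨hb, by rwa [cyl, mem_ofPred_eq, h]⟩, hab, rfl, h⟩
  · rintro ⟨a, ⟨ha, hx⟩, b, ⟨hb, -⟩, hab, rfl, h⟩
    exact ⟨⟨a, ha, b, hb, hab, rfl, h⟩, hx⟩
  · rintro ⟨⟨a, ha, b, hb, hab, rfl, h⟩, hx⟩
    exact ⟨a, ⟨ha, hx⟩, b, ⟨hb, by rwa [cyl, mem_ofPred_eq, h]⟩, hab, rfl, h⟩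
  · rintro ⟨a, ⟨ha, hx⟩, b, ⟨hb, -⟩, hab, rfl, h⟩
    exact ⟨⟨a, ha, b, hb, hab, rfl, h⟩, hx⟩

theorem fst_inter_box (A : Set Space) : Prod.fst '' A ∩ box = Prod.fst '' (A ∩ cyl) ∧
    Prod.fst '' A \ box = Prod.fst '' (A \ cyl) := by
  constructor <;> ext x <;> constructor
  · rintro ⟨⟨a, ha, rfl⟩, hx⟩; exact ⟨a, ⟨ha, hx⟩, rfl⟩
  · rintro ⟨a, ⟨ha, hx⟩, rfl⟩; exact ⟨⟨a, ha, rfl⟩, hx⟩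
  · rintro ⟨⟨a, ha, rfl⟩, hx⟩; exact ⟨a, ⟨ha, hx⟩, rfl⟩
  · rintro ⟨a, ⟨ha, hx⟩, rfl⟩; exact ⟨⟨a, ha, rfl⟩, hx⟩

/-- The charts of a state sum can be chosen such that those outside the disc of the move and
those inside it are separated by the boundary of the disc. -/
theorem StateSum.exists_split {Y : Set Plane} {A : Set Space}
    (h : StateSum W N Γ (dbl A) v) (hW : Valuation m W) (hm : overlayCr N Γ ≤ m)
    (hY : dbl (A ∩ cyl) = Y) (hYb : Y ⊆ Metric.ball 0 1) {lout : List (Plane ≃ₜ Plane)}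
    (h1 : lout.Pairwise Apart) (h2 : ∀ φ ∈ lout, IsChart φ N Γ ∧ φ '' box ⊆ boxᶜ)
    (h3 : ∀ x, (∃ φ ∈ lout, φ 0 = x) ↔ x ∈ dbl (A \ cyl)) :
    ∃ lin : List (Plane ≃ₜ Plane), lin.Pairwise Apart ∧
      (∀ φ ∈ lin, IsChart φ N Γ ∧ φ '' box ⊆ box) ∧ (∀ x, (∃ φ ∈ lin, φ 0 = x) ↔ x ∈ Y) ∧
      v = bracket (bracket (W N) lin) lout Γ := by
  have hfin := h.finite
  have hsub : Y ⊆ dbl A := hY ▸ dbl_mono inter_subset_left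
  have hdbl : dbl A = dbl (A \ cyl) ∪ Y := by
    rw [← hY, ← (dbl_inter_box A).1, ← (dbl_inter_box A).2, sdiff_union_inter]
  obtain ⟨l, -, hl, hx, -⟩ := id h
  obtain ⟨lin, k1, k2, k3⟩ := exists_charts (N := N) (Γ := Γ) (hfin.subset hsub).toFinset (O := box)
    (fun x hx => Filter.mem_of_superset
      (Metric.isOpen_ball.mem_nhds (hYb ((hfin.subset hsub).mem_toFinset.1 hx)))
      Metric.ball_subset_closedBall)
    fun x hx' => by
      obtain ⟨φ, h1, h2⟩ := (hx x).2 (hsub ((hfin.subset hsub).mem_toFinset.1 hx'))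
      exact ⟨φ, hl φ h1, h2⟩
  simp only [Finite.mem_toFinset] at k3
  refine ⟨lin, k1, k2, k3, h.unique ⟨lout ++ lin, ?_, ?_, ?_, by rw [bracket_append]⟩ hW hm⟩
  · refine List.pairwise_append.2 ⟨h1, k1, fun φ hφ ψ hψ => ?_⟩
    exact disjoint_compl_left.mono (h2 φ hφ).2 (k2 ψ hψ).2
  · intro φ hφ
    exact (List.mem_append.1 hφ).elim (fun h => (h2 φ h).1) fun h => (k2 φ h).1
  · intro x
    simp only [List.mem_append, or_and_right, exists_or, h3, k3, hdbl, mem_union]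

/-- A local invariance extends to curves that cross themselves outside the disc of the move: the
crossings outside the disc are smoothed simultaneously. -/
theorem LocalInv.eq {n : ℕ} {T T' : Fin n → Set Space} (h : LocalInv T T')
    (hT : dbl (⋃ i, T i) ⊆ Metric.ball 0 1) (hT' : dbl (⋃ i, T' i) ⊆ Metric.ball 0 1)
    (hW : Valuation m W) (I : Set (Fin n)) (hN : IsCompact N) (hN' : IsCompact N')
    (h1 : N ∩ cyl = ⋃ i ∈ I, T i) (h2 : N' ∩ cyl = ⋃ i ∈ I, T' i) (h3 : N \ cyl = N' \ cyl)
    (h4 : A ∩ cyl = ⋃ i ∈ Iᶜ, T i) (h5 : A' ∩ cyl = ⋃ i ∈ Iᶜ, T' i) (h6 : A \ cyl = A' \ cyl)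
    (hm : overlayCr N (Prod.fst '' A) ≤ m) (hm' : overlayCr N' (Prod.fst '' A') ≤ m)
    (hv : StateSum W N (Prod.fst '' A) (dbl A) v)
    (hv' : StateSum W N' (Prod.fst '' A') (dbl A') v') : v = v' := by
  have hsub : ∀ T : Fin n → Set Space, ⋃ i ∈ Iᶜ, T i ⊆ ⋃ i, T i := fun T =>
    iUnion_mono fun i => iUnion_subset fun _ => subset_rfl
  have hX : dbl (A \ cyl) ⊆ dbl A := dbl_mono sdiff_subset
  have hfin := hv.finite.subset hX
  have hout : ∀ x ∈ dbl (A \ cyl), x ∉ box := fun x hx => by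
    rw [← (dbl_inter_box A).2] at hx; exact hx.2
  obtain ⟨l, -, hl, hx, -⟩ := id hv
  obtain ⟨lout, o1, o2, o3⟩ := exists_charts (N := N) (Γ := Prod.fst '' A) hfin.toFinset (O := boxᶜ)
    (fun x hx => Metric.isClosed_closedBall.isOpen_compl.mem_nhds (hout x (hfin.mem_toFinset.1 hx)))
    fun x hx' => by
      obtain ⟨φ, h1, h2⟩ := (hx x).2 (hX (hfin.mem_toFinset.1 hx'))
      exact ⟨φ, hl φ h1, h2⟩
  simp only [Finite.mem_toFinset] at o3
  have hd : (Prod.fst '' A) \ box = (Prod.fst '' A') \ box := by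
    rw [(fst_inter_box A).2, (fst_inter_box A').2, h6]
  have o2' : ∀ φ ∈ lout, IsChart φ N' (Prod.fst '' A') ∧ φ '' box ⊆ boxᶜ := fun φ hφ => by
    refine ⟨(o2 φ hφ).1.congr (o2 φ hφ).2 hd.symm fun a ha hb => ?_, (o2 φ hφ).2⟩
    have : a ∈ N' \ cyl := ⟨ha, hb⟩
    rw [← h3] at this
    exact this.1
  obtain ⟨lin, k1, k2, k3, rfl⟩ :=
    hv.exists_split hW hm (congrArg dbl h4) ((dbl_mono (hsub T)).trans hT) o1 o2 o3
  obtain ⟨lin', k1', k2', k3', rfl⟩ :=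
    hv'.exists_split hW hm' (congrArg dbl h5) ((dbl_mono (hsub T')).trans hT') o1 o2' (h6 ▸ o3)
  have hin : ∀ {M : Set Space} {Γ₁ Γ₂ : Set Plane} {l : List (Plane ≃ₜ Plane)}, Γ₁ ∩ box = Γ₂ ∩ box →
      (∀ φ ∈ l, IsChart φ M Γ₂ ∧ φ '' box ⊆ box) → ∀ φ ∈ l, IsChart φ M Γ₁ := fun h hl φ hφ =>
    (hl φ hφ).1.congr (hl φ hφ).2 h fun a ha _ => ha
  refine bracket_rel (R := fun C C' => C ∩ box = Prod.fst '' A ∩ box ∧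
    C' ∩ box = Prod.fst '' A' ∩ box ∧ C \ box = C' \ box ∧ overlayCr N C ≤ m ∧ overlayCr N' C' ≤ m)
    ?_ (List.forall₂_same.2 fun φ hφ s C C' => ?_) _ _ ⟨rfl, rfl, hd, hm, hm'⟩
  · rintro C C' ⟨r1, r2, r3, r4, r5⟩
    refine h hW I hN hN' h1 h2 h3 ?_ ?_ r3 r4 r5 ⟨lin, k1, hin r1 k2, k3, rfl⟩
      ⟨lin', k1', hin r2 k2', k3', rfl⟩
    · rw [r1, (fst_inter_box A).1, h4, image_iUnion₂]
    · rw [r2, (fst_inter_box A').1, h5, image_iUnion₂]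
  · rintro ⟨r1, r2, r3, r4, r5⟩
    have hb : Disjoint box (φ '' box) := disjoint_compl_right.mono_right (o2 φ hφ).2
    refine ⟨?_, ?_, smooth_congr_diff s r3, ?_, ?_⟩
    · rw [smooth_inter_of_disjoint hb, r1]
    · rw [smooth_inter_of_disjoint hb, r2]
    · rwa [overlayCr_smooth (o2 φ hφ).1.free]
    · rwa [overlayCr_smooth (o2' φ hφ).1.free]

theorem LocalMove.stateSum_eq {n : ℕ} {T T' : Fin n → Set Space} {D D' : Diagram}
    (hD : LocalMove T T' D D') (h : LocalInv T T')
    (hT : dbl (⋃ i, T i) ⊆ Metric.ball 0 1) (hT' : dbl (⋃ i, T' i) ⊆ Metric.ball 0 1)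
    (hW : Valuation m W) (hm : D.cr ≤ m) (hm' : D'.cr ≤ m)
    (hv : StateSum W D.M (Prod.fst '' D.U) (dbl D.U) v)
    (hv' : StateSum W D'.M (Prod.fst '' D'.U) (dbl D'.U) v') : v = v' := by
  obtain ⟨φ, Θ, Θ', I, hφ, hΘ, hΘ', h1, h2, h3, h4, h5, h6⟩ := hD
  -- in the coordinates `φ`, all valuations are computed through the one lift `Θ`
  have key : ∀ (D : Diagram) {Θ₁ : Space ≃ₜ Space} {v : ZMod 2}, Covers Θ₁ φ → D.cr ≤ m →
      StateSum W D.M (Prod.fst '' D.U) (dbl D.U) v → IsCompact (Θ₁ ⁻¹' D.M) ∧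
      overlayCr (Θ₁ ⁻¹' D.M) (Prod.fst '' (Θ₁ ⁻¹' D.U)) ≤ m ∧
      StateSum (fun M C => W (Θ '' M) (φ '' C)) (Θ₁ ⁻¹' D.M) (Prod.fst '' (Θ₁ ⁻¹' D.U))
        (dbl (Θ₁ ⁻¹' D.U)) v := by
    intro D Θ₁ v hΘ₁ hm hv
    have hM : IsCompact (Θ₁ ⁻¹' D.M) := Θ₁.isCompact_preimage.2 (isCompact_of_isPLLink D.link_M)
    have e1 : Prod.fst '' D.U = φ '' (Prod.fst '' (Θ₁ ⁻¹' D.U)) := by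
      rw [hΘ₁.image_fst, image_preimage_eq _ Θ₁.surjective]
    have e2 : dbl D.U = φ '' dbl (Θ₁ ⁻¹' D.U) := by
      rw [hΘ₁.image_dbl, image_preimage_eq _ Θ₁.surjective]
    have e3 : D.M = Θ₁ '' (Θ₁ ⁻¹' D.M) := (image_preimage_eq _ Θ₁.surjective).symm
    have hm' := D.overlayCr_le.trans hm
    have hs : ∀ C : Set Plane, φ.symm '' (φ '' C) = C := fun C => by simp [image_image]
    have hs' : ∀ C : Set Plane, φ '' (φ.symm '' C) = C := fun C => by simp [image_image]
    refine ⟨hM, ?_, ?_⟩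
    · rwa [e1, e3, hΘ₁.overlayCr φ.injective] at hm'
    · have := hv.map (F := φ.symm) hφ.symm (N' := Θ₁ ⁻¹' D.M)
        (W' := fun M C => W (Θ '' M) (φ '' C))
        (fun a ha => ⟨_, ha, by rw [hΘ₁.proj, φ.symm_apply_apply]⟩) hm' fun C hC => ?_
      · rwa [e1, e2, hs, hs] at this
      · rw [e3] at hC
        have i := hW.inv (Iso.of_covers hΘ₁ hΘ hM hC)
        rw [← e3] at i
        rw [i, hs']
  obtain ⟨a1, a2, a3⟩ := key D hΘ hm hv
  obtain ⟨b1, b2, b3⟩ := key D' hΘ' hm' hv'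
  exact h.eq hT hT' (hW.comap hφ hΘ) I a1 b1 h1 h3 h5 h2 h4 h6 a2 b2 a3 b3

theorem dbl_flat_subset : dbl (⋃ i, flat i) ⊆ Metric.ball 0 1 := by
  rw [iUnion_fin_one, show flat 0 = _ from segment_eq_strand _ _ _, dbl_strand]
  exact empty_subset _

theorem dbl_kinked_subset : dbl (⋃ i, kinked i) ⊆ Metric.ball 0 1 := by
  rw [iUnion_fin_one, dbl_kinked, singleton_subset_iff]
  exact Metric.mem_ball_self one_pos

theorem mem_ball_plane {x y : ℝ} : ((x, y) : Plane) ∈ Metric.ball 0 1 ↔ |x| < 1 ∧ |y| < 1 := by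
  rw [mem_ball_zero_iff, Prod.norm_def, max_lt_iff, Real.norm_eq_abs, Real.norm_eq_abs]

theorem dbl_apart_subset : dbl (⋃ i, apart i) ⊆ Metric.ball 0 1 := by
  rw [iUnion_fin_two, apart_zero, apart_one, dbl_union_strand zero_ne_one]
  rintro ⟨x, y⟩ ⟨h, h'⟩
  rw [mem_segment_plane] at h h'
  obtain ⟨s, -, -, h, -⟩ := h
  obtain ⟨t, -, -, h', -⟩ := h'
  linarith

theorem dbl_overlapping_subset : dbl (⋃ i, overlapping i) ⊆ Metric.ball 0 1 := by
  rw [iUnion_fin_two, overlapping_zero, overlapping_one, dbl_union_strand zero_ne_one, overlap_inter]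
  rintro _ (rfl | rfl) <;> rw [mem_ball_plane] <;> norm_num [abs_lt]

theorem dbl_triangle_subset {s : ℝ} (hs : |s| ≤ 1 / 2) : dbl (⋃ i, triangle s i) ⊆ Metric.ball 0 1 := by
  have h := iUnion_triangle s univ
  simp only [mem_univ, iUnion_true, sel_true trivial] at h
  rw [h, dbl_three, rising_inter_falling]
  rw [abs_le] at hs
  rintro ⟨x, y⟩ ((h | ⟨h, h'⟩) | ⟨h, h'⟩)
  · rw [h]; exact Metric.mem_ball_self one_pos
  all_goals
    simp only [poly, union_empty, mem_union, mem_segment_plane] at h'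
    have hy : |y| ≤ 1 / 2 := by
      obtain ⟨θ, t0, t1, -, t2⟩ | ⟨θ, t0, t1, -, t2⟩ := h' <;> rw [t2, abs_le] <;>
        constructor <;> nlinarith
  · obtain ⟨-, rfl⟩ := mem_rising.1 h
    exact mem_ball_plane.2 ⟨by linarith, by linarith⟩
  · obtain ⟨-, rfl⟩ := mem_falling.1 h
    rw [abs_neg] at hy
    exact mem_ball_plane.2 ⟨by linarith, by rw [abs_neg]; linarith⟩

/-- A Reidemeister move or a planar isotopy preserves the state sum. -/
theorem Step.stateSum {D D' : Diagram} (h : Step D D') (hW : Valuation m W) (hm : D.cr ≤ m)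
    (hm' : D'.cr ≤ m) (htop : m ≠ ⊤) (hv : StateSum W D.M (Prod.fst '' D.U) (dbl D.U) v) :
    StateSum W D'.M (Prod.fst '' D'.U) (dbl D'.U) v := by
  have key : ∀ {n : ℕ} {T T' : Fin n → Set Space}, LocalMove T T' D D' → LocalInv T T' →
      dbl (⋃ i, T i) ⊆ Metric.ball 0 1 → dbl (⋃ i, T' i) ⊆ Metric.ball 0 1 →
      StateSum W D'.M (Prod.fst '' D'.U) (dbl D'.U) v := by
    intro n T T' h h1 h2 h3
    obtain ⟨v', hv'⟩ := D'.exists_stateSum (hm'.trans_lt htop.lt_top).ne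
    rwa [h.stateSum_eq h1 h2 h3 hW hm hm' hv hv']
  have t1 : |(1 / 2 : ℝ)| ≤ 1 / 2 := by norm_num [abs_le]
  have t2 : |(-1 / 2 : ℝ)| ≤ 1 / 2 := by norm_num [abs_le]
  rcases h with h | (h | h) | (h | h) | h | h
  · exact hv.planarIsotopic h hW hm
  · exact key h localInv_kink dbl_flat_subset dbl_kinked_subset
  · exact key h localInv_kink.symm dbl_kinked_subset dbl_flat_subset
  · exact key h localInv_overlap dbl_apart_subset dbl_overlapping_subset
  · exact key h localInv_overlap.symm dbl_overlapping_subset dbl_apart_subset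
  · exact key h localInv_triangle (dbl_triangle_subset t1) (dbl_triangle_subset t2)
  · exact key h localInv_triangle.symm (dbl_triangle_subset t2) (dbl_triangle_subset t1)

end Moves

/-! ### Reachability -/

section Reachable

variable {m : ℕ∞} {N₀ : Set Space} {C₀ : Set Plane}

open Classical in
/-- The indicator function of the overlays that are connected with a given one by an isotopy through
overlays with at most `m` crossings. -/
noncomputable def reachable (m : ℕ∞) (N₀ : Set Space) (C₀ : Set Plane) (N : Set Space)
    (C : Set Plane) : ZMod 2 :=
  if Iso m N₀ C₀ N C then 1 else 0

open Classical in
/-- Overlays that are reachable from a connected curve are connected, since ambient isotopies preserve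
connectedness. -/
theorem valuation_reachable (hC₀ : IsPreconnected C₀) : Valuation m (reachable m N₀ C₀) where
  inv h := if_congr ⟨fun h' => h'.trans h, fun h' => h'.trans h.symm⟩ rfl rfl
  disc hC := if_neg fun ⟨_, f, _, h, _⟩ =>
    hC (h ▸ hC₀.image _ (f.homeo 1).continuous.continuousOn)

theorem isPreconnected_S1 : IsPreconnected S1 :=
  isPreconnected_sphere (by
    rw [rank_prod', Module.rank_self, one_add_one_eq_two]; exact Cardinal.one_lt_two) 0 1

theorem dbl_eq_empty {U : Set Space} (h : InjOn Prod.fst U) : dbl U = ∅ := by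
  rw [eq_empty_iff_forall_notMem]
  rintro x ⟨a, ha, b, hb, hab, rfl, h2⟩
  exact hab (h ha hb h2.symm)

end Reachable

end PLLink

theorem mainTheorem2 (r m : ℕ) (D : ℕ → PLLink.Diagram)
    (hstep : ∀ i < r, PLLink.Step (D i) (D (i + 1)))
    (hcr : ∀ i ≤ r, (D i).cr ≤ m)
    (hsimple₀ : InjOn Prod.fst (D 0).U) (hsimple₁ : InjOn Prod.fst (D r).U) :
    ∃ (Φ : ℝ → PLLink.Space → PLLink.Space) (h : ℝ → PLLink.Plane → PLLink.Plane),
      PLLink.IsAmbientIsotopy Φ ∧ Φ 1 '' (D 0).M = (D r).M ∧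
      PLLink.IsCurveIsotopy h ∧
      h 0 '' PLLink.S1 = Prod.fst '' (D 0).U ∧ h 1 '' PLLink.S1 = Prod.fst '' (D r).U ∧
      ∀ t ∈ Icc (0 : ℝ) 1,
        PLLink.overlayCr (Φ t '' (D 0).M) (h t '' PLLink.S1) ≤ m := by
  obtain ⟨c, c1, c2, c3⟩ := (D 0).knot_U
  have hc : (fun s => (c s).1) '' PLLink.S1 = Prod.fst '' (D 0).U := by rw [← c3, image_image]
  have hcurve : IsPreconnected (Prod.fst '' (D 0).U) := by
    rw [← c3]
    exact (PLLink.isPreconnected_S1.image c c1.1).image _ continuous_fst.continuousOn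
  have hW := PLLink.valuation_reachable (m := m) (N₀ := (D 0).M) hcurve
  have hstart : PLLink.Iso m (D 0).M (Prod.fst '' (D 0).U) (D 0).M (Prod.fst '' (D 0).U) :=
    PLLink.Iso.refl ((D 0).overlayCr_le.trans (hcr 0 (Nat.zero_le r)))
  -- the state sum has the value `1` along the whole sequence
  have hv : ∀ i ≤ r, PLLink.StateSum (PLLink.reachable m (D 0).M (Prod.fst '' (D 0).U))
      (D i).M (Prod.fst '' (D i).U) (PLLink.dbl (D i).U) 1 := by
    intro i
    induction i with
    | zero =>
      intro _
      rw [PLLink.dbl_eq_empty hsimple₀, ← if_pos (α := ZMod 2) (t := 1) (e := 0) hstart]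
      exact PLLink.stateSum_empty
    | succ i ih =>
      intro hi
      exact (hstep i hi).stateSum hW (hcr i (by lia)) (hcr _ hi) (by simp) (ih (by lia))
  have hend := hv r le_rfl
  rw [PLLink.dbl_eq_empty hsimple₁] at hend
  have h1 := hend.eq_of_empty hW ((D r).overlayCr_le.trans (hcr r le_rfl))
  have h2 : PLLink.Iso m (D 0).M (Prod.fst '' (D 0).U) (D r).M (Prod.fst '' (D r).U) := by
    by_contra hno
    exact one_ne_zero (h1.trans (if_neg hno))
  obtain ⟨Φ, f, hΦ, hf, hle⟩ := h2
  have hi : ∀ t, (fun s => f t (c s).1) '' PLLink.S1 = f t '' (Prod.fst '' (D 0).U) := fun t => by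
    rw [← hc, image_image]
  refine ⟨Φ, fun t s => f t (c s).1, Φ.isAmbientIsotopy, hΦ, ⟨?_, fun t _ x hx y hy hxy => ?_⟩, ?_,
    (hi 1).trans hf, fun t ht => by rw [hi]; exact hle t ht⟩
  · have hp : PLLink.PLOn (fun q : ℝ × PLLink.Plane => (q.1, (c q.2).1)) (Icc 0 1 ×ˢ PLLink.S1) :=
      ((PLLink.isPL_id.fst).plOn _).prodMk
        ((PLLink.isPL_id.fst.plOn univ).comp (c1.comp ((PLLink.isPL_id.snd).plOn _) fun q hq => hq.2)
          fun _ _ => mem_univ _)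
    exact (f.pl.plOn univ).comp hp fun _ _ => mem_univ _
  · have hcU : ∀ {x}, x ∈ PLLink.S1 → c x ∈ (D 0).U := fun hx => c3 ▸ mem_image_of_mem c hx
    exact c2 hx hy (hsimple₀ (hcU hx) (hcU hy) ((f.homeo t).injective hxy))
  · rw [hi, show f 0 = id from funext f.start, image_id]
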